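/- **Proposition (Maxwell field).** Work in coordinates $x=(x^\mu)$ on an open set $U\subset\mathbb R^4$, signature $(-,+,+,+)$, curvature convention $\nabla_c\nabla_d u^a-\nabla_d\nabla_c u^a=R^a{}_{bcd}u^b$, $R_{ab}=R^c{}_{acb}$, all fields smooth. Let $\mathcal R(x)$, $\mathcal F^\mu(x)$ be gauge source functions, $\Gamma^\mu=g^{\nu\lambda}\Gamma^\mu{}_{\nu\lambda}$, and treat $\Gamma^\mu,\mathcal F^\mu$ as vectors under $\nabla$. Put $$\mathscr R_{\mu\nu}[g]=R_{\mu\nu}-g_{\sigma(\mu}\nabla_{\nu)}\Gamma^\sigma+g_{\sigma(\mu}\nabla_{\nu)}\mathcal F^\sigma,$$ and let $\blacksquare$ be $\square=g^{\mu\nu}\nabla_\mu\nabla_\nu$ on scalars, and on a covariant tensor $\square T_{\lambda\cdots\rho}$ plus, for each index $\lambda$, the term $\big(2L_{\tau\lambda}+\tfrac16\mathcal R g_{\tau\lambda}-R_{\tau\lambda}-g_{\sigma\tau}\nabla_\lambda(\mathcal F^\sigma-\Gamma^\sigma)\big)T^\tau{}_{\cdots\rho}$. The unknowns are $\Xi,s,L_{ab},d_{abcd},g_{ab},F_{ab}$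 and an auxiliary field $F_{abc}$. Let $T_{ab}=F_{ac}F_b{}^c-\tfrac14g_{ab}F_{cd}F^{cd}$ and $$T_{abc}=\Xi F_{[b}{}^dF_{a]cd}-\tfrac12\Xi F_c{}^dF_{dab}+\tfrac12\Xi g_{c[a}F^{de}F_{b]de}-3F_{cd}F_{[a}{}^d\nabla_{b]}\Xi+F_{de}F^{de}g_{c[a}\nabla_{b]}\Xi-g_{c[a}F_{b]}{}^eF_{de}\nabla^d\Xi ,$$ ${}^*T_{abc}=\tfrac12\epsilon_{ab}{}^{de}T_{dec}$. The *reduced system* is $$\blacksquare\Xi=4s-\tfrac16\Xi\mathcal R,$$ $$\blacksquare s=-\tfrac16s\mathcal R+\Xi L_{ab}L^{ab}-\tfrac16\nabla_a\mathcal R\nabla^a\Xi+\tfrac14\Xi^5T_{ab}T^{ab}-\Xi^3L_{ab}T^{ab}+\Xi\nabla^a\Xi\nabla^b\Xi T_{ab},$$ $$\blacksquare L_{ab}=-2\Xi d_{acbd}L^{cd}+4L_a{}^cL_{bc}-L_{cd}L^{cd}g_{ab}+\tfrac16\nabla_a\nabla_b\mathcal R+\tfrac12\Xi^3d_{acbd}T^{cd}-\Xi\nabla_cT_a{}^c{}_b-2T_{(a|c|b)}\nabla^c\Xi,$$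 $$\begin{aligned}\blacksquare d_{abcd}={}&-4\Xi d_a{}^f{}_{[c}{}^ed_{d]ebf}-2\Xi d_a{}^f{}_b{}^ed_{cdfe}+\tfrac12d_{abcd}\mathcal R-\Xi^2T_{[a}{}^fd_{b]fcd}-\Xi^2T_{[c}{}^fd_{d]fab}\\&-\Xi^2g_{a[c}d_{d]gbf}T^{fg}+\Xi^2g_{b[c}d_{d]gaf}T^{fg}+2\nabla_{[a}T_{|cd|b]}+\epsilon_{abef}\nabla^f\,{}^*T_{cd}{}^e,\end{aligned}$$ $$\mathscr R_{ab}[g]=2L_{ab}+\tfrac16\mathcal Rg_{ab},\qquad \blacksquare F_{bc}=\tfrac13F_{bc}\mathcal R-2\Xi F^{ad}d_{bacd},$$ $$\begin{aligned}\blacksquare F_{abc}={}&4\Xi F_{[b}{}^dT_{c]da}-2\Xi F_a{}^{de}d_{bdce}-4\Xi F^d{}_{[b}{}^ed_{c]ead}+\tfrac12F_{abc}\mathcal R+4F^d{}_{bc}L_{ad}-4F^d{}_{a[b}L_{c]d}-4F^d{}_{[b}{}^eg_{c]a}L_{de}\\&+\tfrac13F_{bc}\nabla_a\mathcal R-\tfrac13F_{a[b}\nabla_{c]}\mathcal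 R+\tfrac13g_{a[b}F_{c]d}\nabla^d\mathcal R-4F^{de}d_{ade[b}\nabla_{c]}\Xi-4F_{[b}{}^ed_{c]dae}\nabla^d\Xi\\&-2F_a{}^ed_{bcde}\nabla^d\Xi-\Xi F^{de}\nabla_ad_{bcde}.\end{aligned}$$ Let $\Upsilon_{ab}=\nabla_a\nabla_b\Xi+\Xi L_{ab}-sg_{ab}-\tfrac12\Xi^3T_{ab}$. **(a)** The system is a proper quasilinear system of wave equations: there are universal polynomials $p_A$ (one per component $u_A$ of the unknowns), in the components of the unknowns, their first derivatives, $g^{\mu\nu}$, $\mathcal R,\partial\mathcal R,\partial^2\mathcal R,\mathcal F,\partial\mathcal F$, such that for $g$ Lorentzian the equations, with the second derivatives $\nabla_a\nabla_b\Xi$ contained in $\nabla T_{abc}$ and $\nabla\,{}^*T_{abc}$ eliminated through $\nabla_a\nabla_b\Xi=-\Xi L_{ab}+sg_{ab}+\tfrac12\Xi^3T_{ab}$, are pointwise and componentwise equivalent to $g^{\sigma\tau}\partial_\sigma\partial_\tau u_A=p_A$. Without this elimination they are equivalent to $g^{\sigma\tau}\partial_\sigma\partial_\tau u_A=p_A+q_A^{\mu\nu}\Upsilon_{\mu\nu}$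 with polynomials $q_A^{\mu\nu}$ in the same arguments, which vanish except in the equations for $L_{ab}$ and $d_{abcd}$. In (b) and (c), $L_{ab}$ is symmetric, $d_{abcd}$ has the symmetries of a Weyl tensor, $F_{ab}=F_{[ab]}$, $F_{abc}=F_{a[bc]}$, and the gauge conditions $R=\mathcal R$, $\Gamma^\mu=\mathcal F^\mu$ hold. **(b)** It is a system for the Einstein–Maxwell equations: if $\nabla^aF_{ab}=0$, $\nabla_{[a}F_{bc]}=0$, $F_{abc}=\nabla_aF_{bc}$ and, for some constant $\lambda$, the conformal Einstein field equations $$\nabla_a\nabla_b\Xi=-\Xi L_{ab}+sg_{ab}+\tfrac12\Xi^3T_{ab},\quad \nabla_as=-L_{ab}\nabla^b\Xi+\tfrac12\Xi^2\nabla^b\Xi T_{ab},\quad \nabla_aL_{bc}-\nabla_bL_{ac}=\nabla_e\Xi d^e{}_{cab}+\Xi T_{abc},$$ $$\nabla_ed^e{}_{abc}=T_{bca},\quad 6\Xi s-3\nabla_c\Xi\nabla^c\Xi=\lambda,\quad R^c{}_{dab}=\Xi d^c{}_{dab}+2(\delta^c{}_{[a}L_{b]d}-g_{d[a}L_{b]}{}^c)$$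 hold on $U$, with $T_{abc}$ defined as $\Xi\nabla_{[a}T_{b]c}+3\nabla_{[a}\Xi T_{b]c}-g_{c[a}T_{b]e}\nabla^e\Xi$, then this $T_{abc}$ equals the expression displayed above and all equations of the reduced system hold on $U$, both as displayed and after the elimination of $\nabla_a\nabla_b\Xi$ described in (a). **(c)** Define the matter zero-quantities $M_b=\nabla^aF_{ab}$, $M_{abc}=\nabla_{[a}F_{bc]}$, $Q_{abc}=F_{abc}-\nabla_aF_{bc}$, and $\Lambda_{abc}=T_{bca}-\nabla_ed^e{}_{abc}$ (with the displayed $T_{abc}$). If $R^c{}_{dab}=\Xi d^c{}_{dab}+2(\delta^c{}_{[a}L_{b]d}-g_{d[a}L_{b]}{}^c)$ and the reduced equations for $F_{ab}$ and $F_{abc}$ hold on $U$, then on $U$ they satisfy the homogeneous wave equations $$\square M_a=\tfrac16M_aR+2M^bL_{ab},\qquad \square M_{abc}=\tfrac12RM_{abc}-6\Xi d_{[a}{}^d{}_b{}^eM_{c]de}-6L_{[a}{}^dM_{bc]d},$$ $$\begin{aligned}\square Q_{abc}={}&4\Xi F_{[b}{}^d\Lambda_{|a|c]d}-2\Xi Q_a{}^{de}d_{bdce}-4\Xi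 Q^d{}_{[b}{}^ed_{c]ead}+\tfrac12Q_{abc}R-4M_{[b}L_{c]a}+4Q^d{}_{bc}L_{ad}\\&-4Q^d{}_{a[b}L_{c]d}+6L_a{}^dM_{bcd}-4Q^d{}_{[b}{}^eg_{c]a}L_{de}.\end{aligned}$$ -/

import Mathlib

open scoped ContDiff

namespace CEM

/-! ### Tensor calculus in a coordinate chart of a four-dimensional spacetime -/

/-- Coordinates `x = (x^0, x^1, x^2, x^3)`. -/
abbrev Pt := Fin 4 → ℝ

/-- Components `T_{i 0 ⋯ i (k-1)}(x)` of a covariant tensor field of rank `k`. -/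
abbrev Tensor (k : ℕ) := Pt → (Fin k → Fin 4) → ℝ

/-- Antisymmetrisation over two indices: `f_{[ab]}`. -/
noncomputable def alt₂ (a b : Fin 4) (f : Fin 4 → Fin 4 → ℝ) : ℝ := (f a b - f b a) / 2

/-- Symmetrisation over two indices: `f_{(ab)}`. -/
noncomputable def sym₂ (a b : Fin 4) (f : Fin 4 → Fin 4 → ℝ) : ℝ := (f a b + f b a) / 2

/-- Antisymmetrisation over three indices: `f_{[abc]}`. -/
noncomputable def alt₃ (a b c : Fin 4) (f : Fin 4 → Fin 4 → Fin 4 → ℝ) : ℝ :=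
  (f a b c + f b c a + f c a b - f a c b - f c b a - f b a c) / 6

/-- The coordinate derivative `∂_m f`. -/
noncomputable def pd (m : Fin 4) (f : Pt → ℝ) (x : Pt) : ℝ := fderiv ℝ f x (Pi.single m 1)

/-- The matrix of components of a rank two tensor at a point. -/
def mat (g : Tensor 2) (x : Pt) : Matrix (Fin 4) (Fin 4) ℝ := Matrix.of fun a b => g x ![a, b]

/-- The contravariant metric `g^{ab}`. -/
noncomputable def ginv (g : Tensor 2) (x : Pt) (a b : Fin 4) : ℝ := (mat g x)⁻¹ a b

/-- `g` is, on `U`, symmetric of signature `(-,+,+,+)`. -/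
def LorentzianOn (U : Set Pt) (g : Tensor 2) : Prop :=
  ∀ x ∈ U, ∃ e : Matrix (Fin 4) (Fin 4) ℝ,
    IsUnit e.det ∧ e.transpose * mat g x * e = Matrix.diagonal ![-1, 1, 1, 1]

/-- Raising the index in position `m`. -/
noncomputable def up (g : Tensor 2) {k : ℕ} (m : Fin k) (T : Tensor k) : Tensor k :=
  fun x i => ∑ r, ginv g x (i m) r * T x (Function.update i m r)

/-- The Christoffel symbols `Γ^a_{bc}`. -/
noncomputable def christoffel (g : Tensor 2) (x : Pt) (a b c : Fin 4) : ℝ :=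
  (1 / 2) * ∑ r, ginv g x a r *
    (pd b (fun y => g y ![r, c]) x + pd c (fun y => g y ![b, r]) x - pd r (fun y => g y ![b, c]) x)

/-- The contracted Christoffel symbols `Γ^a = g^{bc} Γ^a_{bc}`. -/
noncomputable def Gam (g : Tensor 2) (x : Pt) (a : Fin 4) : ℝ :=
  ∑ b, ∑ c, ginv g x b c * christoffel g x a b c

/-- The differential `∇_a φ` of a scalar. -/
noncomputable def grad (φ : Pt → ℝ) : Tensor 1 := fun x i => pd (i 0) φ x

/-- The Levi-Civita derivative; the differentiation index comes first:
`(covD g T)_{a i} = ∇_a T_i`. -/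
noncomputable def covD (g : Tensor 2) {k : ℕ} (T : Tensor k) : Tensor (k + 1) := fun x i =>
  pd (i 0) (fun y => T y (Matrix.vecTail i)) x
    - ∑ m : Fin k, ∑ r, christoffel g x r (i 0) (Matrix.vecTail i m)
        * T x (Function.update (Matrix.vecTail i) m r)

/-- `∇_b V^a` for an object `V^a` with one upper index (`V` may be the contracted Christoffel
symbols, which are treated as the components of a vector). -/
noncomputable def covDVec (g : Tensor 2) (V : Pt → Fin 4 → ℝ) (x : Pt) (b a : Fin 4) : ℝ :=
  pd b (fun y => V y a) x + ∑ c, christoffel g x a b c * V x c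

/-- The geometric wave operator `□ = g^{ab} ∇_a ∇_b` on covariant tensors. -/
noncomputable def box (g : Tensor 2) {k : ℕ} (T : Tensor k) : Tensor k := fun x i =>
  ∑ a, ∑ b, ginv g x a b * covD g (covD g T) x (Matrix.vecCons a (Matrix.vecCons b i))

/-- The wave operator on scalars. -/
noncomputable def boxScalar (g : Tensor 2) (φ : Pt → ℝ) (x : Pt) : ℝ :=
  ∑ a, ∑ b, ginv g x a b * covD g (grad φ) x ![a, b]

/-- The curvature `R^a_{bcd}`, with the convention
`∇_c ∇_d u^a - ∇_d ∇_c u^a = R^a_{bcd} u^b`. -/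
noncomputable def curv (g : Tensor 2) (x : Pt) (a b c d : Fin 4) : ℝ :=
  pd c (fun y => christoffel g y a d b) x - pd d (fun y => christoffel g y a c b) x
    + ∑ e, (christoffel g x a c e * christoffel g x e d b
        - christoffel g x a d e * christoffel g x e c b)

/-- The curvature with all indices down, `R_{abcd}`. -/
noncomputable def riemann (g : Tensor 2) : Tensor 4 := fun x i =>
  ∑ e, g x ![i 0, e] * curv g x e (i 1) (i 2) (i 3)

/-- The Ricci tensor `R_{ab} = R^c_{acb}`. -/
noncomputable def ricci (g : Tensor 2) : Tensor 2 := fun x i => ∑ c, curv g x c (i 0) c (i 1)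

/-- The Ricci scalar. -/
noncomputable def scalarCurv (g : Tensor 2) (x : Pt) : ℝ :=
  ∑ a, ∑ b, ginv g x a b * ricci g x ![a, b]

/-- The volume form `ε_{abcd} = √|det g| [abcd]`. -/
noncomputable def vol (g : Tensor 2) : Tensor 4 := fun x i =>
  Real.sqrt |(mat g x).det| * ((1 : Matrix (Fin 4) (Fin 4) ℝ).submatrix i id).det

/-- The dual `*T_{abc} = ½ ε_{ab}^{de} T_{dec}`. -/
noncomputable def dual (g : Tensor 2) (T : Tensor 3) : Tensor 3 := fun x i =>
  (1 / 2) * ∑ d, ∑ e, up g 2 (up g 3 (vol g)) x ![i 0, i 1, d, e] * T x ![d, e, i 2]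

/-! ### Gauge source functions and the reduced operators -/

/-- Conformal and coordinate gauge source functions `𝓡(x)`, `𝓕^a(x)`. -/
structure GaugeSource where
  R : Pt → ℝ
  F : Pt → Fin 4 → ℝ

/-- The gauge source functions are smooth on `U`. -/
def GaugeSource.SmoothOn (src : GaugeSource) (U : Set Pt) : Prop :=
  ContDiffOn ℝ ∞ src.R U ∧ ∀ a, ContDiffOn ℝ ∞ (fun x => src.F x a) U

/-- The gauge conditions `R = 𝓡(x)` and `Γ^a = 𝓕^a(x)` (generalised wave coordinates). -/
def InGauge (U : Set Pt) (g : Tensor 2) (src : GaugeSource) : Prop :=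
  ∀ x ∈ U, scalarCurv g x = src.R x ∧ ∀ a, Gam g x a = src.F x a

/-- The reduced Ricci operator
`𝓡_{mn}[g] = R_{mn} - g_{a(m} ∇_{n)} Γ^a + g_{a(m} ∇_{n)} 𝓕^a`. -/
noncomputable def reducedRicci (g : Tensor 2) (src : GaugeSource) : Tensor 2 := fun x i =>
  ricci g x i
    - sym₂ (i 0) (i 1) (fun m n => ∑ a, g x ![a, m] * covDVec g (Gam g) x n a)
    + sym₂ (i 0) (i 1) (fun m n => ∑ a, g x ![a, m] * covDVec g src.F x n a)

/-- The coefficient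
`(2 L_{tl} + 𝓡 g_{tl} / 6 - R_{tl}) - g_{at} ∇_l (𝓕^a - Γ^a)` of the reduced wave operator. -/
noncomputable def bbCoef (g L : Tensor 2) (src : GaugeSource) (x : Pt) (t l : Fin 4) : ℝ :=
  (2 * L x ![t, l] + (1 / 6) * src.R x * g x ![t, l] - ricci g x ![t, l])
    - ∑ a, g x ![a, t] * covDVec g (fun y b => src.F y b - Gam g y b) x l a

/-- The reduced wave operator `■` on covariant tensors. On scalars it is `boxScalar`. -/
noncomputable def blackBox (g L : Tensor 2) (src : GaugeSource) {k : ℕ} (T : Tensor k) :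
    Tensor k := fun x i =>
  box g T x i
    + ∑ m : Fin k, ∑ t, bbCoef g L src x t (i m) * up g m T x (Function.update i m t)

/-! ### The fields -/

/-- The unknowns: conformal factor `Ξ`, Friedrich scalar `s`, Schouten tensor `L_{ab}`, rescaled
Weyl tensor `d_{abcd}`, metric `g_{ab}`, Faraday tensor `F_{ab}`, auxiliary field
`H_{abc}` (the field `F_{abc}`). -/
structure Fields where
  Xi : Pt → ℝ
  s : Pt → ℝ
  L : Tensor 2
  d : Tensor 4
  g : Tensor 2
  F : Tensor 2
  H : Tensor 3

/-- Labels of the components of the unknowns, and of the corresponding evolution equations. -/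
inductive Slot
  | Xi
  | s
  | L (i : Fin 2 → Fin 4)
  | d (i : Fin 4 → Fin 4)
  | g (i : Fin 2 → Fin 4)
  | F (i : Fin 2 → Fin 4)
  | H (i : Fin 3 → Fin 4)

namespace Fields

/-- The components of the unknowns. -/
def comp (u : Fields) : Slot → Pt → ℝ
  | .Xi => u.Xi
  | .s => u.s
  | .L i => fun x => u.L x i
  | .d i => fun x => u.d x i
  | .g i => fun x => u.g x i
  | .F i => fun x => u.F x i
  | .H i => fun x => u.H x i

/-- All fields are smooth on `U`, and the metric is Lorentzian there. -/
def RegularOn (u : Fields) (U : Set Pt) : Prop :=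
  (∀ A, ContDiffOn ℝ ∞ (u.comp A) U) ∧ LorentzianOn U u.g

/-- The algebraic symmetries: `L_{ab} = L_{(ab)}`, `d_{abcd}` has the symmetries of a Weyl tensor,
`F_{ab} = F_{[ab]}`, `H_{abc} = H_{a[bc]}`. -/
structure SymmetricOn (u : Fields) (U : Set Pt) : Prop where
  L_symm : ∀ x ∈ U, ∀ a b, u.L x ![a, b] = u.L x ![b, a]
  d_antisymm₁ : ∀ x ∈ U, ∀ a b c e, u.d x ![a, b, c, e] = -u.d x ![b, a, c, e]
  d_antisymm₂ : ∀ x ∈ U, ∀ a b c e, u.d x ![a, b, c, e] = -u.d x ![a, b, e, c]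
  d_pair : ∀ x ∈ U, ∀ a b c e, u.d x ![a, b, c, e] = u.d x ![c, e, a, b]
  d_cyclic : ∀ x ∈ U, ∀ a b c e,
    u.d x ![a, b, c, e] + u.d x ![a, c, e, b] + u.d x ![a, e, b, c] = 0
  d_tracefree : ∀ x ∈ U, ∀ b e, ∑ a, up u.g 0 u.d x ![a, b, a, e] = 0
  F_antisymm : ∀ x ∈ U, ∀ a b, u.F x ![a, b] = -u.F x ![b, a]
  H_antisymm : ∀ x ∈ U, ∀ a b c, u.H x ![a, b, c] = -u.H x ![a, c, b]

/-- The components `∇^a Ξ`. -/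
noncomputable def gradUp (u : Fields) (x : Pt) (a : Fin 4) : ℝ := up u.g 0 (grad u.Xi) x ![a]

/-- `F_{cd} F^{cd}`. -/
noncomputable def FF (u : Fields) (x : Pt) : ℝ :=
  ∑ c, ∑ d, u.F x ![c, d] * up u.g 0 (up u.g 1 u.F) x ![c, d]

/-- The unphysical Maxwell energy-momentum tensor
`T_{ab} = F_{ac} F_b^c - ¼ g_{ab} F_{cd} F^{cd}`. -/
noncomputable def emT (u : Fields) : Tensor 2 := fun x i =>
  ∑ c, u.F x ![i 0, c] * up u.g 1 u.F x ![i 1, c] - (1 / 4) * u.g x i * u.FF x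

/-- `L^{ab}`. -/
noncomputable def Lup (u : Fields) : Tensor 2 := up u.g 0 (up u.g 1 u.L)

/-- `T^{ab}`. -/
noncomputable def emTup (u : Fields) : Tensor 2 := up u.g 0 (up u.g 1 u.emT)

/-- `F^{ab}`. -/
noncomputable def Fup (u : Fields) : Tensor 2 := up u.g 0 (up u.g 1 u.F)

/-- The definition of the rescaled Cotton tensor of an energy-momentum tensor `T_{ab}`, here that
of the Maxwell field:
`T_{abc} = Ξ ∇_{[a} T_{b]c} + 3 ∇_{[a}Ξ T_{b]c} - g_{c[a} T_{b]e} ∇^e Ξ`. -/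
noncomputable def cottonDef (u : Fields) : Tensor 3 := fun x i =>
  u.Xi x * alt₂ (i 0) (i 1) (fun a b => covD u.g u.emT x ![a, b, i 2])
    + 3 * alt₂ (i 0) (i 1) (fun a b => grad u.Xi x ![a] * u.emT x ![b, i 2])
    - alt₂ (i 0) (i 1) (fun a b => u.g x ![i 2, a] * ∑ e, u.emT x ![b, e] * u.gradUp x e)

/-- The part of the Maxwell rescaled Cotton tensor without `∇Ξ`:
`Ξ F_{[b}^d H_{a]cd} - ½ Ξ F_c^d H_{dab} + ½ Ξ g_{c[a} F^{de} H_{b]de}`. -/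
noncomputable def cottonAlg (u : Fields) : Tensor 3 := fun x i =>
  u.Xi x * alt₂ (i 1) (i 0) (fun b a => ∑ d, up u.g 1 u.F x ![b, d] * u.H x ![a, i 2, d])
    - (1 / 2) * u.Xi x * ∑ d, up u.g 1 u.F x ![i 2, d] * u.H x ![d, i 0, i 1]
    + (1 / 2) * u.Xi x * alt₂ (i 0) (i 1) (fun a b =>
        u.g x ![i 2, a] * ∑ d, ∑ e, u.Fup x ![d, e] * u.H x ![b, d, e])

/-- The part of the Maxwell rescaled Cotton tensor which is linear in `v = ∇Ξ`:
`-3 F_{cd} F_{[a}^d v_{b]} + F_{de} F^{de} g_{c[a} v_{b]} - g_{c[a} F_{b]}^e F_{de} v^d`. -/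
noncomputable def cottonLin (u : Fields) (v : Tensor 1) : Tensor 3 := fun x i =>
  -3 * alt₂ (i 0) (i 1) (fun a b =>
      (∑ d, u.F x ![i 2, d] * up u.g 1 u.F x ![a, d]) * v x ![b])
    + u.FF x * alt₂ (i 0) (i 1) (fun a b => u.g x ![i 2, a] * v x ![b])
    - alt₂ (i 0) (i 1) (fun a b => u.g x ![i 2, a] *
        ∑ d, ∑ e, up u.g 1 u.F x ![b, e] * u.F x ![d, e] * up u.g 0 v x ![d])

/-- The rescaled Cotton tensor `T_{abc}` of the Maxwell field in terms of the auxiliary field. -/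
noncomputable def cotton (u : Fields) : Tensor 3 := fun x i =>
  u.cottonAlg x i + u.cottonLin (grad u.Xi) x i

/-! ### Zero-quantities -/

/-- `Υ_{ab} = ∇_a ∇_b Ξ + Ξ L_{ab} - s g_{ab} - ½ Ξ³ T_{ab}`. -/
noncomputable def Upsilon (u : Fields) : Tensor 2 := fun x i =>
  covD u.g (grad u.Xi) x i + u.Xi x * u.L x i - u.s x * u.g x i
    - (1 / 2) * u.Xi x ^ 3 * u.emT x i

/-- `Λ_{abc} = T_{bca} - ∇_e d^e_{abc}`, with `T_{abc}` in terms of the auxiliary field. -/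
noncomputable def Lambda (u : Fields) : Tensor 3 := fun x i =>
  u.cotton x ![i 1, i 2, i 0] - ∑ e, up u.g 0 (covD u.g u.d) x ![e, e, i 0, i 1, i 2]

/-- `P_{cdab} = R_{cdab} - Ξ d_{cdab} - 2 (g_{c[a} L_{b]d} - g_{d[a} L_{b]c})`. -/
noncomputable def Pzq (u : Fields) : Tensor 4 := fun x i =>
  riemann u.g x i - u.Xi x * u.d x i
    - 2 * (alt₂ (i 2) (i 3) (fun a b => u.g x ![i 0, a] * u.L x ![b, i 1])
      - alt₂ (i 2) (i 3) (fun a b => u.g x ![i 1, a] * u.L x ![b, i 0]))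

/-- `M_b = ∇^a F_{ab}`. -/
noncomputable def M₁ (u : Fields) : Tensor 1 := fun x i =>
  ∑ a, up u.g 0 (covD u.g u.F) x ![a, a, i 0]

/-- `M_{abc} = ∇_{[a} F_{bc]}`. -/
noncomputable def M₃ (u : Fields) : Tensor 3 := fun x i =>
  alt₃ (i 0) (i 1) (i 2) (fun a b c => covD u.g u.F x ![a, b, c])

/-- `Q_{abc} = H_{abc} - ∇_a F_{bc}`. -/
noncomputable def Q₃ (u : Fields) : Tensor 3 := fun x i => u.H x i - covD u.g u.F x i

/-! ### The conformal Einstein-Maxwell equations -/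

/-- The metric tracefree conformal Einstein field equations with the Maxwell field as matter,
together with the Maxwell equations. (That `T_{ab}` is divergence-free is a consequence of the
Maxwell equations.) -/
structure IsConformalEinsteinMaxwell (u : Fields) (U : Set Pt) (lam : ℝ) : Prop where
  cfe₁ : ∀ x ∈ U, ∀ a b, covD u.g (grad u.Xi) x ![a, b] =
    -u.Xi x * u.L x ![a, b] + u.s x * u.g x ![a, b] + (1 / 2) * u.Xi x ^ 3 * u.emT x ![a, b]
  cfe₂ : ∀ x ∈ U, ∀ a, grad u.s x ![a] =
    -(∑ b, u.L x ![a, b] * u.gradUp x b)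
      + (1 / 2) * u.Xi x ^ 2 * ∑ b, u.gradUp x b * u.emT x ![a, b]
  cfe₃ : ∀ x ∈ U, ∀ a b c, covD u.g u.L x ![a, b, c] - covD u.g u.L x ![b, a, c] =
    (∑ e, u.gradUp x e * u.d x ![e, c, a, b]) + u.Xi x * u.cottonDef x ![a, b, c]
  cfe₄ : ∀ x ∈ U, ∀ a b c, ∑ e, up u.g 0 (covD u.g u.d) x ![e, e, a, b, c] =
    u.cottonDef x ![b, c, a]
  cfe₅ : ∀ x ∈ U,
    6 * u.Xi x * u.s x - 3 * ∑ c, grad u.Xi x ![c] * u.gradUp x c = lam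
  cfe₆ : ∀ x ∈ U, ∀ i, u.Pzq x i = 0
  maxwell₁ : ∀ x ∈ U, ∀ i, u.M₁ x i = 0
  maxwell₂ : ∀ x ∈ U, ∀ i, u.M₃ x i = 0

/-! ### The reduced evolution system

In `rhs` below, `DT` stands for `∇_e T_{abc}` and `SDT` for `∇_e *T_{abc}` (derivative index
first). The system as it stands has `DT = ∇T`, `SDT = ∇ *T`. Since `T_{abc}` contains `∇Ξ`, these
contain `∇∇Ξ`; in the variant `EliminatedEq` the terms `∇_a ∇_b Ξ` are eliminated through
`∇_a ∇_b Ξ = - Ξ L_{ab} + s g_{ab} + ½ Ξ³ T_{ab}`. -/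

/-- Right-hand side of the equation for `s`. -/
noncomputable def rhs_s (u : Fields) (src : GaugeSource) (x : Pt) : ℝ :=
  -(1 / 6) * u.s x * src.R x
    + u.Xi x * (∑ m, ∑ n, u.L x ![m, n] * u.Lup x ![m, n])
    - (1 / 6) * (∑ m, grad src.R x ![m] * u.gradUp x m)
    + (1 / 4) * u.Xi x ^ 5 * (∑ m, ∑ n, u.emT x ![m, n] * u.emTup x ![m, n])
    - u.Xi x ^ 3 * (∑ m, ∑ n, u.L x ![m, n] * u.emTup x ![m, n])
    + u.Xi x * (∑ m, ∑ n, u.gradUp x m * u.gradUp x n * u.emT x ![m, n])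

/-- Right-hand side of the equation for `L_{ab}`. -/
noncomputable def rhs_L (u : Fields) (src : GaugeSource) (DT : Tensor 4) (x : Pt)
    (a b : Fin 4) : ℝ :=
  -2 * u.Xi x * (∑ c, ∑ d, u.d x ![a, c, b, d] * u.Lup x ![c, d])
    + 4 * (∑ c, up u.g 1 u.L x ![a, c] * u.L x ![b, c])
    - (∑ c, ∑ d, u.L x ![c, d] * u.Lup x ![c, d]) * u.g x ![a, b]
    + (1 / 6) * covD u.g (grad src.R) x ![a, b]
    + (1 / 2) * u.Xi x ^ 3 * (∑ c, ∑ d, u.d x ![a, c, b, d] * u.emTup x ![c, d])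
    - u.Xi x * (∑ c, up u.g 0 DT x ![c, a, c, b])
    - 2 * (∑ c, sym₂ a b (fun a b => u.cotton x ![a, c, b]) * u.gradUp x c)

/-- Right-hand side of the equation for `d_{abcd}`. -/
noncomputable def rhs_d (u : Fields) (src : GaugeSource) (DT SDT : Tensor 4) (x : Pt)
    (a b c d : Fin 4) : ℝ :=
  -4 * u.Xi x * alt₂ c d (fun c d =>
      ∑ f, ∑ e, up u.g 1 (up u.g 3 u.d) x ![a, f, c, e] * u.d x ![d, e, b, f])
    - 2 * u.Xi x * (∑ f, ∑ e, up u.g 1 (up u.g 3 u.d) x ![a, f, b, e] * u.d x ![c, d, f, e])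
    + (1 / 2) * u.d x ![a, b, c, d] * src.R x
    - u.Xi x ^ 2 * alt₂ a b (fun a b => ∑ f, up u.g 1 u.emT x ![a, f] * u.d x ![b, f, c, d])
    - u.Xi x ^ 2 * alt₂ c d (fun c d => ∑ f, up u.g 1 u.emT x ![c, f] * u.d x ![d, f, a, b])
    - u.Xi x ^ 2 * alt₂ c d (fun c d =>
        u.g x ![a, c] * ∑ h, ∑ f, u.d x ![d, h, b, f] * u.emTup x ![f, h])
    + u.Xi x ^ 2 * alt₂ c d (fun c d =>
        u.g x ![b, c] * ∑ h, ∑ f, u.d x ![d, h, a, f] * u.emTup x ![f, h])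
    + 2 * alt₂ a b (fun a b => DT x ![a, c, d, b])
    + ∑ e, ∑ f, vol u.g x ![a, b, e, f] * up u.g 0 (up u.g 3 SDT) x ![f, c, d, e]

/-- Right-hand side of the equation for `F_{bc}`. -/
noncomputable def rhs_F (u : Fields) (src : GaugeSource) (x : Pt) (b c : Fin 4) : ℝ :=
  (1 / 3) * u.F x ![b, c] * src.R x
    - 2 * u.Xi x * (∑ a, ∑ d, u.Fup x ![a, d] * u.d x ![b, a, c, d])

/-- Right-hand side of the equation for the auxiliary field `H_{abc}`. -/
noncomputable def rhs_H (u : Fields) (src : GaugeSource) (x : Pt) (a b c : Fin 4) : ℝ :=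
  4 * u.Xi x * alt₂ b c (fun b c => ∑ d, up u.g 1 u.F x ![b, d] * u.cotton x ![c, d, a])
    - 2 * u.Xi x * (∑ d, ∑ e, up u.g 1 (up u.g 2 u.H) x ![a, d, e] * u.d x ![b, d, c, e])
    - 4 * u.Xi x * alt₂ b c (fun b c =>
        ∑ d, ∑ e, up u.g 0 (up u.g 2 u.H) x ![d, b, e] * u.d x ![c, e, a, d])
    + (1 / 2) * u.H x ![a, b, c] * src.R x
    + 4 * (∑ d, up u.g 0 u.H x ![d, b, c] * u.L x ![a, d])
    - 4 * alt₂ b c (fun b c => ∑ d, up u.g 0 u.H x ![d, a, b] * u.L x ![c, d])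
    - 4 * alt₂ b c (fun b c =>
        ∑ d, ∑ e, up u.g 0 (up u.g 2 u.H) x ![d, b, e] * u.g x ![c, a] * u.L x ![d, e])
    + (1 / 3) * u.F x ![b, c] * grad src.R x ![a]
    - (1 / 3) * alt₂ b c (fun b c => u.F x ![a, b] * grad src.R x ![c])
    + (1 / 3) * alt₂ b c (fun b c =>
        u.g x ![a, b] * ∑ d, u.F x ![c, d] * up u.g 0 (grad src.R) x ![d])
    - 4 * alt₂ b c (fun b c =>
        (∑ d, ∑ e, u.Fup x ![d, e] * u.d x ![a, d, e, b]) * grad u.Xi x ![c])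
    - 4 * alt₂ b c (fun b c =>
        ∑ d, ∑ e, up u.g 1 u.F x ![b, e] * u.d x ![c, d, a, e] * u.gradUp x d)
    - 2 * (∑ d, ∑ e, up u.g 1 u.F x ![a, e] * u.d x ![b, c, d, e] * u.gradUp x d)
    - u.Xi x * (∑ d, ∑ e, u.Fup x ![d, e] * covD u.g u.d x ![a, b, c, d, e])

/-- Left-hand sides of the reduced system: `■` of the unknowns, and the reduced Ricci operator for
the metric. -/
noncomputable def lhs (u : Fields) (src : GaugeSource) (x : Pt) : Slot → ℝ
  | .Xi => boxScalar u.g u.Xi x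
  | .s => boxScalar u.g u.s x
  | .L i => blackBox u.g u.L src u.L x i
  | .d i => blackBox u.g u.L src u.d x i
  | .g i => reducedRicci u.g src x i
  | .F i => blackBox u.g u.L src u.F x i
  | .H i => blackBox u.g u.L src u.H x i

/-- Right-hand sides of the reduced system. -/
noncomputable def rhs (u : Fields) (src : GaugeSource) (DT SDT : Tensor 4) (x : Pt) : Slot → ℝ
  | .Xi => 4 * u.s x - (1 / 6) * u.Xi x * src.R x
  | .s => u.rhs_s src x
  | .L i => u.rhs_L src DT x (i 0) (i 1)
  | .d i => u.rhs_d src DT SDT x (i 0) (i 1) (i 2) (i 3)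
  | .g i => 2 * u.L x i + (1 / 6) * src.R x * u.g x i
  | .F i => u.rhs_F src x (i 0) (i 1)
  | .H i => u.rhs_H src x (i 0) (i 1) (i 2)

/-- The reduced evolution equation with label `A` holds at `x`. -/
def ReducedEq (u : Fields) (src : GaugeSource) (A : Slot) (x : Pt) : Prop :=
  u.lhs src x A = u.rhs src (covD u.g u.cotton) (covD u.g (dual u.g u.cotton)) x A

/-- What the second derivatives of `Ξ` contribute to `∇_e T_{abc}`, with `∇_e ∇_a Ξ` replaced by
`Υ_{ea}`. Hence `∇_e T_{abc} - cottonUpsilon_{eabc}` is `∇_e T_{abc}` with `∇_e ∇_a Ξ` replaced by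
`- Ξ L_{ea} + s g_{ea} + ½ Ξ³ T_{ea}`. -/
noncomputable def cottonUpsilon (u : Fields) : Tensor 4 := fun x i =>
  u.cottonLin (fun y j => u.Upsilon y ![i 0, j 0]) x (Matrix.vecTail i)

/-- The same for `∇_e *T_{abc}`. -/
noncomputable def dualCottonUpsilon (u : Fields) : Tensor 4 := fun x i =>
  dual u.g (fun y j => u.cottonUpsilon y (Matrix.vecCons (i 0) j)) x (Matrix.vecTail i)

/-- The reduced evolution equation with label `A`, with `∇∇Ξ` eliminated from the derivatives of
the rescaled Cotton tensor, holds at `x`. -/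
def EliminatedEq (u : Fields) (src : GaugeSource) (A : Slot) (x : Pt) : Prop :=
  u.lhs src x A = u.rhs src (fun y i => covD u.g u.cotton y i - u.cottonUpsilon y i)
    (fun y i => covD u.g (dual u.g u.cotton) y i - u.dualCottonUpsilon y i) x A

/-! ### Principal parts -/

/-- The scalar wave operator `g^{mn} ∂_m ∂_n` on the component `A`. -/
noncomputable def principal (u : Fields) (A : Slot) (x : Pt) : ℝ :=
  ∑ m, ∑ n, ginv u.g x m n * pd m (pd n (u.comp A)) x

end Fields

/-- The arguments of the lower order terms: the unknowns, their first derivatives, the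
contravariant metric, and the gauge source functions with the derivatives
`∂𝓡, ∂∂𝓡, ∂𝓕`. No second derivative of an unknown is among them. -/
inductive JetVar
  | val (A : Slot)
  | der (m : Fin 4) (A : Slot)
  | ginv (m n : Fin 4)
  | R
  | dR (m : Fin 4)
  | ddR (m n : Fin 4)
  | srcF (a : Fin 4)
  | dsrcF (m a : Fin 4)

/-- The values of these arguments at a point. -/
noncomputable def jet (u : Fields) (src : GaugeSource) (x : Pt) : JetVar → ℝ
  | .val A => u.comp A x
  | .der m A => pd m (u.comp A) x
  | .ginv m n => ginv u.g x m n
  | .R => src.R x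
  | .dR m => pd m src.R x
  | .ddR m n => pd m (pd n src.R) x
  | .srcF a => src.F x a
  | .dsrcF m a => pd m (fun y => src.F y a) x

/-! ### The homogeneous wave equations for the matter zero-quantities -/

namespace Fields

/-- `□ M_a = R M_a / 6 + 2 M^b L_{ab}`. -/
def WaveM₁ (u : Fields) (x : Pt) : Prop := ∀ a,
  box u.g u.M₁ x ![a] =
    (1 / 6) * u.M₁ x ![a] * scalarCurv u.g x
      + 2 * ∑ b, up u.g 0 u.M₁ x ![b] * u.L x ![a, b]

/-- `□ M_{abc} = ½ R M_{abc} - 6 Ξ d_{[a}^d_b^e M_{c]de} - 6 L_{[a}^d M_{bc]d}`. -/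
def WaveM₃ (u : Fields) (x : Pt) : Prop := ∀ a b c,
  box u.g u.M₃ x ![a, b, c] =
    (1 / 2) * scalarCurv u.g x * u.M₃ x ![a, b, c]
      - 6 * u.Xi x * alt₃ a b c (fun a b c =>
          ∑ d, ∑ e, up u.g 1 (up u.g 3 u.d) x ![a, d, b, e] * u.M₃ x ![c, d, e])
      - 6 * alt₃ a b c (fun a b c => ∑ d, up u.g 1 u.L x ![a, d] * u.M₃ x ![b, c, d])

/-- `□ Q_{abc} = 4 Ξ F_{[b}^d Λ_{|a|c]d} - 2 Ξ Q_a^{de} d_{bdce} - 4 Ξ Q^d_{[b}^e d_{c]ead}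
+ ½ R Q_{abc} - 4 M_{[b} L_{c]a} + 4 Q^d_{bc} L_{ad} - 4 Q^d_{a[b} L_{c]d} + 6 L_a^d M_{bcd}
- 4 Q^d_{[b}^e g_{c]a} L_{de}`. -/
def WaveQ₃ (u : Fields) (x : Pt) : Prop := ∀ a b c,
  box u.g u.Q₃ x ![a, b, c] =
    4 * u.Xi x * alt₂ b c (fun b c => ∑ d, up u.g 1 u.F x ![b, d] * u.Lambda x ![a, c, d])
      - 2 * u.Xi x * (∑ d, ∑ e, up u.g 1 (up u.g 2 u.Q₃) x ![a, d, e] * u.d x ![b, d, c, e])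
      - 4 * u.Xi x * alt₂ b c (fun b c =>
          ∑ d, ∑ e, up u.g 0 (up u.g 2 u.Q₃) x ![d, b, e] * u.d x ![c, e, a, d])
      + (1 / 2) * u.Q₃ x ![a, b, c] * scalarCurv u.g x
      - 4 * alt₂ b c (fun b c => u.M₁ x ![b] * u.L x ![c, a])
      + 4 * (∑ d, up u.g 0 u.Q₃ x ![d, b, c] * u.L x ![a, d])
      - 4 * alt₂ b c (fun b c => ∑ d, up u.g 0 u.Q₃ x ![d, a, b] * u.L x ![c, d])
      + 6 * (∑ d, up u.g 1 u.L x ![a, d] * u.M₃ x ![b, c, d])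
      - 4 * alt₂ b c (fun b c =>
          ∑ d, ∑ e, up u.g 0 (up u.g 2 u.Q₃) x ![d, b, e] * u.g x ![c, a] * u.L x ![d, e])

end Fields

end CEM

set_option linter.unusedSimpArgs false

namespace CEM

/-! ### Coordinate derivatives of smooth functions -/

/-! The proof is coordinate tensor calculus. It rests on `∇g = 0`, the product rule for contracted
products (`covD_ctr_mul`, `covD_ctr_ctr_mul`) and the Ricci identity (`covD_covD_comm`). Where
`P_{abcd} = 0` is assumed, the Riemann tensor is the algebraic expression `K` in `Ξ, d, g, L`. The
second Bianchi identity for `K` then yields `∇^a L_{ab} = ∇_b L^c{}_c` and the curl equation for `L`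
(`div_L`, `curl_L`). One ingredient is special to dimension four: `g_{[e}{}^{[f} d_{ab]}{}^{cd]} =
0` for every tensor with Weyl symmetries (`kulkarni_eq_zero`). It is verified in an orthonormal
frame and used for `d` and also for each `∇_e d`.

Part (a) is a count of second derivatives. In `□T` the second derivatives of the metric enter
through `g^{ab} ∂_a Γ^r{}_{bl}`, once for each index of `T`. The correction in `■` contains `-R_{tl}
+ g_{at} ∇_l Γ^a`, whose second-derivative part is exactly `g_{rt} g^{ab} ∂_a Γ^r{}_{bl}`, so the
two cancel (`IsPoly.bbCoef`, `IsPoly.blackBox`). In the reduced Ricci operator only `-½ g^{ce} ∂_c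
∂_e g_{mn}` survives (`IsPoly.reducedRicci`). On the right, second derivatives of unknowns occur
only in `∇T_{abc}` and `∇ *T_{abc}`, and there only as `∇∇Ξ`, linearly. Trading `∇∇Ξ` for `Υ` leaves
polynomials (`isPoly_covD_cotton`). The square root in the volume form is harmless because two
volume forms always occur together and their product is minus a Gram determinant.

Part (b) differentiates the first-order equations once more, takes traces and commutes derivatives.
For `Ξ` and `s` this is a trace. For `L` it is the divergence of the curl equation. For `d` the
four-dimensional identity expresses the cyclic sum of `∇_e d_{abck}` through the divergence of `d`,
hence through the Cotton tensor (`covD_d_cyc`); taking a further divergence gives `□d`, and the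
double dual term is evaluated by `double_dual`. In the gauge `R = 𝓡`, `Γ = 𝓕` the operator `■` is
simply `□` (`blackBox_eq`).

Parts (b) and (c) share the Maxwell computations. `box_F` writes `□F` as its reduced right-hand side
plus `3 ∇^a M_{abc} + ∇_b M_c - ∇_c M_b`, so the reduced equation for `F` says that this combination
vanishes. Its divergence gives the wave equation for `M_a`, because `∇^a M_a` and the double
divergence of `M_{abc}` vanish. Its exterior derivative gives the wave equation for `M_{abc}`,
because `M_{abc}` is closed. Finally `box_covD_F` computes `□∇_a F_{bc}`; it has the form of the
right-hand side for `F_{abc}` with `∇F` in place of `F_{abc}` and the divergence of `d` in place of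
the Cotton tensor, up to terms in `M`. Subtracting it from the reduced equation for `F_{abc}` gives
the equation for `Q`; letting `M` and `Q` vanish, with the divergence of `d` equal to the Cotton
tensor, gives the reduced equation for `F_{abc}` itself. -/

theorem diffAt {U : Set Pt} (hU : IsOpen U) {f : Pt → ℝ} (hf : ContDiffOn ℝ ∞ f U) {x : Pt}
    (hx : x ∈ U) : DifferentiableAt ℝ f x :=
  (hf.contDiffAt (hU.mem_nhds hx)).differentiableAt (by simp)

theorem pd_congr {U : Set Pt} (hU : IsOpen U) {f h : Pt → ℝ} (hfh : ∀ x ∈ U, f x = h x) {x : Pt}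
    (hx : x ∈ U) (m : Fin 4) : pd m f x = pd m h x := by
  have : f =ᶠ[nhds x] h := Filter.eventuallyEq_of_mem (hU.mem_nhds hx) hfh
  simp only [pd, this.fderiv_eq]

theorem pd_const (m : Fin 4) (c : ℝ) (x : Pt) : pd m (fun _ => c) x = 0 := by
  simp [pd]

theorem pd_add {m : Fin 4} {f h : Pt → ℝ} {x : Pt} (hf : DifferentiableAt ℝ f x)
    (hh : DifferentiableAt ℝ h x) : pd m (fun y => f y + h y) x = pd m f x + pd m h x := by
  simp [pd, fderiv_fun_add hf hh]

theorem pd_sub {m : Fin 4} {f h : Pt → ℝ} {x : Pt} (hf : DifferentiableAt ℝ f x)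
    (hh : DifferentiableAt ℝ h x) : pd m (fun y => f y - h y) x = pd m f x - pd m h x := by
  simp [pd, fderiv_fun_sub hf hh]

theorem pd_mul {m : Fin 4} {f h : Pt → ℝ} {x : Pt} (hf : DifferentiableAt ℝ f x)
    (hh : DifferentiableAt ℝ h x) :
    pd m (fun y => f y * h y) x = pd m f x * h x + f x * pd m h x := by
  simp [pd, fderiv_fun_mul hf hh]; ring

theorem pd_const_mul {m : Fin 4} (c : ℝ) {h : Pt → ℝ} {x : Pt} (hh : DifferentiableAt ℝ h x) :
    pd m (fun y => c * h y) x = c * pd m h x := by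
  simp [pd, fderiv_const_mul hh]

theorem pd_sum {ι : Type*} {s : Finset ι} {m : Fin 4} {f : ι → Pt → ℝ} {x : Pt}
    (hf : ∀ i ∈ s, DifferentiableAt ℝ (f i) x) :
    pd m (fun y => ∑ i ∈ s, f i y) x = ∑ i ∈ s, pd m (f i) x := by
  simp [pd, fderiv_fun_sum hf]

theorem pd_sum_sum_mul {ι κ : Type*} [Fintype ι] [Fintype κ] {m : Fin 4} {f h : ι → κ → Pt → ℝ}
    {x : Pt} (hf : ∀ i j, DifferentiableAt ℝ (f i j) x)
    (hh : ∀ i j, DifferentiableAt ℝ (h i j) x) :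
    pd m (fun y => ∑ i, ∑ j, f i j y * h i j y) x
      = ∑ i, ∑ j, (pd m (f i j) x * h i j x + f i j x * pd m (h i j) x) := by
  have hd : ∀ i j, DifferentiableAt ℝ (fun y => f i j y * h i j y) x := fun i j =>
    (hf i j).mul (hh i j)
  rw [pd_sum fun i _ => DifferentiableAt.fun_sum fun j _ => hd i j]
  refine Finset.sum_congr rfl fun i _ => ?_
  rw [pd_sum fun j _ => hd i j]
  exact Finset.sum_congr rfl fun j _ => pd_mul (hf i j) (hh i j)

theorem smooth_pd {U : Set Pt} (hU : IsOpen U) {f : Pt → ℝ} (hf : ContDiffOn ℝ ∞ f U)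
    (m : Fin 4) : ContDiffOn ℝ ∞ (pd m f) U :=
  (hf.fderiv_of_isOpen hU (m := ∞) (by simp)).clm_apply contDiffOn_const

theorem pd_comm {U : Set Pt} (hU : IsOpen U) {f : Pt → ℝ} (hf : ContDiffOn ℝ ∞ f U) {x : Pt}
    (hx : x ∈ U) (a b : Fin 4) : pd a (pd b f) x = pd b (pd a f) x := by
  have hc : ContDiffAt ℝ ∞ f x := hf.contDiffAt (hU.mem_nhds hx)
  have hs : IsSymmSndFDerivAt ℝ f x := hc.isSymmSndFDerivAt
    (by rw [minSmoothness_of_isRCLikeNormedField]; exact WithTop.coe_le_coe.2 (le_top : (2 : ℕ∞) ≤ ⊤))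
  have hd : DifferentiableAt ℝ (fderiv ℝ f) x :=
    ((hf.fderiv_of_isOpen hU (m := ∞) (by simp)).contDiffAt
      (hU.mem_nhds hx)).differentiableAt (by simp)
  have key : ∀ a b, pd a (pd b f) x
      = fderiv ℝ (fderiv ℝ f) x (Pi.single a 1) (Pi.single b 1) := by
    intro a b
    have : pd b f = fun y => fderiv ℝ f y (Pi.single b 1) := rfl
    rw [this, pd, fderiv_clm_apply hd (differentiableAt_const _)]
    simp
  rw [key, key]; exact hs _ _

/-- All components of a tensor field are smooth on `U`. -/
def SmoothT (U : Set Pt) {k : ℕ} (T : Tensor k) : Prop := ∀ i, ContDiffOn ℝ ∞ (fun x => T x i) U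

/-! ### The metric and its inverse -/

/-- The properties of the metric used in the tensor calculus. -/
structure IsMetricOn (U : Set Pt) (g : Tensor 2) : Prop where
  isOpen : IsOpen U
  smooth : SmoothT U g
  symm : ∀ x ∈ U, ∀ a b, g x ![a, b] = g x ![b, a]
  det_neg : ∀ x ∈ U, (mat g x).det < 0

theorem eq_pair {α : Type*} (i : Fin 2 → α) : i = ![i 0, i 1] := by
  funext j; fin_cases j <;> rfl

theorem eq_triple {α : Type*} (i : Fin 3 → α) : i = ![i 0, i 1, i 2] := by
  funext j; fin_cases j <;> rfl

theorem eq_quad {α : Type*} (i : Fin 4 → α) : i = ![i 0, i 1, i 2, i 3] := by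
  funext j; fin_cases j <;> rfl

/-- Inverting the frame writes the metric as a congruence transform of the symmetric matrix
`diag(-1,1,1,1)`. -/
theorem LorentzianOn.symm {U : Set Pt} {g : Tensor 2} (h : LorentzianOn U g) {x : Pt}
    (hx : x ∈ U) (a b : Fin 4) : g x ![a, b] = g x ![b, a] := by
  obtain ⟨e, he, hd⟩ := h x hx
  have h1 : (mat g x) = (e⁻¹).transpose * Matrix.diagonal ![-1, 1, 1, 1] * e⁻¹ := by
    rw [← hd]
    have : e * e⁻¹ = 1 := Matrix.mul_nonsing_inv _ he
    have h2 : (e⁻¹).transpose * e.transpose = 1 := by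
      rw [← Matrix.transpose_mul, this, Matrix.transpose_one]
    calc mat g x = ((e⁻¹).transpose * e.transpose) * mat g x * (e * e⁻¹) := by
          rw [h2, this]; simp
      _ = _ := by simp only [Matrix.mul_assoc]
  have h2 : (mat g x).transpose = mat g x := by
    rw [h1]; simp [Matrix.transpose_mul, Matrix.mul_assoc]
  exact congrFun (congrFun h2 b) a

/-- Determinants of the frame relation give `(det e)² det g = -1`. -/
theorem LorentzianOn.det_neg {U : Set Pt} {g : Tensor 2} (h : LorentzianOn U g) {x : Pt}
    (hx : x ∈ U) : (mat g x).det < 0 := by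
  obtain ⟨e, he, hd⟩ := h x hx
  have h1 := congrArg Matrix.det hd
  have h3 : e.det ≠ 0 := he.ne_zero
  simp [Fin.prod_univ_succ] at h1
  have h4 : 0 < e.det ^ 2 := by positivity
  nlinarith

theorem isMetricOn_of_regular {U : Set Pt} {u : Fields} (hU : IsOpen U) (h : u.RegularOn U) :
    IsMetricOn U u.g where
  isOpen := hU
  smooth i := h.1 (.g i)
  symm _ hx a b := h.2.symm hx a b
  det_neg _ hx := h.2.det_neg hx

namespace IsMetricOn

variable {U : Set Pt} {g : Tensor 2}

theorem ginv_mul (hg : IsMetricOn U g) {x : Pt} (hx : x ∈ U) (a b : Fin 4) :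
    ∑ c, ginv g x a c * g x ![c, b] = if a = b then 1 else 0 := by
  have h := Matrix.nonsing_inv_mul (mat g x) (hg.det_neg x hx).ne.isUnit
  have := congrFun (congrFun h a) b
  rwa [Matrix.mul_apply, Matrix.one_apply] at this

theorem ginv_symm (hg : IsMetricOn U g) {x : Pt} (hx : x ∈ U) (a b : Fin 4) :
    ginv g x a b = ginv g x b a := by
  have h2 : (mat g x).transpose = mat g x := by
    ext i j; exact hg.symm x hx j i
  have : ((mat g x)⁻¹).transpose = (mat g x)⁻¹ := by
    rw [Matrix.transpose_nonsing_inv, h2]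
  exact congrFun (congrFun this b) a

theorem mul_ginv (hg : IsMetricOn U g) {x : Pt} (hx : x ∈ U) (a b : Fin 4) :
    ∑ c, g x ![a, c] * ginv g x c b = if a = b then 1 else 0 := by
  have h := Matrix.mul_nonsing_inv (mat g x) (hg.det_neg x hx).ne.isUnit
  have := congrFun (congrFun h a) b
  rwa [Matrix.mul_apply, Matrix.one_apply] at this

end IsMetricOn

theorem smooth_det {U : Set Pt} {n : ℕ} {A : Pt → Matrix (Fin n) (Fin n) ℝ}
    (h : ∀ a b, ContDiffOn ℝ ∞ (fun x => A x a b) U) : ContDiffOn ℝ ∞ (fun x => (A x).det) U := by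
  simp only [Matrix.det_apply]
  exact ContDiffOn.sum fun σ _ => (contDiffOn_prod fun i _ => h _ _).const_smul _

/-- Cramer's rule: each entry is a quotient of determinants of smooth entries, with a denominator
that is nowhere zero. -/
theorem IsMetricOn.smooth_ginv {U : Set Pt} {g : Tensor 2} (hg : IsMetricOn U g) (a b : Fin 4) :
    ContDiffOn ℝ ∞ (fun x => ginv g x a b) U := by
  have hA : ∀ a b, ContDiffOn ℝ ∞ (fun x => mat g x a b) U := fun a b => hg.smooth ![a, b]
  have : (fun x => ginv g x a b)
      = fun x => ((mat g x).det)⁻¹ * ((mat g x).updateRow b (Pi.single a 1)).det := by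
    funext x
    simp [ginv, Matrix.inv_def, Ring.inverse_eq_inv', Matrix.adjugate_apply]
  rw [this]
  refine ((smooth_det hA).inv fun x hx => (hg.det_neg x hx).ne).mul (smooth_det fun i j => ?_)
  by_cases hi : i = b
  · subst hi; simpa using contDiffOn_const
  · simpa [Matrix.updateRow_ne hi] using hA i j

theorem IsMetricOn.smooth_christoffel {U : Set Pt} {g : Tensor 2} (hg : IsMetricOn U g)
    (a b c : Fin 4) : ContDiffOn ℝ ∞ (fun x => christoffel g x a b c) U := by
  unfold christoffel
  exact contDiffOn_const.mul (ContDiffOn.sum fun r _ => (hg.smooth_ginv a r).mul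
    (((smooth_pd hg.isOpen (hg.smooth _) _).add (smooth_pd hg.isOpen (hg.smooth _) _)).sub
      (smooth_pd hg.isOpen (hg.smooth _) _)))

namespace IsMetricOn

variable {U : Set Pt} {g : Tensor 2}

theorem christoffel_symm (hg : IsMetricOn U g) {x : Pt} (hx : x ∈ U) (a b c : Fin 4) :
    christoffel g x a b c = christoffel g x a c b := by
  unfold christoffel
  congr 1
  refine Finset.sum_congr rfl fun r _ => ?_
  rw [pd_congr hg.isOpen (fun y hy => hg.symm y hy b r) hx c,
    pd_congr hg.isOpen (fun y hy => hg.symm y hy r c) hx b,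
    pd_congr hg.isOpen (fun y hy => hg.symm y hy b c) hx r]
  ring

/-- Lowering the index removes the inverse metric and leaves the Christoffel symbols of the first
kind; metric compatibility is then linear algebra in the derivatives of `g`. -/
theorem lower_christoffel (hg : IsMetricOn U g) {x : Pt} (hx : x ∈ U) (s b c : Fin 4) :
    ∑ a, g x ![s, a] * christoffel g x a b c = (1 / 2) *
      (pd b (fun y => g y ![s, c]) x + pd c (fun y => g y ![b, s]) x
        - pd s (fun y => g y ![b, c]) x) := by
  unfold christoffel
  set W : Fin 4 → ℝ := fun r => pd b (fun y => g y ![r, c]) x + pd c (fun y => g y ![b, r]) x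
        - pd r (fun y => g y ![b, c]) x with hW
  change ∑ a, g x ![s, a] * (1 / 2 * ∑ r, ginv g x a r * W r) = 1 / 2 * W s
  have : ∀ a, g x ![s, a] * (1 / 2 * ∑ r, ginv g x a r * W r)
      = 1 / 2 * ∑ r, (g x ![s, a] * ginv g x a r) * W r := by
    intro a; rw [Finset.mul_sum, Finset.mul_sum, Finset.mul_sum]
    exact Finset.sum_congr rfl fun r _ => by ring
  simp_rw [this]
  rw [← Finset.mul_sum, Finset.sum_comm]
  simp_rw [← Finset.sum_mul, hg.mul_ginv hx]
  simp

/-- The Christoffel symbols are those of a metric connection. -/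
theorem pd_metric (hg : IsMetricOn U g) {x : Pt} (hx : x ∈ U) (e a b : Fin 4) :
    pd e (fun y => g y ![a, b]) x
      = ∑ r, christoffel g x r e a * g x ![r, b] + ∑ r, christoffel g x r e b * g x ![a, r] := by
  have h1 : ∑ r, christoffel g x r e a * g x ![r, b]
      = ∑ r, g x ![b, r] * christoffel g x r e a :=
    Finset.sum_congr rfl fun r _ => by rw [hg.symm x hx r b]; ring
  have h2 : ∑ r, christoffel g x r e b * g x ![a, r]
      = ∑ r, g x ![a, r] * christoffel g x r e b :=
    Finset.sum_congr rfl fun r _ => by ring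
  rw [h1, h2, hg.lower_christoffel hx, hg.lower_christoffel hx,
    pd_congr hg.isOpen (fun y hy => hg.symm y hy b a) hx e,
    pd_congr hg.isOpen (fun y hy => hg.symm y hy e b) hx a,
    pd_congr hg.isOpen (fun y hy => hg.symm y hy e a) hx b]
  ring

/-- Differentiating `g⁻¹ g = 1` gives `X K + H Y = 0` for the matrices below. Metric compatibility
is `Y = Gᵀ K + K G`; multiplying by the inverse isolates the derivative of `g⁻¹`. -/
theorem pd_ginv (hg : IsMetricOn U g) {x : Pt} (hx : x ∈ U) (e p q : Fin 4) :
    pd e (fun y => ginv g y p q) x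
      = -∑ r, christoffel g x p e r * ginv g x r q - ∑ r, christoffel g x q e r * ginv g x p r := by
  have hd : ∀ a b, DifferentiableAt ℝ (fun y => ginv g y a b) x := fun a b =>
    diffAt hg.isOpen (hg.smooth_ginv a b) hx
  have hd' : ∀ a b, DifferentiableAt ℝ (fun y => g y ![a, b]) x := fun a b =>
    diffAt hg.isOpen (hg.smooth ![a, b]) hx
  set X : Matrix (Fin 4) (Fin 4) ℝ := fun a b => pd e (fun y => ginv g y a b) x with hX
  set G : Matrix (Fin 4) (Fin 4) ℝ := fun a b => christoffel g x a e b with hG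
  set H : Matrix (Fin 4) (Fin 4) ℝ := fun a b => ginv g x a b with hH
  set Y : Matrix (Fin 4) (Fin 4) ℝ := fun a b => pd e (fun y => g y ![a, b]) x with hY
  set K : Matrix (Fin 4) (Fin 4) ℝ := fun a b => g x ![a, b] with hK
  have hKH : K * H = 1 := by
    ext a b; simp only [Matrix.mul_apply, Matrix.one_apply]; exact hg.mul_ginv hx a b
  have hHK : H * K = 1 := by
    ext a b; simp only [Matrix.mul_apply, Matrix.one_apply]; exact hg.ginv_mul hx a b
  have hXK : X * K + H * Y = 0 := by
    ext a b
    have h1 : pd e (fun y => ∑ c, ginv g y a c * g y ![c, b]) x = 0 := by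
      rw [pd_congr hg.isOpen (fun y hy => hg.ginv_mul hy a b) hx e, pd_const]
    rw [pd_sum (f := fun c y => ginv g y a c * g y ![c, b])
      fun c _ => (hd a c).mul (hd' c b)] at h1
    simp only [pd_mul (hd a _) (hd' _ b), Finset.sum_add_distrib] at h1
    simpa [Matrix.mul_apply] using h1
  have hYK : Y = G.transpose * K + K * G := by
    ext a b
    simp only [Matrix.add_apply, Matrix.mul_apply, Matrix.transpose_apply]
    refine (hg.pd_metric hx e a b).trans ?_
    congr 1
    exact Finset.sum_congr rfl fun r _ => mul_comm _ _
  have hX2 : X = -(H * G.transpose) - G * H := by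
    have h3 : X * K * H = -(H * Y * H) := by
      rw [eq_neg_of_add_eq_zero_left hXK, Matrix.neg_mul]
    rw [Matrix.mul_assoc, hKH, Matrix.mul_one] at h3
    rw [h3, hYK]
    have h4 : H * (G.transpose * K + K * G) * H
        = H * G.transpose * (K * H) + (H * K) * G * H := by
      simp only [Matrix.mul_add, Matrix.add_mul, Matrix.mul_assoc]
    rw [h4, hKH, hHK]; simp only [Matrix.mul_one, Matrix.one_mul]; abel
  have h5 := congrFun (congrFun hX2 p) q
  have h6 : X p q = -∑ r, ginv g x p r * christoffel g x q e r
      - ∑ r, christoffel g x p e r * ginv g x r q := by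
    rw [h5, Matrix.sub_apply, Matrix.neg_apply, Matrix.mul_apply, Matrix.mul_apply]
    rfl
  rw [show pd e (fun y => ginv g y p q) x = X p q from rfl, h6]
  have : ∑ r, ginv g x p r * christoffel g x q e r = ∑ r, christoffel g x q e r * ginv g x p r :=
    Finset.sum_congr rfl fun r _ => mul_comm _ _
  rw [this]; ring

end IsMetricOn

end CEM
namespace CEM

/-! ### The covariant derivative of tensors of arbitrary rank -/

/-- Contraction of two lower indices with a contravariant metric `h`. -/
noncomputable def ctr (h : Fin 4 → Fin 4 → ℝ) (f : Fin 4 → Fin 4 → ℝ) : ℝ :=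
  ∑ p, ∑ q, h p q * f p q

theorem update_cons_zero' {k : ℕ} (a r : Fin 4) (i : Fin k → Fin 4) :
    Function.update (Matrix.vecCons a i) 0 r = Matrix.vecCons r i := by
  simp [Matrix.vecCons]

theorem update_cons_succ' {k : ℕ} (a r : Fin 4) (i : Fin k → Fin 4) (m : Fin k) :
    Function.update (Matrix.vecCons a i) m.succ r = Matrix.vecCons a (Function.update i m r) := by
  simp [Matrix.vecCons, Fin.cons_update]

theorem covD_cons (g : Tensor 2) {k : ℕ} (T : Tensor k) (x : Pt) (e : Fin 4) (i : Fin k → Fin 4) :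
    covD g T x (Matrix.vecCons e i) = pd e (fun y => T y i) x
      - ∑ m : Fin k, ∑ r, christoffel g x r e (i m) * T x (Function.update i m r) := by
  simp [covD]

theorem smooth_covD {U : Set Pt} {g : Tensor 2} (hg : IsMetricOn U g) {k : ℕ} {T : Tensor k}
    (hT : SmoothT U T) : SmoothT U (covD g T) := fun i => by
  unfold covD
  exact (smooth_pd hg.isOpen (hT _) _).sub (ContDiffOn.sum fun m _ => ContDiffOn.sum fun r _ =>
    (hg.smooth_christoffel _ _ _).mul (hT _))

theorem covD_congr {U : Set Pt} (hU : IsOpen U) {g : Tensor 2} {k : ℕ} {T S : Tensor k}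
    (h : ∀ x ∈ U, ∀ i, T x i = S x i) {x : Pt} (hx : x ∈ U) (i : Fin (k + 1) → Fin 4) :
    covD g T x i = covD g S x i := by
  unfold covD
  rw [pd_congr hU (fun y hy => h y hy _) hx]
  simp only [h x hx]

theorem covD_zero (g : Tensor 2) {k : ℕ} (x : Pt) (i : Fin (k + 1) → Fin 4) :
    covD g (fun _ (_ : Fin k → Fin 4) => 0) x i = 0 := by
  simp [covD, pd_const]

theorem covD_add {U : Set Pt} (hU : IsOpen U) {g : Tensor 2} {k : ℕ} {T S : Tensor k}
    (hT : SmoothT U T) (hS : SmoothT U S) {x : Pt} (hx : x ∈ U) (i : Fin (k + 1) → Fin 4) :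
    covD g (fun y j => T y j + S y j) x i = covD g T x i + covD g S x i := by
  unfold covD
  rw [pd_add (diffAt hU (hT _) hx) (diffAt hU (hS _) hx)]
  simp only [mul_add, Finset.sum_add_distrib]; ring

theorem covD_sub {U : Set Pt} (hU : IsOpen U) {g : Tensor 2} {k : ℕ} {T S : Tensor k}
    (hT : SmoothT U T) (hS : SmoothT U S) {x : Pt} (hx : x ∈ U) (i : Fin (k + 1) → Fin 4) :
    covD g (fun y j => T y j - S y j) x i = covD g T x i - covD g S x i := by
  unfold covD
  rw [pd_sub (diffAt hU (hT _) hx) (diffAt hU (hS _) hx)]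
  simp only [mul_sub, Finset.sum_sub_distrib]; ring

theorem covD_smul {U : Set Pt} (hU : IsOpen U) {g : Tensor 2} {k : ℕ} {φ : Pt → ℝ} {T : Tensor k}
    (hφ : ContDiffOn ℝ ∞ φ U) (hT : SmoothT U T) {x : Pt} (hx : x ∈ U) (e : Fin 4)
    (i : Fin k → Fin 4) :
    covD g (fun y j => φ y * T y j) x (Matrix.vecCons e i)
      = pd e φ x * T x i + φ x * covD g T x (Matrix.vecCons e i) := by
  rw [covD_cons, covD_cons, pd_mul (diffAt hU hφ hx) (diffAt hU (hT _) hx), mul_sub,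
    Finset.mul_sum]
  simp only [Finset.mul_sum]
  rw [add_sub_assoc]; congr 2
  exact Finset.sum_congr rfl fun m _ => Finset.sum_congr rfl fun r _ => by ring

theorem covD_const_mul {U : Set Pt} (hU : IsOpen U) {g : Tensor 2} {k : ℕ} (c : ℝ) {T : Tensor k}
    (hT : SmoothT U T) {x : Pt} (hx : x ∈ U) (i : Fin (k + 1) → Fin 4) :
    covD g (fun y j => c * T y j) x i = c * covD g T x i := by
  unfold covD
  rw [pd_const_mul c (diffAt hU (hT _) hx), mul_sub, Finset.mul_sum]
  simp only [Finset.mul_sum]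
  congr 1
  exact Finset.sum_congr rfl fun m _ => Finset.sum_congr rfl fun r _ => by ring

/-- Permuting the indices of a tensor. -/
theorem covD_reindex (g : Tensor 2) {k n : ℕ} (T : Tensor k) {ρ : Fin k → Fin n}
    (hρ : Function.Bijective ρ) (x : Pt) (e : Fin 4) (i : Fin n → Fin 4) :
    covD g (fun y j => T y (j ∘ ρ)) x (Matrix.vecCons e i)
      = covD g T x (Matrix.vecCons e (i ∘ ρ)) := by
  rw [covD_cons, covD_cons]
  congr 1
  refine (Fintype.sum_bijective ρ hρ _ _ fun m => Finset.sum_congr rfl fun r _ => ?_).symm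
  have : Function.update i (ρ m) r ∘ ρ = Function.update (i ∘ ρ) m r := by
    funext j
    by_cases h : j = m
    · subst h; simp
    · simp [h, hρ.1.eq_iff]
  rw [this]; rfl

/-- The tensor product. -/
def tmul {k l : ℕ} (T : Tensor k) (S : Tensor l) : Tensor (k + l) := fun x i =>
  T x (i ∘ Fin.castAdd l) * S x (i ∘ Fin.natAdd k)

/-- Each Christoffel correction acts on a single slot, hence on exactly one of the two factors. -/
theorem covD_tmul {U : Set Pt} (hU : IsOpen U) {g : Tensor 2} {k l : ℕ} {T : Tensor k}
    {S : Tensor l} (hT : SmoothT U T) (hS : SmoothT U S) {x : Pt} (hx : x ∈ U) (e : Fin 4)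
    (i : Fin (k + l) → Fin 4) :
    covD g (tmul T S) x (Matrix.vecCons e i)
      = covD g T x (Matrix.vecCons e (i ∘ Fin.castAdd l)) * S x (i ∘ Fin.natAdd k)
        + T x (i ∘ Fin.castAdd l) * covD g S x (Matrix.vecCons e (i ∘ Fin.natAdd k)) := by
  have h1 : ∀ (m : Fin k) (r : Fin 4), Function.update i (Fin.castAdd l m) r ∘ Fin.castAdd l
      = Function.update (i ∘ Fin.castAdd l) m r := by
    intro m r; funext j; by_cases h : j = m
    · subst h; simp
    · simp [h]
  have h2 : ∀ (m : Fin k) (r : Fin 4), Function.update i (Fin.castAdd l m) r ∘ Fin.natAdd k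
      = i ∘ Fin.natAdd k := by
    intro m r; funext j
    have : Fin.natAdd k j ≠ Fin.castAdd l m := by
      intro h; have := congrArg Fin.val h; simp at this; omega
    simp [this]
  have h3 : ∀ (m : Fin l) (r : Fin 4), Function.update i (Fin.natAdd k m) r ∘ Fin.natAdd k
      = Function.update (i ∘ Fin.natAdd k) m r := by
    intro m r; funext j; by_cases h : j = m
    · subst h; simp
    · simp [h]
  have h4 : ∀ (m : Fin l) (r : Fin 4), Function.update i (Fin.natAdd k m) r ∘ Fin.castAdd l
      = i ∘ Fin.castAdd l := by
    intro m r; funext j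
    have : Fin.castAdd l j ≠ Fin.natAdd k m := by
      intro h; have := congrArg Fin.val h; simp at this; omega
    simp [this]
  rw [covD_cons, covD_cons, covD_cons, Fin.sum_univ_add]
  simp only [tmul, h1, h2, h3, h4]
  rw [pd_mul (diffAt hU (hT _) hx) (diffAt hU (hS _) hx)]
  rw [sub_mul, mul_sub, Finset.sum_mul, Finset.mul_sum]
  simp only [Finset.sum_mul, Finset.mul_sum, Function.comp_apply]
  have h5 : ∀ a b c d e' f : ℝ, c = e' → d = f → a + b - (c + d) = a - e' + (b - f) := by
    intros; subst_vars; ring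
  refine h5 _ _ _ _ _ _ ?_ ?_
  · exact Finset.sum_congr rfl fun m _ => Finset.sum_congr rfl fun r _ => by ring
  · exact Finset.sum_congr rfl fun m _ => Finset.sum_congr rfl fun r _ => by ring

/-- The product rule, for a product whose indices are distributed over the factors. -/
theorem covD_mul {U : Set Pt} (hU : IsOpen U) {g : Tensor 2} {k l n : ℕ} {A : Tensor k}
    {B : Tensor l} (hA : SmoothT U A) (hB : SmoothT U B) {α : Fin k → Fin n} {β : Fin l → Fin n}
    (hαβ : Function.Bijective (Fin.append α β)) {x : Pt} (hx : x ∈ U) (e : Fin 4)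
    (i : Fin n → Fin 4) :
    covD g (fun y j => A y (j ∘ α) * B y (j ∘ β)) x (Matrix.vecCons e i)
      = covD g A x (Matrix.vecCons e (i ∘ α)) * B x (i ∘ β)
        + A x (i ∘ α) * covD g B x (Matrix.vecCons e (i ∘ β)) := by
  have h1 : ∀ j : Fin n → Fin 4, (j ∘ Fin.append α β) ∘ Fin.castAdd l = j ∘ α := fun j => by
    funext m; simp
  have h2 : ∀ j : Fin n → Fin 4, (j ∘ Fin.append α β) ∘ Fin.natAdd k = j ∘ β := fun j => by
    funext m; simp
  have := covD_reindex g (tmul A B) hαβ x e i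
  rw [covD_tmul hU hA hB hx, h1, h2] at this
  rw [← this]
  simp only [tmul, h1, h2]

/-- Contraction of the first two indices. -/
noncomputable def tctr (g : Tensor 2) {k : ℕ} (T : Tensor (k + 2)) : Tensor k := fun x i =>
  ctr (ginv g x) (fun p q => T x (Matrix.vecCons p (Matrix.vecCons q i)))

theorem smooth_ctr {U : Set Pt} {g : Tensor 2} (hg : IsMetricOn U g)
    {f : Pt → Fin 4 → Fin 4 → ℝ} (hf : ∀ p q, ContDiffOn ℝ ∞ (fun x => f x p q) U) :
    ContDiffOn ℝ ∞ (fun x => ctr (ginv g x) (f x)) U :=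
  ContDiffOn.sum fun _ _ => ContDiffOn.sum fun _ _ => (hg.smooth_ginv _ _).mul (hf _ _)

theorem smooth_tctr {U : Set Pt} {g : Tensor 2} (hg : IsMetricOn U g) {k : ℕ}
    {T : Tensor (k + 2)} (hT : SmoothT U T) : SmoothT U (tctr g T) := fun _ =>
  smooth_ctr hg fun _ _ => hT _

/-- The derivative of the contravariant metric supplies exactly the Christoffel corrections of the
two contracted slots, so contraction commutes with `∇`. -/
theorem covD_tctr {U : Set Pt} {g : Tensor 2} (hg : IsMetricOn U g) {k : ℕ}
    {T : Tensor (k + 2)} (hT : SmoothT U T) {x : Pt} (hx : x ∈ U) (e : Fin 4) (i : Fin k → Fin 4) :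
    covD g (tctr g T) x (Matrix.vecCons e i) = ctr (ginv g x) (fun p q =>
      covD g T x (Matrix.vecCons e (Matrix.vecCons p (Matrix.vecCons q i)))) := by
  have hd : ∀ p q, DifferentiableAt ℝ (fun y => ginv g y p q) x := fun p q =>
    diffAt hg.isOpen (hg.smooth_ginv p q) hx
  have hd' : ∀ j, DifferentiableAt ℝ (fun y => T y j) x := fun j =>
    diffAt hg.isOpen (hT j) hx
  have hpd : pd e (fun y => tctr g T y i) x = ∑ p, ∑ q,
      (pd e (fun y => ginv g y p q) x * T x (Matrix.vecCons p (Matrix.vecCons q i))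
        + ginv g x p q * pd e (fun y => T y (Matrix.vecCons p (Matrix.vecCons q i))) x) := by
    unfold tctr ctr
    exact pd_sum_sum_mul (fun p q => hd p q) fun p q => hd' _
  rw [covD_cons, hpd]
  simp only [covD_cons, Fin.sum_univ_succ (n := k + 1), Fin.sum_univ_succ (n := k),
    update_cons_zero', Matrix.cons_val_zero, Matrix.cons_val_succ,
    update_cons_succ', hg.pd_ginv hx, tctr, ctr]
  set t : Fin 4 → Fin 4 → ℝ := fun p q => T x (Matrix.vecCons p (Matrix.vecCons q i))
  have e1 : ∑ p, ∑ q, (∑ r, christoffel g x p e r * ginv g x r q) * t p q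
      = ∑ p, ∑ q, ginv g x p q * ∑ r, christoffel g x r e p * t r q := by
    simp only [Finset.sum_mul, Finset.mul_sum]
    have : ∀ f : Fin 4 → Fin 4 → Fin 4 → ℝ, ∑ p, ∑ q, ∑ r, f p q r = ∑ r, ∑ q, ∑ p, f p q r := by
      intro f
      rw [Finset.sum_congr rfl fun p _ => Finset.sum_comm, Finset.sum_comm]
      exact Finset.sum_congr rfl fun r _ => Finset.sum_comm
    rw [this]
    exact Finset.sum_congr rfl fun _ _ => Finset.sum_congr rfl fun _ _ =>
      Finset.sum_congr rfl fun _ _ => by ring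
  have e2 : ∑ p, ∑ q, (∑ r, christoffel g x q e r * ginv g x p r) * t p q
      = ∑ p, ∑ q, ginv g x p q * ∑ r, christoffel g x r e q * t p r := by
    simp only [Finset.sum_mul, Finset.mul_sum]
    refine Finset.sum_congr rfl fun p _ => ?_
    rw [Finset.sum_comm]
    exact Finset.sum_congr rfl fun _ _ => Finset.sum_congr rfl fun _ _ => by ring
  have e3 : ∑ m : Fin k, ∑ r, christoffel g x r e (i m) * ∑ p, ∑ q, ginv g x p q
        * T x (Matrix.vecCons p (Matrix.vecCons q (Function.update i m r)))
      = ∑ p, ∑ q, ginv g x p q * ∑ m : Fin k, ∑ r, christoffel g x r e (i m)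
        * T x (Matrix.vecCons p (Matrix.vecCons q (Function.update i m r))) := by
    simp only [Finset.mul_sum]
    rw [Finset.sum_congr rfl fun m _ => Finset.sum_comm, Finset.sum_comm]
    refine Finset.sum_congr rfl fun p _ => ?_
    rw [Finset.sum_congr rfl fun m _ => Finset.sum_comm, Finset.sum_comm]
    exact Finset.sum_congr rfl fun _ _ => Finset.sum_congr rfl fun _ _ =>
      Finset.sum_congr rfl fun _ _ => by ring
  rw [e3]
  simp only [sub_mul, neg_mul, mul_sub, mul_add, Finset.sum_add_distrib, Finset.sum_sub_distrib,
    Finset.sum_neg_distrib]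
  rw [e1, e2]; ring

/-- The product rule, with one contraction. -/
theorem covD_ctr_mul {U : Set Pt} {g : Tensor 2} (hg : IsMetricOn U g) {k l n : ℕ} {A : Tensor k}
    {B : Tensor l} (hA : SmoothT U A) (hB : SmoothT U B) {α : Fin k → Fin (n + 2)}
    {β : Fin l → Fin (n + 2)} (hαβ : Function.Bijective (Fin.append α β)) {x : Pt} (hx : x ∈ U)
    (e : Fin 4) (i : Fin n → Fin 4) :
    covD g (fun y j => ctr (ginv g y) fun p q =>
        A y (Matrix.vecCons p (Matrix.vecCons q j) ∘ α)
          * B y (Matrix.vecCons p (Matrix.vecCons q j) ∘ β)) x (Matrix.vecCons e i)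
      = ctr (ginv g x) fun p q =>
        covD g A x (Matrix.vecCons e (Matrix.vecCons p (Matrix.vecCons q i) ∘ α))
          * B x (Matrix.vecCons p (Matrix.vecCons q i) ∘ β)
        + A x (Matrix.vecCons p (Matrix.vecCons q i) ∘ α)
          * covD g B x (Matrix.vecCons e (Matrix.vecCons p (Matrix.vecCons q i) ∘ β)) := by
  have h := covD_tctr hg (T := fun y (j : Fin (n + 2) → Fin 4) => A y (j ∘ α) * B y (j ∘ β))
    (fun j => (hA _).mul (hB _)) hx e i
  simp only [covD_mul hg.isOpen hA hB hαβ hx] at h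
  exact h

/-- The product rule, with two contractions. -/
theorem covD_ctr_ctr_mul {U : Set Pt} {g : Tensor 2} (hg : IsMetricOn U g) {k l n : ℕ}
    {A : Tensor k} {B : Tensor l} (hA : SmoothT U A) (hB : SmoothT U B)
    {α : Fin k → Fin (n + 2 + 2)} {β : Fin l → Fin (n + 2 + 2)}
    (hαβ : Function.Bijective (Fin.append α β)) {x : Pt} (hx : x ∈ U)
    (e : Fin 4) (i : Fin n → Fin 4) :
    covD g (fun y j => ctr (ginv g y) fun p q => ctr (ginv g y) fun r s =>
        A y (Matrix.vecCons r (Matrix.vecCons s (Matrix.vecCons p (Matrix.vecCons q j))) ∘ α)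
          * B y (Matrix.vecCons r (Matrix.vecCons s (Matrix.vecCons p (Matrix.vecCons q j))) ∘ β))
        x (Matrix.vecCons e i)
      = ctr (ginv g x) fun p q => ctr (ginv g x) fun r s =>
        covD g A x (Matrix.vecCons e
          (Matrix.vecCons r (Matrix.vecCons s (Matrix.vecCons p (Matrix.vecCons q i))) ∘ α))
          * B x (Matrix.vecCons r (Matrix.vecCons s (Matrix.vecCons p (Matrix.vecCons q i))) ∘ β)
        + A x (Matrix.vecCons r (Matrix.vecCons s (Matrix.vecCons p (Matrix.vecCons q i))) ∘ α)
          * covD g B x (Matrix.vecCons e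
          (Matrix.vecCons r (Matrix.vecCons s (Matrix.vecCons p (Matrix.vecCons q i))) ∘ β)) := by
  have hs : SmoothT U (fun y (j : Fin (n + 2 + 2) → Fin 4) => A y (j ∘ α) * B y (j ∘ β)) :=
    fun j => (hA _).mul (hB _)
  have h := covD_tctr hg (smooth_tctr hg hs) hx e i
  simp only [covD_tctr hg hs hx, covD_mul hg.isOpen hA hB hαβ hx] at h
  exact h

theorem comp_cons {α β : Type*} {n : ℕ} (f : α → β) (a : α) (s : Fin n → α) :
    f ∘ Matrix.vecCons a s = Matrix.vecCons (f a) (f ∘ s) := by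
  funext j; refine Fin.cases ?_ (fun j => ?_) j <;> simp

theorem comp_empty {α β : Type*} (f : α → β) (s : Fin 0 → α) : f ∘ s = ![] :=
  Subsingleton.elim _ _

theorem covD_metric {U : Set Pt} {g : Tensor 2} (hg : IsMetricOn U g) {x : Pt} (hx : x ∈ U)
    (i : Fin 3 → Fin 4) : covD g g x i = 0 := by
  rw [eq_triple i, covD_cons, hg.pd_metric hx]
  have h1 : ∀ a b r : Fin 4, Function.update ![a, b] 0 r = ![r, b] := fun a b r =>
    update_cons_zero' _ _ _
  have h2 : ∀ a b r : Fin 4, Function.update ![a, b] 1 r = ![a, r] := fun a b r => by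
    funext j; fin_cases j <;> simp
  simp [Fin.sum_univ_two, h1, h2]

/-! ### The Ricci identity -/

/-- All second derivatives are expanded in coordinates. The `∂∂T` terms cancel by Schwarz, the
correction in the derivative slot by symmetry of the Christoffel symbols, and the `Γ ∂T` terms
because they are symmetric in `a, b`. Products of two Christoffel symbols acting on different slots
cancel after exchanging the slots; those acting on the same slot combine with `∂Γ` to the curvature.
-/
theorem covD_covD_comm {U : Set Pt} {g : Tensor 2} (hg : IsMetricOn U g) {k : ℕ} {T : Tensor k}
    (hT : SmoothT U T) {x : Pt} (hx : x ∈ U) (a b : Fin 4) (i : Fin k → Fin 4) :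
    covD g (covD g T) x (Matrix.vecCons a (Matrix.vecCons b i))
      - covD g (covD g T) x (Matrix.vecCons b (Matrix.vecCons a i))
      = -∑ m, ∑ r, curv g x r (i m) a b * T x (Function.update i m r) := by
  have hU := hg.isOpen
  have hdT : ∀ j, DifferentiableAt ℝ (fun y => T y j) x := fun j => diffAt hU (hT j) hx
  have hdpT : ∀ c j, DifferentiableAt ℝ (pd c fun y => T y j) x := fun c j =>
    diffAt hU (smooth_pd hU (hT j) c) hx
  have hdG : ∀ p q r, DifferentiableAt ℝ (fun y => christoffel g y p q r) x := fun p q r =>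
    diffAt hU (hg.smooth_christoffel p q r) hx
  -- the second derivative, expanded
  have key : ∀ a b, covD g (covD g T) x (Matrix.vecCons a (Matrix.vecCons b i))
      = pd a (pd b fun y => T y i) x
        - ∑ m, ∑ r, pd a (fun y => christoffel g y r b (i m)) x * T x (Function.update i m r)
        - ∑ m, ∑ r, christoffel g x r b (i m) * pd a (fun y => T y (Function.update i m r)) x
        - ∑ r, christoffel g x r a b * covD g T x (Matrix.vecCons r i)
        - ∑ m, ∑ r, christoffel g x r a (i m) * pd b (fun y => T y (Function.update i m r)) x
        + ∑ m, ∑ r, christoffel g x r a (i m) * ∑ m', ∑ r',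
            christoffel g x r' b (Function.update i m r m')
              * T x (Function.update (Function.update i m r) m' r') := by
    intro a b
    have h1 : pd a (fun y => covD g T y (Matrix.vecCons b i)) x
        = pd a (pd b fun y => T y i) x
        - ∑ m, ∑ r, (pd a (fun y => christoffel g y r b (i m)) x * T x (Function.update i m r)
          + christoffel g x r b (i m) * pd a (fun y => T y (Function.update i m r)) x) := by
      simp only [covD_cons]
      have hs : DifferentiableAt ℝ (fun y => ∑ m, ∑ r, christoffel g y r b (i m)
          * T y (Function.update i m r)) x :=
        DifferentiableAt.fun_sum fun m _ => DifferentiableAt.fun_sum fun r _ =>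
          (hdG _ _ _).mul (hdT _)
      rw [pd_sub (hdpT b i) hs, pd_sum_sum_mul (fun m r => hdG _ _ _) fun m r => hdT _]
    rw [covD_cons, h1, Fin.sum_univ_succ]
    simp only [update_cons_zero', Matrix.cons_val_zero, Matrix.cons_val_succ, update_cons_succ']
    have h2 : ∑ m : Fin k, ∑ r, christoffel g x r a (i m)
          * covD g T x (Matrix.vecCons b (Function.update i m r))
        = ∑ m, ∑ r, christoffel g x r a (i m) * pd b (fun y => T y (Function.update i m r)) x
        - ∑ m, ∑ r, christoffel g x r a (i m) * ∑ m', ∑ r',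
            christoffel g x r' b (Function.update i m r m')
              * T x (Function.update (Function.update i m r) m' r') := by
      simp only [covD_cons, mul_sub, Finset.sum_sub_distrib]
    rw [h2]
    simp only [Finset.sum_add_distrib]
    ring
  -- the quadratic part
  have quad : ∀ a b, ∑ m, ∑ r, christoffel g x r a (i m) * ∑ m', ∑ r',
            christoffel g x r' b (Function.update i m r m')
              * T x (Function.update (Function.update i m r) m' r')
      = ∑ m, ∑ r, (∑ s, christoffel g x s a (i m) * christoffel g x r b s)
            * T x (Function.update i m r)
        + ∑ m, ∑ m', (if m' = m then 0 else ∑ r, ∑ r', christoffel g x r a (i m)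
            * christoffel g x r' b (i m')
              * T x (Function.update (Function.update i m r) m' r')) := by
    intro a b
    rw [← Finset.sum_add_distrib]
    refine Finset.sum_congr rfl fun m _ => ?_
    have h3 : ∑ r, christoffel g x r a (i m) * ∑ m', ∑ r',
            christoffel g x r' b (Function.update i m r m')
              * T x (Function.update (Function.update i m r) m' r')
        = ∑ m', ∑ r, ∑ r', christoffel g x r a (i m)
            * christoffel g x r' b (Function.update i m r m')
              * T x (Function.update (Function.update i m r) m' r') := by
      simp only [Finset.mul_sum]
      rw [Finset.sum_comm]
      exact Finset.sum_congr rfl fun _ _ => Finset.sum_congr rfl fun _ _ =>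
        Finset.sum_congr rfl fun _ _ => by ring
    rw [h3, ← Finset.add_sum_erase _ _ (Finset.mem_univ m),
      ← Finset.add_sum_erase (a := m) _ (fun m' => if m' = m then (0 : ℝ) else _)
        (Finset.mem_univ m)]
    simp only [Function.update_self, Function.update_idem, if_true, zero_add]
    congr 1
    · rw [Finset.sum_comm]
      exact Finset.sum_congr rfl fun _ _ => by rw [Finset.sum_mul]
    · refine Finset.sum_congr rfl fun m' hm' => ?_
      have hne : m' ≠ m := (Finset.mem_erase.1 hm').1
      simp [hne]
  -- Corrections on two distinct slots commute, so the off-diagonal part is symmetric in `a, b`.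
  have swap : ∑ m, ∑ m', (if m' = m then 0 else ∑ r, ∑ r', christoffel g x r a (i m)
            * christoffel g x r' b (i m')
              * T x (Function.update (Function.update i m r) m' r'))
      = ∑ m, ∑ m', (if m' = m then 0 else ∑ r, ∑ r', christoffel g x r b (i m)
            * christoffel g x r' a (i m')
              * T x (Function.update (Function.update i m r) m' r')) := by
    rw [Finset.sum_comm]
    refine Finset.sum_congr rfl fun m _ => Finset.sum_congr rfl fun m' _ => ?_
    by_cases h : m = m'
    · simp [h]
    · rw [if_neg h, if_neg (Ne.symm h), Finset.sum_comm]
      refine Finset.sum_congr rfl fun r _ => Finset.sum_congr rfl fun r' _ => ?_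
      rw [Function.update_comm h]; ring
  have hC : ∑ r, christoffel g x r a b * covD g T x (Matrix.vecCons r i)
      = ∑ r, christoffel g x r b a * covD g T x (Matrix.vecCons r i) :=
    Finset.sum_congr rfl fun r _ => by rw [hg.christoffel_symm hx]
  have hcurv : ∑ m, ∑ r, curv g x r (i m) a b * T x (Function.update i m r)
      = ∑ m, ∑ r, pd a (fun y => christoffel g y r b (i m)) x * T x (Function.update i m r)
        - ∑ m, ∑ r, pd b (fun y => christoffel g y r a (i m)) x * T x (Function.update i m r)
        + (∑ m, ∑ r, (∑ s, christoffel g x s b (i m) * christoffel g x r a s)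
            * T x (Function.update i m r)
          - ∑ m, ∑ r, (∑ s, christoffel g x s a (i m) * christoffel g x r b s)
            * T x (Function.update i m r)) := by
    simp only [← Finset.sum_sub_distrib, ← Finset.sum_add_distrib]
    refine Finset.sum_congr rfl fun m _ => Finset.sum_congr rfl fun r _ => ?_
    rw [curv, ← sub_mul, ← sub_mul, ← add_mul, ← Finset.sum_sub_distrib]
    congr 2
    exact Finset.sum_congr rfl fun s _ => by ring
  rw [key a b, key b a, quad a b, quad b a, swap, hC, hcurv, pd_comm hU (hT i) hx a b]
  ring

end CEM
namespace CEM

/-! ### Algebra of contractions -/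

section Contraction

variable {h : Fin 4 → Fin 4 → ℝ}

theorem ctr_congr {f f' : Fin 4 → Fin 4 → ℝ} (H : ∀ p q, f p q = f' p q) : ctr h f = ctr h f' := by
  simp only [ctr, H]

theorem ctr_zero : ctr h (fun _ _ => 0) = 0 := by simp [ctr]

theorem ctr_add (f f' : Fin 4 → Fin 4 → ℝ) :
    ctr h (fun p q => f p q + f' p q) = ctr h f + ctr h f' := by
  simp only [ctr, mul_add, Finset.sum_add_distrib]

theorem ctr_sub (f f' : Fin 4 → Fin 4 → ℝ) :
    ctr h (fun p q => f p q - f' p q) = ctr h f - ctr h f' := by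
  simp only [ctr, mul_sub, Finset.sum_sub_distrib]

theorem ctr_neg (f : Fin 4 → Fin 4 → ℝ) : ctr h (fun p q => -f p q) = -ctr h f := by
  simp only [ctr, mul_neg, Finset.sum_neg_distrib]

theorem ctr_mul_left (c : ℝ) (f : Fin 4 → Fin 4 → ℝ) :
    ctr h (fun p q => c * f p q) = c * ctr h f := by
  simp only [ctr, Finset.mul_sum]
  exact Finset.sum_congr rfl fun p _ => Finset.sum_congr rfl fun q _ => by ring

theorem ctr_mul_right (c : ℝ) (f : Fin 4 → Fin 4 → ℝ) :
    ctr h (fun p q => f p q * c) = ctr h f * c := by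
  simp only [ctr, Finset.sum_mul]
  exact Finset.sum_congr rfl fun p _ => Finset.sum_congr rfl fun q _ => by ring

theorem ctr_comm {k : Fin 4 → Fin 4 → ℝ} (f : Fin 4 → Fin 4 → Fin 4 → Fin 4 → ℝ) :
    ctr h (fun p q => ctr k fun r s => f p q r s) = ctr k (fun r s => ctr h fun p q => f p q r s) := by
  simp only [ctr, Finset.mul_sum]
  have : ∀ F : Fin 4 → Fin 4 → Fin 4 → Fin 4 → ℝ,
      ∑ p, ∑ q, ∑ r, ∑ s, F p q r s = ∑ r, ∑ s, ∑ p, ∑ q, F p q r s := by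
    intro F
    rw [Finset.sum_congr rfl fun p _ => Finset.sum_comm, Finset.sum_comm]
    refine Finset.sum_congr rfl fun r _ => ?_
    rw [Finset.sum_congr rfl fun p _ => Finset.sum_comm, Finset.sum_comm]
  rw [this]
  exact Finset.sum_congr rfl fun _ _ => Finset.sum_congr rfl fun _ _ =>
    Finset.sum_congr rfl fun _ _ => Finset.sum_congr rfl fun _ _ => by ring

end Contraction

/-- A symmetric metric with its inverse, at one point. -/
structure MetAlg (h g : Fin 4 → Fin 4 → ℝ) : Prop where
  hs : ∀ a b, h a b = h b a
  gs : ∀ a b, g a b = g b a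
  inv : ∀ a b, ∑ c, g a c * h c b = if a = b then 1 else 0

namespace MetAlg

variable {h g : Fin 4 → Fin 4 → ℝ} (H : MetAlg h g)
include H

theorem swap (f : Fin 4 → Fin 4 → ℝ) : ctr h f = ctr h (fun p q => f q p) := by
  simp only [ctr]
  rw [Finset.sum_comm]
  exact Finset.sum_congr rfl fun p _ => Finset.sum_congr rfl fun q _ => by rw [H.hs]

theorem ctr_g_left (a : Fin 4) (f : Fin 4 → ℝ) : ctr h (fun p q => g a p * f q) = f a := by
  simp only [ctr]
  rw [Finset.sum_comm]
  have : ∀ q, ∑ p, h p q * (g a p * f q) = (if a = q then 1 else 0) * f q := by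
    intro q; rw [← H.inv, Finset.sum_mul]
    exact Finset.sum_congr rfl fun p _ => by ring
  simp [this]

theorem ctr_g_left' (a : Fin 4) (f : Fin 4 → ℝ) : ctr h (fun p q => g p a * f q) = f a := by
  simp only [H.gs _ a]; exact H.ctr_g_left a f

theorem ctr_g_right (a : Fin 4) (f : Fin 4 → ℝ) : ctr h (fun p q => g a q * f p) = f a := by
  rw [H.swap]; exact H.ctr_g_left a f

theorem ctr_g_right' (a : Fin 4) (f : Fin 4 → ℝ) : ctr h (fun p q => g q a * f p) = f a := by
  rw [H.swap]; exact H.ctr_g_left' a f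

theorem ctr_g : ctr h (fun p q => g p q) = 4 := by
  have : ∀ p, ∑ q, h p q * g p q = 1 := by
    intro p
    have := H.inv p p
    simp only [if_true] at this
    rw [← this]
    exact Finset.sum_congr rfl fun q _ => by rw [H.hs p q]; ring
  simp [ctr, this]

/-- The contraction of a symmetric with an antisymmetric object vanishes. -/
theorem ctr_antisymm {f : Fin 4 → Fin 4 → ℝ} (hf : ∀ p q, f p q = -f q p) : ctr h f = 0 := by
  have h1 := H.swap f
  have h2 : ctr h (fun p q => f q p) = -ctr h f := by
    rw [← ctr_neg]; exact ctr_congr fun p q => hf q p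
  linarith

end MetAlg

/-- The algebraic symmetries of a Weyl tensor at one point. -/
structure WeylAlg (h : Fin 4 → Fin 4 → ℝ) (d : Fin 4 → Fin 4 → Fin 4 → Fin 4 → ℝ) : Prop where
  anti₁ : ∀ a b c e, d a b c e = -d b a c e
  anti₂ : ∀ a b c e, d a b c e = -d a b e c
  pair : ∀ a b c e, d a b c e = d c e a b
  cyc : ∀ a b c e, d a b c e + d a c e b + d a e b c = 0
  tr₀₂ : ∀ b e, ctr h (fun p q => d p b q e) = 0

namespace WeylAlg

variable {h g : Fin 4 → Fin 4 → ℝ} {d : Fin 4 → Fin 4 → Fin 4 → Fin 4 → ℝ} (D : WeylAlg h d)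
include D

theorem tr₀₃ (b c : Fin 4) : ctr h (fun p q => d p b c q) = 0 := by
  rw [ctr_congr fun p q => D.anti₂ p b c q, ctr_neg, D.tr₀₂, neg_zero]

theorem tr₁₂ (a e : Fin 4) : ctr h (fun p q => d a p q e) = 0 := by
  rw [ctr_congr fun p q => D.anti₁ a p q e, ctr_neg, D.tr₀₂, neg_zero]

end WeylAlg

/-- A totally antisymmetric object with three indices in dimension four is determined by its four
increasing components. -/
theorem alternating_fin_four {f : Fin 4 → Fin 4 → Fin 4 → ℝ} (h₁ : ∀ a b c, f a b c = -f b a c)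
    (h₂ : ∀ a b c, f a b c = -f a c b) (h012 : f 0 1 2 = 0) (h013 : f 0 1 3 = 0)
    (h023 : f 0 2 3 = 0) (h123 : f 1 2 3 = 0) (a b c : Fin 4) : f a b c = 0 := by
  have e₁ : ∀ a c, f a a c = 0 := fun a c => by linarith [h₁ a a c]
  have e₂ : ∀ a b, f a b b = 0 := fun a b => by linarith [h₂ a b b]
  have e₃ : ∀ a b, f a b a = 0 := fun a b => by rw [h₁, e₂, neg_zero]
  have s : ∀ a b c, f a b c = 0 → f b a c = 0 ∧ f a c b = 0 := fun a b c h => by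
    constructor
    · rw [h₁, h, neg_zero]
    · rw [h₂, h, neg_zero]
  have s6 : ∀ a b c, f a b c = 0 → f b a c = 0 ∧ f a c b = 0 ∧ f b c a = 0 ∧ f c a b = 0
      ∧ f c b a = 0 := fun a b c h =>
    ⟨(s a b c h).1, (s a b c h).2, (s _ _ _ (s a b c h).1).2, (s _ _ _ (s a b c h).2).1,
      (s _ _ _ (s _ _ _ (s a b c h).1).2).1⟩
  obtain ⟨_, _, _, _, _⟩ := s6 _ _ _ h012
  obtain ⟨_, _, _, _, _⟩ := s6 _ _ _ h013
  obtain ⟨_, _, _, _, _⟩ := s6 _ _ _ h023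
  obtain ⟨_, _, _, _, _⟩ := s6 _ _ _ h123
  fin_cases a <;> fin_cases b <;> fin_cases c <;>
    first
    | exact e₁ _ _
    | exact e₂ _ _
    | exact e₃ _ _
    | assumption

/-- The tensor `3 · 3 · g_{[e}{}^{[f} d_{ab]}{}^{cd]}` (all indices lowered). -/
def kulkarni (g : Fin 4 → Fin 4 → ℝ) (d : Fin 4 → Fin 4 → Fin 4 → Fin 4 → ℝ)
    (a b e c k f : Fin 4) : ℝ :=
  (g e f * d a b c k + g e c * d a b k f + g e k * d a b f c)
    + (g a f * d b e c k + g a c * d b e k f + g a k * d b e f c)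
    + (g b f * d e a c k + g b c * d e a k f + g b k * d e a f c)

/-- In dimension four, a Weyl tensor satisfies `g_{[e}{}^{[f} d_{ab]}{}^{cd]} = 0`; here in an
orthonormal frame. -/
theorem kulkarni_diag {d : Fin 4 → Fin 4 → Fin 4 → Fin 4 → ℝ}
    (anti₁ : ∀ a b c e, d a b c e = -d b a c e) (anti₂ : ∀ a b c e, d a b c e = -d a b e c)
    (pair : ∀ a b c e, d a b c e = d c e a b)
    (tr : ∀ b e, ∑ k, (![-1, 1, 1, 1] : Fin 4 → ℝ) k * d k b k e = 0) (a b e c k f : Fin 4) :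
    kulkarni (fun i j => if i = j then (![-1, 1, 1, 1] : Fin 4 → ℝ) i else 0) d a b e c k f = 0 := by
  revert a b e
  -- The expression alternates in `a, b, e` and in `c, k, f`. It remains to check sixteen
  -- components, one for each pair of increasing triples.
  have main : ∀ a b e : Fin 4, (a = 0 ∧ b = 1 ∧ e = 2) ∨ (a = 0 ∧ b = 1 ∧ e = 3) ∨
      (a = 0 ∧ b = 2 ∧ e = 3) ∨ (a = 1 ∧ b = 2 ∧ e = 3) →
      kulkarni (fun i j => if i = j then (![-1, 1, 1, 1] : Fin 4 → ℝ) i else 0) d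
        a b e c k f = 0 := by
    intro a b e habe
    revert c k f
    apply alternating_fin_four
    · intro c k f
      unfold kulkarni
      rw [anti₂ a b c k, anti₂ a b k f, anti₂ a b f c, anti₂ b e c k, anti₂ b e k f, anti₂ b e f c,
        anti₂ e a c k, anti₂ e a k f, anti₂ e a f c]; ring
    · intro c k f
      unfold kulkarni
      rw [anti₂ a b c k, anti₂ a b k f, anti₂ a b f c, anti₂ b e c k, anti₂ b e k f, anti₂ b e f c,
        anti₂ e a c k, anti₂ e a k f, anti₂ e a f c]; ring
    all_goals
      have z : ∀ a c e, d a a c e = 0 := fun a c e => by linarith [anti₁ a a c e]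
      have z' : ∀ a c e, d c e a a = 0 := fun a c e => by linarith [anti₂ c e a a]
      -- The ten independent trace conditions, rewritten in independent components of `d`, imply
      -- each of the sixteen equations linearly.
      have t00 := tr 0 0; have t11 := tr 1 1; have t22 := tr 2 2; have t33 := tr 3 3
      have t01 := tr 0 1; have t02 := tr 0 2; have t03 := tr 0 3
      have t12 := tr 1 2; have t13 := tr 1 3; have t23 := tr 2 3
      simp [Fin.sum_univ_four, z, z', anti₁ 1 0, anti₁ 2 0, anti₁ 3 0, anti₁ 2 1, anti₁ 3 1,
        anti₁ 3 2, anti₂ _ _ 1 0, anti₂ _ _ 2 0, anti₂ _ _ 3 0, anti₂ _ _ 2 1, anti₂ _ _ 3 1,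
        anti₂ _ _ 3 2, pair 0 2 0 1, pair 0 3 0 1, pair 1 2 0 1, pair 1 3 0 1, pair 2 3 0 1,
        pair 0 3 0 2, pair 1 2 0 2, pair 1 3 0 2, pair 2 3 0 2, pair 1 2 0 3, pair 1 3 0 3,
        pair 2 3 0 3, pair 1 3 1 2, pair 2 3 1 2, pair 2 3 1 3]
        at t00 t11 t22 t33 t01 t02 t03 t12 t13 t23
      rcases habe with ⟨rfl, rfl, rfl⟩ | ⟨rfl, rfl, rfl⟩ | ⟨rfl, rfl, rfl⟩ | ⟨rfl, rfl, rfl⟩ <;>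
      · simp [kulkarni, anti₁ 1 0, anti₁ 2 0, anti₁ 3 0, anti₁ 2 1, anti₁ 3 1,
          anti₁ 3 2, anti₂ _ _ 1 0, anti₂ _ _ 2 0, anti₂ _ _ 3 0, anti₂ _ _ 2 1, anti₂ _ _ 3 1,
          anti₂ _ _ 3 2, pair 0 2 0 1, pair 0 3 0 1, pair 1 2 0 1, pair 1 3 0 1, pair 2 3 0 1,
          pair 0 3 0 2, pair 1 2 0 2, pair 1 3 0 2, pair 2 3 0 2, pair 1 2 0 3, pair 1 3 0 3,
          pair 2 3 0 3, pair 1 3 1 2, pair 2 3 1 2, pair 2 3 1 3]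
        linarith
  apply alternating_fin_four
  · intro a b e
    unfold kulkarni
    rw [anti₁ a b c k, anti₁ a b k f, anti₁ a b f c, anti₁ b e c k, anti₁ b e k f, anti₁ b e f c,
      anti₁ e a c k, anti₁ e a k f, anti₁ e a f c]; ring
  · intro a b e
    unfold kulkarni
    rw [anti₁ a b c k, anti₁ a b k f, anti₁ a b f c, anti₁ b e c k, anti₁ b e k f, anti₁ b e f c,
      anti₁ e a c k, anti₁ e a k f, anti₁ e a f c]; ring
  all_goals exact main _ _ _ (by simp)

/-! ### Transfer of the identity from an orthonormal frame to arbitrary components -/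

section Frame

/-- Evaluation of a tensor of rank four on vectors. -/
noncomputable def eval₄ (d : Fin 4 → Fin 4 → Fin 4 → Fin 4 → ℝ) (v w x y : Fin 4 → ℝ) : ℝ :=
  ∑ a, ∑ b, ∑ c, ∑ k, v a * w b * x c * y k * d a b c k

/-- Evaluation of a tensor of rank two on vectors. -/
noncomputable def eval₂ (g : Fin 4 → Fin 4 → ℝ) (v w : Fin 4 → ℝ) : ℝ :=
  ∑ a, ∑ b, v a * w b * g a b

/-- `kulkarni` evaluated on vectors. -/
noncomputable def kulkarniVec (g : Fin 4 → Fin 4 → ℝ) (d : Fin 4 → Fin 4 → Fin 4 → Fin 4 → ℝ)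
    (a b e c k f : Fin 4 → ℝ) : ℝ :=
  (eval₂ g e f * eval₄ d a b c k + eval₂ g e c * eval₄ d a b k f + eval₂ g e k * eval₄ d a b f c)
    + (eval₂ g a f * eval₄ d b e c k + eval₂ g a c * eval₄ d b e k f
      + eval₂ g a k * eval₄ d b e f c)
    + (eval₂ g b f * eval₄ d e a c k + eval₂ g b c * eval₄ d e a k f
      + eval₂ g b k * eval₄ d e a f c)

/-- The columns of an invertible matrix span, so a linear form that vanishes on them is zero. -/
theorem eq_zero_of_frame {e : Matrix (Fin 4) (Fin 4) ℝ} (he : IsUnit e.det)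
    {f : (Fin 4 → ℝ) → ℝ} (hadd : ∀ v w, f (v + w) = f v + f w)
    (hsmul : ∀ (c : ℝ) v, f (c • v) = c * f v) (hf : ∀ k, f (fun a => e a k) = 0)
    (v : Fin 4 → ℝ) : f v = 0 := by
  have hlin : IsLinearMap ℝ f := ⟨hadd, hsmul⟩
  have hv : v = ∑ k, (e⁻¹.mulVec v) k • (fun a => e a k) := by
    have h1 : e.mulVec (e⁻¹.mulVec v) = v := by
      rw [Matrix.mulVec_mulVec, Matrix.mul_nonsing_inv _ he, Matrix.one_mulVec]
    conv_lhs => rw [← h1]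
    funext a
    simp [Matrix.mulVec, dotProduct, mul_comm]
  have h2 : ∀ v, f v = hlin.mk' f v := fun _ => rfl
  rw [hv, h2, map_sum]
  refine Finset.sum_eq_zero fun k _ => ?_
  rw [map_smul, ← h2, hf, smul_zero]

variable {h g : Fin 4 → Fin 4 → ℝ} {d : Fin 4 → Fin 4 → Fin 4 → Fin 4 → ℝ}

/-- The identity is multilinear, so it may be tested on an orthonormal frame, where it is
`kulkarni_diag`. The coordinate components are recovered by evaluation on the standard basis
vectors. -/
theorem kulkarni_eq_zero (D : WeylAlg h d) {e : Matrix (Fin 4) (Fin 4) ℝ} (he : IsUnit e.det)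
    (heg : ∀ i j, ∑ a, ∑ b, e a i * e b j * g a b
      = if i = j then (![-1, 1, 1, 1] : Fin 4 → ℝ) i else 0)
    (heh : ∀ a b, h a b = ∑ k, (![-1, 1, 1, 1] : Fin 4 → ℝ) k * e a k * e b k)
    (a b c k f l : Fin 4) : kulkarni g d a b c k f l = 0 := by
  unfold kulkarni
  have a₁ : ∀ v w x y, eval₄ d v w x y = -eval₄ d w v x y := by
    intro v w x y
    unfold eval₄
    rw [Finset.sum_comm]
    simp only [← Finset.sum_neg_distrib]
    refine Finset.sum_congr rfl fun b _ => Finset.sum_congr rfl fun a _ =>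
      Finset.sum_congr rfl fun c _ => Finset.sum_congr rfl fun k _ => ?_
    rw [D.anti₁ a b]; ring
  have a₂ : ∀ v w x y, eval₄ d v w x y = -eval₄ d v w y x := by
    intro v w x y
    unfold eval₄
    simp only [← Finset.sum_neg_distrib]
    refine Finset.sum_congr rfl fun b _ => Finset.sum_congr rfl fun a _ => ?_
    rw [Finset.sum_comm]
    refine Finset.sum_congr rfl fun c _ => Finset.sum_congr rfl fun k _ => ?_
    rw [D.anti₂ _ _ k]; ring
  have pr : ∀ v w x y, eval₄ d v w x y = eval₄ d x y v w := by
    intro v w x y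
    unfold eval₄
    have : ∀ F : Fin 4 → Fin 4 → Fin 4 → Fin 4 → ℝ,
        ∑ p, ∑ q, ∑ r, ∑ s, F p q r s = ∑ r, ∑ s, ∑ p, ∑ q, F p q r s := by
      intro F
      rw [Finset.sum_congr rfl fun p _ => Finset.sum_comm, Finset.sum_comm]
      refine Finset.sum_congr rfl fun r _ => ?_
      rw [Finset.sum_congr rfl fun p _ => Finset.sum_comm, Finset.sum_comm]
    rw [this]
    refine Finset.sum_congr rfl fun b _ => Finset.sum_congr rfl fun a _ =>
      Finset.sum_congr rfl fun c _ => Finset.sum_congr rfl fun k _ => ?_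
    rw [D.pair]; ring
  set E : Fin 4 → Fin 4 → ℝ := fun i a => e a i with hE
  -- Since `h` is the sum of `± e_k ⊗ e_k`, the trace with `h` becomes the signed frame trace that
  -- `kulkarni_diag` requires.
  have tr : ∀ j l, ∑ i, (![-1, 1, 1, 1] : Fin 4 → ℝ) i * eval₄ d (E i) (E j) (E i) (E l) = 0 := by
    intro j l
    have h1 : ∑ i, (![-1, 1, 1, 1] : Fin 4 → ℝ) i * eval₄ d (E i) (E j) (E i) (E l)
        = ∑ b, ∑ k, E j b * E l k * ctr h (fun a c => d a b c k) := by
      simp only [eval₄, ctr, heh, Finset.mul_sum, Finset.sum_mul]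
      rw [Finset.sum_congr rfl fun i _ => Finset.sum_comm, Finset.sum_comm]
      refine Finset.sum_congr rfl fun b _ => ?_
      rw [Finset.sum_congr rfl fun i _ => Finset.sum_congr rfl fun a _ => Finset.sum_comm,
        Finset.sum_congr rfl fun i _ => Finset.sum_comm, Finset.sum_comm]
      refine Finset.sum_congr rfl fun k _ => ?_
      rw [Finset.sum_comm]
      refine Finset.sum_congr rfl fun a _ => ?_
      rw [Finset.sum_comm]
      exact Finset.sum_congr rfl fun c _ => Finset.sum_congr rfl fun i _ => by
        simp only [hE]; ring
    rw [h1]; simp [D.tr₀₂]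
  have base : ∀ i₁ i₂ i₃ i₄ i₅ i₆,
      kulkarniVec g d (E i₁) (E i₂) (E i₃) (E i₄) (E i₅) (E i₆) = 0 := by
    intro i₁ i₂ i₃ i₄ i₅ i₆
    have := kulkarni_diag (d := fun i j k l => eval₄ d (E i) (E j) (E k) (E l))
      (fun _ _ _ _ => a₁ _ _ _ _) (fun _ _ _ _ => a₂ _ _ _ _) (fun _ _ _ _ => pr _ _ _ _) tr
      i₁ i₂ i₃ i₄ i₅ i₆
    have hg' : ∀ i j, eval₂ g (E i) (E j)
        = if i = j then (![-1, 1, 1, 1] : Fin 4 → ℝ) i else 0 := heg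
    simpa only [kulkarni, kulkarniVec, hg'] using this
  have sw₁ : ∀ v₁ v₂ v₃ v₄ v₅ v₆, kulkarniVec g d v₁ v₂ v₃ v₄ v₅ v₆
      = -kulkarniVec g d v₂ v₁ v₃ v₄ v₅ v₆ := by
    intro v₁ v₂ v₃ v₄ v₅ v₆
    unfold kulkarniVec
    rw [a₁ v₁ v₂ v₄ v₅, a₁ v₁ v₂ v₅ v₆, a₁ v₁ v₂ v₆ v₄, a₁ v₂ v₃ v₄ v₅, a₁ v₂ v₃ v₅ v₆,
      a₁ v₂ v₃ v₆ v₄, a₁ v₃ v₁ v₄ v₅, a₁ v₃ v₁ v₅ v₆, a₁ v₃ v₁ v₆ v₄]; ring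
  have sw₂ : ∀ v₁ v₂ v₃ v₄ v₅ v₆, kulkarniVec g d v₁ v₂ v₃ v₄ v₅ v₆
      = -kulkarniVec g d v₁ v₃ v₂ v₄ v₅ v₆ := by
    intro v₁ v₂ v₃ v₄ v₅ v₆
    unfold kulkarniVec
    rw [a₁ v₁ v₂ v₄ v₅, a₁ v₁ v₂ v₅ v₆, a₁ v₁ v₂ v₆ v₄, a₁ v₂ v₃ v₄ v₅, a₁ v₂ v₃ v₅ v₆,
      a₁ v₂ v₃ v₆ v₄, a₁ v₃ v₁ v₄ v₅, a₁ v₃ v₁ v₅ v₆, a₁ v₃ v₁ v₆ v₄]; ring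
  have sw₄ : ∀ v₁ v₂ v₃ v₄ v₅ v₆, kulkarniVec g d v₁ v₂ v₃ v₄ v₅ v₆
      = -kulkarniVec g d v₁ v₂ v₃ v₅ v₄ v₆ := by
    intro v₁ v₂ v₃ v₄ v₅ v₆
    unfold kulkarniVec
    rw [a₂ v₁ v₂ v₄ v₅, a₂ v₁ v₂ v₅ v₆, a₂ v₁ v₂ v₆ v₄, a₂ v₂ v₃ v₄ v₅, a₂ v₂ v₃ v₅ v₆,
      a₂ v₂ v₃ v₆ v₄, a₂ v₃ v₁ v₄ v₅, a₂ v₃ v₁ v₅ v₆, a₂ v₃ v₁ v₆ v₄]; ring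
  have sw₅ : ∀ v₁ v₂ v₃ v₄ v₅ v₆, kulkarniVec g d v₁ v₂ v₃ v₄ v₅ v₆
      = -kulkarniVec g d v₁ v₂ v₃ v₄ v₆ v₅ := by
    intro v₁ v₂ v₃ v₄ v₅ v₆
    unfold kulkarniVec
    rw [a₂ v₁ v₂ v₄ v₅, a₂ v₁ v₂ v₅ v₆, a₂ v₁ v₂ v₆ v₄, a₂ v₂ v₃ v₄ v₅, a₂ v₂ v₃ v₅ v₆,
      a₂ v₂ v₃ v₆ v₄, a₂ v₃ v₁ v₄ v₅, a₂ v₃ v₁ v₅ v₆, a₂ v₃ v₁ v₆ v₄]; ring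
  -- Linear extension is carried out only in one argument of each triple, here and in `ext₆`; the
  -- transpositions `sw₁`, `sw₂`, `sw₄`, `sw₅` move the other arguments there.
  have ext₃ : ∀ v₁ v₂ v₄ v₅ v₆, (∀ i, kulkarniVec g d v₁ v₂ (E i) v₄ v₅ v₆ = 0) →
      ∀ v₃, kulkarniVec g d v₁ v₂ v₃ v₄ v₅ v₆ = 0 := by
    intro v₁ v₂ v₄ v₅ v₆ hb
    refine eq_zero_of_frame he (f := fun v => kulkarniVec g d v₁ v₂ v v₄ v₅ v₆) ?_ ?_ hb
    · intro v w
      simp only [kulkarniVec, eval₄, eval₂, Pi.add_apply, add_mul, mul_add,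
        Finset.sum_add_distrib]; ring
    · intro c v
      have e4 : ∀ w x y, eval₄ d (c • v) w x y = c * eval₄ d v w x y := by
        intro w x y; simp only [eval₄, Finset.mul_sum, Pi.smul_apply, smul_eq_mul, mul_assoc]
      have e2 : ∀ w, eval₂ g (c • v) w = c * eval₂ g v w := by
        intro w; simp only [eval₂, Finset.mul_sum, Pi.smul_apply, smul_eq_mul, mul_assoc]
      simp only [kulkarniVec]
      rw [a₁ v₂ (c • v), a₁ v₂ (c • v), a₁ v₂ (c • v), a₁ v₂ v, a₁ v₂ v, a₁ v₂ v]
      simp only [e4, e2]; ring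
  have ext₆ : ∀ v₁ v₂ v₃ v₄ v₅, (∀ i, kulkarniVec g d v₁ v₂ v₃ v₄ v₅ (E i) = 0) →
      ∀ v₆, kulkarniVec g d v₁ v₂ v₃ v₄ v₅ v₆ = 0 := by
    intro v₁ v₂ v₃ v₄ v₅ hb
    refine eq_zero_of_frame he (f := fun v => kulkarniVec g d v₁ v₂ v₃ v₄ v₅ v) ?_ ?_ hb
    · intro v w
      simp only [kulkarniVec, eval₄, eval₂, Pi.add_apply, add_mul, mul_add,
        Finset.sum_add_distrib]; ring
    · intro c v
      have e4 : ∀ x y z, eval₄ d x y (c • v) z = c * eval₄ d x y v z := by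
        intro x y z; simp only [eval₄, Finset.mul_sum, Pi.smul_apply, smul_eq_mul]
        exact Finset.sum_congr rfl fun _ _ => Finset.sum_congr rfl fun _ _ =>
          Finset.sum_congr rfl fun _ _ => Finset.sum_congr rfl fun _ _ => by ring
      have e2 : ∀ w, eval₂ g w (c • v) = c * eval₂ g w v := by
        intro w; simp only [eval₂, Finset.mul_sum, Pi.smul_apply, smul_eq_mul]
        exact Finset.sum_congr rfl fun _ _ => Finset.sum_congr rfl fun _ _ => by ring
      simp only [kulkarniVec]
      rw [a₂ _ _ v₅ (c • v), a₂ _ _ v₅ (c • v), a₂ _ _ v₅ (c • v), a₂ _ _ v₅ v, a₂ _ _ v₅ v,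
        a₂ _ _ v₅ v]
      simp only [e4, e2]; ring
  have first : ∀ i₄ i₅ i₆ v₁ v₂ v₃, kulkarniVec g d v₁ v₂ v₃ (E i₄) (E i₅) (E i₆) = 0 := by
    intro i₄ i₅ i₆
    have s1 : ∀ i₁ i₂ v₃, kulkarniVec g d (E i₁) (E i₂) v₃ (E i₄) (E i₅) (E i₆) = 0 :=
      fun i₁ i₂ => ext₃ _ _ _ _ _ fun i => base _ _ _ _ _ _
    have s2 : ∀ i₁ v₂ v₃, kulkarniVec g d (E i₁) v₂ v₃ (E i₄) (E i₅) (E i₆) = 0 :=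
      fun i₁ v₂ => ext₃ _ _ _ _ _ fun i => by rw [sw₂, s1, neg_zero]
    exact fun v₁ v₂ => ext₃ _ _ _ _ _ fun i => by rw [sw₂, sw₁, s2, neg_zero, neg_zero]
  have all : ∀ v₁ v₂ v₃ v₄ v₅ v₆, kulkarniVec g d v₁ v₂ v₃ v₄ v₅ v₆ = 0 := by
    intro v₁ v₂ v₃
    have s1 : ∀ i₄ i₅ v₆, kulkarniVec g d v₁ v₂ v₃ (E i₄) (E i₅) v₆ = 0 :=
      fun i₄ i₅ => ext₆ _ _ _ _ _ fun i => first _ _ _ _ _ _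
    have s2 : ∀ i₄ v₅ v₆, kulkarniVec g d v₁ v₂ v₃ (E i₄) v₅ v₆ = 0 :=
      fun i₄ v₅ => ext₆ _ _ _ _ _ fun i => by rw [sw₅, s1, neg_zero]
    exact fun v₄ v₅ => ext₆ _ _ _ _ _ fun i => by rw [sw₅, sw₄, s2, neg_zero, neg_zero]
  have := all (Pi.single a 1) (Pi.single b 1) (Pi.single c 1) (Pi.single k 1) (Pi.single f 1)
    (Pi.single l 1)
  have e4 : ∀ p q r s, eval₄ d (Pi.single p 1) (Pi.single q 1) (Pi.single r 1) (Pi.single s 1)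
      = d p q r s := by
    intro p q r s; simp [eval₄, Pi.single_apply]
  have e2 : ∀ p q, eval₂ g (Pi.single p 1) (Pi.single q 1) = g p q := by
    intro p q; simp [eval₂, Pi.single_apply]
  simpa only [kulkarniVec, e4, e2] using this

end Frame

end CEM
namespace CEM

/-! ### Spacetimes whose curvature is given by `L` and `d` -/

/-- The tensor `Ξ d_{abce} + 2 (g_{a[c} L_{e]b} - g_{b[c} L_{e]a})`. -/
def curvAlg (Ξ : ℝ) (d : Fin 4 → Fin 4 → Fin 4 → Fin 4 → ℝ) (g L : Fin 4 → Fin 4 → ℝ)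
    (a b c e : Fin 4) : ℝ :=
  Ξ * d a b c e + g a c * L e b - g a e * L c b - g b c * L e a + g b e * L c a

/-- Regular symmetric fields for which `P_{abcd} = 0`. -/
structure Fields.Setting (u : Fields) (U : Set Pt) : Prop where
  isOpen : IsOpen U
  reg : u.RegularOn U
  sym : u.SymmetricOn U
  pzq : ∀ x ∈ U, ∀ i, u.Pzq x i = 0

/-- The Riemann tensor in terms of `L` and `d`. -/
def Fields.K (u : Fields) : Tensor 4 := fun x i =>
  curvAlg (u.Xi x) (fun a b c e => u.d x ![a, b, c, e]) (fun a b => u.g x ![a, b])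
    (fun a b => u.L x ![a, b]) (i 0) (i 1) (i 2) (i 3)

/-- The trace of `L`. -/
noncomputable def Fields.trL (u : Fields) (x : Pt) : ℝ :=
  ctr (ginv u.g x) fun p q => u.L x ![p, q]

namespace Fields.Setting

variable {u : Fields} {U : Set Pt} (S : u.Setting U)
include S

theorem metric : IsMetricOn U u.g := isMetricOn_of_regular S.isOpen S.reg

theorem smooth_L : SmoothT U u.L := fun i => S.reg.1 (.L i)
theorem smooth_d : SmoothT U u.d := fun i => S.reg.1 (.d i)
theorem smooth_g : SmoothT U u.g := fun i => S.reg.1 (.g i)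
theorem smooth_F : SmoothT U u.F := fun i => S.reg.1 (.F i)
theorem smooth_H : SmoothT U u.H := fun i => S.reg.1 (.H i)
theorem smooth_Xi : ContDiffOn ℝ ∞ u.Xi U := S.reg.1 .Xi
theorem smooth_K : SmoothT U u.K := fun i => by
  unfold Fields.K curvAlg
  exact ((((S.smooth_Xi.mul (S.smooth_d _)).add ((S.smooth_g _).mul (S.smooth_L _))).sub
    ((S.smooth_g _).mul (S.smooth_L _))).sub ((S.smooth_g _).mul (S.smooth_L _))).add
    ((S.smooth_g _).mul (S.smooth_L _))

variable {x : Pt} (hx : x ∈ U)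
include hx

theorem metAlg : MetAlg (ginv u.g x) (fun a b => u.g x ![a, b]) where
  hs := S.metric.ginv_symm hx
  gs := S.metric.symm x hx
  inv := S.metric.mul_ginv hx

theorem weylAlg : WeylAlg (ginv u.g x) (fun a b c e => u.d x ![a, b, c, e]) where
  anti₁ := S.sym.d_antisymm₁ x hx
  anti₂ := S.sym.d_antisymm₂ x hx
  pair := S.sym.d_pair x hx
  cyc := S.sym.d_cyclic x hx
  tr₀₂ b e := by
    have := S.sym.d_tracefree x hx b e
    simp only [up, Matrix.cons_val_zero, update_cons_zero'] at this
    rw [ctr, ← this, Finset.sum_comm]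
    refine Finset.sum_congr rfl fun a _ => Finset.sum_congr rfl fun r _ => ?_
    rw [S.metric.ginv_symm hx]

/-- Stated for any tensor with Weyl symmetries, so that it also covers `∇_e d` at fixed `e`. -/
theorem kulkarni_of_weylAlg {d : Fin 4 → Fin 4 → Fin 4 → Fin 4 → ℝ} (D : WeylAlg (ginv u.g x) d)
    (a b c k f l : Fin 4) : kulkarni (fun a b => u.g x ![a, b]) d a b c k f l = 0 := by
  obtain ⟨e, he, hd⟩ := S.reg.2 x hx
  refine CEM.kulkarni_eq_zero D he (fun i j => ?_) (fun a b => ?_) a b c k f l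
  · have := congrFun (congrFun hd i) j
    rw [Matrix.diagonal_apply] at this
    rw [← this]
    simp only [Matrix.mul_apply, Matrix.transpose_apply, Finset.sum_mul]
    rw [Finset.sum_comm]
    exact Finset.sum_congr rfl fun p _ => Finset.sum_congr rfl fun q _ => by
      rw [show mat u.g x q p = u.g x ![q, p] from rfl]; ring
  · have h2 : (mat u.g x)⁻¹ = e * Matrix.diagonal ![-1, 1, 1, 1] * e.transpose := by
      apply Matrix.inv_eq_right_inv
      have hη : (Matrix.diagonal ![-1, 1, 1, 1] : Matrix (Fin 4) (Fin 4) ℝ)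
          * Matrix.diagonal ![-1, 1, 1, 1] = 1 := by
        rw [Matrix.diagonal_mul_diagonal]
        ext i j; fin_cases i <;> fin_cases j <;> simp
      have h3 : e.transpose * mat u.g x * (e * Matrix.diagonal ![-1, 1, 1, 1]) = 1 := by
        rw [← Matrix.mul_assoc, hd, hη]
      have het : IsUnit e.transpose.det := by rwa [Matrix.det_transpose]
      have h4 := mul_eq_one_comm.1 h3
      have h5 : e.transpose * (mat u.g x * (e * Matrix.diagonal ![-1, 1, 1, 1]
          * e.transpose)) = e.transpose * 1 := by
        rw [Matrix.mul_one, ← Matrix.mul_assoc, ← Matrix.mul_assoc _ _ e.transpose, h3,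
          Matrix.one_mul]
      have := congrArg (fun M => (e.transpose)⁻¹ * M) h5
      simpa only [← Matrix.mul_assoc, Matrix.nonsing_inv_mul _ het, Matrix.one_mul] using this
    rw [ginv, h2]
    rw [Matrix.mul_apply]
    simp only [Matrix.transpose_apply, Matrix.mul_diagonal]
    exact Finset.sum_congr rfl fun k _ => by ring

theorem kulkarni_eq_zero (a b c k f l : Fin 4) :
    kulkarni (fun a b => u.g x ![a, b]) (fun a b c e => u.d x ![a, b, c, e]) a b c k f l = 0 :=
  S.kulkarni_of_weylAlg hx (S.weylAlg hx) a b c k f l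

theorem riemann_eq (i : Fin 4 → Fin 4) : riemann u.g x i = u.K x i := by
  have := S.pzq x hx i
  unfold Pzq alt₂ at this
  have hd : u.K x i = curvAlg (u.Xi x) (fun a b c e => u.d x ![a, b, c, e])
    (fun a b => u.g x ![a, b]) (fun a b => u.L x ![a, b]) (i 0) (i 1) (i 2) (i 3) := rfl
  rw [hd, curvAlg]
  simp only [← eq_quad i]
  linarith

theorem curv_eq (a b c e : Fin 4) :
    curv u.g x a b c e = ∑ s, ginv u.g x a s * u.K x ![s, b, c, e] := by
  have h1 : ∀ s, u.K x ![s, b, c, e] = ∑ r, u.g x ![s, r] * curv u.g x r b c e := fun s => by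
    rw [← S.riemann_eq hx]; rfl
  simp only [h1, Finset.mul_sum, ← mul_assoc]
  rw [Finset.sum_comm]
  simp only [← Finset.sum_mul, S.metric.ginv_mul hx]
  simp

theorem K_anti₁ (a b c e : Fin 4) : u.K x ![a, b, c, e] = -u.K x ![b, a, c, e] := by
  have h1 := (S.weylAlg hx).anti₁ a b c e
  simp only [Fields.K, curvAlg, Matrix.cons_val] at *
  rw [h1]; ring

theorem K_anti₂ (a b c e : Fin 4) : u.K x ![a, b, c, e] = -u.K x ![a, b, e, c] := by
  have h1 := (S.weylAlg hx).anti₂ a b c e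
  simp only [Fields.K, curvAlg, Matrix.cons_val] at *
  rw [h1]; ring

theorem K_cyc (a b c e : Fin 4) :
    u.K x ![a, b, c, e] + u.K x ![a, c, e, b] + u.K x ![a, e, b, c] = 0 := by
  have h1 := (S.weylAlg hx).cyc a b c e
  have gs := (S.metAlg hx).gs
  have ls := S.sym.L_symm x hx
  simp only [Fields.K, curvAlg, Matrix.cons_val] at *
  rw [gs c b, gs e c, gs e b, ls e b, ls c b, ls e c]
  linear_combination u.Xi x * h1

theorem ctr_K (a b : Fin 4) : ctr (ginv u.g x) (fun p q => u.K x ![p, a, q, b])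
    = 2 * u.L x ![a, b] + u.trL x * u.g x ![a, b] := by
  have H := S.metAlg hx
  have ls := S.sym.L_symm x hx
  simp only [Fields.K, curvAlg, Matrix.cons_val, ctr_add, ctr_sub, ctr_mul_left, ctr_mul_right,
    (S.weylAlg hx).tr₀₂]
  have h1 := H.ctr_g_left' b (fun q => u.L x ![q, a])
  have h2 := H.ctr_g_right a (fun q => u.L x ![b, q])
  have h3 := H.ctr_g
  rw [h1, h2, h3, Fields.trL, H.swap, ls b a]
  ring

theorem ricci_eq (a b : Fin 4) : ricci u.g x ![a, b]
    = 2 * u.L x ![a, b] + u.trL x * u.g x ![a, b] := by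
  rw [← S.ctr_K hx]
  simp only [ricci, S.curv_eq hx, ctr, Matrix.cons_val_zero, Matrix.cons_val_one]
  exact (S.metAlg hx).swap fun p q => u.K x ![q, a, p, b]

theorem scalarCurv_eq : scalarCurv u.g x = 6 * u.trL x := by
  have : scalarCurv u.g x = ctr (ginv u.g x) fun a b => ricci u.g x ![a, b] := rfl
  rw [this, ctr_congr fun a b => S.ricci_eq hx a b, ctr_add, ctr_mul_left, ctr_mul_left,
    (S.metAlg hx).ctr_g]
  rw [Fields.trL]; ring

/-- The Ricci identity. -/
theorem comm {k : ℕ} {T : Tensor k} (hT : SmoothT U T) (a b : Fin 4) (i : Fin k → Fin 4) :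
    covD u.g (covD u.g T) x (Matrix.vecCons a (Matrix.vecCons b i))
      - covD u.g (covD u.g T) x (Matrix.vecCons b (Matrix.vecCons a i))
      = -∑ m, ctr (ginv u.g x) fun r s => u.K x ![s, i m, a, b] * T x (Function.update i m r) := by
  rw [covD_covD_comm S.metric hT hx]
  congr 1
  refine Finset.sum_congr rfl fun m _ => Finset.sum_congr rfl fun r _ => ?_
  rw [S.curv_eq hx, Finset.sum_mul]
  exact Finset.sum_congr rfl fun s _ => by ring

theorem comm₁ {T : Tensor 1} (hT : SmoothT U T) (a b c : Fin 4) :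
    covD u.g (covD u.g T) x ![a, b, c] - covD u.g (covD u.g T) x ![b, a, c]
      = -ctr (ginv u.g x) fun r s => u.K x ![s, c, a, b] * T x ![r] := by
  rw [S.comm hx hT a b ![c]]
  simp [update_cons_zero']

theorem comm₂ {T : Tensor 2} (hT : SmoothT U T) (a b c e : Fin 4) :
    covD u.g (covD u.g T) x ![a, b, c, e] - covD u.g (covD u.g T) x ![b, a, c, e]
      = -(ctr (ginv u.g x) fun r s => u.K x ![s, c, a, b] * T x ![r, e])
        - ctr (ginv u.g x) fun r s => u.K x ![s, e, a, b] * T x ![c, r] := by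
  rw [S.comm hx hT a b ![c, e]]
  simp [Fin.sum_univ_succ, update_cons_zero', update_cons_succ']
  ring

theorem comm₃ {T : Tensor 3} (hT : SmoothT U T) (a b c e f : Fin 4) :
    covD u.g (covD u.g T) x ![a, b, c, e, f] - covD u.g (covD u.g T) x ![b, a, c, e, f]
      = -(ctr (ginv u.g x) fun r s => u.K x ![s, c, a, b] * T x ![r, e, f])
        - (ctr (ginv u.g x) fun r s => u.K x ![s, e, a, b] * T x ![c, r, f])
        - ctr (ginv u.g x) fun r s => u.K x ![s, f, a, b] * T x ![c, e, r] := by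
  rw [S.comm hx hT a b ![c, e, f]]
  simp [Fin.sum_univ_succ, update_cons_zero', update_cons_succ']
  ring

theorem comm₄ {T : Tensor 4} (hT : SmoothT U T) (a b c e f k : Fin 4) :
    covD u.g (covD u.g T) x ![a, b, c, e, f, k] - covD u.g (covD u.g T) x ![b, a, c, e, f, k]
      = -(ctr (ginv u.g x) fun r s => u.K x ![s, c, a, b] * T x ![r, e, f, k])
        - (ctr (ginv u.g x) fun r s => u.K x ![s, e, a, b] * T x ![c, r, f, k])
        - (ctr (ginv u.g x) fun r s => u.K x ![s, f, a, b] * T x ![c, e, r, k])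
        - ctr (ginv u.g x) fun r s => u.K x ![s, k, a, b] * T x ![c, e, f, r] := by
  rw [S.comm hx hT a b ![c, e, f, k]]
  simp [Fin.sum_univ_succ, update_cons_zero', update_cons_succ']
  ring

end Fields.Setting

end CEM
-- Symmetries of covariant derivatives and the second Bianchi identity
namespace CEM

section Symmetries

variable {U : Set Pt} {g : Tensor 2}

theorem smooth_reindex {k n : ℕ} {T : Tensor k} (hT : SmoothT U T) (ρ : Fin k → Fin n) :
    SmoothT U (fun y j => T y (j ∘ ρ)) := fun _ => hT _

/-- An index symmetry is invariance under a permutation of slots, and `∇` commutes with such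
permutations. -/
theorem covD_of_symm (hU : IsOpen U) {k : ℕ} {T : Tensor k} {ρ : Fin k → Fin k}
    (hρ : Function.Bijective ρ) (h : ∀ x ∈ U, ∀ i, T x i = T x (i ∘ ρ)) {x : Pt} (hx : x ∈ U)
    (e : Fin 4) (i : Fin k → Fin 4) :
    covD g T x (Matrix.vecCons e i) = covD g T x (Matrix.vecCons e (i ∘ ρ)) := by
  rw [← covD_reindex g T hρ]
  exact covD_congr hU h hx _

theorem covD_of_antisymm (hU : IsOpen U) {k : ℕ} {T : Tensor k} (hT : SmoothT U T)
    {ρ : Fin k → Fin k}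
    (hρ : Function.Bijective ρ) (h : ∀ x ∈ U, ∀ i, T x i = -T x (i ∘ ρ)) {x : Pt} (hx : x ∈ U)
    (e : Fin 4) (i : Fin k → Fin 4) :
    covD g T x (Matrix.vecCons e i) = -covD g T x (Matrix.vecCons e (i ∘ ρ)) := by
  rw [← covD_reindex g T hρ, ← neg_one_mul, ← covD_const_mul hU (-1) (smooth_reindex hT ρ) hx]
  exact covD_congr hU (fun y hy j => by rw [neg_one_mul]; exact h y hy j) hx _

end Symmetries

namespace Fields.Setting

variable {u : Fields} {U : Set Pt} (S : u.Setting U)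
include S

theorem smooth_covD {k : ℕ} {T : Tensor k} (hT : SmoothT U T) : SmoothT U (covD u.g T) :=
  CEM.smooth_covD S.metric hT

theorem smooth_grad {φ : Pt → ℝ} (hφ : ContDiffOn ℝ ∞ φ U) : SmoothT U (grad φ) := fun _ =>
  smooth_pd S.isOpen hφ _

theorem smooth_trL : ContDiffOn ℝ ∞ u.trL U := smooth_ctr S.metric fun _ _ => S.smooth_L _

variable {x : Pt} (hx : x ∈ U)
include hx

theorem covD_L_symm (e a b : Fin 4) : covD u.g u.L x ![e, a, b] = covD u.g u.L x ![e, b, a] := by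
  have := covD_of_symm (g := u.g) S.isOpen (T := u.L) (ρ := ![1, 0]) (by decide)
    (fun y hy i => by
      conv_lhs => rw [eq_pair i]
      rw [S.sym.L_symm y hy]; simp [comp_cons, comp_empty]) hx e ![a, b]
  simpa [comp_cons, comp_empty] using this

theorem covD_F_antisymm (e a b : Fin 4) :
    covD u.g u.F x ![e, a, b] = -covD u.g u.F x ![e, b, a] := by
  have := covD_of_antisymm (g := u.g) S.isOpen (T := u.F) S.smooth_F (ρ := ![1, 0]) (by decide)
    (fun y hy i => by
      conv_lhs => rw [eq_pair i]
      rw [S.sym.F_antisymm y hy]; simp [comp_cons, comp_empty]) hx e ![a, b]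
  simpa [comp_cons, comp_empty] using this

theorem covD_covD_F_antisymm (f e a b : Fin 4) :
    covD u.g (covD u.g u.F) x ![f, e, a, b] = -covD u.g (covD u.g u.F) x ![f, e, b, a] := by
  have := covD_of_antisymm (g := u.g) S.isOpen (T := covD u.g u.F) (S.smooth_covD S.smooth_F)
    (ρ := ![0, 2, 1]) (by decide)
    (fun y hy i => by
      conv_lhs => rw [eq_triple i]
      rw [S.covD_F_antisymm hy]; simp [comp_cons, comp_empty]) hx f ![e, a, b]
  simpa [comp_cons, comp_empty] using this

/-- All Weyl symmetries are expressed by permutations of slots and one metric trace, and `∇`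
commutes with both. Packaging the result as `WeylAlg` makes the four-dimensional identity available
for `∇_e d`. -/
theorem covD_weyl (e : Fin 4) :
    WeylAlg (ginv u.g x) (fun a b c k => covD u.g u.d x ![e, a, b, c, k]) where
  anti₁ a b c k := by
    have := covD_of_antisymm (g := u.g) S.isOpen (T := u.d) S.smooth_d (ρ := ![1, 0, 2, 3])
      (by decide) (fun y hy i => by
        conv_lhs => rw [eq_quad i]
        rw [S.sym.d_antisymm₁ y hy]; simp [comp_cons, comp_empty]) hx e ![a, b, c, k]
    simpa [comp_cons, comp_empty] using this
  anti₂ a b c k := by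
    have := covD_of_antisymm (g := u.g) S.isOpen (T := u.d) S.smooth_d (ρ := ![0, 1, 3, 2])
      (by decide) (fun y hy i => by
        conv_lhs => rw [eq_quad i]
        rw [S.sym.d_antisymm₂ y hy]; simp [comp_cons, comp_empty]) hx e ![a, b, c, k]
    simpa [comp_cons, comp_empty] using this
  pair a b c k := by
    have := covD_of_symm (g := u.g) S.isOpen (T := u.d) (ρ := ![2, 3, 0, 1])
      (by decide) (fun y hy i => by
        conv_lhs => rw [eq_quad i]
        rw [S.sym.d_pair y hy]; simp [comp_cons, comp_empty]) hx e ![a, b, c, k]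
    simpa [comp_cons, comp_empty] using this
  cyc a b c k := by
    have hρ : Function.Bijective (![0, 2, 3, 1] : Fin 4 → Fin 4) := by decide
    have hρ' : Function.Bijective (![0, 3, 1, 2] : Fin 4 → Fin 4) := by decide
    have h := covD_congr S.isOpen (g := u.g) (T := fun y j => u.d y j + u.d y (j ∘ ![0, 2, 3, 1])
        + u.d y (j ∘ ![0, 3, 1, 2])) (S := fun _ _ => 0) (fun y hy i => by
          have := S.sym.d_cyclic y hy (i 0) (i 1) (i 2) (i 3)
          rw [← eq_quad i] at this
          simpa [comp_cons, comp_empty] using this) hx ![e, a, b, c, k]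
    rw [covD_zero, covD_add S.isOpen (T := fun y j => u.d y j + u.d y (j ∘ ![0, 2, 3, 1]))
      (fun i => (S.smooth_d _).add (S.smooth_d _)) (smooth_reindex S.smooth_d _) hx,
      covD_add S.isOpen S.smooth_d (smooth_reindex S.smooth_d _) hx,
      covD_reindex _ _ hρ, covD_reindex _ _ hρ'] at h
    simpa [comp_cons, comp_empty] using h
  tr₀₂ b k := by
    have hρ : Function.Bijective (![0, 2, 1, 3] : Fin 4 → Fin 4) := by decide
    have h := covD_tctr S.metric (k := 2) (T := fun y j => u.d y (j ∘ ![0, 2, 1, 3]))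
      (smooth_reindex S.smooth_d _) hx e ![b, k]
    rw [covD_congr S.isOpen (S := fun _ _ => 0) (fun y hy i => by
      have := (S.weylAlg hy).tr₀₂ (i 0) (i 1)
      simpa [tctr, comp_cons, comp_empty] using this) hx, covD_zero] at h
    simp only [covD_reindex _ _ hρ] at h
    simpa [comp_cons, comp_empty] using h.symm

/-- The covariant derivative of the Riemann tensor. -/
theorem covD_K (f a b c e : Fin 4) : covD u.g u.K x ![f, a, b, c, e]
    = pd f u.Xi x * u.d x ![a, b, c, e]
      + curvAlg (u.Xi x) (fun a b c e => covD u.g u.d x ![f, a, b, c, e])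
        (fun a b => u.g x ![a, b]) (fun a b => covD u.g u.L x ![f, a, b]) a b c e := by
  have hs : ∀ α β : Fin 2 → Fin 4, SmoothT U (fun y j => u.g y (j ∘ α) * u.L y (j ∘ β)) :=
    fun α β i => (S.smooth_g _).mul (S.smooth_L _)
  have h := covD_congr S.isOpen (g := u.g) (T := u.K) (S := fun y j => u.Xi y * u.d y j
      + u.g y (j ∘ ![0, 2]) * u.L y (j ∘ ![3, 1]) - u.g y (j ∘ ![0, 3]) * u.L y (j ∘ ![2, 1])
      - u.g y (j ∘ ![1, 2]) * u.L y (j ∘ ![3, 0]) + u.g y (j ∘ ![1, 3]) * u.L y (j ∘ ![2, 0]))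
      (fun y hy i => by
        simp only [Fields.K, curvAlg, comp_cons, comp_empty, ← eq_quad i]) hx ![f, a, b, c, e]
  have h0 : SmoothT U (fun y j => u.Xi y * u.d y j) := fun i => S.smooth_Xi.mul (S.smooth_d i)
  have h1 := fun i => (h0 i).add (hs ![0, 2] ![3, 1] i)
  have h2 := fun i => (h1 i).sub (hs ![0, 3] ![2, 1] i)
  have h3 := fun i => (h2 i).sub (hs ![1, 2] ![3, 0] i)
  rw [h, covD_add S.isOpen h3 (hs _ _) hx, covD_sub S.isOpen h2 (hs _ _) hx,
    covD_sub S.isOpen h1 (hs _ _) hx, covD_add S.isOpen h0 (hs _ _) hx,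
    covD_smul S.isOpen S.smooth_Xi S.smooth_d hx,
    covD_mul S.isOpen S.smooth_g S.smooth_L (by decide) hx,
    covD_mul S.isOpen S.smooth_g S.smooth_L (by decide) hx,
    covD_mul S.isOpen S.smooth_g S.smooth_L (by decide) hx,
    covD_mul S.isOpen S.smooth_g S.smooth_L (by decide) hx]
  simp only [covD_metric S.metric hx, curvAlg, comp_cons, comp_empty, Matrix.cons_val]
  ring

/-- The second Bianchi identity. -/
theorem bianchi (s e a b c : Fin 4) : covD u.g u.K x ![a, s, e, b, c]
    + covD u.g u.K x ![b, s, e, c, a] + covD u.g u.K x ![c, s, e, a, b] = 0 := by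
  have H := S.metAlg hx
  -- A test covector with constant components, chosen so that at `x` they equal `g_{js}`;
  -- contracting it there with the curvature extracts `K_{s…}`. The third derivatives of `w`, summed
  -- cyclically with signs, are computed twice: as the derivative of a commutator and as a
  -- commutator acting on `∇w`.
  set w : Tensor 1 := fun _ j => u.g x ![j 0, s] with hw
  have hws : SmoothT U w := fun _ => contDiffOn_const
  have hVs := S.smooth_covD hws
  have hWs := S.smooth_covD hVs
  have hρ : Function.Bijective (![1, 0, 2] : Fin 3 → Fin 3) := by decide
  -- the derivative of the commutator
  have key : ∀ a b c : Fin 4, covD u.g (covD u.g (covD u.g w)) x ![a, b, c, e]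
      - covD u.g (covD u.g (covD u.g w)) x ![a, c, b, e]
      = -covD u.g u.K x ![a, s, e, b, c]
        - ctr (ginv u.g x) fun r t => u.K x ![t, e, b, c] * covD u.g w x ![a, r] := by
    intro a b c
    have h := covD_congr S.isOpen (g := u.g)
      (T := fun y j => covD u.g (covD u.g w) y j - covD u.g (covD u.g w) y (j ∘ ![1, 0, 2]))
      (S := fun y j => (-1 : ℝ) * ctr (ginv u.g y) fun p q =>
        u.K y (Matrix.vecCons p (Matrix.vecCons q j) ∘ ![1, 4, 2, 3])
          * w y (Matrix.vecCons p (Matrix.vecCons q j) ∘ ![0])) (fun y hy i => by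
        have := S.comm₁ hy hws (i 0) (i 1) (i 2)
        rw [← eq_triple i] at this
        simpa [comp_cons, comp_empty] using this) hx ![a, b, c, e]
    have hsm : SmoothT U (fun y (j : Fin 3 → Fin 4) => ctr (ginv u.g y) fun p q =>
        u.K y (Matrix.vecCons p (Matrix.vecCons q j) ∘ ![1, 4, 2, 3])
          * w y (Matrix.vecCons p (Matrix.vecCons q j) ∘ ![0])) := fun i =>
      smooth_ctr S.metric fun p q => (S.smooth_K _).mul (hws _)
    rw [covD_sub S.isOpen hWs (smooth_reindex hWs _) hx, covD_reindex _ _ hρ,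
      covD_const_mul S.isOpen _ hsm hx,
      covD_ctr_mul S.metric S.smooth_K hws (by decide) hx, ctr_add] at h
    simp only [comp_cons, comp_empty, Matrix.cons_val] at h
    have h2 := H.ctr_g_left' s (fun q => covD u.g u.K x ![a, q, e, b, c])
    rw [ctr_congr (f' := fun p q => u.g x ![p, s] * covD u.g u.K x ![a, q, e, b, c])
      (fun p q => by simp [hw, mul_comm]), h2] at h
    linarith
  have k1 := key a b c
  have k2 := key b c a
  have k3 := key c a b
  have c1 := S.comm₂ hx hVs a b c e
  have c2 := S.comm₂ hx hVs b c a e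
  have c3 := S.comm₂ hx hVs c a b e
  -- The curvature terms acting on the derivative slot of `∇w` drop out by the first Bianchi
  -- identity.
  have hz : (ctr (ginv u.g x) fun r t => u.K x ![t, c, a, b] * covD u.g w x ![r, e])
      + (ctr (ginv u.g x) fun r t => u.K x ![t, a, b, c] * covD u.g w x ![r, e])
      + (ctr (ginv u.g x) fun r t => u.K x ![t, b, c, a] * covD u.g w x ![r, e]) = 0 := by
    rw [← ctr_add, ← ctr_add, ← ctr_zero (h := ginv u.g x)]
    refine ctr_congr fun r t => ?_
    have := S.K_cyc hx t a b c
    rw [← add_mul, ← add_mul]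
    rw [show u.K x ![t, c, a, b] + u.K x ![t, a, b, c] + u.K x ![t, b, c, a] = 0 by linarith,
      zero_mul]
  linarith

end Fields.Setting

end CEM
-- Traces of the curvature and the contracted Bianchi identities
namespace CEM

section CurvatureAlgebra

variable {h g L : Fin 4 → Fin 4 → ℝ} {Ξ : ℝ} {d : Fin 4 → Fin 4 → Fin 4 → Fin 4 → ℝ}

/-- Separated from the fields so that it applies both to `K` and to the part of `∇_f K` built from
`∇_f d` and `∇_f L`. -/
theorem ctr_curvAlg (H : MetAlg h g) (D : WeylAlg h d) (a b : Fin 4)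
    (ls : ∀ a b, L a b = L b a) :
    ctr h (fun p q => curvAlg Ξ d g L p a q b) = 2 * L a b + ctr h L * g a b := by
  simp only [curvAlg, ctr_add, ctr_sub, ctr_mul_left, ctr_mul_right, D.tr₀₂]
  have h1 := H.ctr_g_left' b (fun q => L q a)
  have h2 := H.ctr_g_right a (fun q => L b q)
  have h3 := H.ctr_g
  have h4 := H.swap fun p q => L q p
  rw [h1, h2, h3, h4, ls b a]
  ring

theorem ctr_curvAlg_mul (H : MetAlg h g) (b e a : Fin 4) (T : Fin 4 → ℝ) :
    ctr h (fun r s => curvAlg Ξ d g L s b e a * T r)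
      = Ξ * ctr h (fun r s => d s b e a * T r) + L a b * T e - L e b * T a
        - g b e * ctr h (fun r s => L a s * T r) + g b a * ctr h (fun r s => L e s * T r) := by
  simp only [curvAlg, add_mul, sub_mul, ctr_add, ctr_sub, mul_assoc, ctr_mul_left]
  have h1 := H.ctr_g_right' e (fun r => L a b * T r)
  have h2 := H.ctr_g_right' a (fun r => L e b * T r)
  rw [h1, h2]

/-- Commuting a divergence through a derivative: the index of the divergence. -/
theorem ctr_ctr_curvAlg_div (H : MetAlg h g) (D : WeylAlg h d) (ls : ∀ a b, L a b = L b a)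
    (a : Fin 4) (T : Fin 4 → ℝ) :
    ctr h (fun p q => ctr h fun r s => curvAlg Ξ d g L s q p a * T r)
      = -2 * ctr h (fun r s => L a s * T r) - ctr h L * T a := by
  rw [ctr_comm]
  have h1 : ∀ s, ctr h (fun p q => curvAlg Ξ d g L s q p a) = -2 * L s a - ctr h L * g s a := by
    intro s
    have h2 := ctr_curvAlg (Ξ := Ξ) H D s a ls
    rw [H.swap]
    have h3 : ∀ p q, curvAlg Ξ d g L s p q a = -curvAlg Ξ d g L p s q a := fun p q => by
      simp only [curvAlg]; rw [D.anti₁ s p]; ring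
    rw [ctr_congr h3, ctr_neg, h2]; ring
  have h2 : ∀ r s, ctr h (fun p q => curvAlg Ξ d g L s q p a * T r)
      = -2 * (L a s * T r) - ctr h L * (g a s * T r) := fun r s => by
    rw [ctr_mul_right, h1, ls s a, H.gs s a]; ring
  rw [ctr_congr h2, ctr_sub, ctr_mul_left, ctr_mul_left, H.ctr_g_right]

/-- Commuting a divergence through a derivative: the other indices. -/
theorem ctr_ctr_curvAlg (H : MetAlg h g) (b a : Fin 4) (T : Fin 4 → Fin 4 → ℝ) :
    ctr h (fun p q => ctr h fun r s => curvAlg Ξ d g L s b p a * T q r)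
      = Ξ * ctr h (fun p q => ctr h fun r s => d s b p a * T q r) + L a b * ctr h T
        - ctr h (fun p q => L p b * T q a) - ctr h (fun r s => L a s * T b r)
        + g b a * ctr h (fun p q => ctr h fun r s => L p s * T q r) := by
  rw [ctr_congr fun p q => ctr_curvAlg_mul H b p a (T q)]
  simp only [ctr_add, ctr_sub, ctr_mul_left]
  rw [H.ctr_g_left b fun q => ctr h fun r s => L a s * T q r, H.swap fun p q => T q p]

end CurvatureAlgebra

namespace Fields

/-- The divergence `∇^e d_{eabc}`. -/
noncomputable def divd (u : Fields) : Tensor 3 := fun x i =>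
  ctr (ginv u.g x) fun p q => covD u.g u.d x ![p, q, i 0, i 1, i 2]

/-- `∇^e Ξ d_{eabc}`. -/
noncomputable def gradd (u : Fields) (x : Pt) (a b c : Fin 4) : ℝ :=
  ctr (ginv u.g x) fun p q => pd p u.Xi x * u.d x ![q, a, b, c]

end Fields

namespace Fields.Setting

variable {u : Fields} {U : Set Pt} (S : u.Setting U)
include S

variable {x : Pt} (hx : x ∈ U)
include hx

theorem pd_trL (e : Fin 4) :
    pd e u.trL x = ctr (ginv u.g x) fun p q => covD u.g u.L x ![e, p, q] := by
  have h := covD_tctr S.metric (k := 0) S.smooth_L hx e ![]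
  rw [← h, covD_cons]
  simp [tctr, Fields.trL]
  rfl

theorem covD_K_pair (f a b c e : Fin 4) :
    covD u.g u.K x ![f, a, b, c, e] = covD u.g u.K x ![f, c, e, a, b] := by
  have h1 := (S.covD_weyl hx f).pair a b c e
  have h2 := (S.weylAlg hx).pair a b c e
  have gs := (S.metAlg hx).gs
  have ls := S.covD_L_symm hx f
  simp only [S.covD_K hx, curvAlg] at *
  rw [h1, h2, gs c a, gs c b, gs e a, gs e b, ls b e, ls b c, ls a e, ls a c]; ring

theorem ctr_covD_K (f a b : Fin 4) :
    ctr (ginv u.g x) (fun p q => covD u.g u.K x ![f, p, a, q, b])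
      = 2 * covD u.g u.L x ![f, a, b] + pd f u.trL x * u.g x ![a, b] := by
  rw [ctr_congr fun p q => S.covD_K hx f p a q b, ctr_add, ctr_mul_left, (S.weylAlg hx).tr₀₂,
    ctr_curvAlg (S.metAlg hx) (S.covD_weyl hx f) a b (S.covD_L_symm hx f), S.pd_trL hx]
  ring

/-- The Bianchi identity turns the divergence into a curl of the trace of `K`, and that trace is `2
L + (tr L) g`. -/
theorem div_K_bianchi (s b a : Fin 4) :
    ctr (ginv u.g x) (fun p q => covD u.g u.K x ![p, s, b, q, a])
      = 2 * (covD u.g u.L x ![s, a, b] - covD u.g u.L x ![b, a, s])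
        + u.g x ![a, b] * pd s u.trL x - u.g x ![a, s] * pd b u.trL x := by
  have h1 : ∀ p q, covD u.g u.K x ![p, s, b, q, a]
      = covD u.g u.K x ![s, q, a, p, b] - covD u.g u.K x ![b, q, a, p, s] := by
    intro p q
    have b1 := S.bianchi hx q a p s b
    have b2 := S.covD_K_pair hx p s b q a
    have b3 : covD u.g u.K x ![s, q, a, b, p] = -covD u.g u.K x ![s, q, a, p, b] := by
      have h1 := (S.covD_weyl hx s).anti₂ q a b p
      have h2 := (S.weylAlg hx).anti₂ q a b p
      simp only [S.covD_K hx, curvAlg] at *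
      rw [h1, h2]; ring
    linarith
  have e1 := S.ctr_covD_K hx s a b
  have e2 := S.ctr_covD_K hx b a s
  rw [(S.metAlg hx).swap] at e1 e2
  rw [ctr_congr h1, ctr_sub, e1, e2]; ring

/-- The same divergence evaluated directly from the algebraic form of `K`. Comparison with
`div_K_bianchi` gives `div_L` and `curl_L`. -/
theorem div_K (s b a : Fin 4) :
    ctr (ginv u.g x) (fun p q => covD u.g u.K x ![p, s, b, q, a])
      = u.gradd x a s b + u.Xi x * u.divd x ![a, s, b]
        + (covD u.g u.L x ![s, a, b] - covD u.g u.L x ![b, a, s])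
        - u.g x ![s, a] * ctr (ginv u.g x) (fun p q => covD u.g u.L x ![p, q, b])
        + u.g x ![b, a] * ctr (ginv u.g x) (fun p q => covD u.g u.L x ![p, q, s]) := by
  have H := S.metAlg hx
  have g1 : (ctr (ginv u.g x) fun p q => pd p u.Xi x * u.d x ![s, b, q, a]) = u.gradd x a s b :=
    ctr_congr fun p q => by rw [(S.weylAlg hx).pair q a s b]
  have g2 : (ctr (ginv u.g x) fun p q => covD u.g u.d x ![p, s, b, q, a])
      = u.divd x ![a, s, b] :=
    ctr_congr fun p q => by rw [(S.covD_weyl hx p).pair s b q a]; rfl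
  rw [ctr_congr fun p q => S.covD_K hx p s b q a]
  simp only [curvAlg, ctr_add, ctr_sub, ctr_mul_left]
  rw [g1, g2, H.ctr_g_right s fun p => covD u.g u.L x ![p, a, b],
    H.ctr_g_right b fun p => covD u.g u.L x ![p, a, s]]
  ring

theorem divd_trace (b : Fin 4) : ctr (ginv u.g x) (fun p q => u.divd x ![p, q, b]) = 0 := by
  simp only [Fields.divd, Matrix.cons_val]
  rw [ctr_comm, ← ctr_zero (h := ginv u.g x)]
  exact ctr_congr fun p q => (S.covD_weyl hx p).tr₁₂ _ _

theorem gradd_trace (b : Fin 4) : ctr (ginv u.g x) (fun p q => u.gradd x p q b) = 0 := by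
  simp only [Fields.gradd]
  rw [ctr_comm, ← ctr_zero (h := ginv u.g x)]
  refine ctr_congr fun p q => ?_
  rw [ctr_mul_left, (S.weylAlg hx).tr₁₂, mul_zero]

/-- The contracted Bianchi identity `∇^a L_{ab} = ∇_b L`. -/
theorem div_L (b : Fin 4) :
    ctr (ginv u.g x) (fun p q => covD u.g u.L x ![p, q, b]) = pd b u.trL x := by
  have H := S.metAlg hx
  -- The two evaluations of the divergence are equated with one pair of indices left to be traced.
  -- The traces of `gradd` and `divd` vanish since `d` is trace-free, and only `∇^a L_{ab}` and `∇_b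
  -- tr L` remain.
  have e : ∀ p q, 2 * (covD u.g u.L x ![q, p, b] - covD u.g u.L x ![b, p, q])
        + u.g x ![p, b] * pd q u.trL x - u.g x ![p, q] * pd b u.trL x
      = u.gradd x p q b + u.Xi x * u.divd x ![p, q, b]
        + (covD u.g u.L x ![q, p, b] - covD u.g u.L x ![b, p, q])
        - u.g x ![q, p] * ctr (ginv u.g x) (fun p q => covD u.g u.L x ![p, q, b])
        + u.g x ![b, p] * ctr (ginv u.g x) (fun r t => covD u.g u.L x ![r, t, q]) := fun p q => by
    rw [← S.div_K_bianchi hx, ← S.div_K hx]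
  have e' := ctr_congr (h := ginv u.g x) e
  simp only [ctr_add, ctr_sub, ctr_mul_left, ctr_mul_right, S.divd_trace hx, S.gradd_trace hx] at e'
  have w1 := H.swap fun p q => covD u.g u.L x ![q, p, b]
  have w2 := H.swap fun p q => u.g x ![q, p]
  have w3 := H.ctr_g
  rw [w1, w2, w3, ← S.pd_trL hx, H.ctr_g_left' b fun q => pd q u.trL x,
    H.ctr_g_left b fun q => ctr (ginv u.g x) fun r t => covD u.g u.L x ![r, t, q]] at e'
  linarith

/-- The equation `∇_a L_{bc} - ∇_b L_{ac} = ∇_e Ξ d^e{}_{cab} + Ξ ∇_e d^e{}_{cab}`. -/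
theorem curl_L (s a b : Fin 4) :
    covD u.g u.L x ![s, a, b] - covD u.g u.L x ![b, a, s]
      = u.gradd x a s b + u.Xi x * u.divd x ![a, s, b] := by
  have h1 := S.div_K_bianchi hx s b a
  have h2 := S.div_K hx s b a
  have gs := (S.metAlg hx).gs
  rw [S.div_L hx, S.div_L hx, gs s a, gs b a] at h2
  linarith

theorem div_K_eq (s b a : Fin 4) :
    ctr (ginv u.g x) (fun p q => covD u.g u.K x ![p, s, b, q, a])
      = 2 * (u.gradd x a s b + u.Xi x * u.divd x ![a, s, b])
        + u.g x ![a, b] * pd s u.trL x - u.g x ![a, s] * pd b u.trL x := by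
  rw [S.div_K_bianchi hx, S.curl_L hx]

end Fields.Setting

end CEM
-- Full contractions with a two-index tensor, and translation of raised indices into contractions
namespace CEM

section FullContraction

variable {h : Fin 4 → Fin 4 → ℝ}

/-- The full contraction `F^{ae} f_{ae}`. -/
noncomputable def dctr (h F f : Fin 4 → Fin 4 → ℝ) : ℝ :=
  ctr h fun a a' => ctr h fun e e' => F a' e' * f a e

theorem dctr_congr {F f f' : Fin 4 → Fin 4 → ℝ} (H : ∀ a e, f a e = f' a e) :
    dctr h F f = dctr h F f' := ctr_congr fun _ _ => ctr_congr fun _ _ => by rw [H]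

theorem dctr_add (F f f' : Fin 4 → Fin 4 → ℝ) :
    dctr h F (fun a e => f a e + f' a e) = dctr h F f + dctr h F f' := by
  simp only [dctr, mul_add, ctr_add]

theorem dctr_sub (F f f' : Fin 4 → Fin 4 → ℝ) :
    dctr h F (fun a e => f a e - f' a e) = dctr h F f - dctr h F f' := by
  simp only [dctr, mul_sub, ctr_sub]

theorem dctr_neg (F f : Fin 4 → Fin 4 → ℝ) :
    dctr h F (fun a e => -f a e) = -dctr h F f := by
  simp only [dctr, mul_neg, ctr_neg]

theorem dctr_mul_left (F : Fin 4 → Fin 4 → ℝ) (c : ℝ) (f : Fin 4 → Fin 4 → ℝ) :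
    dctr h F (fun a e => c * f a e) = c * dctr h F f := by
  simp only [dctr, ← ctr_mul_left]
  exact ctr_congr fun _ _ => ctr_congr fun _ _ => by ring

theorem dctr_zero (F : Fin 4 → Fin 4 → ℝ) : dctr h F (fun _ _ => 0) = 0 := by
  simp [dctr, ctr]

theorem dctr_transpose (F f : Fin 4 → Fin 4 → ℝ) :
    dctr h F f = dctr h (fun a e => F e a) (fun a e => f e a) := by
  simp only [dctr]; rw [ctr_comm]

theorem dctr_neg_left (F f : Fin 4 → Fin 4 → ℝ) :
    dctr h (fun a e => -F a e) f = -dctr h F f := by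
  simp only [dctr, neg_mul, ctr_neg]

theorem dctr_swap_of_antisymm {F : Fin 4 → Fin 4 → ℝ} (hF : ∀ a b, F a b = -F b a)
    (f : Fin 4 → Fin 4 → ℝ) : dctr h F (fun a e => f e a) = -dctr h F f := by
  rw [dctr_transpose, ← dctr_neg_left]
  simp only [dctr]
  exact ctr_congr fun p q => ctr_congr fun r s => by rw [hF]

theorem dctr_eq_zero {F : Fin 4 → Fin 4 → ℝ} (hF : ∀ a b, F a b = -F b a)
    {f : Fin 4 → Fin 4 → ℝ} (hf : ∀ a b, f a b = f b a) : dctr h F f = 0 := by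
  have h1 := dctr_swap_of_antisymm (h := h) hF f
  rw [dctr_congr fun a e => hf e a] at h1
  linarith

theorem dctr_comm (H : ∀ a b, h a b = h b a) (F f : Fin 4 → Fin 4 → ℝ) :
    dctr h F f = dctr h f F := by
  simp only [dctr, ctr, Finset.mul_sum]
  rw [Finset.sum_comm]
  refine Finset.sum_congr rfl fun a _ => Finset.sum_congr rfl fun b _ => ?_
  rw [Finset.sum_comm]
  refine Finset.sum_congr rfl fun c _ => Finset.sum_congr rfl fun e _ => ?_
  rw [H b a, H e c]; ring

/-- This and the next three lemmas pass from sums with explicitly raised indices to `ctr` and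
`dctr`, where no index is raised and the linearity rules apply. -/
theorem sum_up (T f : Fin 4 → ℝ) :
    ∑ d, (∑ r, h d r * T r) * f d = ctr h fun d r => T r * f d := by
  simp only [ctr, Finset.sum_mul, mul_assoc]

theorem sum_up' (T f : Fin 4 → ℝ) :
    ∑ d, f d * (∑ r, h d r * T r) = ctr h fun d r => f d * T r := by
  simp only [ctr, Finset.mul_sum]
  exact Finset.sum_congr rfl fun _ _ => Finset.sum_congr rfl fun _ _ => by ring

theorem sum_up_up (T f : Fin 4 → Fin 4 → ℝ) :
    ∑ a, ∑ e, (∑ r, h a r * ∑ s, h e s * T r s) * f a e = dctr h T f := by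
  simp only [dctr, ctr, Finset.sum_mul, Finset.mul_sum]
  refine Finset.sum_congr rfl fun a _ => ?_
  rw [Finset.sum_comm]
  exact Finset.sum_congr rfl fun _ _ => Finset.sum_congr rfl fun _ _ =>
    Finset.sum_congr rfl fun _ _ => by ring

theorem sum_up_up' (T f : Fin 4 → Fin 4 → ℝ) :
    ∑ a, ∑ e, f a e * (∑ r, h a r * ∑ s, h e s * T r s) = dctr h T f := by
  rw [← sum_up_up]
  exact Finset.sum_congr rfl fun _ _ => Finset.sum_congr rfl fun _ _ => mul_comm _ _

end FullContraction

section Updates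

variable (a b c e r : Fin 4)

theorem upd₁ : Function.update ![a] 0 r = ![r] := update_cons_zero' _ _ _
theorem upd₂₀ : Function.update ![a, b] 0 r = ![r, b] := update_cons_zero' _ _ _
theorem upd₂₁ : Function.update ![a, b] 1 r = ![a, r] := by
  funext j; fin_cases j <;> simp
theorem upd₃₀ : Function.update ![a, b, c] 0 r = ![r, b, c] := update_cons_zero' _ _ _
theorem upd₃₁ : Function.update ![a, b, c] 1 r = ![a, r, c] := by
  funext j; fin_cases j <;> simp
theorem upd₃₂ : Function.update ![a, b, c] 2 r = ![a, b, r] := by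
  funext j; fin_cases j <;> simp
theorem upd₄₁ : Function.update ![a, b, c, e] 1 r = ![a, r, c, e] := by
  funext j; fin_cases j <;> simp
theorem upd₄₂ : Function.update ![a, b, c, e] 2 r = ![a, b, r, e] := by
  funext j; fin_cases j <;> simp
theorem upd₄₃ : Function.update ![a, b, c, e] 3 r = ![a, b, c, r] := by
  funext j; fin_cases j <;> simp

end Updates

theorem box_eq (g : Tensor 2) {k : ℕ} (T : Tensor k) (x : Pt) (i : Fin k → Fin 4) :
    box g T x i = ctr (ginv g x) fun p q =>
      covD g (covD g T) x (Matrix.vecCons p (Matrix.vecCons q i)) := rfl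

theorem covD_box {U : Set Pt} {g : Tensor 2} (hg : IsMetricOn U g) {k : ℕ} {T : Tensor k}
    (hT : SmoothT U T) {x : Pt} (hx : x ∈ U) (e : Fin 4) (i : Fin k → Fin 4) :
    covD g (box g T) x (Matrix.vecCons e i) = ctr (ginv g x) fun p q =>
      covD g (covD g (covD g T)) x (Matrix.vecCons e (Matrix.vecCons p (Matrix.vecCons q i))) :=
  covD_tctr hg (smooth_covD hg (smooth_covD hg hT)) hx e i

/-- A total contraction of a totally antisymmetric object with a cyclic one vanishes. -/
theorem ctr_cyclic {h : Fin 4 → Fin 4 → ℝ} {M Z : Fin 4 → Fin 4 → Fin 4 → ℝ}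
    (hM : ∀ a b c, M a b c = M b c a) (hZ : ∀ a b c, Z a b c + Z b c a + Z c a b = 0) :
    ctr h (fun e b => ctr h fun p q => ctr h fun r s => Z e p r * M b q s) = 0 := by
  set X := ctr h (fun e b => ctr h fun p q => ctr h fun r s => Z e p r * M b q s) with hX
  have h1 : ctr h (fun e b => ctr h fun p q => ctr h fun r s => Z p r e * M b q s) = X := by
    rw [hX]
    have : ∀ e b, (ctr h fun p q => ctr h fun r s => Z p r e * M b q s)
        = ctr h fun p q => ctr h fun r s => Z p r e * M q s b := fun e b =>
      ctr_congr fun p q => ctr_congr fun r s => by rw [hM]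
    rw [ctr_congr this, ctr_comm]
    exact ctr_congr fun p q => by rw [ctr_comm]
  have h2 : ctr h (fun e b => ctr h fun p q => ctr h fun r s => Z r e p * M b q s) = X := by
    rw [hX]
    have : ∀ e b, (ctr h fun p q => ctr h fun r s => Z r e p * M b q s)
        = ctr h fun p q => ctr h fun r s => Z r e p * M s b q := fun e b =>
      ctr_congr fun p q => ctr_congr fun r s => by rw [hM s]
    rw [ctr_congr this, ctr_congr fun e b => ctr_comm _, ctr_comm]
  have h3 : X + X + X = 0 := by
    nth_rewrite 3 [← h2]
    nth_rewrite 2 [← h1]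
    rw [hX, ← ctr_add, ← ctr_add, ← ctr_zero (h := h)]
    refine ctr_congr fun e b => ?_
    rw [← ctr_add, ← ctr_add, ← ctr_zero (h := h)]
    refine ctr_congr fun p q => ?_
    rw [← ctr_add, ← ctr_add, ← ctr_zero (h := h)]
    refine ctr_congr fun r s => ?_
    linear_combination M b q s * hZ e p r
  linarith

namespace Fields.Setting

variable {u : Fields} {U : Set Pt} (S : u.Setting U)
include S

theorem smooth_covD_F : SmoothT U (covD u.g u.F) := S.smooth_covD S.smooth_F

theorem M₁_eq {x : Pt} (hx : x ∈ U) (i : Fin 1 → Fin 4) :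
    u.M₁ x i = ctr (ginv u.g x) fun p q => covD u.g u.F x ![p, q, i 0] := by
  rw [(S.metAlg hx).swap]
  simp only [Fields.M₁, up, update_cons_zero', Matrix.cons_val_zero, ctr]

end Fields.Setting

end CEM
-- The wave operator on the Faraday tensor
namespace CEM

theorem alt₃_of_antisymm {f : Fin 4 → Fin 4 → Fin 4 → ℝ} (hf : ∀ a b c, f a b c = -f a c b)
    (a b c : Fin 4) : alt₃ a b c f = (f a b c + f b c a + f c a b) / 3 := by
  unfold alt₃
  rw [hf a c b, hf c b a, hf b a c]; ring

theorem alt₃_of_antisymm' {f : Fin 4 → Fin 4 → Fin 4 → ℝ} (hf : ∀ a b c, f a b c = -f b a c)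
    (a b c : Fin 4) : alt₃ a b c f = (f a b c + f b c a + f c a b) / 3 := by
  unfold alt₃
  rw [hf a c b, hf c b a, hf b a c]; ring

/-- The contraction `F^{ae} d_{baec}`. -/
noncomputable def Fields.Fd (u : Fields) : Tensor 2 := fun x i =>
  dctr (ginv u.g x) (fun a e => u.F x ![a, e]) fun a e => u.d x ![i 0, a, i 1, e]

namespace Fields.Setting

variable {u : Fields} {U : Set Pt} (S : u.Setting U)
include S

theorem smooth_M₁ : SmoothT U u.M₁ := fun i => by
  refine (smooth_ctr S.metric (f := fun y p q => covD u.g u.F y ![p, q, i 0])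
    fun p q => S.smooth_covD_F _).congr fun y hy => S.M₁_eq hy i

theorem M₃_eq {x : Pt} (hx : x ∈ U) (i : Fin 3 → Fin 4) :
    u.M₃ x i = 1 / 3 * (covD u.g u.F x ![i 0, i 1, i 2] + covD u.g u.F x ![i 1, i 2, i 0]
      + covD u.g u.F x ![i 2, i 0, i 1]) := by
  rw [Fields.M₃, alt₃_of_antisymm (S.covD_F_antisymm hx)]; ring

theorem smooth_M₃ : SmoothT U u.M₃ := fun i => by
  refine (contDiffOn_const.mul (((S.smooth_covD_F _).add (S.smooth_covD_F _)).add
    (S.smooth_covD_F _))).congr fun y hy => S.M₃_eq hy i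

theorem smooth_Fd : SmoothT U u.Fd := fun i =>
  smooth_ctr S.metric (f := fun y a a' => ctr (ginv u.g y) fun e e' =>
      u.F y ![a', e'] * u.d y ![i 0, a, i 1, e]) fun a a' =>
    smooth_ctr S.metric (f := fun y e e' => u.F y ![a', e'] * u.d y ![i 0, a, i 1, e]) fun _ _ =>
      (S.smooth_F _).mul (S.smooth_d _)

variable {x : Pt} (hx : x ∈ U)
include hx

theorem covD_M₁ (e b : Fin 4) : covD u.g u.M₁ x ![e, b]
    = ctr (ginv u.g x) fun p q => covD u.g (covD u.g u.F) x ![e, p, q, b] := by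
  rw [covD_congr S.isOpen (S := tctr u.g (covD u.g u.F)) (fun y hy i => by
    rw [S.M₁_eq hy, tctr]
    exact ctr_congr fun p q => by rw [show i = ![i 0] from List.ofFn_inj.mp rfl]; rfl) hx,
    covD_tctr S.metric S.smooth_covD_F hx]

theorem covD_M₃ (e a b c : Fin 4) : covD u.g u.M₃ x ![e, a, b, c]
    = 1 / 3 * (covD u.g (covD u.g u.F) x ![e, a, b, c] + covD u.g (covD u.g u.F) x ![e, b, c, a]
      + covD u.g (covD u.g u.F) x ![e, c, a, b]) := by
  have hG := S.smooth_covD_F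
  have hρ : Function.Bijective (![1, 2, 0] : Fin 3 → Fin 3) := by decide
  have hρ' : Function.Bijective (![2, 0, 1] : Fin 3 → Fin 3) := by decide
  rw [covD_congr S.isOpen (S := fun y j => 1 / 3 * (covD u.g u.F y j
    + covD u.g u.F y (j ∘ ![1, 2, 0]) + covD u.g u.F y (j ∘ ![2, 0, 1]))) (fun y hy i => by
      rw [S.M₃_eq hy, ← eq_triple i]; simp [comp_cons, comp_empty]) hx,
    covD_const_mul S.isOpen (T := fun y j => covD u.g u.F y j
    + covD u.g u.F y (j ∘ ![1, 2, 0]) + covD u.g u.F y (j ∘ ![2, 0, 1])) _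
      (fun i => ((hG _).add (hG _)).add (hG _)) hx,
    covD_add S.isOpen (T := fun y j => covD u.g u.F y j
    + covD u.g u.F y (j ∘ ![1, 2, 0])) (fun i => (hG _).add (hG _)) (smooth_reindex hG _) hx,
    covD_add S.isOpen hG (smooth_reindex hG _) hx, covD_reindex _ _ hρ, covD_reindex _ _ hρ']
  simp [comp_cons, comp_empty]

/-- The expression whose vanishing is the reduced equation for `F_{bc}`. -/
theorem box_F (b c : Fin 4) : box u.g u.F x ![b, c]
    = 3 * ctr (ginv u.g x) (fun p q => covD u.g u.M₃ x ![p, q, b, c])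
      + covD u.g u.M₁ x ![b, c] - covD u.g u.M₁ x ![c, b]
      + 2 * u.trL x * u.F x ![b, c] - 2 * u.Xi x * u.Fd x ![b, c] := by
  have H := S.metAlg hx
  have D := S.weylAlg hx
  have ls := S.sym.L_symm x hx
  have fa := S.sym.F_antisymm x hx
  set h := ginv u.g x with hh
  -- Contracting `∇_p ∇_{[q} F_{bc]}` gives `□F` together with two mixed second derivatives.
  have e1 : 3 * ctr h (fun p q => covD u.g u.M₃ x ![p, q, b, c]) = box u.g u.F x ![b, c]
      - ctr h (fun p q => covD u.g (covD u.g u.F) x ![p, b, q, c])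
      + ctr h (fun p q => covD u.g (covD u.g u.F) x ![p, c, q, b]) := by
    rw [box_eq, ← ctr_mul_left, ← ctr_sub, ← ctr_add]
    refine ctr_congr fun p q => ?_
    rw [S.covD_M₃ hx, S.covD_covD_F_antisymm hx p b c q]; ring
  -- In each mixed term the derivatives are commuted so that the inner one becomes the divergence
  -- `M`; the curvature terms are evaluated with the algebraic form of `K`.
  have e2 : ∀ c b, ctr h (fun p q => covD u.g (covD u.g u.F) x ![p, c, q, b])
      = covD u.g u.M₁ x ![c, b] + 2 * ctr h (fun r s => u.L x ![c, s] * u.F x ![r, b])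
        + u.trL x * u.F x ![c, b]
        - u.Xi x * ctr h (fun p q => ctr h fun r s => u.d x ![s, b, p, c] * u.F x ![q, r])
        + ctr h (fun p q => u.L x ![p, b] * u.F x ![q, c])
        + ctr h (fun r s => u.L x ![c, s] * u.F x ![b, r]) := by
    intro c b
    have k1 : ctr h (fun p q => covD u.g (covD u.g u.F) x ![p, c, q, b])
        = covD u.g u.M₁ x ![c, b]
          - ctr h (fun p q => ctr h fun r s => u.K x ![s, q, p, c] * u.F x ![r, b])
          - ctr h (fun p q => ctr h fun r s => u.K x ![s, b, p, c] * u.F x ![q, r]) := by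
      rw [S.covD_M₁ hx, ← ctr_sub, ← ctr_sub]
      refine ctr_congr fun p q => ?_
      linarith [S.comm₂ hx S.smooth_F p c q b]
    have k2 := ctr_ctr_curvAlg_div (Ξ := u.Xi x) H D ls c fun r => u.F x ![r, b]
    have k3 := ctr_ctr_curvAlg (Ξ := u.Xi x) (d := fun a b c e => u.d x ![a, b, c, e])
      (L := fun a b => u.L x ![a, b]) H b c fun q r => u.F x ![q, r]
    have z1 : ctr h (fun q r => u.F x ![q, r]) = 0 := H.ctr_antisymm fa
    have z2 : ctr h (fun p q => ctr h fun r s => u.L x ![p, s] * u.F x ![q, r]) = 0 := by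
      have : ctr h (fun p q => ctr h fun r s => u.L x ![p, s] * u.F x ![q, r])
          = dctr h (fun a e => u.F x ![a, e]) (fun a e => u.L x ![a, e]) := by
        refine ctr_congr fun p q => ?_
        rw [H.swap]
        exact ctr_congr fun r s => mul_comm _ _
      rw [this]
      exact dctr_eq_zero fa ls
    rw [z1, z2] at k3
    simp only [Fields.K, Matrix.cons_val] at k1
    rw [k1, k2, k3]
    rw [Fields.trL, ← hh]; ring
  rw [e2, e2] at e1
  have f1 : ∀ b c, ctr h (fun r s => u.L x ![b, s] * u.F x ![c, r])
      = -ctr h (fun r s => u.L x ![b, s] * u.F x ![r, c]) := by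
    intro b c
    rw [← ctr_neg]; exact ctr_congr fun r s => by rw [fa]; ring
  have f2 : ∀ b c, ctr h (fun p q => u.L x ![p, b] * u.F x ![q, c])
      = ctr h (fun r s => u.L x ![b, s] * u.F x ![r, c]) := by
    intro b c
    rw [H.swap]; exact ctr_congr fun r s => by rw [ls]
  have f3 : ctr h (fun p q => ctr h fun r s => u.d x ![s, b, p, c] * u.F x ![q, r])
      = -u.Fd x ![b, c] := by
    simp only [Fields.Fd, dctr, Matrix.cons_val]
    rw [← hh, ← ctr_neg, ctr_comm, H.swap]
    refine ctr_congr fun p q => ?_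
    rw [← ctr_neg]
    refine ctr_congr fun r s => ?_
    rw [D.anti₁ p b r c, D.anti₂ b p r c, fa s q]; ring
  have f4 : ctr h (fun p q => ctr h fun r s => u.d x ![s, c, p, b] * u.F x ![q, r])
      = u.Fd x ![b, c] := by
    simp only [Fields.Fd, dctr, Matrix.cons_val]
    rw [← hh]
    refine ctr_congr fun p q => ?_
    rw [H.swap]
    refine ctr_congr fun r s => ?_
    rw [D.pair r c p b, D.anti₁ p b r c, D.anti₂ b p r c, D.anti₂ b p c r]; ring
  rw [f1 b c, f1 c b, f2 b c, f2 c b, f3, f4, fa c b] at e1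
  linarith

end Fields.Setting

end CEM
-- Wave equation for the divergence of the Faraday tensor
namespace CEM

theorem ctr_ctr_symm_antisymm {h g L F : Fin 4 → Fin 4 → ℝ} (H : MetAlg h g)
    (ls : ∀ a b, L a b = L b a) (fa : ∀ a b, F a b = -F b a) :
    ctr h (fun p q => ctr h fun r s => L p s * F q r) = 0 := by
  have : ctr h (fun p q => ctr h fun r s => L p s * F q r) = dctr h F L := by
    refine ctr_congr fun p q => ?_
    rw [H.swap]
    exact ctr_congr fun r s => mul_comm _ _
  rw [this]
  exact dctr_eq_zero fa ls

namespace Fields.Setting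

theorem M₃_anti (u : Fields) (x : Pt) (a b c : Fin 4) :
    u.M₃ x ![a, b, c] = -u.M₃ x ![a, c, b] := by
  simp only [Fields.M₃, alt₃, Matrix.cons_val]; ring

theorem M₃_anti' (u : Fields) (x : Pt) (a b c : Fin 4) :
    u.M₃ x ![a, b, c] = -u.M₃ x ![b, a, c] := by
  simp only [Fields.M₃, alt₃, Matrix.cons_val]; ring

theorem M₃_cyc (u : Fields) (x : Pt) (a b c : Fin 4) :
    u.M₃ x ![a, b, c] = u.M₃ x ![b, c, a] := by
  simp only [Fields.M₃, alt₃, Matrix.cons_val]; ring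

variable {u : Fields} {U : Set Pt} (S : u.Setting U)
include S

variable {x : Pt} (hx : x ∈ U)
include hx

/-- By antisymmetry twice the double divergence of `F` is a commutator. Its curvature terms are
traces of `K`, hence symmetric tensors, contracted with the antisymmetric `F`. -/
theorem div_M₁ : ctr (ginv u.g x) (fun p q => covD u.g u.M₁ x ![p, q]) = 0 := by
  have H := S.metAlg hx
  have D := S.weylAlg hx
  have ls := S.sym.L_symm x hx
  have fa := S.sym.F_antisymm x hx
  set h := ginv u.g x with hh
  set X := ctr h (fun p q => ctr h fun r s => covD u.g (covD u.g u.F) x ![p, r, s, q]) with hX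
  have h0 : ctr h (fun p q => covD u.g u.M₁ x ![p, q]) = X := ctr_congr fun p q => S.covD_M₁ hx p q
  have h1 : X = -ctr h (fun p q => ctr h fun r s => covD u.g (covD u.g u.F) x ![r, p, s, q]) := by
    rw [hX, ctr_comm, ← ctr_neg]
    refine ctr_congr fun p q => ?_
    rw [← ctr_neg]
    exact ctr_congr fun r s => S.covD_covD_F_antisymm hx r p q s
  have h2 : 2 * X = -ctr h (fun p q => ctr h fun r s => ctr h fun t v =>
        u.K x ![v, s, p, r] * u.F x ![t, q])
      - ctr h (fun r s => ctr h fun p q => ctr h fun t v =>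
        u.K x ![v, q, p, r] * u.F x ![s, t]) := by
    rw [ctr_comm (k := h) (fun r s p q => ctr h fun t v => u.K x ![v, q, p, r] * u.F x ![s, t]),
      ← ctr_neg, ← ctr_sub, two_mul]
    nth_rewrite 2 [h1]
    rw [hX, ← sub_eq_add_neg, ← ctr_sub]
    refine ctr_congr fun p q => ?_
    rw [← ctr_neg, ← ctr_sub, ← ctr_sub]
    exact ctr_congr fun r s => S.comm₂ hx S.smooth_F p r s q
  have h3 : ctr h (fun p q => ctr h fun r s => ctr h fun t v =>
        u.K x ![v, s, p, r] * u.F x ![t, q]) = 0 := by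
    have : ∀ p q, (ctr h fun r s => ctr h fun t v => u.K x ![v, s, p, r] * u.F x ![t, q])
        = 2 * ctr h (fun t v => u.L x ![p, v] * u.F x ![t, q])
          + u.trL x * u.F x ![p, q] := by
      intro p q
      have k2 := ctr_ctr_curvAlg_div (Ξ := u.Xi x) H D ls p fun t => u.F x ![t, q]
      have : ∀ r s t v, u.K x ![v, s, p, r] * u.F x ![t, q]
          = -(u.K x ![v, s, r, p] * u.F x ![t, q]) := fun r s t v => by
        rw [S.K_anti₂ hx]; ring
      simp only [this, ctr_neg]
      rw [show (ctr h fun r s => ctr h fun t v => u.K x ![v, s, r, p] * u.F x ![t, q]) = _ from k2]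
      rw [Fields.trL, ← hh]; ring
    rw [ctr_congr this, ctr_add, ctr_mul_left, ctr_mul_left, H.ctr_antisymm fa,
      ctr_congr fun p q => ctr_congr fun t v => by rw [fa t q, mul_neg]]
    simp only [ctr_neg]
    rw [ctr_ctr_symm_antisymm H ls fa]; ring
  have h4 : ctr h (fun r s => ctr h fun p q => ctr h fun t v =>
        u.K x ![v, q, p, r] * u.F x ![s, t]) = 0 := by
    have : ∀ r s, (ctr h fun p q => ctr h fun t v => u.K x ![v, q, p, r] * u.F x ![s, t])
        = -2 * ctr h (fun t v => u.L x ![r, v] * u.F x ![s, t])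
          - u.trL x * u.F x ![s, r] := fun r s =>
      ctr_ctr_curvAlg_div (Ξ := u.Xi x) H D ls r fun t => u.F x ![s, t]
    rw [ctr_congr this, ctr_sub, ctr_mul_left, ctr_mul_left, ctr_ctr_symm_antisymm H ls fa,
      H.ctr_antisymm fun p q => fa q p]; ring
  rw [h0]
  linarith

theorem covD_covD_M₃_anti (e p q b c : Fin 4) : covD u.g (covD u.g u.M₃) x ![e, p, q, b, c]
    = -covD u.g (covD u.g u.M₃) x ![e, p, b, q, c] := by
  have h1 : ∀ y ∈ U, ∀ i, covD u.g u.M₃ y i = -covD u.g u.M₃ y (i ∘ ![0, 2, 1, 3]) := by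
    intro y hy i
    have := covD_of_antisymm (g := u.g) S.isOpen S.smooth_M₃ (ρ := ![1, 0, 2]) (by decide)
      (fun z hz i => by
        conv_lhs => rw [eq_triple i]
        rw [M₃_anti']; simp [comp_cons, comp_empty]) hy (i 0) ![i 1, i 2, i 3]
    rw [eq_quad i]
    simpa [comp_cons, comp_empty] using this
  have := covD_of_antisymm (g := u.g) S.isOpen (S.smooth_covD S.smooth_M₃)
    (ρ := ![0, 2, 1, 3]) (by decide) h1 hx e ![p, q, b, c]
  simpa [comp_cons, comp_empty] using this

theorem covD_covD_M₃_cyc (e p a b c : Fin 4) : covD u.g (covD u.g u.M₃) x ![e, p, a, b, c]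
    = covD u.g (covD u.g u.M₃) x ![e, p, b, c, a] := by
  have h1 : ∀ y ∈ U, ∀ i, covD u.g u.M₃ y i = covD u.g u.M₃ y (i ∘ ![0, 2, 3, 1]) := by
    intro y hy i
    have := covD_of_symm (g := u.g) S.isOpen (T := u.M₃) (ρ := ![1, 2, 0]) (by decide)
      (fun z hz i => by
        conv_lhs => rw [eq_triple i]
        rw [M₃_cyc]; simp [comp_cons, comp_empty]) hy (i 0) ![i 1, i 2, i 3]
    rw [eq_quad i]
    simpa [comp_cons, comp_empty] using this
  have := covD_of_symm (g := u.g) S.isOpen (T := covD u.g u.M₃)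
    (ρ := ![0, 2, 3, 1]) (by decide) h1 hx e ![p, a, b, c]
  simpa [comp_cons, comp_empty] using this

/-- Antisymmetry again makes the double divergence half a commutator. The curvature acting on the
two contracted slots is a symmetric trace against an antisymmetric tensor; the term from the free
slot needs the first Bianchi identity. -/
theorem div_div_M₃ (c : Fin 4) : ctr (ginv u.g x) (fun e b => ctr (ginv u.g x) fun p q =>
    covD u.g (covD u.g u.M₃) x ![e, p, q, b, c]) = 0 := by
  have H := S.metAlg hx
  have D := S.weylAlg hx
  have ls := S.sym.L_symm x hx
  set h := ginv u.g x with hh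
  set X := ctr h (fun e b => ctr h fun p q => covD u.g (covD u.g u.M₃) x ![e, p, q, b, c]) with hX
  have h1 : X = -ctr h (fun e b => ctr h fun p q =>
      covD u.g (covD u.g u.M₃) x ![p, e, q, b, c]) := by
    rw [hX, ctr_comm, ← ctr_neg]
    refine ctr_congr fun e b => ?_
    rw [← ctr_neg]
    exact ctr_congr fun p q => S.covD_covD_M₃_anti hx p e b q c
  have h2 : 2 * X = -ctr h (fun e b => ctr h fun p q => ctr h fun r s =>
        u.K x ![s, q, e, p] * u.M₃ x ![r, b, c])
      - ctr h (fun p q => ctr h fun e b => ctr h fun r s =>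
        u.K x ![s, b, e, p] * u.M₃ x ![q, r, c])
      - ctr h (fun e b => ctr h fun p q => ctr h fun r s =>
        u.K x ![s, c, e, p] * u.M₃ x ![q, b, r]) := by
    rw [ctr_comm (k := h) (fun p q e b => ctr h fun r s => u.K x ![s, b, e, p] * u.M₃ x ![q, r, c]),
      ← ctr_neg, ← ctr_sub, ← ctr_sub, two_mul]
    nth_rewrite 2 [h1]
    rw [hX, ← sub_eq_add_neg, ← ctr_sub]
    refine ctr_congr fun p q => ?_
    rw [← ctr_neg, ← ctr_sub, ← ctr_sub, ← ctr_sub]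
    exact ctr_congr fun r s => S.comm₃ hx S.smooth_M₃ p r s q c
  have ma : ∀ p q, u.M₃ x ![p, q, c] = -u.M₃ x ![q, p, c] := fun p q => M₃_anti' u x p q c
  have h3 : ctr h (fun e b => ctr h fun p q => ctr h fun r s =>
        u.K x ![s, q, e, p] * u.M₃ x ![r, b, c]) = 0 := by
    have : ∀ e b, (ctr h fun p q => ctr h fun r s => u.K x ![s, q, e, p] * u.M₃ x ![r, b, c])
        = 2 * ctr h (fun r s => u.L x ![e, s] * u.M₃ x ![r, b, c])
          + u.trL x * u.M₃ x ![e, b, c] := by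
      intro e b
      have k2 := ctr_ctr_curvAlg_div (Ξ := u.Xi x) H D ls e fun r => u.M₃ x ![r, b, c]
      have : ∀ p q r s, u.K x ![s, q, e, p] * u.M₃ x ![r, b, c]
          = -(u.K x ![s, q, p, e] * u.M₃ x ![r, b, c]) := fun p q r s => by
        rw [S.K_anti₂ hx]; ring
      simp only [this, ctr_neg]
      rw [show (ctr h fun p q => ctr h fun r s => u.K x ![s, q, p, e] * u.M₃ x ![r, b, c]) = _
        from k2]
      rw [Fields.trL, ← hh]; ring
    rw [ctr_congr this, ctr_add, ctr_mul_left, ctr_mul_left, H.ctr_antisymm ma,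
      ctr_congr fun p q => ctr_congr fun t v => by rw [ma t q, mul_neg]]
    simp only [ctr_neg]
    rw [ctr_ctr_symm_antisymm H ls ma]; ring
  have h4 : ctr h (fun p q => ctr h fun e b => ctr h fun r s =>
        u.K x ![s, b, e, p] * u.M₃ x ![q, r, c]) = 0 := by
    have : ∀ p q, (ctr h fun e b => ctr h fun r s => u.K x ![s, b, e, p] * u.M₃ x ![q, r, c])
        = -2 * ctr h (fun r s => u.L x ![p, s] * u.M₃ x ![q, r, c])
          - u.trL x * u.M₃ x ![q, p, c] := fun p q =>
      ctr_ctr_curvAlg_div (Ξ := u.Xi x) H D ls p fun r => u.M₃ x ![q, r, c]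
    rw [ctr_congr this, ctr_sub, ctr_mul_left, ctr_mul_left, ctr_ctr_symm_antisymm H ls ma,
      H.ctr_antisymm fun p q => ma q p]; ring
  -- The cyclic sum of `K` over `e, p, r` vanishes while `M` is cyclically invariant, which is the
  -- situation of `ctr_cyclic`.
  have h5 : ctr h (fun e b => ctr h fun p q => ctr h fun r s =>
        u.K x ![s, c, e, p] * u.M₃ x ![q, b, r]) = 0 := by
    have := ctr_cyclic (h := h) (M := fun a b c => u.M₃ x ![a, b, c])
      (Z := fun e p r => u.K x ![r, c, e, p]) (fun a b c => M₃_cyc u x a b c) (fun e p r => by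
        have k1 := S.K_cyc hx c e p r
        rw [S.K_anti₁ hx r c, S.K_anti₁ hx e c, S.K_anti₁ hx p c]; linarith)
    rw [← neg_eq_zero, ← this, ← ctr_neg]
    refine ctr_congr fun e b => ?_
    rw [← ctr_neg]
    refine ctr_congr fun p q => ?_
    rw [← ctr_neg, H.swap]
    exact ctr_congr fun r s => by rw [M₃_anti' u x q b]; ring
  linarith

variable (hW : ∀ y ∈ U, ∀ b c, 3 * ctr (ginv u.g y) (fun p q => covD u.g u.M₃ y ![p, q, b, c])
      + covD u.g u.M₁ y ![b, c] - covD u.g u.M₁ y ![c, b] = 0)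
include hW

/-- By `box_F`, `hW` is the reduced equation for `F`. It holds on the whole open set and may
therefore be differentiated. -/
theorem covD_reduced_F (e b c : Fin 4) :
    3 * ctr (ginv u.g x) (fun p q => covD u.g (covD u.g u.M₃) x ![e, p, q, b, c])
      + covD u.g (covD u.g u.M₁) x ![e, b, c] - covD u.g (covD u.g u.M₁) x ![e, c, b] = 0 := by
  have hρ : Function.Bijective (![1, 0] : Fin 2 → Fin 2) := by decide
  have s1 := S.smooth_covD S.smooth_M₁
  have s3 := S.smooth_covD S.smooth_M₃
  have s4 := smooth_tctr S.metric s3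
  have s5 : SmoothT U (fun y j => 3 * tctr u.g (covD u.g u.M₃) y j + covD u.g u.M₁ y j) :=
    fun i => (contDiffOn_const.mul (s4 i)).add (s1 i)
  have h := covD_congr S.isOpen (g := u.g) (T := fun y j => 3 * tctr u.g (covD u.g u.M₃) y j
    + covD u.g u.M₁ y j - covD u.g u.M₁ y (j ∘ ![1, 0])) (S := fun _ _ => 0) (fun y hy i => by
      have := hW y hy (i 0) (i 1)
      rw [eq_pair i]
      simpa [tctr, comp_cons, comp_empty] using this) hx ![e, b, c]
  rw [covD_zero, covD_sub S.isOpen s5 (smooth_reindex s1 _) hx,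
    covD_add S.isOpen (T := fun y j => 3 * tctr u.g (covD u.g u.M₃) y j)
      (fun i => contDiffOn_const.mul (s4 i)) s1 hx,
    covD_const_mul S.isOpen _ s4 hx, covD_reindex _ _ hρ, covD_tctr S.metric s3 hx] at h
  simpa [comp_cons, comp_empty] using h

/-- The divergence of `3 ∇^a M_{abc} + ∇_b M_c - ∇_c M_b = 0` loses its first term by `div_div_M₃`
and leaves `□M_c = ∇^b ∇_c M_b`. Commuting produces a Ricci term, and `∇_c ∇^b M_b` vanishes by
`div_M₁`. -/
theorem waveM₁ : u.WaveM₁ x := by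
  intro c
  have H := S.metAlg hx
  have D := S.weylAlg hx
  have ls := S.sym.L_symm x hx
  set h := ginv u.g x with hh
  have h1 : box u.g u.M₁ x ![c] = ctr h (fun e b => covD u.g (covD u.g u.M₁) x ![e, c, b]) := by
    rw [box_eq]
    have : ∀ e b, covD u.g (covD u.g u.M₁) x ![e, b, c]
        = covD u.g (covD u.g u.M₁) x ![e, c, b]
          - 3 * ctr h (fun p q => covD u.g (covD u.g u.M₃) x ![e, p, q, b, c]) := fun e b => by
      linarith [S.covD_reduced_F hx hW e b c]
    rw [ctr_congr this, ctr_sub, ctr_mul_left, S.div_div_M₃ hx]; ring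
  have h2 : ctr h (fun e b => covD u.g (covD u.g u.M₁) x ![e, c, b])
      = ctr h (fun e b => covD u.g (covD u.g u.M₁) x ![c, e, b])
        - ctr h (fun e b => ctr h fun r s => u.K x ![s, b, e, c] * u.M₁ x ![r]) := by
    rw [← ctr_sub]
    exact ctr_congr fun e b => by linarith [S.comm₁ hx S.smooth_M₁ e c b]
  have h3 : ctr h (fun e b => covD u.g (covD u.g u.M₁) x ![c, e, b]) = 0 := by
    have k := covD_tctr S.metric (k := 0) (S.smooth_covD S.smooth_M₁) hx c ![]
    rw [covD_congr S.isOpen (S := fun _ _ => 0) (fun y hy i => by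
      rw [← S.div_M₁ hy, tctr]
      exact ctr_congr fun p q => by rw [Subsingleton.elim i ![]]) hx, covD_zero] at k
    exact k.symm
  have h4 := ctr_ctr_curvAlg_div (Ξ := u.Xi x) H D ls c fun r => u.M₁ x ![r]
  rw [h1, h2, h3, show (ctr h fun e b => ctr h fun r s => u.K x ![s, b, e, c] * u.M₁ x ![r]) = _
    from h4, S.scalarCurv_eq hx]
  simp only [up, upd₁, Matrix.cons_val_zero, sum_up]
  rw [H.swap fun r s => u.L x ![c, s] * u.M₁ x ![r], Fields.trL, ← hh]
  rw [ctr_congr fun p q => mul_comm (u.L x ![c, p]) (u.M₁ x ![q])]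
  ring

end Fields.Setting

end CEM
-- Wave equation for the exterior derivative of the Faraday tensor
namespace CEM

namespace Fields.Setting

variable {u : Fields} {U : Set Pt} (S : u.Setting U)
include S

variable {x : Pt} (hx : x ∈ U)
include hx

/-- The exterior derivative of `M_{abc}` vanishes. -/
theorem covD_M₃_closed (e a b c : Fin 4) : covD u.g u.M₃ x ![e, a, b, c]
    = covD u.g u.M₃ x ![a, e, b, c] + covD u.g u.M₃ x ![b, a, e, c]
      + covD u.g u.M₃ x ![c, a, b, e] := by
  have fa := S.sym.F_antisymm x hx
  have key : ∀ a b c e, covD u.g (covD u.g u.F) x ![a, b, c, e]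
      - covD u.g (covD u.g u.F) x ![b, a, c, e]
      = -(ctr (ginv u.g x) fun r s => u.K x ![s, c, a, b] * u.F x ![r, e])
        + ctr (ginv u.g x) fun r s => u.K x ![s, e, a, b] * u.F x ![r, c] := by
    intro a b c e
    rw [S.comm₂ hx S.smooth_F, sub_eq_add_neg, ← ctr_neg (fun r s => u.K x ![s, e, a, b] * _)]
    congr 1
    exact ctr_congr fun r s => by rw [fa c r]; ring
  -- The exterior derivative of `dF` is a sum of commutators of second derivatives; their curvature
  -- terms cancel in cyclic triples by the first Bianchi identity.
  have cyc : ∀ a b c e, (ctr (ginv u.g x) fun r s => u.K x ![s, a, b, c] * u.F x ![r, e])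
      + (ctr (ginv u.g x) fun r s => u.K x ![s, b, c, a] * u.F x ![r, e])
      + (ctr (ginv u.g x) fun r s => u.K x ![s, c, a, b] * u.F x ![r, e]) = 0 := by
    intro a b c e
    rw [← ctr_add, ← ctr_add, ← ctr_zero (h := ginv u.g x)]
    refine ctr_congr fun r s => ?_
    linear_combination u.F x ![r, e] * S.K_cyc hx s a b c
  have an := S.covD_covD_F_antisymm hx
  have k1 := key e a b c
  have k2 := key e b c a
  have k3 := key e c a b
  have k4 := key a b c e
  have k5 := key b c a e
  have k6 := key c a b e
  have sw : ∀ a b c e, (ctr (ginv u.g x) fun r s => u.K x ![s, a, b, c] * u.F x ![r, e])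
      = -(ctr (ginv u.g x) fun r s => u.K x ![s, a, c, b] * u.F x ![r, e]) := by
    intro a b c e
    rw [← ctr_neg]
    exact ctr_congr fun r s => by rw [S.K_anti₂ hx]; ring
  have c1 := cyc a b c e
  have c2 := cyc e a b c
  have c3 := cyc e b c a
  have c4 := cyc e c a b
  have s1 := sw b e a c
  have s2 := sw c e a b
  have s3 := sw c e b a
  have s4 := sw a e b c
  have s5 := sw a e c b
  have s6 := sw b e c a
  simp only [S.covD_M₃ hx]
  have a1 := an a e b c
  have a2 := an b a e c
  have a3 := an c a b e
  have a4 := an a b c e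
  have a5 := an b c a e
  have a6 := an a c e b
  have a7 := an c e a b
  have a8 := an c b e a
  have a9 := an b e c a
  linarith

theorem covD_covD_M₃_closed (f e a b c : Fin 4) : covD u.g (covD u.g u.M₃) x ![f, e, a, b, c]
    = covD u.g (covD u.g u.M₃) x ![f, a, e, b, c] + covD u.g (covD u.g u.M₃) x ![f, b, e, c, a]
      + covD u.g (covD u.g u.M₃) x ![f, c, e, a, b] := by
  have h1 : Function.Bijective (![1, 0, 2, 3] : Fin 4 → Fin 4) := by decide
  have h2 : Function.Bijective (![2, 1, 0, 3] : Fin 4 → Fin 4) := by decide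
  have h3 : Function.Bijective (![3, 1, 2, 0] : Fin 4 → Fin 4) := by decide
  have hG := S.smooth_covD S.smooth_M₃
  have := covD_congr (g := u.g) S.isOpen (T := covD u.g u.M₃) (S := fun y j =>
    covD u.g u.M₃ y (j ∘ ![1, 0, 2, 3]) + covD u.g u.M₃ y (j ∘ ![2, 1, 0, 3])
      + covD u.g u.M₃ y (j ∘ ![3, 1, 2, 0])) (fun y hy i => by
        conv_lhs => rw [eq_quad i]
        rw [S.covD_M₃_closed hy]; simp [comp_cons, comp_empty]) hx ![f, e, a, b, c]
  rw [covD_add S.isOpen (T := fun y j => covD u.g u.M₃ y (j ∘ ![1, 0, 2, 3])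
    + covD u.g u.M₃ y (j ∘ ![2, 1, 0, 3])) (fun i => (hG _).add (hG _)) (smooth_reindex hG _) hx,
    covD_add S.isOpen (smooth_reindex hG _) (smooth_reindex hG _) hx,
    covD_reindex _ _ h1, covD_reindex _ _ h2, covD_reindex _ _ h3] at this
  rw [this]
  simp only [comp_cons, comp_empty, Matrix.cons_val]
  rw [S.covD_covD_M₃_cyc hx f b a e c, S.covD_covD_M₃_cyc hx f c e a b,
    S.covD_covD_M₃_cyc hx f c a b e]

/-- A Weitzenböck argument. Closedness turns `□M_{abc}` into the cyclic sum of `∇^p ∇_a M_{pbc}`.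
Commuting leaves curvature terms and the cyclic sum of `∇_a ∇^p M_{pbc}`. By `hW` the latter is a
multiple of the exterior derivative of `dM₁`, which is zero. -/
theorem waveM₃ (hW : ∀ y ∈ U, ∀ b c,
    3 * ctr (ginv u.g y) (fun p q => covD u.g u.M₃ y ![p, q, b, c])
      + covD u.g u.M₁ y ![b, c] - covD u.g u.M₁ y ![c, b] = 0) : u.WaveM₃ x := by
  intro a b c
  have H := S.metAlg hx
  have D := S.weylAlg hx
  have ls := S.sym.L_symm x hx
  have ma := M₃_anti u x
  have ma' := M₃_anti' u x
  have mc := M₃_cyc u x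
  set h := ginv u.g x with hh
  set ℓ : Fin 4 → Fin 4 → Fin 4 → ℝ := fun a b c =>
    ctr h fun p q => u.L x ![a, p] * u.M₃ x ![b, c, q] with hℓ
  set f : Fin 4 → Fin 4 → Fin 4 → ℝ := fun a b c =>
    ctr h fun p q => ctr h fun r s => u.d x ![a, p, b, r] * u.M₃ x ![c, q, s] with hf
  have ℓa : ∀ a b c, ℓ a b c = -ℓ a c b := fun a b c => by
    simp only [hℓ]; rw [← ctr_neg]; exact ctr_congr fun p q => by rw [ma' b c q]; ring
  have fa : ∀ a b c, f a b c = -f b a c := fun a b c => by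
    simp only [hf]; rw [← ctr_neg, ctr_comm]
    refine ctr_congr fun p q => ?_
    rw [← ctr_neg]
    refine ctr_congr fun r s => ?_
    rw [D.pair, ma c s q]; ring
  have hℓ1 : ∀ a b c, ctr h (fun r s => u.L x ![a, s] * u.M₃ x ![r, b, c]) = ℓ a b c := by
    intro a b c
    rw [H.swap]; exact ctr_congr fun p q => by rw [mc]
  have hf1 : ∀ a b c, ctr h (fun p q => ctr h fun r s => u.d x ![s, b, p, a] * u.M₃ x ![q, r, c])
      = f a b c := by
    intro a b c
    refine ctr_congr fun p q => ?_
    rw [H.swap]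
    refine ctr_congr fun r s => ?_
    rw [D.pair, D.anti₁, D.anti₂, ← mc c q s]; ring
  -- One commutator, with the curvature terms sorted into the trace of `L`, a contraction with `d`
  -- (`f`) and a contraction with `L` (`ℓ`).
  have hcomm : ∀ a b c, ctr h (fun p q => covD u.g (covD u.g u.M₃) x ![p, a, q, b, c])
      - ctr h (fun p q => covD u.g (covD u.g u.M₃) x ![a, p, q, b, c])
      = u.trL x * u.M₃ x ![a, b, c] - u.Xi x * f a b c + u.Xi x * f a c b
        - ℓ b c a - ℓ c a b := by
    intro a b c
    have k0 := ctr_ctr_curvAlg_div (Ξ := u.Xi x) H D ls a fun r => u.M₃ x ![r, b, c]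
    have k1 := ctr_ctr_curvAlg (Ξ := u.Xi x) (d := fun a b c e => u.d x ![a, b, c, e])
      (L := fun a b => u.L x ![a, b]) H b a fun q r => u.M₃ x ![q, r, c]
    have k2 := ctr_ctr_curvAlg (Ξ := u.Xi x) (d := fun a b c e => u.d x ![a, b, c, e])
      (L := fun a b => u.L x ![a, b]) H c a fun q r => u.M₃ x ![q, r, b]
    have z : ∀ c, ctr h (fun q r => u.M₃ x ![q, r, c]) = 0 := fun c =>
      H.ctr_antisymm fun p q => ma' p q c
    have z' : ∀ c, ctr h (fun p q => ctr h fun r s => u.L x ![p, s] * u.M₃ x ![q, r, c]) = 0 :=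
      fun c => ctr_ctr_symm_antisymm H ls fun p q => ma' p q c
    have y1 : ∀ a b c, ctr h (fun p q => u.L x ![p, b] * u.M₃ x ![q, a, c]) = ℓ b a c := by
      intro a b c
      exact ctr_congr fun p q => by rw [ls p b, mc]
    have y2 : ∀ a b c, ctr h (fun r s => u.L x ![a, s] * u.M₃ x ![b, r, c]) = ℓ a c b := by
      intro a b c
      rw [H.swap]; exact ctr_congr fun p q => by rw [← mc c b q]
    rw [hf1, z, z', y1, y2] at k1 k2
    rw [hℓ1] at k0
    rw [← ctr_sub, ctr_congr fun p q => S.comm₃ hx S.smooth_M₃ p a q b c, ctr_sub, ctr_sub, ctr_neg]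
    rw [ctr_congr fun p q => ctr_congr fun r s => show
      u.K x ![s, c, p, a] * u.M₃ x ![q, b, r] = -(u.K x ![s, c, p, a] * u.M₃ x ![q, r, b]) by
        rw [ma q b r]; ring]
    simp only [ctr_neg]
    simp only [Fields.K, Matrix.cons_val] at *
    rw [k0, k1, k2]
    rw [Fields.trL, ← hh, ℓa b a c, ℓa a b c]; ring
  have h1 : box u.g u.M₃ x ![a, b, c]
      = ctr h (fun p q => covD u.g (covD u.g u.M₃) x ![p, a, q, b, c])
        + ctr h (fun p q => covD u.g (covD u.g u.M₃) x ![p, b, q, c, a])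
        + ctr h (fun p q => covD u.g (covD u.g u.M₃) x ![p, c, q, a, b]) := by
    rw [box_eq, ← ctr_add, ← ctr_add]
    exact ctr_congr fun p q => S.covD_covD_M₃_closed hx p q a b c
  have r1 := S.covD_reduced_F hx hW a b c
  have r2 := S.covD_reduced_F hx hW b c a
  have r3 := S.covD_reduced_F hx hW c a b
  have c1 := S.comm₁ hx S.smooth_M₁ a b c
  have c2 := S.comm₁ hx S.smooth_M₁ b c a
  have c3 := S.comm₁ hx S.smooth_M₁ c a b
  -- This is `d(dM₁) = 0`: the cyclic sum of the commutators on `M₁` vanishes by the first Bianchi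
  -- identity.
  have cyc : ctr h (fun r s => u.K x ![s, c, a, b] * u.M₁ x ![r])
      + ctr h (fun r s => u.K x ![s, a, b, c] * u.M₁ x ![r])
      + ctr h (fun r s => u.K x ![s, b, c, a] * u.M₁ x ![r]) = 0 := by
    rw [← ctr_add, ← ctr_add, ← ctr_zero (h := h)]
    refine ctr_congr fun r s => ?_
    linear_combination u.M₁ x ![r] * S.K_cyc hx s c a b
  have t1 := hcomm a b c
  have t2 := hcomm b c a
  have t3 := hcomm c a b
  have g1 : ∀ a b c, ∑ d, ∑ e, up u.g 1 (up u.g 3 u.d) x ![a, d, b, e] * u.M₃ x ![c, d, e]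
      = f a b c := by
    intro a b c
    simp only [up, upd₄₁, upd₄₃, Matrix.cons_val]
    rw [sum_up_up (h := ginv u.g x) (fun r s => u.d x ![a, r, b, s]) fun d e => u.M₃ x ![c, d, e]]
    simp only [dctr, hf]
    rw [← hh, H.swap]
    exact ctr_congr fun p q => H.swap _
  have g2 : ∀ a b c, ∑ d, up u.g 1 u.L x ![a, d] * u.M₃ x ![b, c, d] = ℓ a b c := by
    intro a b c
    simp only [up, upd₂₁, Matrix.cons_val]
    rw [sum_up, ← hh, H.swap]
  simp only [g1, g2]
  rw [alt₃_of_antisymm' fa, alt₃_of_antisymm ℓa, S.scalarCurv_eq hx, h1]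
  have f1 := fa a c b
  have f2 := fa b a c
  have f3 := fa c b a
  rw [f1] at t1
  rw [f2] at t2
  rw [f3] at t3
  have m1 := mc a b c
  have m2 := mc b c a
  rw [← m2, ← m1] at t3
  rw [← m1] at t2
  linarith

end Fields.Setting

end CEM
-- Contractions of the four-dimensional identity with a vector and a two-form
namespace CEM

section Algebra

variable {h g : Fin 4 → Fin 4 → ℝ} (H : MetAlg h g)
include H

theorem dctr_g_right (F : Fin 4 → Fin 4 → ℝ) (b : Fin 4) (w : Fin 4 → ℝ) :
    dctr h F (fun y z => g b z * w y) = ctr h fun y y' => F y' b * w y := by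
  refine ctr_congr fun y y' => ?_
  rw [ctr_congr fun e e' => show F y' e' * (g b e * w y) = g b e * (F y' e' * w y) by ring]
  exact H.ctr_g_left b fun e' => F y' e' * w y

theorem dctr_g_left (F : Fin 4 → Fin 4 → ℝ) (b : Fin 4) (w : Fin 4 → ℝ) :
    dctr h F (fun y z => g b y * w z) = ctr h fun y y' => F b y' * w y := by
  rw [dctr_transpose]
  exact dctr_g_right H (fun a e => F e a) b w

/-- The contraction of `kulkarni` with a vector. -/
theorem kulkarni_ctr {d : Fin 4 → Fin 4 → Fin 4 → Fin 4 → ℝ} (D : WeylAlg h d)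
    (hk : ∀ a b c k f l, kulkarni g d a b c k f l = 0) {v : Fin 4 → ℝ}
    {W : Fin 4 → Fin 4 → Fin 4 → ℝ} (hW : ∀ a b c, W a b c = ctr h fun p q => v p * d q a b c)
    (a b c k f : Fin 4) :
    v f * d a b c k + v c * d a b k f + v k * d a b f c
      - (g a f * W b c k + g a c * W b k f + g a k * W b f c)
      + (g b f * W a c k + g b c * W a k f + g b k * W a f c) = 0 := by
  have e : ctr h (fun p q => v p * kulkarni g d a b q c k f) = 0 := by
    simp only [hk, mul_zero, ctr_zero]
  have t1 : ∀ f (X : ℝ), ctr h (fun p q => v p * (g q f * X)) = v f * X := fun f X => by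
    rw [ctr_congr fun p q => show v p * (g q f * X) = g q f * (v p * X) by ring]
    exact H.ctr_g_right' f fun p => v p * X
  have t2 : ∀ b c k (X : ℝ), ctr h (fun p q => v p * (X * d b q c k)) = -(X * W b c k) := by
    intro b c k X
    rw [hW, ← ctr_mul_left, ← ctr_neg]
    exact ctr_congr fun p q => by rw [D.anti₁ b q]; ring
  have t3 : ∀ b c k (X : ℝ), ctr h (fun p q => v p * (X * d q b c k)) = X * W b c k := by
    intro b c k X
    rw [hW, ← ctr_mul_left]
    exact ctr_congr fun p q => by ring
  simp only [kulkarni, mul_add, ctr_add, t1, t2, t3] at e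
  linarith

/-- The part with `∇Ξ` of the wave equation for `∇_a F_{bc}`. -/
theorem gradient_terms {d : Fin 4 → Fin 4 → Fin 4 → Fin 4 → ℝ} (D : WeylAlg h d)
    (hk : ∀ a b c k f l, kulkarni g d a b c k f l = 0) {v : Fin 4 → ℝ}
    {W : Fin 4 → Fin 4 → Fin 4 → ℝ} (hW : ∀ a b c, W a b c = ctr h fun p q => v p * d q a b c)
    {F E : Fin 4 → Fin 4 → ℝ} (fa : ∀ a b, F a b = -F b a)
    (hE : ∀ b c, E b c = dctr h F fun y z => d b y c z) (a b c : Fin 4) :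
    v a * E b c - v b * E a c + v c * E a b
      + ctr h (fun p q => W p b c * F q a)
      + ctr h (fun p q => W b a p * F q c) - ctr h (fun p q => W a b p * F q c)
      - (ctr h (fun p q => W c a p * F q b) - ctr h (fun p q => W a c p * F q b)) = 0 := by
  have Wa : ∀ a b c, W a b c = -W a c b := fun a b c => by
    rw [hW, hW, ← ctr_neg]; exact ctr_congr fun p q => by rw [D.anti₂]; ring
  have Wc : ∀ a b c, W a b c + W b c a + W c a b = 0 := fun a b c => by
    rw [hW, hW, hW, ← ctr_add, ← ctr_add, ← ctr_zero (h := h)]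
    exact ctr_congr fun p q => by linear_combination v p * D.cyc q a b c
  set β : Fin 4 → Fin 4 → Fin 4 → ℝ := fun b c a => ctr h fun y y' => F y' b * W c a y with hβ
  have hβ' : ∀ b c a, ctr h (fun p q => W c a p * F q b) = β b c a := fun b c a =>
    ctr_congr fun p q => mul_comm _ _
  have hγ : ctr h (fun p q => W p b c * F q a) = ctr h fun p q => F q a * W p b c :=
    ctr_congr fun p q => mul_comm _ _
  set γ := ctr h fun p q => F q a * W p b c with hγ'
  set α := dctr h F fun y z => v z * d b c a y with hα
  set ww : Fin 4 → ℝ := fun c => dctr h F fun y z => W c y z with hw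
  -- Cyclicity of `W` reduces the contraction over its outer indices to half of the contraction over
  -- its last two.
  have hw' : ∀ c, dctr h F (fun y z => W z c y) = -ww c / 2 := fun c => by
    have h1 := dctr_swap_of_antisymm (h := h) fa fun y z => W z c y
    have h2 : dctr h F (fun y z => W z c y + W c y z - W y c z) = 0 := by
      rw [← dctr_zero (h := h) F]
      exact dctr_congr fun y z => by linarith [Wc z c y, Wa y z c]
    rw [dctr_sub, dctr_add] at h2
    linarith
  have n1 : dctr h F (fun y z => v y * d b c z a) = α := by
    have := dctr_swap_of_antisymm (h := h) fa fun y z => v y * d b c z a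
    rw [← neg_eq_iff_eq_neg] at this
    rw [← this, hα, ← dctr_neg]
    exact dctr_congr fun y z => by rw [D.anti₂]; ring
  have n2 : dctr h F (fun y z => d b c y z) = 2 * E b c := by
    have h1 := dctr_swap_of_antisymm (h := h) fa fun y z => d b y c z
    have h2 : dctr h F (fun y z => d b c y z) = dctr h F (fun y z => d b y c z - d b z c y) :=
      dctr_congr fun y z => by linarith [D.cyc b c y z, D.anti₂ b y c z]
    rw [h2, dctr_sub, h1, hE]; ring
  have n3 : ∀ b c a, dctr h F (fun y z => g b z * W c a y) = β b c a := fun b c a =>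
    dctr_g_right H F b fun y => W c a y
  have n4 : ∀ b c a, dctr h F (fun y z => g b y * W c z a) = β b c a := fun b c a => by
    rw [dctr_g_left H F b fun z => W c z a]
    exact ctr_congr fun p q => by rw [fa, Wa]; ring
  -- First use of the identity: both indices contracted with `F` lie in the second antisymmetric
  -- triple.
  have i1 : dctr h F (fun y z => v z * d b c a y + v a * d b c y z + v y * d b c z a
      - (g b z * W c a y + g b a * W c y z + g b y * W c z a)
      + (g c z * W b a y + g c a * W b y z + g c y * W b z a)) = 0 := by
    rw [← dctr_zero (h := h) F]
    exact dctr_congr fun y z => kulkarni_ctr H D hk hW b c a y z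
  simp only [dctr_add, dctr_sub, dctr_mul_left, n1, n2, n3, n4] at i1
  have m1 : dctr h F (fun y z => v y * d a z b c) = -α := by
    rw [hα, ← dctr_swap_of_antisymm fa]
    exact dctr_congr fun y z => by rw [D.pair]
  have m2 : ∀ c, dctr h F (fun y z => d a z c y) = -E a c := fun c => by
    rw [hE, ← dctr_swap_of_antisymm fa]
  have m3 : ∀ c, dctr h F (fun y z => d a z y c) = E a c := fun c => by
    rw [← neg_neg (E a c), ← m2, ← dctr_neg]
    exact dctr_congr fun y z => by rw [D.anti₂]
  have m4 : dctr h F (fun y z => g a y * W z b c) = -γ := by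
    rw [dctr_g_left H F a fun z => W z b c, hγ', ← ctr_neg]
    exact ctr_congr fun p q => by rw [fa]; ring
  have m5 : dctr h F (fun y z => W z y b) = ww b / 2 := by
    have : dctr h F (fun y z => W z y b) = -dctr h F (fun y z => W z b y) := by
      rw [← dctr_neg]; exact dctr_congr fun y z => Wa _ _ _
    rw [this, hw']; ring
  have m6 : dctr h F (fun y z => g z y * W a b c) = 0 :=
    dctr_eq_zero fa fun y z => by rw [H.gs]
  have m7 : dctr h F (fun y z => g z b * W a c y) = β b a c := by
    rw [← n3]; exact dctr_congr fun y z => by rw [H.gs]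
  have m8 : dctr h F (fun y z => g z c * W a y b) = -β c a b := by
    rw [← n3, ← dctr_neg]; exact dctr_congr fun y z => by rw [H.gs, Wa a y b]; ring
  -- Second use: `F` joins one index of the first triple to one of the second. The claim is a linear
  -- combination of `i1` and `i2`.
  have i2 : dctr h F (fun y z => v y * d a z b c + v b * d a z c y + v c * d a z y b
      - (g a y * W z b c + g a b * W z c y + g a c * W z y b)
      + (g z y * W a b c + g z b * W a c y + g z c * W a y b)) = 0 := by
    rw [← dctr_zero (h := h) F]
    exact dctr_congr fun y z => kulkarni_ctr H D hk hW a z b c y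
  simp only [dctr_add, dctr_sub, dctr_mul_left, m1, m2, m3, m4, hw', m5, m6, m7, m8] at i2
  rw [hβ', hβ', hβ', hβ', hγ]
  rw [H.gs b a, H.gs c a] at i1
  have o1 : (dctr h F fun y z => W c y z) = ww c := rfl
  have o2 : (dctr h F fun y z => W b y z) = ww b := rfl
  rw [o1, o2] at i1
  linarith

end Algebra

namespace Fields

/-- The terms with undifferentiated `H` and curvature of the equation for `H_{abc}`. -/
noncomputable def auxH (u : Fields) (x : Pt) (X : Tensor 3) (a b c : Fin 4) : ℝ :=
  -2 * u.Xi x * (∑ d, ∑ e, up u.g 1 (up u.g 2 X) x ![a, d, e] * u.d x ![b, d, c, e])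
    - 4 * u.Xi x * alt₂ b c (fun b c =>
        ∑ d, ∑ e, up u.g 0 (up u.g 2 X) x ![d, b, e] * u.d x ![c, e, a, d])
    + 4 * (∑ d, up u.g 0 X x ![d, b, c] * u.L x ![a, d])
    - 4 * alt₂ b c (fun b c => ∑ d, up u.g 0 X x ![d, a, b] * u.L x ![c, d])
    - 4 * alt₂ b c (fun b c =>
        ∑ d, ∑ e, up u.g 0 (up u.g 2 X) x ![d, b, e] * u.g x ![c, a] * u.L x ![d, e])

/-- The terms without `H` and without the Cotton tensor of the equation for `H_{abc}`. -/
noncomputable def restH (u : Fields) (src : GaugeSource) (x : Pt) (a b c : Fin 4) : ℝ :=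
  (1 / 3) * u.F x ![b, c] * grad src.R x ![a]
    - (1 / 3) * alt₂ b c (fun b c => u.F x ![a, b] * grad src.R x ![c])
    + (1 / 3) * alt₂ b c (fun b c =>
        u.g x ![a, b] * ∑ d, u.F x ![c, d] * up u.g 0 (grad src.R) x ![d])
    - 4 * alt₂ b c (fun b c =>
        (∑ d, ∑ e, u.Fup x ![d, e] * u.d x ![a, d, e, b]) * grad u.Xi x ![c])
    - 4 * alt₂ b c (fun b c =>
        ∑ d, ∑ e, up u.g 1 u.F x ![b, e] * u.d x ![c, d, a, e] * u.gradUp x d)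
    - 2 * (∑ d, ∑ e, up u.g 1 u.F x ![a, e] * u.d x ![b, c, d, e] * u.gradUp x d)
    - u.Xi x * (∑ d, ∑ e, u.Fup x ![d, e] * covD u.g u.d x ![a, b, c, d, e])

theorem rhs_H_eq (u : Fields) (src : GaugeSource) (x : Pt) (a b c : Fin 4) :
    u.rhs_H src x a b c
      = 4 * u.Xi x * alt₂ b c (fun b c => ∑ d, up u.g 1 u.F x ![b, d] * u.cotton x ![c, d, a])
        + u.auxH x u.H a b c + (1 / 2) * u.H x ![a, b, c] * src.R x + u.restH src x a b c := by
  unfold rhs_H auxH restH; ring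

/-- In this form the expression is visibly linear in `X`, which is what allows `H` and `∇F` to be
subtracted under it. -/
theorem auxH_eq (u : Fields) (x : Pt) (X : Tensor 3) (a b c : Fin 4) :
    u.auxH x X a b c
      = -2 * u.Xi x * dctr (ginv u.g x) (fun p q => X x ![a, p, q])
          (fun p q => u.d x ![b, p, c, q])
        - 2 * u.Xi x * dctr (ginv u.g x) (fun p q => X x ![p, b, q])
          (fun p q => u.d x ![c, q, a, p])
        + 2 * u.Xi x * dctr (ginv u.g x) (fun p q => X x ![p, c, q])
          (fun p q => u.d x ![b, q, a, p])
        + 4 * ctr (ginv u.g x) (fun p q => X x ![q, b, c] * u.L x ![a, p])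
        - 2 * ctr (ginv u.g x) (fun p q => X x ![q, a, b] * u.L x ![c, p])
        + 2 * ctr (ginv u.g x) (fun p q => X x ![q, a, c] * u.L x ![b, p])
        - 2 * u.g x ![c, a] * dctr (ginv u.g x) (fun p q => X x ![p, b, q])
          (fun p q => u.L x ![p, q])
        + 2 * u.g x ![b, a] * dctr (ginv u.g x) (fun p q => X x ![p, c, q])
          (fun p q => u.L x ![p, q]) := by
  have e : ∀ b c, ∑ d, ∑ e, up u.g 0 (up u.g 2 X) x ![d, b, e] * u.g x ![c, a] * u.L x ![d, e]
      = u.g x ![c, a] * ∑ d, ∑ e, up u.g 0 (up u.g 2 X) x ![d, b, e] * u.L x ![d, e] := by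
    intro b c
    simp only [Finset.mul_sum]
    exact Finset.sum_congr rfl fun _ _ => Finset.sum_congr rfl fun _ _ => by ring
  unfold auxH alt₂
  simp only [e]
  simp only [up, upd₃₀, upd₃₁, upd₃₂, Matrix.cons_val]
  have w1 := fun b c => sum_up_up (h := ginv u.g x) (fun r s => X x ![a, r, s])
    fun d e => u.d x ![b, d, c, e]
  have w2 := fun b c => sum_up_up (h := ginv u.g x) (fun r s => X x ![r, b, s])
    fun d e => u.d x ![c, e, a, d]
  have w3 := fun b => sum_up_up (h := ginv u.g x) (fun r s => X x ![r, b, s])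
    fun d e => u.L x ![d, e]
  have w4 := fun a b c => sum_up (h := ginv u.g x) (fun r => X x ![r, b, c])
    fun d => u.L x ![a, d]
  simp only [w1, w2, w3, w4]
  ring

end Fields

end CEM
-- The wave operator on the derivative of the Faraday tensor
namespace CEM

theorem sum_up_mul_up {h : Fin 4 → Fin 4 → ℝ} (hs : ∀ a b, h a b = h b a) (F v : Fin 4 → ℝ)
    (D : Fin 4 → Fin 4 → ℝ) :
    ∑ d, ∑ e, (∑ r, h e r * F r) * D d e * (∑ r, h d r * v r)
      = ctr h fun p q => ctr h (fun r s => v r * D s p) * F q := by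
  rw [Finset.sum_comm]
  unfold ctr
  refine Finset.sum_congr rfl fun e _ => ?_
  have h1 : ∑ r, ∑ s, h r s * (v r * D s e) = ∑ d, D d e * ∑ r, h d r * v r := by
    rw [Finset.sum_comm]
    refine Finset.sum_congr rfl fun d _ => ?_
    rw [Finset.mul_sum]
    exact Finset.sum_congr rfl fun r _ => by rw [hs]; ring
  beta_reduce
  rw [h1]
  have h2 : ∀ X : ℝ, ∑ q, h e q * (X * F q) = (∑ r, h e r * F r) * X := fun X => by
    rw [Finset.sum_mul]; exact Finset.sum_congr rfl fun _ _ => by ring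
  rw [h2, Finset.mul_sum]
  exact Finset.sum_congr rfl fun _ _ => by ring

/-- In the gauge `R = 𝓡`, and `R = 6 tr L` by the form of the curvature; both hold on an open set,
so their gradients agree. -/
theorem scalarGrad_eq {U : Set Pt} (hU : IsOpen U) {u : Fields} {src : GaugeSource}
    (hg : InGauge U u.g src) {x : Pt} (hx : x ∈ U) (S : u.Setting U) (m : Fin 4) :
    pd m src.R x = 6 * pd m u.trL x := by
  rw [pd_congr hU (h := fun y => 6 * u.trL y) (fun y hy => by
    rw [← (hg y hy).1, S.scalarCurv_eq hy]) hx,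
    pd_const_mul _ (diffAt hU S.smooth_trL hx)]

namespace Fields.Setting

variable {u : Fields} {U : Set Pt} (S : u.Setting U)
include S

variable {x : Pt} (hx : x ∈ U)
include hx

theorem covD_Fd (e b c : Fin 4) : covD u.g u.Fd x ![e, b, c]
    = dctr (ginv u.g x) (fun p q => covD u.g u.F x ![e, p, q]) (fun p q => u.d x ![b, p, c, q])
      + dctr (ginv u.g x) (fun p q => u.F x ![p, q])
        (fun p q => covD u.g u.d x ![e, b, p, c, q]) := by
  have := covD_ctr_ctr_mul S.metric S.smooth_F S.smooth_d (n := 2)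
    (α := ![3, 1]) (β := ![4, 2, 5, 0]) (by decide) hx e ![b, c]
  have h0 : covD u.g u.Fd x ![e, b, c] = _ := Eq.trans (covD_congr S.isOpen (fun y hy i => by
    simp only [comp_cons, comp_empty]; rfl) hx _) this
  rw [h0]
  simp only [dctr]
  rw [← ctr_add]
  refine ctr_congr fun p q => ?_
  rw [← ctr_add]
  refine ctr_congr fun r s => ?_
  simp [comp_cons, comp_empty]

/-- Commuting the wave operator with a derivative. -/
theorem box_covD_F_raw (a b c : Fin 4) : box u.g (covD u.g u.F) x ![a, b, c]
    = covD u.g (box u.g u.F) x ![a, b, c]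
      - ctr (ginv u.g x) (fun r s => ctr (ginv u.g x) (fun p q =>
          covD u.g u.K x ![p, s, b, q, a]) * u.F x ![r, c])
      - ctr (ginv u.g x) (fun r s => ctr (ginv u.g x) (fun p q =>
          covD u.g u.K x ![p, s, c, q, a]) * u.F x ![b, r])
      - ctr (ginv u.g x) (fun p q => ctr (ginv u.g x) fun r s =>
          u.K x ![s, q, p, a] * covD u.g u.F x ![r, b, c])
      - 2 * ctr (ginv u.g x) (fun p q => ctr (ginv u.g x) fun r s =>
          u.K x ![s, b, p, a] * covD u.g u.F x ![q, r, c])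
      - 2 * ctr (ginv u.g x) (fun p q => ctr (ginv u.g x) fun r s =>
          u.K x ![s, c, p, a] * covD u.g u.F x ![q, b, r]) := by
  have H := S.metAlg hx
  have hρ : Function.Bijective (![1, 0, 2, 3] : Fin 4 → Fin 4) := by decide
  have hG := S.smooth_covD_F
  have hN := S.smooth_covD hG
  have hK := S.smooth_K
  have hF := S.smooth_F
  set C₁ : Tensor 4 := fun y j => ctr (ginv u.g y) fun p q =>
    u.K y (Matrix.vecCons p (Matrix.vecCons q j) ∘ ![1, 4, 2, 3])
      * u.F y (Matrix.vecCons p (Matrix.vecCons q j) ∘ ![0, 5]) with hC₁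
  set C₂ : Tensor 4 := fun y j => ctr (ginv u.g y) fun p q =>
    u.K y (Matrix.vecCons p (Matrix.vecCons q j) ∘ ![1, 5, 2, 3])
      * u.F y (Matrix.vecCons p (Matrix.vecCons q j) ∘ ![4, 0]) with hC₂
  have s1 : SmoothT U C₁ := fun i => smooth_ctr S.metric
    (f := fun y p q => u.K y (Matrix.vecCons p (Matrix.vecCons q i) ∘ ![1, 4, 2, 3])
      * u.F y (Matrix.vecCons p (Matrix.vecCons q i) ∘ ![0, 5])) fun p q => (hK _).mul (hF _)
  have s2 : SmoothT U C₂ := fun i => smooth_ctr S.metric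
    (f := fun y p q => u.K y (Matrix.vecCons p (Matrix.vecCons q i) ∘ ![1, 5, 2, 3])
      * u.F y (Matrix.vecCons p (Matrix.vecCons q i) ∘ ![4, 0])) fun p q => (hK _).mul (hF _)
  -- The two inner derivatives are interchanged first. This Ricci identity holds on the open set and
  -- is itself differentiated, which produces the `∇K` terms.
  have step : ∀ p q, covD u.g (covD u.g (covD u.g u.F)) x ![p, q, a, b, c]
      = covD u.g (covD u.g (covD u.g u.F)) x ![p, a, q, b, c]
        - covD u.g C₁ x ![p, q, a, b, c] - covD u.g C₂ x ![p, q, a, b, c] := by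
    intro p q
    rw [covD_congr (g := u.g) S.isOpen (T := covD u.g (covD u.g u.F)) (S := fun y j =>
      covD u.g (covD u.g u.F) y (j ∘ ![1, 0, 2, 3]) - C₁ y j - C₂ y j) (fun y hy i => by
        conv_lhs => rw [eq_quad i]
        have := S.comm₂ hy S.smooth_F (i 0) (i 1) (i 2) (i 3)
        simp only [hC₁, hC₂, comp_cons, comp_empty, Matrix.cons_val]
        linarith) hx,
      covD_sub S.isOpen (T := fun y j => covD u.g (covD u.g u.F) y (j ∘ ![1, 0, 2, 3]) - C₁ y j)
        (fun i => (hN _).sub (s1 _)) s2 hx,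
      covD_sub S.isOpen (smooth_reindex hN _) s1 hx, covD_reindex _ _ hρ]
    simp only [comp_cons, comp_empty, Matrix.cons_val]
  have d1 : ∀ p q, covD u.g C₁ x ![p, q, a, b, c] = ctr (ginv u.g x) (fun r s =>
      covD u.g u.K x ![p, s, b, q, a] * u.F x ![r, c])
      + ctr (ginv u.g x) (fun r s => u.K x ![s, b, q, a] * covD u.g u.F x ![p, r, c]) := by
    intro p q
    have := covD_ctr_mul S.metric hK hF (α := ![1, 4, 2, 3]) (β := ![0, 5]) (by decide) hx p
      ![q, a, b, c]
    rw [hC₁, this, ctr_add]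
    simp only [comp_cons, comp_empty, Matrix.cons_val]
  have d2 : ∀ p q, covD u.g C₂ x ![p, q, a, b, c] = ctr (ginv u.g x) (fun r s =>
      covD u.g u.K x ![p, s, c, q, a] * u.F x ![b, r])
      + ctr (ginv u.g x) (fun r s => u.K x ![s, c, q, a] * covD u.g u.F x ![p, b, r]) := by
    intro p q
    have := covD_ctr_mul S.metric hK hF (α := ![1, 5, 2, 3]) (β := ![4, 0]) (by decide) hx p
      ![q, a, b, c]
    rw [hC₂, this, ctr_add]
    simp only [comp_cons, comp_empty, Matrix.cons_val]
  -- Now the two outer derivatives are interchanged; here `K` acts on all three indices of `∇F`,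
  -- including its derivative index.
  have step2 : ∀ p q, covD u.g (covD u.g (covD u.g u.F)) x ![p, a, q, b, c]
      = covD u.g (covD u.g (covD u.g u.F)) x ![a, p, q, b, c]
        - ctr (ginv u.g x) (fun r s => u.K x ![s, q, p, a] * covD u.g u.F x ![r, b, c])
        - ctr (ginv u.g x) (fun r s => u.K x ![s, b, p, a] * covD u.g u.F x ![q, r, c])
        - ctr (ginv u.g x) (fun r s => u.K x ![s, c, p, a] * covD u.g u.F x ![q, b, r]) := by
    intro p q
    have := S.comm₃ hx hG p a q b c
    linarith
  have e1 : ∀ b (X : Fin 4 → Fin 4 → ℝ), ctr (ginv u.g x) (fun p q => ctr (ginv u.g x) fun r s =>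
        covD u.g u.K x ![p, s, b, q, a] * X r s)
      = ctr (ginv u.g x) (fun r s => ctr (ginv u.g x) (fun p q =>
          covD u.g u.K x ![p, s, b, q, a]) * X r s) := by
    intro b X
    rw [ctr_comm]
    exact ctr_congr fun r s => by rw [ctr_mul_right]
  rw [box_eq, covD_box S.metric hF hx, ctr_congr fun p q => (step p q)]
  simp only [d1, d2, step2, ctr_sub, ctr_add]
  rw [e1 b fun r _ => u.F x ![r, c], e1 c fun r _ => u.F x ![b, r],
    H.swap fun p q => ctr (ginv u.g x) fun r s => u.K x ![s, b, q, a] * covD u.g u.F x ![p, r, c],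
    H.swap fun p q => ctr (ginv u.g x) fun r s => u.K x ![s, c, q, a] * covD u.g u.F x ![p, b, r]]
  ring

theorem ctr_covD_F (c : Fin 4) :
    ctr (ginv u.g x) (fun p q => covD u.g u.F x ![p, q, c]) = u.M₁ x ![c] :=
  (S.M₁_eq hx ![c]).symm

/-- The result is arranged as the right-hand side of the equation for `F_{abc}` with `∇F` for
`F_{abc}` and the divergence of `d` for the Cotton tensor. The deviation consists only of terms in
`M₁`, from traces of `∇F`, and in `M₃`, from antisymmetrised `∇F` contracted with `L`. -/
theorem box_covD_F {src : GaugeSource} (hg : InGauge U u.g src)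
    (hF : ∀ y ∈ U, ∀ b c, box u.g u.F y ![b, c]
      = 2 * u.trL y * u.F y ![b, c] - 2 * u.Xi y * u.Fd y ![b, c]) (a b c : Fin 4) :
    box u.g (covD u.g u.F) x ![a, b, c]
      = 4 * u.Xi x * alt₂ b c (fun b c => ∑ d, up u.g 1 u.F x ![b, d] * u.divd x ![a, c, d])
        + u.auxH x (covD u.g u.F) a b c + 3 * u.trL x * covD u.g u.F x ![a, b, c]
        + u.restH src x a b c + 4 * alt₂ b c (fun b c => u.M₁ x ![b] * u.L x ![c, a])
        - 6 * ∑ d, up u.g 1 u.L x ![a, d] * u.M₃ x ![b, c, d] := by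
  have H := S.metAlg hx
  have D := S.weylAlg hx
  have ls := S.sym.L_symm x hx
  have fa := S.sym.F_antisymm x hx
  have ga := S.covD_F_antisymm hx
  have raw := S.box_covD_F_raw hx a b c
  -- The equation `hF` for `F` is inserted before the outer derivative is taken.
  have hbox : covD u.g (box u.g u.F) x ![a, b, c]
      = 2 * pd a u.trL x * u.F x ![b, c] + 2 * u.trL x * covD u.g u.F x ![a, b, c]
        - 2 * pd a u.Xi x * u.Fd x ![b, c] - 2 * u.Xi x * covD u.g u.Fd x ![a, b, c] := by
    have sT : ContDiffOn ℝ ∞ (fun y => 2 * u.trL y) U := contDiffOn_const.mul S.smooth_trL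
    have sX : ContDiffOn ℝ ∞ (fun y => 2 * u.Xi y) U := contDiffOn_const.mul S.smooth_Xi
    rw [covD_congr (g := u.g) S.isOpen (S := fun y j => 2 * u.trL y * u.F y j
        - 2 * u.Xi y * u.Fd y j) (fun y hy i => by
          rw [eq_pair i]; exact hF y hy _ _) hx,
      covD_sub S.isOpen (fun i => sT.mul (S.smooth_F i)) (fun i => sX.mul (S.smooth_Fd i)) hx,
      covD_smul S.isOpen sT S.smooth_F hx, covD_smul S.isOpen sX S.smooth_Fd hx,
      pd_const_mul _ (diffAt S.isOpen S.smooth_trL hx),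
      pd_const_mul _ (diffAt S.isOpen S.smooth_Xi hx)]
    ring
  rw [hbox, S.covD_Fd hx] at raw
  have eR : ∀ m, grad src.R x ![m] = 6 * pd m u.trL x := fun m => by
    simp only [grad, Matrix.cons_val]
    exact scalarGrad_eq S.isOpen hg hx S m
  set h := ginv u.g x with hh
  set G := covD u.g u.F with hG
  -- the divergence of the curvature
  set V : Fin 4 → ℝ := fun c => ctr h fun r s => pd s u.trL x * u.F x ![r, c] with hV
  -- `div_K_eq` replaces the divergence of the curvature by `∇Ξ` contracted with `d`, the divergence
  -- of `d`, and the gradient of `tr L`.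
  have q1 : ∀ b c, ctr h (fun r s => ctr h (fun p q => covD u.g u.K x ![p, s, b, q, a])
      * u.F x ![r, c]) = 2 * ctr h (fun r s => u.gradd x a s b * u.F x ![r, c])
        + 2 * u.Xi x * ctr h (fun r s => u.divd x ![a, s, b] * u.F x ![r, c])
        + u.g x ![a, b] * V c - pd b u.trL x * u.F x ![a, c] := by
    intro b c
    rw [ctr_congr fun r s => show ctr h (fun p q => covD u.g u.K x ![p, s, b, q, a])
      * u.F x ![r, c] = 2 * (u.gradd x a s b * u.F x ![r, c])
        + 2 * u.Xi x * (u.divd x ![a, s, b] * u.F x ![r, c])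
        + u.g x ![a, b] * (pd s u.trL x * u.F x ![r, c])
        - u.g x ![a, s] * (pd b u.trL x * u.F x ![r, c]) by rw [S.div_K_eq hx]; ring]
    simp only [ctr_add, ctr_sub, ctr_mul_left]
    rw [H.ctr_g_right a fun r => pd b u.trL x * u.F x ![r, c]]
  have q2 : ctr h (fun r s => ctr h (fun p q => covD u.g u.K x ![p, s, c, q, a])
      * u.F x ![b, r]) = -ctr h (fun r s => ctr h (fun p q => covD u.g u.K x ![p, s, c, q, a])
      * u.F x ![r, b]) := by
    rw [← ctr_neg]; exact ctr_congr fun r s => by rw [fa]; ring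
  rw [q2, q1, q1] at raw
  -- the curvature terms
  have k0 := ctr_ctr_curvAlg_div (Ξ := u.Xi x) H D ls a fun r => G x ![r, b, c]
  have k1 := ctr_ctr_curvAlg (Ξ := u.Xi x) (d := fun a b c e => u.d x ![a, b, c, e])
    (L := fun a b => u.L x ![a, b]) H b a fun q r => G x ![q, r, c]
  have k2 := ctr_ctr_curvAlg (Ξ := u.Xi x) (d := fun a b c e => u.d x ![a, b, c, e])
    (L := fun a b => u.L x ![a, b]) H c a fun q r => G x ![q, r, b]
  rw [S.ctr_covD_F hx] at k1 k2
  have q3 : ctr h (fun p q => ctr h fun r s => u.K x ![s, c, p, a] * G x ![q, b, r])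
      = -ctr h (fun p q => ctr h fun r s => u.K x ![s, c, p, a] * G x ![q, r, b]) := by
    rw [← ctr_neg]
    refine ctr_congr fun p q => ?_
    rw [← ctr_neg]; exact ctr_congr fun r s => by rw [ga q b r]; ring
  have q4 : ctr h (fun p q => ctr h fun r s => u.K x ![s, q, p, a] * G x ![r, b, c]) = _ := k0
  have q5 : ctr h (fun p q => ctr h fun r s => u.K x ![s, b, p, a] * G x ![q, r, c]) = _ := k1
  have q6 : ctr h (fun p q => ctr h fun r s => u.K x ![s, c, p, a] * G x ![q, r, b]) = _ := k2
  rw [q3, q4, q5, q6] at raw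
  have tl : ctr h (fun a b => u.L x ![a, b]) = u.trL x := rfl
  rw [tl] at raw
  -- the same terms on the right
  have p1 : ∀ b c, ctr h (fun p q => ctr h fun r s => u.d x ![s, b, p, a] * G x ![q, r, c])
      = -dctr h (fun p q => G x ![p, c, q]) (fun p q => u.d x ![b, q, a, p]) := by
    intro b c
    rw [← dctr_neg]
    refine ctr_congr fun p q => ?_
    rw [H.swap]
    refine ctr_congr fun r s => ?_
    rw [D.anti₁, D.anti₂, ga]; ring
  have p2 : ∀ c, ctr h (fun p q => ctr h fun r s => u.L x ![p, s] * G x ![q, r, c])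
      = -dctr h (fun p q => G x ![p, c, q]) (fun p q => u.L x ![p, q]) := by
    intro c
    rw [← dctr_neg]
    refine ctr_congr fun p q => ?_
    rw [H.swap]
    refine ctr_congr fun r s => ?_
    rw [ga]; ring
  have p3 : ∀ b c, ctr h (fun p q => u.L x ![p, b] * G x ![q, a, c])
      = ctr h (fun p q => G x ![q, a, c] * u.L x ![b, p]) := by
    intro b c
    exact ctr_congr fun p q => by rw [ls]; ring
  set m : Fin 4 → Fin 4 → ℝ := fun b c =>
    ctr h fun r s => u.L x ![a, s] * G x ![b, r, c] with hm
  set n := ctr h fun r s => u.L x ![a, s] * G x ![r, b, c] with hn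
  have p5 : ctr h (fun p q => G x ![q, b, c] * u.L x ![a, p]) = n := by
    rw [H.swap]; exact ctr_congr fun p q => mul_comm _ _
  -- The three contractions of `L` with `∇F` that belong to different index positions are tied
  -- together by the definition of `M₃`.
  have p6 : ∑ d, up u.g 1 u.L x ![a, d] * u.M₃ x ![b, c, d]
      = 1 / 3 * (n + -m b c + m c b) := by
    simp only [up, upd₂₁, Matrix.cons_val]
    rw [sum_up, ← hh, hm, hn, ← ctr_neg, ← ctr_add, ← ctr_add, ← ctr_mul_left]
    refine ctr_congr fun p q => ?_
    have : u.M₃ x ![b, c, p] = 1 / 3 * (G x ![b, c, p] + G x ![c, p, b] + G x ![p, b, c]) :=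
      S.M₃_eq hx _
    rw [this, ga b p c]
    ring
  have p7 : alt₂ b c (fun b c => ∑ d, up u.g 1 u.F x ![b, d] * u.divd x ![a, c, d])
      = (1 / 2) * (-ctr h (fun r s => u.divd x ![a, s, b] * u.F x ![r, c])
        + ctr h (fun r s => u.divd x ![a, s, c] * u.F x ![r, b])) := by
    have dv : ∀ a b c, u.divd x ![a, b, c] = -u.divd x ![a, c, b] := fun a b c => by
      simp only [Fields.divd, Matrix.cons_val]
      rw [← ctr_neg]; exact ctr_congr fun p q => (S.covD_weyl hx p).anti₂ _ _ _ _
    have : ∀ b c, ∑ d, up u.g 1 u.F x ![b, d] * u.divd x ![a, c, d]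
        = ctr h (fun r s => u.divd x ![a, s, c] * u.F x ![r, b]) := by
      intro b c
      simp only [up, upd₂₁, Matrix.cons_val]
      rw [sum_up, ← hh, H.swap]
      exact ctr_congr fun p q => by rw [dv, fa]; ring
    simp only [alt₂, this]; ring
  -- the remaining terms
  have r1 : ∀ c, ∑ d, u.F x ![c, d] * up u.g 0 (grad src.R) x ![d] = -6 * V c := by
    intro c
    simp only [up, upd₁, Matrix.cons_val, eR]
    rw [sum_up', ← hh, hV, ← ctr_mul_left]
    exact ctr_congr fun p q => by rw [fa]; ring
  have gX : ∀ r, grad u.Xi x ![r] = pd r u.Xi x := fun r => rfl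
  have gU : ∀ a, u.gradUp x a = ∑ r, h a r * pd r u.Xi x := fun a => by
    simp only [Fields.gradUp, up, upd₁, Matrix.cons_val, gX]
    rfl
  have r2 : ∀ b c, ∑ d, ∑ e, u.Fup x ![d, e] * u.d x ![b, d, e, c] = -u.Fd x ![b, c] := by
    intro b c
    simp only [Fields.Fup, up, upd₂₀, upd₂₁, Matrix.cons_val]
    rw [sum_up_up, ← hh, Fields.Fd, ← hh, ← dctr_neg]
    exact dctr_congr fun p q => D.anti₂ _ _ _ _
  have r3 : ∀ b c, ∑ d, ∑ e, up u.g 1 u.F x ![b, e] * u.d x ![c, d, a, e] * u.gradUp x d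
      = ctr h (fun p q => u.gradd x c a p * u.F x ![q, b]) := by
    intro b c
    simp only [gU, up, upd₂₁, Matrix.cons_val, Fields.gradd]
    rw [← hh, sum_up_mul_up H.hs (fun r => u.F x ![b, r]) (fun r => pd r u.Xi x)
      fun d e => u.d x ![c, d, a, e]]
    refine ctr_congr fun p q => ?_
    rw [fa b q, mul_neg, ← neg_mul, ← ctr_neg]
    congr 1
    exact ctr_congr fun r s => by rw [D.anti₁]; ring
  have r4 : ∑ d, ∑ e, up u.g 1 u.F x ![a, e] * u.d x ![b, c, d, e] * u.gradUp x d
      = -ctr h (fun p q => u.gradd x p b c * u.F x ![q, a]) := by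
    simp only [gU, up, upd₂₁, Matrix.cons_val, Fields.gradd]
    rw [← hh, sum_up_mul_up H.hs (fun r => u.F x ![a, r]) (fun r => pd r u.Xi x)
      fun d e => u.d x ![b, c, d, e], ← ctr_neg]
    refine ctr_congr fun p q => ?_
    rw [fa a q, mul_neg]
    congr 2
    exact ctr_congr fun r s => by rw [D.pair]
  have r5 : ∑ d, ∑ e, u.Fup x ![d, e] * covD u.g u.d x ![a, b, c, d, e]
      = 2 * dctr h (fun p q => u.F x ![p, q]) (fun p q => covD u.g u.d x ![a, b, p, c, q]) := by
    simp only [Fields.Fup, up, upd₂₀, upd₂₁, Matrix.cons_val]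
    rw [sum_up_up, ← hh]
    have D' := S.covD_weyl hx a
    have h1 := dctr_swap_of_antisymm (h := h) fa fun y z => covD u.g u.d x ![a, b, y, c, z]
    have h2 : dctr h (fun p q => u.F x ![p, q]) (fun y z => covD u.g u.d x ![a, b, c, y, z])
        = dctr h (fun p q => u.F x ![p, q])
          (fun y z => covD u.g u.d x ![a, b, y, c, z] - covD u.g u.d x ![a, b, z, c, y]) :=
      dctr_congr fun y z => by linarith [D'.cyc b c y z, D'.anti₂ b y c z]
    rw [h2, dctr_sub, h1]; ring
  -- The `∇Ξ` terms found here and those of the displayed equation look different; twice this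
  -- identity is their difference.
  have gt := gradient_terms H D (S.kulkarni_eq_zero hx) (v := fun p => pd p u.Xi x)
    (W := fun a b c => u.gradd x a b c) (fun a b c => rfl) fa
    (E := fun b c => u.Fd x ![b, c]) (fun b c => rfl) a b c
  have Wa : ∀ a b c, u.gradd x a b c = -u.gradd x a c b := fun a b c => by
    simp only [Fields.gradd]; rw [← ctr_neg]; exact ctr_congr fun p q => by rw [D.anti₂]; ring
  have w1 : ∀ b c, ctr h (fun p q => u.gradd x a b p * u.F x ![q, c])
      = -ctr h (fun r s => u.gradd x a s b * u.F x ![r, c]) := by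
    intro b c
    rw [H.swap, ← ctr_neg]
    exact ctr_congr fun r s => by rw [Wa]; ring
  rw [Fields.auxH_eq, p6, p7]
  simp only [Fields.restH, alt₂, r1, r2, r3, r4, r5, eR, gX, ← hh]
  rw [p1, p1, p2, p2, p3, p3] at raw
  rw [w1, w1] at gt
  rw [p5, ls c a, ls b a, H.gs c a, H.gs b a]
  rw [H.gs c a, H.gs b a] at raw
  linear_combination raw - 2 * gt

end Fields.Setting

end CEM
-- The reduced operator in the gauge, and the wave equation for `Q`
namespace CEM

theorem dctr_sub_left {h : Fin 4 → Fin 4 → ℝ} (F F' f : Fin 4 → Fin 4 → ℝ) :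
    dctr h (fun a e => F a e - F' a e) f = dctr h F f - dctr h F' f := by
  simp only [dctr, sub_mul, ctr_sub]

theorem box_sub {U : Set Pt} {g : Tensor 2} (hg : IsMetricOn U g) {k : ℕ} {T S : Tensor k}
    (hT : SmoothT U T) (hS : SmoothT U S) {x : Pt} (hx : x ∈ U) (i : Fin k → Fin 4) :
    box g (fun y j => T y j - S y j) x i = box g T x i - box g S x i := by
  rw [box_eq, box_eq, box_eq, ← ctr_sub]
  refine ctr_congr fun p q => ?_
  rw [← covD_sub hg.isOpen (smooth_covD hg hT) (smooth_covD hg hS) hx]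
  exact covD_congr hg.isOpen (fun y hy j => covD_sub hg.isOpen hT hS hy j) hx _

theorem covDVec_congr {U : Set Pt} (hU : IsOpen U) {g : Tensor 2} {V W : Pt → Fin 4 → ℝ}
    (h : ∀ y ∈ U, ∀ a, V y a = W y a) {x : Pt} (hx : x ∈ U) (b a : Fin 4) :
    covDVec g V x b a = covDVec g W x b a := by
  unfold covDVec
  rw [pd_congr hU (fun y hy => h y hy a) hx]
  simp only [h x hx]

theorem covDVec_zero (g : Tensor 2) (x : Pt) (b a : Fin 4) :
    covDVec g (fun _ _ => 0) x b a = 0 := by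
  simp [covDVec, pd_const]

theorem Fields.auxH_Q₃ (u : Fields) (x : Pt) (a b c : Fin 4) : u.auxH x u.Q₃ a b c
    = u.auxH x u.H a b c - u.auxH x (covD u.g u.F) a b c := by
  rw [Fields.auxH_eq, Fields.auxH_eq, Fields.auxH_eq]
  simp only [Fields.Q₃, sub_mul, dctr_sub_left, ctr_sub]
  ring

namespace Fields.Setting

variable {u : Fields} {U : Set Pt} (S : u.Setting U)
include S

variable {src : GaugeSource} (hg : InGauge U u.g src)
include hg

variable {x : Pt} (hx : x ∈ U)
include hx

theorem src_R_eq : src.R x = 6 * u.trL x := by rw [← (hg x hx).1, S.scalarCurv_eq hx]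

/-- In the gauge `𝓕 - Γ` vanishes on an open set, hence so does its derivative, and the Ricci tensor
is `2 L + (𝓡/6) g`. Consequently `■` is `□`. -/
theorem bbCoef_eq_zero (t l : Fin 4) : bbCoef u.g u.L src x t l = 0 := by
  unfold bbCoef
  have : ∀ a, covDVec u.g (fun y b => src.F y b - Gam u.g y b) x l a = 0 := fun a => by
    rw [covDVec_congr S.isOpen (W := fun _ _ => 0) (fun y hy a => by
      rw [(hg y hy).2]; ring) hx, covDVec_zero]
  simp only [this, mul_zero, Finset.sum_const_zero]
  rw [S.ricci_eq hx, S.src_R_eq hg hx]; ring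

theorem blackBox_eq {k : ℕ} (T : Tensor k) (i : Fin k → Fin 4) :
    blackBox u.g u.L src T x i = box u.g T x i := by
  simp [blackBox, S.bbCoef_eq_zero hg hx]

theorem rhs_F_eq (b c : Fin 4) : u.rhs_F src x b c
    = 2 * u.trL x * u.F x ![b, c] - 2 * u.Xi x * u.Fd x ![b, c] := by
  unfold Fields.rhs_F
  have : ∑ a, ∑ d, u.Fup x ![a, d] * u.d x ![b, a, c, d] = u.Fd x ![b, c] := by
    simp only [Fields.Fup, up, upd₂₀, upd₂₁, Matrix.cons_val]
    rw [sum_up_up]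
    rfl
  rw [this, S.src_R_eq hg hx]; ring

omit hx hg

include hx

theorem Lambda_eq (a b c : Fin 4) :
    u.Lambda x ![a, b, c] = u.cotton x ![b, c, a] - u.divd x ![a, b, c] := by
  unfold Fields.Lambda Fields.divd
  rw [(S.metAlg hx).swap]
  simp only [up, update_cons_zero', Matrix.cons_val, ctr]

include hg

/-- The difference of the reduced equation for `F_{abc}` and `box_covD_F`. The part `restH` is
common and cancels, `auxH` is linear, and the Cotton tensor minus the divergence of `d` is `Λ`. -/
theorem waveQ₃ (hF : ∀ y ∈ U, ∀ b c, box u.g u.F y ![b, c]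
      = 2 * u.trL y * u.F y ![b, c] - 2 * u.Xi y * u.Fd y ![b, c])
    (hH : ∀ a b c, box u.g u.H x ![a, b, c] = u.rhs_H src x a b c) : u.WaveQ₃ x := by
  intro a b c
  have h1 : box u.g u.Q₃ x ![a, b, c] = _ :=
    box_sub S.metric S.smooth_H S.smooth_covD_F hx ![a, b, c]
  have h2 := u.auxH_Q₃ x a b c
  have h3 : u.Q₃ x ![a, b, c] = u.H x ![a, b, c] - covD u.g u.F x ![a, b, c] := rfl
  have h4 : ∀ b c, ∑ d, up u.g 1 u.F x ![b, d] * u.Lambda x ![a, c, d]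
      = ∑ d, up u.g 1 u.F x ![b, d] * u.cotton x ![c, d, a]
        - ∑ d, up u.g 1 u.F x ![b, d] * u.divd x ![a, c, d] := fun b c => by
    rw [← Finset.sum_sub_distrib]
    exact Finset.sum_congr rfl fun d _ => by rw [S.Lambda_eq hx]; ring
  rw [h1, hH, rhs_H_eq, S.box_covD_F hx hg hF, S.src_R_eq hg hx, S.scalarCurv_eq hx, h3]
  simp only [Fields.auxH, alt₂] at h2
  simp only [Fields.auxH, alt₂, h4]
  linear_combination -h2

end Fields.Setting

/-- The wave equations for the matter zero-quantities. -/
theorem wave_zeroQuantities {U : Set Pt} {u : Fields} {src : GaugeSource} (hU : IsOpen U)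
    (reg : u.RegularOn U) (sym : u.SymmetricOn U) (hg : InGauge U u.g src)
    (pzq : ∀ x ∈ U, ∀ i, u.Pzq x i = 0)
    (eqF : ∀ x ∈ U, ∀ i, u.ReducedEq src (Slot.F i) x)
    (eqH : ∀ x ∈ U, ∀ i, u.ReducedEq src (Slot.H i) x) {x : Pt} (hx : x ∈ U) :
    u.WaveM₁ x ∧ u.WaveM₃ x ∧ u.WaveQ₃ x := by
  have S : u.Setting U := ⟨hU, reg, sym, pzq⟩
  have hF : ∀ y ∈ U, ∀ b c, box u.g u.F y ![b, c]
      = 2 * u.trL y * u.F y ![b, c] - 2 * u.Xi y * u.Fd y ![b, c] := fun y hy b c => by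
    rw [← S.rhs_F_eq hg hy, ← S.blackBox_eq hg hy]
    exact eqF y hy ![b, c]
  have hW : ∀ y ∈ U, ∀ b c, 3 * ctr (ginv u.g y) (fun p q => covD u.g u.M₃ y ![p, q, b, c])
      + covD u.g u.M₁ y ![b, c] - covD u.g u.M₁ y ![c, b] = 0 := fun y hy b c => by
    have h1 := S.box_F hy b c
    rw [hF y hy] at h1
    linarith
  refine ⟨S.waveM₁ hx hW, S.waveM₃ hx hW, S.waveQ₃ hg hx hF fun a b c => ?_⟩
  rw [← S.blackBox_eq hg hx]
  exact eqH x hx ![a, b, c]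

end CEM
namespace CEM

/-! ### Contraction of two volume forms -/

section DoubleDual

variable {h g : Fin 4 → Fin 4 → ℝ}

/-- Laplace expansion into 2×2 minors with the columns `c, k` separated from `p, q`, because the
latter pair is contracted with an antisymmetric object. -/
theorem det_laplace (g : Fin 4 → Fin 4 → ℝ) (a b e f c k p q : Fin 4) :
    (Matrix.of fun m n => g (![a, b, e, f] m) (![c, k, p, q] n)).det
      = (g e c * g f k - g e k * g f c) * (g a p * g b q - g a q * g b p)
        - (g b c * g f k - g b k * g f c) * (g a p * g e q - g a q * g e p)
        + (g b c * g e k - g b k * g e c) * (g a p * g f q - g a q * g f p)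
        + (g a c * g f k - g a k * g f c) * (g b p * g e q - g b q * g e p)
        - (g a c * g e k - g a k * g e c) * (g b p * g f q - g b q * g f p)
        + (g a c * g b k - g a k * g b c) * (g e p * g f q - g e q * g f p) := by
  simp [Matrix.det_succ_row_zero, Fin.sum_univ_succ, Fin.succAbove]
  ring

theorem dctr_alt (H : MetAlg h g) {Y : Fin 4 → Fin 4 → ℝ} (hY : ∀ p q, Y p q = -Y q p)
    (m n : Fin 4) : dctr h (fun p q => g m p * g n q - g m q * g n p) Y = 2 * Y m n := by
  have key : ∀ m n, dctr h (fun p q => g m p * g n q) Y = Y m n := fun m n => by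
    have : ∀ a a', ctr h (fun e e' => g m a' * g n e' * Y a e) = g m a' * Y a n := fun a a' => by
      rw [← H.ctr_g_right n (fun e => Y a e), ← ctr_mul_left]
      exact ctr_congr fun _ _ => by ring
    unfold dctr
    rw [ctr_congr this]
    exact H.ctr_g_right m fun a => Y a n
  have h1 : dctr h (fun p q => g m p * g n q - g m q * g n p) Y
      = dctr h (fun p q => g m p * g n q) Y - dctr h (fun p q => g n p * g m q) Y := by
    rw [← dctr_sub_left]
    simp only [mul_comm]
  rw [h1, key, key, hY n m]; ring

/-- The contraction of two volume forms with `X_{fpqe}`. -/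
theorem double_dual (H : MetAlg h g) {V : (Fin 4 → Fin 4) → ℝ}
    (hV : ∀ i j, V i * V j = -(Matrix.of fun m n => g (i m) (j n)).det)
    {X : Fin 4 → Fin 4 → Fin 4 → Fin 4 → ℝ} (hX : ∀ f p q e, X f p q e = -X f q p e)
    (tr : ∀ f q, ctr h (fun p e => X f p q e) = 0) (a b c k : Fin 4) :
    ctr h (fun e e' => ctr h fun f f' => V ![a, b, e, f]
        * ((1 / 2) * dctr h (fun p q => V ![c, k, p, q]) fun p q => X f' p q e'))
      = X c a b k - X k a b c
        + g a c * ctr h (fun e e' => X e b e' k) - g a k * ctr h (fun e e' => X e b e' c)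
        + g b c * ctr h (fun e e' => X e e' a k) - g b k * ctr h (fun e e' => X e e' a c) := by
  have step : ∀ e e' f f', V ![a, b, e, f]
        * ((1 / 2) * dctr h (fun p q => V ![c, k, p, q]) fun p q => X f' p q e')
      = -((g e c * g f k - g e k * g f c) * X f' a b e'
        - (g b c * g f k - g b k * g f c) * X f' a e e'
        + (g b c * g e k - g b k * g e c) * X f' a f e'
        + (g a c * g f k - g a k * g f c) * X f' b e e'
        - (g a c * g e k - g a k * g e c) * X f' b f e'
        + (g a c * g b k - g a k * g b c) * X f' e f e') := by
    intro e e' f f'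
    have Y : ∀ p q, X f' p q e' = -X f' q p e' := fun p q => hX _ _ _ _
    have k1 := dctr_alt H Y
    have : V ![a, b, e, f] * dctr h (fun p q => V ![c, k, p, q]) (fun p q => X f' p q e')
        = -(dctr h (fun p q => (g e c * g f k - g e k * g f c) * (g a p * g b q - g a q * g b p)
        - (g b c * g f k - g b k * g f c) * (g a p * g e q - g a q * g e p)
        + (g b c * g e k - g b k * g e c) * (g a p * g f q - g a q * g f p)
        + (g a c * g f k - g a k * g f c) * (g b p * g e q - g b q * g e p)
        - (g a c * g e k - g a k * g e c) * (g b p * g f q - g b q * g f p)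
        + (g a c * g b k - g a k * g b c) * (g e p * g f q - g e q * g f p))
          fun p q => X f' p q e') := by
      rw [← dctr_neg_left]
      unfold dctr
      rw [← ctr_mul_left]
      refine ctr_congr fun p p' => ?_
      rw [← ctr_mul_left]
      refine ctr_congr fun q q' => ?_
      rw [← mul_assoc, hV, det_laplace]
    have lin : ∀ (c : ℝ) (F f : Fin 4 → Fin 4 → ℝ), dctr h (fun p q => c * F p q) f
        = c * dctr h F f := fun c F f => by
      simp only [dctr, mul_assoc, ctr_mul_left]
    have add : ∀ (F F' f : Fin 4 → Fin 4 → ℝ), dctr h (fun p q => F p q + F' p q) f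
        = dctr h F f + dctr h F' f := fun F F' f => by
      simp only [dctr, add_mul, ctr_add]
    simp only [dctr_sub_left, lin, add] at this
    have k2 : ∀ m n, dctr h (fun p q => g m p * g n q) (fun p q => X f' p q e')
        - dctr h (fun p q => g m q * g n p) (fun p q => X f' p q e') = 2 * X f' m n e' := by
      intro m n; rw [← dctr_sub_left, k1]
    simp only [← dctr_sub_left] at this
    rw [k1, k1, k1, k1, k1, k1] at this
    linear_combination (1 / 2) * this
  have tr' : ∀ f q, ctr h (fun p e => X f q p e) = 0 := fun f q => by
    rw [← neg_eq_zero, ← ctr_neg, ← tr f q]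
    exact ctr_congr fun p e => by rw [hX]; ring
  have g2 : ∀ (m n : Fin 4) (Z : Fin 4 → Fin 4 → ℝ),
      ctr h (fun e e' => ctr h fun f f' => g e m * g f n * Z f' e') = Z n m := by
    intro m n Z
    have : ∀ e e', ctr h (fun f f' => g e m * g f n * Z f' e') = g e m * Z n e' := fun e e' => by
      rw [← H.ctr_g_left' n (fun f => Z f e'), ← ctr_mul_left]
      exact ctr_congr fun _ _ => by ring
    rw [ctr_congr this]
    exact H.ctr_g_left' m fun a => Z n a
  have t1 := g2 c k fun f' e' => X f' a b e'
  have t2 := g2 k c fun f' e' => X f' a b e'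
  have t3 : ∀ a m, ctr h (fun e e' => ctr h fun f f' => g f m * X f' a e e') = 0 := by
    intro a m
    rw [ctr_comm, ← ctr_zero (h := h)]
    refine ctr_congr fun f f' => ?_
    rw [ctr_mul_left, tr', mul_zero]
  have t4 : ∀ a m, ctr h (fun e e' => g e m * ctr h fun f f' => X f' a f e')
      = ctr h (fun e e' => X e a e' m) := fun a m => by
    rw [H.ctr_g_left' m fun e' => ctr h fun f f' => X f' a f e', H.swap]
  have t5 : ctr h (fun e e' => ctr h fun f f' => X f' e f e') = 0 := by
    rw [ctr_comm, ← ctr_zero (h := h)]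
    exact ctr_congr fun f f' => tr f' f
  have t6 : ∀ m, ctr h (fun e e' => X e e' a m) = -ctr h (fun e e' => X e a e' m) := fun m => by
    rw [← ctr_neg]; exact ctr_congr fun p e => hX _ _ _ _
  rw [ctr_congr fun e e' => ctr_congr fun f f' => (step e e' f f').trans (show _
      = -(g e c * g f k * X f' a b e' - g e k * g f c * X f' a b e'
        - (g b c * (g f k * X f' a e e') - g b k * (g f c * X f' a e e'))
        + (g b c * (g e k * X f' a f e') - g b k * (g e c * X f' a f e'))
        + (g a c * (g f k * X f' b e e') - g a k * (g f c * X f' b e e'))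
        - (g a c * (g e k * X f' b f e') - g a k * (g e c * X f' b f e'))
        + (g a c * g b k - g a k * g b c) * X f' e f e') by ring)]
  simp only [ctr_neg, ctr_add, ctr_sub, ctr_mul_left, t3, t4, t5]
  rw [t6, t6, t1, t2]
  ring

end DoubleDual

/-! ### The volume form is parallel -/

section VolumeForm

variable {U : Set Pt} {g : Tensor 2} (hg : IsMetricOn U g)

theorem covD_sum {U : Set Pt} (hU : IsOpen U) {g : Tensor 2} {k : ℕ} {ι : Type*} (s : Finset ι)
    {T : ι → Tensor k} (hT : ∀ σ, SmoothT U (T σ)) {x : Pt} (hx : x ∈ U)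
    (i : Fin (k + 1) → Fin 4) :
    covD g (fun y j => ∑ σ ∈ s, T σ y j) x i = ∑ σ ∈ s, covD g (T σ) x i := by
  classical
  induction s using Finset.induction_on with
  | empty => simpa using covD_zero g x i
  | insert σ s hs ih =>
    simp only [Finset.sum_insert hs]
    rw [covD_add hU (hT σ) (fun j => ContDiffOn.sum fun τ _ => hT τ j) hx, ih]

/-- The Gram matrix is `A g Bᵀ` with selection matrices `A, B`. The sign comes from `|det g| = -det
g` in Lorentzian signature. -/
theorem vol_mul_vol {x : Pt} (hdet : (mat g x).det < 0) (i j : Fin 4 → Fin 4) :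
    vol g x i * vol g x j = -(Matrix.of fun m n => g x ![i m, j n]).det := by
  have h1 : (Matrix.of fun m n => g x ![i m, j n])
      = (1 : Matrix (Fin 4) (Fin 4) ℝ).submatrix i id * mat g x
        * ((1 : Matrix (Fin 4) (Fin 4) ℝ).submatrix j id).transpose := by
    ext m n
    simp [Matrix.mul_apply, mat, Matrix.one_apply]
  rw [h1, Matrix.det_mul, Matrix.det_mul, Matrix.det_transpose]
  have h2 : Real.sqrt |(mat g x).det| * Real.sqrt |(mat g x).det| = -(mat g x).det := by
    rw [Real.mul_self_sqrt (abs_nonneg _), abs_of_neg hdet]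
  unfold vol
  linear_combination ((1 : Matrix (Fin 4) (Fin 4) ℝ).submatrix i id).det
    * ((1 : Matrix (Fin 4) (Fin 4) ℝ).submatrix j id).det * h2

include hg

theorem smooth_vol : SmoothT U (vol g) := fun i => by
  unfold vol
  have h1 : ContDiffOn ℝ ∞ (fun x => (mat g x).det) U := smooth_det fun a b => hg.smooth ![a, b]
  have h2 : ContDiffOn ℝ ∞ (fun x => Real.sqrt (-(mat g x).det)) U :=
    h1.neg.sqrt fun x hx => (neg_pos.2 (hg.det_neg x hx)).ne'
  exact (h2.congr fun x hx => by rw [abs_of_neg (hg.det_neg x hx)]).mul contDiffOn_const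

/-- A product of four metric coefficients. -/
theorem covD_metric_prod {ρ : Fin 8 → Fin 8} (hρ : Function.Bijective ρ) {x : Pt} (hx : x ∈ U)
    (e : Fin 4) (i : Fin 8 → Fin 4) :
    covD g (fun y j => ∏ m : Fin 4, g y ![j (ρ (Fin.castAdd 4 m)), j (ρ (Fin.natAdd 4 m))]) x
      (Matrix.vecCons e i) = 0 := by
  -- Four factors are built as a product of products, so that the two-factor product rule suffices.
  -- The index lists pair slot `m` with slot `m + 4`.
  set A : Tensor 4 := fun y j => g y (j ∘ ![0, 2]) * g y (j ∘ ![1, 3]) with hA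
  set B : Tensor 8 := fun y j => A y (j ∘ ![0, 1, 4, 5]) * A y (j ∘ ![2, 3, 6, 7]) with hB
  have sA : SmoothT U A := fun _ => (hg.smooth _).mul (hg.smooth _)
  have cA : ∀ e i, covD g A x (Matrix.vecCons e i) = 0 := fun e i => by
    rw [hA, covD_mul hg.isOpen hg.smooth hg.smooth (α := ![0, 2]) (β := ![1, 3]) (by decide) hx,
      covD_metric hg hx, covD_metric hg hx]; ring
  have cB : ∀ e i, covD g B x (Matrix.vecCons e i) = 0 := fun e i => by
    rw [hB, covD_mul hg.isOpen sA sA (α := ![0, 1, 4, 5]) (β := ![2, 3, 6, 7]) (by decide) hx,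
      cA, cA]; ring
  have e1 : (fun y (j : Fin 8 → Fin 4) =>
      ∏ m : Fin 4, g y ![j (ρ (Fin.castAdd 4 m)), j (ρ (Fin.natAdd 4 m))])
      = fun y j => B y (j ∘ ρ) := by
    funext y j
    simp only [hB, hA, Fin.prod_univ_four, comp_cons, comp_empty, Function.comp_apply,
      Matrix.cons_val]
    simp only [mul_assoc]
    rfl
  rw [e1, covD_reindex g B hρ, cB]

/-- `ε ⊗ ε` is a signed sum of products of metric components and hence parallel. Working with the
square avoids differentiating the square root of the determinant. -/
theorem covD_vol_mul {x : Pt} (hx : x ∈ U) (e : Fin 4) (i j : Fin 4 → Fin 4) :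
    covD g (vol g) x (Matrix.vecCons e i) * vol g x j
      + vol g x i * covD g (vol g) x (Matrix.vecCons e j) = 0 := by
  have hV := smooth_vol hg
  have h1 := covD_tmul (g := g) hg.isOpen hV hV hx e (Fin.append i j)
  have hl : Fin.append i j ∘ Fin.castAdd 4 = i := by funext m; simp
  have hr : Fin.append i j ∘ Fin.natAdd 4 = j := funext fun m => Fin.append_right i j m
  rw [hl, hr] at h1
  rw [← h1]
  set ρ : Equiv.Perm (Fin 4) → Fin (4 + 4) → Fin (4 + 4) := fun σ =>
    finSumFinEquiv ∘ Sum.map σ id ∘ (finSumFinEquiv (m := 4) (n := 4)).symm with hρ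
  have bρ : ∀ σ, Function.Bijective (ρ σ) := fun σ =>
    finSumFinEquiv.bijective.comp
      ((Function.Bijective.sumMap σ.bijective Function.bijective_id).comp
        finSumFinEquiv.symm.bijective)
  have h2 : ∀ y ∈ U, ∀ k : Fin 8 → Fin 4, tmul (vol g) (vol g) y k
      = ∑ σ : Equiv.Perm (Fin 4), (-((Equiv.Perm.sign σ : ℤ) : ℝ)) * ∏ m : Fin 4,
        g y ![k (ρ σ (Fin.castAdd 4 m)), k (ρ σ (Fin.natAdd 4 m))] := by
    intro y hy k
    rw [tmul, vol_mul_vol (hg.det_neg y hy), Matrix.det_apply', ← Finset.sum_neg_distrib]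
    refine Finset.sum_congr rfl fun σ _ => ?_
    rw [neg_mul]
    congr 2
  have sP : ∀ σ, SmoothT U (fun y (k : Fin 8 → Fin 4) => ∏ m : Fin 4,
        g y ![k (ρ σ (Fin.castAdd 4 m)), k (ρ σ (Fin.natAdd 4 m))]) := fun σ i =>
    contDiffOn_prod fun m _ => hg.smooth _
  rw [covD_congr hg.isOpen h2 hx, covD_sum hg.isOpen _ (fun σ i => contDiffOn_const.mul (sP σ i)) hx]
  refine Finset.sum_eq_zero fun σ _ => ?_
  rw [covD_const_mul hg.isOpen _ (sP σ) hx]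
  have := covD_metric_prod hg (bρ σ) hx e (Fin.append i j)
  rw [this, mul_zero]

/-- The volume form is covariantly constant. -/
theorem covD_vol {x : Pt} (hx : x ∈ U) (i : Fin 5 → Fin 4) : covD g (vol g) x i = 0 := by
  have key := fun j => covD_vol_mul hg hx (i 0) (Matrix.vecTail i) j
  have hi : Matrix.vecCons (i 0) (Matrix.vecTail i) = i := Matrix.cons_head_tail i
  rw [hi] at key
  have h0 : vol g x id ≠ 0 := by
    unfold vol
    simp [(hg.det_neg x hx).ne]
  -- If the component of `ε` vanishes, the product rule is tested against the nonzero component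
  -- `ε_{0123}`; otherwise against the component itself, giving `2 ε_i ∇ε_i = 0`.
  by_cases hz : vol g x (Matrix.vecTail i) = 0
  · have := key id
    rw [hz, zero_mul, add_zero] at this
    exact (mul_eq_zero.1 this).resolve_right h0
  · have := key (Matrix.vecTail i)
    rw [hi] at this
    have h2 : vol g x (Matrix.vecTail i) * covD g (vol g) x i = 0 := by linarith
    exact (mul_eq_zero.1 h2).resolve_left hz

omit hg in
theorem dual_eq (g : Tensor 2) (T : Tensor 3) (x : Pt) (i : Fin 3 → Fin 4) : dual g T x i
    = (1 / 2) * dctr (ginv g x) (fun p q => vol g x ![i 0, i 1, p, q])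
      fun p q => T x ![p, q, i 2] := by
  unfold dual
  simp only [up, upd₄₂, upd₄₃, Matrix.cons_val]
  rw [sum_up_up]

/-- Only the derivative of `T` survives, as both `ε` and `g⁻¹` are parallel. -/
theorem covD_dual {T : Tensor 3} (hT : SmoothT U T) {x : Pt} (hx : x ∈ U) (f c k e : Fin 4) :
    covD g (dual g T) x ![f, c, k, e]
      = (1 / 2) * dctr (ginv g x) (fun p q => vol g x ![c, k, p, q])
        fun p q => covD g T x ![f, p, q, e] := by
  have hV := smooth_vol hg
  have h1 := covD_ctr_ctr_mul hg hV hT (n := 3) (α := ![4, 5, 3, 1]) (β := ![2, 0, 6])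
    (by decide) hx f ![c, k, e]
  have h0 : covD g (dual g T) x ![f, c, k, e] = (1 / 2) * _ := Eq.trans
    (covD_congr hg.isOpen (fun y hy i => dual_eq g T y i) hx _)
    ((covD_const_mul hg.isOpen (T := fun y i => dctr (ginv g y) (fun p q => vol g y ![i 0, i 1, p, q])
      fun p q => T y ![p, q, i 2]) _ (fun i => smooth_ctr hg fun p q => smooth_ctr hg fun r s =>
        (hV _).mul (hT _)) hx _).trans (congrArg (1 / 2 * ·) (Eq.trans
          (covD_congr hg.isOpen (fun y hy i => by simp only [comp_cons, comp_empty]; rfl) hx _) h1)))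
  rw [h0]
  congr 1
  refine ctr_congr fun p q => ctr_congr fun r s => ?_
  rw [covD_vol hg hx, zero_mul, zero_add]
  simp [comp_cons, comp_empty]

end VolumeForm

end CEM
-- Energy-momentum tensor and rescaled Cotton tensor of the Maxwell field
namespace CEM

namespace Fields

theorem FF_eq (u : Fields) (x : Pt) :
    u.FF x = dctr (ginv u.g x) (fun p q => u.F x ![p, q]) fun p q => u.F x ![p, q] := by
  unfold FF
  simp only [up, upd₂₀, upd₂₁, Matrix.cons_val]
  rw [sum_up_up']

theorem emT_eq (u : Fields) (x : Pt) (i : Fin 2 → Fin 4) : u.emT x i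
    = ctr (ginv u.g x) (fun p q => u.F x ![i 0, p] * u.F x ![i 1, q])
      - (1 / 4) * u.g x i * u.FF x := by
  unfold emT
  simp only [up, upd₂₁, Matrix.cons_val]
  rw [sum_up']

theorem gradUp_eq (u : Fields) (x : Pt) (a : Fin 4) :
    u.gradUp x a = ∑ r, ginv u.g x a r * pd r u.Xi x := by
  simp only [gradUp, up, upd₁, Matrix.cons_val]
  rfl

theorem sum_gradUp (u : Fields) (x : Pt) (f : Fin 4 → ℝ) :
    ∑ e, f e * u.gradUp x e = ctr (ginv u.g x) fun p q => f p * pd q u.Xi x := by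
  simp only [gradUp_eq]
  rw [sum_up']

theorem sum_gradUp' (u : Fields) (x : Pt) (f : Fin 4 → ℝ) :
    ∑ e, u.gradUp x e * f e = ctr (ginv u.g x) fun p q => f p * pd q u.Xi x := by
  rw [← sum_gradUp]
  exact Finset.sum_congr rfl fun _ _ => mul_comm _ _

theorem cotton_eq (u : Fields) {x : Pt} (hs : ∀ a b, ginv u.g x a b = ginv u.g x b a)
    (a b c : Fin 4) : u.cotton x ![a, b, c]
    = (1 / 2) * u.Xi x * (ctr (ginv u.g x) (fun p q => u.F x ![b, q] * u.H x ![a, c, p])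
        - ctr (ginv u.g x) (fun p q => u.F x ![a, q] * u.H x ![b, c, p]))
      - (1 / 2) * u.Xi x * ctr (ginv u.g x) (fun p q => u.F x ![c, q] * u.H x ![p, a, b])
      + (1 / 4) * u.Xi x *
        (u.g x ![c, a] * dctr (ginv u.g x) (fun p q => u.F x ![p, q]) (fun p q => u.H x ![b, p, q])
        - u.g x ![c, b]
          * dctr (ginv u.g x) (fun p q => u.F x ![p, q]) (fun p q => u.H x ![a, p, q]))
      - (3 / 2) * (ctr (ginv u.g x) (fun p q => u.F x ![c, p] * u.F x ![a, q]) * pd b u.Xi x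
        - ctr (ginv u.g x) (fun p q => u.F x ![c, p] * u.F x ![b, q]) * pd a u.Xi x)
      + (1 / 2) * u.FF x * (u.g x ![c, a] * pd b u.Xi x - u.g x ![c, b] * pd a u.Xi x)
      - (1 / 2) * (u.g x ![c, a] * ctr (ginv u.g x) (fun p q =>
          ctr (ginv u.g x) (fun r s => pd r u.Xi x * u.F x ![s, p]) * u.F x ![b, q])
        - u.g x ![c, b] * ctr (ginv u.g x) (fun p q =>
          ctr (ginv u.g x) (fun r s => pd r u.Xi x * u.F x ![s, p]) * u.F x ![a, q])) := by
  have gX : ∀ r, grad u.Xi x ![r] = pd r u.Xi x := fun r => rfl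
  have w := fun b => sum_up_mul_up hs (fun r => u.F x ![b, r]) (fun r => pd r u.Xi x)
    fun d e => u.F x ![d, e]
  have w1 := fun b a => sum_up (h := ginv u.g x) (fun r => u.F x ![b, r])
    (fun d => u.H x ![a, c, d])
  have w2 := sum_up (h := ginv u.g x) (fun r => u.F x ![c, r]) (fun d => u.H x ![d, a, b])
  have w3 := fun a => sum_up' (h := ginv u.g x) (fun r => u.F x ![a, r]) (fun d => u.F x ![c, d])
  have w4 := fun a => sum_up_up (h := ginv u.g x) (fun r s => u.F x ![r, s])
    (fun d e => u.H x ![a, d, e])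
  unfold cotton cottonAlg cottonLin alt₂
  simp only [Fup, up, upd₁, upd₂₀, upd₂₁, Matrix.cons_val, gX, w, w1, w2, w3, w4]
  ring

end Fields

namespace Fields.Setting

variable {u : Fields} {U : Set Pt} (S : u.Setting U)
include S

theorem smooth_FF : ContDiffOn ℝ ∞ u.FF U :=
  (smooth_ctr S.metric (f := fun x p q => ctr (ginv u.g x) fun r s =>
    u.F x ![q, s] * u.F x ![p, r]) fun p q => smooth_ctr S.metric
      (f := fun x r s => u.F x ![q, s] * u.F x ![p, r]) fun _ _ =>
        (S.smooth_F _).mul (S.smooth_F _)).congr fun x _ => u.FF_eq x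

theorem smooth_emT : SmoothT U u.emT := fun i =>
  ((smooth_ctr S.metric (f := fun x p q => u.F x ![i 0, p] * u.F x ![i 1, q]) fun _ _ =>
    (S.smooth_F _).mul (S.smooth_F _)).sub ((contDiffOn_const.mul (S.smooth_g i)).mul
      S.smooth_FF)).congr fun x _ => u.emT_eq x i

variable {x : Pt} (hx : x ∈ U)
include hx

theorem emT_symm (a b : Fin 4) : u.emT x ![a, b] = u.emT x ![b, a] := by
  have H := S.metAlg hx
  simp only [emT_eq, Matrix.cons_val]
  rw [H.gs a b, H.swap]
  simp only [mul_comm (u.F x ![b, _])]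

theorem emT_trace : ctr (ginv u.g x) (fun a b => u.emT x ![a, b]) = 0 := by
  have H := S.metAlg hx
  simp only [emT_eq, Matrix.cons_val, ctr_sub, ctr_mul_left, mul_comm _ (u.FF x),
    mul_comm (1 / 4 : ℝ)]
  have h1 : ctr (ginv u.g x) (fun a b => ctr (ginv u.g x) fun p q => u.F x ![a, p] * u.F x ![b, q])
      = u.FF x := by
    rw [FF_eq]
    exact ctr_congr fun a b => ctr_congr fun p q => mul_comm _ _
  rw [h1]
  have h2 := H.ctr_g
  simp only [mul_assoc, ctr_mul_left, ctr_mul_right]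
  rw [h2]; ring

/-- The two terms of the product rule coincide because the full contraction is symmetric in its
arguments. -/
theorem pd_FF (e : Fin 4) : pd e u.FF x
    = 2 * dctr (ginv u.g x) (fun p q => u.F x ![p, q]) fun p q => covD u.g u.F x ![e, p, q] := by
  have h1 := covD_ctr_ctr_mul S.metric S.smooth_F S.smooth_F (n := 0)
    (α := ![3, 1]) (β := ![2, 0]) (by decide) hx e ![]
  have h2 : covD u.g (fun y (_ : Fin 0 → Fin 4) => u.FF y) x (Matrix.vecCons e ![])
      = pd e u.FF x := by rw [covD_cons]; simp
  have h3 : pd e u.FF x = _ := h2.symm.trans (Eq.trans (covD_congr S.isOpen (fun y hy i => by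
    rw [FF_eq]; simp only [comp_cons, comp_empty]; rfl) hx _) h1)
  rw [h3]
  have h4 := dctr_comm (S.metAlg hx).hs (fun p q => u.F x ![p, q])
    fun p q => covD u.g u.F x ![e, p, q]
  rw [two_mul]
  nth_rewrite 1 [h4]
  simp only [dctr]
  rw [← ctr_add]
  refine ctr_congr fun p q => ?_
  rw [← ctr_add]
  refine ctr_congr fun r s => ?_
  simp [comp_cons, comp_empty]

theorem covD_emT (e a b : Fin 4) : covD u.g u.emT x ![e, a, b]
    = ctr (ginv u.g x) (fun p q => u.F x ![b, q] * covD u.g u.F x ![e, a, p])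
      + ctr (ginv u.g x) (fun p q => u.F x ![a, q] * covD u.g u.F x ![e, b, p])
      - (1 / 2) * u.g x ![a, b] * dctr (ginv u.g x) (fun p q => u.F x ![p, q])
        (fun p q => covD u.g u.F x ![e, p, q]) := by
  have H := S.metAlg hx
  set A : Tensor 2 := fun y i => ctr (ginv u.g y) fun p q =>
    u.F y (Matrix.vecCons p (Matrix.vecCons q i) ∘ ![2, 0])
      * u.F y (Matrix.vecCons p (Matrix.vecCons q i) ∘ ![3, 1]) with hA
  have sA : SmoothT U A := fun i => smooth_ctr S.metric (f := fun y p q =>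
    u.F y (Matrix.vecCons p (Matrix.vecCons q i) ∘ ![2, 0])
      * u.F y (Matrix.vecCons p (Matrix.vecCons q i) ∘ ![3, 1])) fun p q =>
        (S.smooth_F _).mul (S.smooth_F _)
  have sF : ContDiffOn ℝ ∞ (fun y => (1 / 4) * u.FF y) U := contDiffOn_const.mul S.smooth_FF
  rw [covD_congr S.isOpen (S := fun y i => A y i - (1 / 4) * u.FF y * u.g y i) (fun y hy i => by
      rw [emT_eq]; simp only [hA, comp_cons, comp_empty, Matrix.cons_val]; ring) hx,
    covD_sub S.isOpen sA (fun i => sF.mul (S.smooth_g i)) hx,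
    covD_smul S.isOpen sF S.smooth_g hx, covD_metric S.metric hx,
    pd_const_mul _ (diffAt S.isOpen S.smooth_FF hx), S.pd_FF hx]
  rw [hA, covD_ctr_mul S.metric S.smooth_F S.smooth_F (α := ![2, 0]) (β := ![3, 1])
    (by decide) hx e ![a, b], ctr_add]
  simp only [comp_cons, comp_empty, Matrix.cons_val]
  rw [H.swap fun p q => u.F x ![a, p] * covD u.g u.F x ![e, b, q]]
  simp only [mul_comm (covD u.g u.F x ![e, a, _])]
  ring

variable (m₁ : ∀ i, u.M₁ x i = 0) (m₃ : ∀ i, u.M₃ x i = 0)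

include m₃ in
theorem covD_F_cyc (a b c : Fin 4) : covD u.g u.F x ![a, b, c]
    = covD u.g u.F x ![b, a, c] - covD u.g u.F x ![c, a, b] := by
  have h1 := S.M₃_eq hx ![a, b, c]
  rw [m₃] at h1
  simp only [Matrix.cons_val] at h1
  have h2 := S.covD_F_antisymm hx b a c
  linarith

include m₁ m₃ in
/-- The energy-momentum tensor is divergence free. -/
theorem div_emT (b : Fin 4) :
    ctr (ginv u.g x) (fun p q => covD u.g u.emT x ![p, q, b]) = 0 := by
  have H := S.metAlg hx
  have fa := S.sym.F_antisymm x hx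
  simp only [S.covD_emT hx, ctr_add, ctr_sub]
  have h1 : ctr (ginv u.g x) (fun e a => ctr (ginv u.g x) fun p q =>
      u.F x ![b, q] * covD u.g u.F x ![e, a, p]) = 0 := by
    rw [ctr_comm, ← ctr_zero (h := ginv u.g x)]
    refine ctr_congr fun p q => ?_
    rw [ctr_mul_left, S.ctr_covD_F hx, m₁, mul_zero]
  have h2 : ctr (ginv u.g x) (fun e a => ctr (ginv u.g x) fun p q =>
      u.F x ![a, q] * covD u.g u.F x ![e, b, p])
      = dctr (ginv u.g x) (fun p q => u.F x ![p, q]) fun e p => covD u.g u.F x ![e, b, p] := rfl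
  have h3 : ctr (ginv u.g x) (fun e a => (1 / 2) * u.g x ![a, b] * dctr (ginv u.g x)
        (fun p q => u.F x ![p, q]) fun p q => covD u.g u.F x ![e, p, q])
      = (1 / 2) * dctr (ginv u.g x) (fun p q => u.F x ![p, q])
        fun p q => covD u.g u.F x ![b, p, q] := by
    simp only [mul_assoc]
    rw [ctr_mul_left]
    congr 1
    exact H.ctr_g_right' b fun e => dctr (ginv u.g x) (fun p q => u.F x ![p, q])
      fun p q => covD u.g u.F x ![e, p, q]
  -- By `dF = 0` the derivative of the trace part equals the remaining divergence term, so the two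
  -- cancel with the coefficient `½`.
  have h4 : dctr (ginv u.g x) (fun p q => u.F x ![p, q]) (fun p q => covD u.g u.F x ![b, p, q])
      = 2 * dctr (ginv u.g x) (fun p q => u.F x ![p, q]) fun e p => covD u.g u.F x ![e, b, p] := by
    have k := dctr_swap_of_antisymm (h := ginv u.g x) fa fun e p => covD u.g u.F x ![e, b, p]
    rw [dctr_congr fun p q => S.covD_F_cyc hx m₃ b p q, dctr_sub, k]; ring
  rw [h1, h2, h3, h4]; ring

include m₃ in
/-- The two expressions for the Cotton tensor of the Maxwell field agree. -/
theorem cottonDef_eq (hq : ∀ i, u.Q₃ x i = 0) (i : Fin 3 → Fin 4) :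
    u.cottonDef x i = u.cotton x i := by
  have H := S.metAlg hx
  have hH : ∀ i, u.H x i = covD u.g u.F x i := fun i => sub_eq_zero.1 (hq i)
  have gX : ∀ r, grad u.Xi x ![r] = pd r u.Xi x := fun r => rfl
  have ga := S.covD_F_antisymm hx
  obtain ⟨a, b, c, rfl⟩ : ∃ a b c, i = ![a, b, c] := ⟨_, _, _, eq_triple i⟩
  rw [u.cotton_eq H.hs]
  have h1 : ∀ b, ∑ e, u.emT x ![b, e] * u.gradUp x e
      = ctr (ginv u.g x) (fun p q => ctr (ginv u.g x) (fun r s => pd r u.Xi x * u.F x ![s, p])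
          * u.F x ![b, q]) - (1 / 4) * u.FF x * pd b u.Xi x := by
    intro b
    rw [u.sum_gradUp]
    simp only [emT_eq, Matrix.cons_val, sub_mul, ctr_sub]
    have k1 : ctr (ginv u.g x) (fun p q => (1 / 4) * u.g x ![b, p] * u.FF x * pd q u.Xi x)
        = (1 / 4) * u.FF x * pd b u.Xi x := by
      rw [← H.ctr_g_left b fun q => pd q u.Xi x, ← ctr_mul_left]
      exact ctr_congr fun p q => by ring
    rw [k1]
    congr 1
    rw [ctr_congr fun p q => (ctr_mul_right (h := ginv u.g x) (pd q u.Xi x)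
      fun r s => u.F x ![b, r] * u.F x ![p, s]).symm, ctr_comm, H.swap]
    refine ctr_congr fun p q => ?_
    rw [← ctr_mul_right, H.swap]
    exact ctr_congr fun r s => by ring
  -- The one place where `dF = 0` enters: `∇_a F_{bp} - ∇_b F_{ap}` becomes `-∇_p F_{ab}`.
  have h2 : ctr (ginv u.g x) (fun p q => u.F x ![c, q] * covD u.g u.F x ![a, b, p])
      - ctr (ginv u.g x) (fun p q => u.F x ![c, q] * covD u.g u.F x ![b, a, p])
      = -ctr (ginv u.g x) (fun p q => u.F x ![c, q] * covD u.g u.F x ![p, a, b]) := by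
    rw [← ctr_sub, ← ctr_neg]
    exact ctr_congr fun p q => by
      linear_combination u.F x ![c, q] * S.covD_F_cyc hx m₃ a b p
  unfold cottonDef alt₂
  simp only [Matrix.cons_val, h1, gX, S.covD_emT hx, hH]
  simp only [emT_eq, Matrix.cons_val]
  have h3 : ∀ a b, ctr (ginv u.g x) (fun p q => u.F x ![a, p] * u.F x ![b, q])
      = ctr (ginv u.g x) (fun p q => u.F x ![b, p] * u.F x ![a, q]) := fun a b => by
    rw [H.swap]; exact ctr_congr fun _ _ => mul_comm _ _
  rw [h3 b c, h3 a c, H.gs c a, H.gs c b]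
  linear_combination (1 / 2) * u.Xi x * h2

end Fields.Setting

end CEM
-- Evolution equations for the conformal factor, the Friedrich scalar and the Schouten tensor
namespace CEM

namespace Fields

/-- The consequences of the conformal Einstein-Maxwell equations from which the reduced system is
derived. -/
structure Solution (u : Fields) (U : Set Pt) (src : GaugeSource) : Prop where
  setting : u.Setting U
  gauge : InGauge U u.g src
  hess : ∀ x ∈ U, ∀ a b, covD u.g (grad u.Xi) x ![a, b] =
    -u.Xi x * u.L x ![a, b] + u.s x * u.g x ![a, b] + (1 / 2) * u.Xi x ^ 3 * u.emT x ![a, b]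
  grad_s : ∀ x ∈ U, ∀ a, grad u.s x ![a] =
    -ctr (ginv u.g x) (fun p q => u.L x ![a, p] * pd q u.Xi x)
      + (1 / 2) * u.Xi x ^ 2 * ctr (ginv u.g x) (fun p q => u.emT x ![a, p] * pd q u.Xi x)
  div : ∀ x ∈ U, ∀ a b c, u.cotton x ![b, c, a] = u.divd x ![a, b, c]
  m₁ : ∀ x ∈ U, ∀ i, u.M₁ x i = 0
  m₃ : ∀ x ∈ U, ∀ i, u.M₃ x i = 0
  q₃ : ∀ x ∈ U, ∀ i, u.Q₃ x i = 0

namespace Solution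

variable {u : Fields} {U : Set Pt} {src : GaugeSource} (S : u.Solution U src)
include S

theorem smooth_divd : SmoothT U u.divd := fun i =>
  smooth_ctr S.setting.metric (f := fun x p q => covD u.g u.d x ![p, q, i 0, i 1, i 2])
    fun _ _ => S.setting.smooth_covD S.setting.smooth_d _

/-- On a solution the Cotton tensor may be replaced by the divergence of `d` before differentiation;
its antisymmetry and trace properties are then inherited from the Weyl symmetries. -/
theorem cotton_eq_divd : ∀ x ∈ U, ∀ i : Fin 3 → Fin 4,
    u.cotton x i = u.divd x (i ∘ ![2, 0, 1]) := fun x hx i => by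
  conv_lhs => rw [eq_triple i]
  rw [S.div x hx]
  simp [comp_cons, comp_empty]

theorem smooth_cotton : SmoothT U u.cotton := fun i =>
  (S.smooth_divd (i ∘ ![2, 0, 1])).congr fun x hx => S.cotton_eq_divd x hx i

variable {x : Pt} (hx : x ∈ U)
include hx

theorem covD_cotton (e a b c : Fin 4) : covD u.g u.cotton x ![e, a, b, c]
    = covD u.g u.divd x ![e, c, a, b] := by
  rw [covD_congr S.setting.isOpen S.cotton_eq_divd hx, covD_reindex _ _ (by decide)]
  simp only [comp_cons, comp_empty, Matrix.cons_val]

theorem divd_antisymm (a b c : Fin 4) : u.divd x ![a, b, c] = -u.divd x ![a, c, b] := by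
  simp only [Fields.divd, Matrix.cons_val]
  rw [← ctr_neg]; exact ctr_congr fun p q => (S.setting.covD_weyl hx p).anti₂ _ _ _ _

theorem covD_divd_antisymm (e a b c : Fin 4) :
    covD u.g u.divd x ![e, a, b, c] = -covD u.g u.divd x ![e, a, c, b] := by
  have := covD_of_antisymm (g := u.g) S.setting.isOpen S.smooth_divd (ρ := ![0, 2, 1])
    (by decide) (fun y hy i => by
      conv_lhs => rw [eq_triple i]
      rw [S.divd_antisymm hy]; simp [comp_cons, comp_empty]) hx e ![a, b, c]
  simpa [comp_cons, comp_empty] using this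

theorem cotton_antisymm (a b c : Fin 4) : u.cotton x ![a, b, c] = -u.cotton x ![b, a, c] := by
  rw [S.div x hx, S.div x hx, S.divd_antisymm hx]

theorem covD_cotton_antisymm (e a b c : Fin 4) :
    covD u.g u.cotton x ![e, a, b, c] = -covD u.g u.cotton x ![e, b, a, c] := by
  rw [S.covD_cotton hx, S.covD_cotton hx, S.covD_divd_antisymm hx]

theorem covD_divd_trace (e b : Fin 4) :
    ctr (ginv u.g x) (fun p q => covD u.g u.divd x ![e, p, q, b]) = 0 := by
  have k := covD_tctr S.setting.metric (k := 1) S.smooth_divd hx e ![b]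
  rw [covD_congr S.setting.isOpen (S := fun _ _ => 0) (fun y hy i => by
    rw [← S.setting.divd_trace hy (i 0), tctr]
    exact ctr_congr fun p q => by
      rw [show i = ![i 0] from List.ofFn_inj.mp rfl]; rfl) hx, covD_zero] at k
  exact k.symm

/-- The evolution equation for the conformal factor. -/
theorem eq_Xi : boxScalar u.g u.Xi x = 4 * u.s x - (1 / 6) * u.Xi x * src.R x := by
  have H := S.setting.metAlg hx
  have h1 : boxScalar u.g u.Xi x
      = ctr (ginv u.g x) fun a b => covD u.g (grad u.Xi) x ![a, b] := rfl
  have h2 : ctr (ginv u.g x) (fun a b => u.L x ![a, b]) = u.trL x := rfl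
  rw [h1, ctr_congr fun a b => S.hess x hx a b, ctr_add, ctr_add, ctr_mul_left, ctr_mul_left,
    ctr_mul_left, S.setting.emT_trace hx, H.ctr_g, h2, S.setting.src_R_eq S.gauge hx]
  ring

omit S in
omit hx in
theorem ctr_ctr_eq_dctr {h g : Fin 4 → Fin 4 → ℝ} (H : MetAlg h g) (A B : Fin 4 → Fin 4 → ℝ) :
    ctr h (fun e a => ctr h fun p q => A a p * B e q) = dctr h A B := by
  refine ctr_congr fun e a => ?_
  rw [H.swap]

omit hx in
theorem smooth_ctr_gradXi {A : Tensor 2} (hA : SmoothT U A) :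
    SmoothT U (fun y (i : Fin 1 → Fin 4) =>
      ctr (ginv u.g y) fun p q => A y ![i 0, p] * grad u.Xi y ![q]) := fun i =>
  smooth_ctr S.setting.metric (f := fun y p q => A y ![i 0, p] * grad u.Xi y ![q]) fun _ _ =>
    (hA _).mul (S.setting.smooth_grad S.setting.smooth_Xi _)

theorem covD_ctr_gradXi {A : Tensor 2} (hA : SmoothT U A) (e a : Fin 4) :
    covD u.g (fun y (i : Fin 1 → Fin 4) =>
      ctr (ginv u.g y) fun p q => A y ![i 0, p] * grad u.Xi y ![q]) x ![e, a]
      = ctr (ginv u.g x) (fun p q => covD u.g A x ![e, a, p] * pd q u.Xi x)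
        + ctr (ginv u.g x) (fun p q => A x ![a, p] * covD u.g (grad u.Xi) x ![e, q]) := by
  have h := covD_ctr_mul S.setting.metric hA (S.setting.smooth_grad S.setting.smooth_Xi)
    (n := 1) (α := ![2, 0]) (β := ![1]) (by decide) hx e ![a]
  simp only [comp_cons, comp_empty, Matrix.cons_val] at h
  rw [← ctr_add]
  exact Eq.trans (covD_congr S.setting.isOpen (fun y hy i => rfl) hx _) h

/-- The evolution equation for the Friedrich scalar. -/
theorem eq_s : boxScalar u.g u.s x = u.rhs_s src x := by
  have H := S.setting.metAlg hx
  have hU := S.setting.isOpen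
  have sL := S.setting.smooth_L
  have sE := S.setting.smooth_emT
  have sX := S.setting.smooth_Xi
  have h2 : ctr (ginv u.g x) (fun a b => u.L x ![a, b]) = u.trL x := rfl
  have sX2 : ContDiffOn ℝ ∞ (fun y => (1 / 2) * u.Xi y ^ 2) U := contDiffOn_const.mul (sX.pow 2)
  have pX2 : ∀ e, pd e (fun y => (1 / 2) * u.Xi y ^ 2) x = u.Xi x * pd e u.Xi x := fun e => by
    have d := diffAt hU sX hx
    rw [pd_const_mul _ (show DifferentiableAt ℝ (fun y => u.Xi y ^ 2) x from d.pow 2)]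
    simp only [pow_two]
    rw [pd_mul d d]; ring
  -- Derivative of the first-order equation for `s`, not yet traced; the Hessian of `Ξ` is kept for
  -- substitution in `tY`.
  have h0 : ∀ e a, covD u.g (grad u.s) x ![e, a]
      = -(ctr (ginv u.g x) (fun p q => covD u.g u.L x ![e, a, p] * pd q u.Xi x)
        + ctr (ginv u.g x) (fun p q => u.L x ![a, p] * covD u.g (grad u.Xi) x ![e, q]))
        + (u.Xi x * (pd e u.Xi x * ctr (ginv u.g x) (fun p q => u.emT x ![a, p] * pd q u.Xi x))
          + (1 / 2) * u.Xi x ^ 2 *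
            (ctr (ginv u.g x) (fun p q => covD u.g u.emT x ![e, a, p] * pd q u.Xi x)
            + ctr (ginv u.g x) fun p q => u.emT x ![a, p] * covD u.g (grad u.Xi) x ![e, q])) := by
    intro e a
    have s1 := S.smooth_ctr_gradXi sL
    have s2 := S.smooth_ctr_gradXi sE
    have s3 : SmoothT U (fun y (i : Fin 1 → Fin 4) => (-1) *
      ctr (ginv u.g y) fun p q => u.L y ![i 0, p] * grad u.Xi y ![q]) :=
      fun i => contDiffOn_const.mul (s1 i)
    have s4 : SmoothT U (fun y (i : Fin 1 → Fin 4) => (1 / 2) * u.Xi y ^ 2 *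
      ctr (ginv u.g y) fun p q => u.emT y ![i 0, p] * grad u.Xi y ![q]) :=
      fun i => sX2.mul (s2 i)
    rw [covD_congr hU (S := fun y (i : Fin 1 → Fin 4) => (-1) *
      ctr (ginv u.g y) (fun p q => u.L y ![i 0, p] * grad u.Xi y ![q])
      + (1 / 2) * u.Xi y ^ 2 *
        ctr (ginv u.g y) fun p q => u.emT y ![i 0, p] * grad u.Xi y ![q]) (fun y hy i => by
          rw [show i = ![i 0] from List.ofFn_inj.mp rfl, S.grad_s y hy]
          simp only [neg_mul, one_mul]; rfl) hx,
      covD_add hU s3 s4 hx, covD_const_mul hU _ s1 hx, covD_smul hU sX2 s2 hx,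
      S.covD_ctr_gradXi hx sL, S.covD_ctr_gradXi hx sE, pX2]
    simp only [grad, Matrix.cons_val]
    ring
  have h1 : boxScalar u.g u.s x
      = ctr (ginv u.g x) fun a b => covD u.g (grad u.s) x ![a, b] := rfl
  -- The Hessian of `Ξ` is eliminated under the trace; used with `A = L` and with `A` the
  -- energy-momentum tensor, the latter being trace-free.
  have tY : ∀ A : Tensor 2, ctr (ginv u.g x) (fun e a => ctr (ginv u.g x) fun p q =>
        A x ![a, p] * covD u.g (grad u.Xi) x ![e, q])
      = -u.Xi x * dctr (ginv u.g x) (fun a b => A x ![a, b]) (fun a b => u.L x ![a, b])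
        + u.s x * ctr (ginv u.g x) (fun a b => A x ![a, b])
        + (1 / 2) * u.Xi x ^ 3
          * dctr (ginv u.g x) (fun a b => A x ![a, b]) (fun a b => u.emT x ![a, b]) := by
    intro A
    have k1 := ctr_ctr_eq_dctr H (fun a b => A x ![a, b]) fun a b => u.L x ![a, b]
    have k2 := ctr_ctr_eq_dctr H (fun a b => A x ![a, b]) fun a b => u.emT x ![a, b]
    have k3 : ctr (ginv u.g x) (fun e a => ctr (ginv u.g x) fun p q =>
        u.g x ![e, q] * A x ![a, p]) = ctr (ginv u.g x) (fun a b => A x ![a, b]) := by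
      rw [H.swap fun a b => A x ![a, b]]
      exact ctr_congr fun e a => H.ctr_g_right e fun p => A x ![a, p]
    rw [← k1, ← k2, ← k3]
    simp only [← ctr_mul_left, ← ctr_add]
    refine ctr_congr fun e a => ?_
    exact ctr_congr fun p q => by rw [S.hess x hx]; ring
  -- Here divergences appear: that of `L` is the gradient of `tr L`, and that of the energy-momentum
  -- tensor is zero.
  have t1 : ∀ A : Tensor 2, ctr (ginv u.g x) (fun e a => ctr (ginv u.g x) fun p q =>
        covD u.g A x ![e, a, p] * pd q u.Xi x) = ctr (ginv u.g x) fun p q =>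
          ctr (ginv u.g x) (fun e a => covD u.g A x ![e, a, p]) * pd q u.Xi x := fun A => by
    rw [ctr_comm]
    exact ctr_congr fun p q => ctr_mul_right _ _
  have eR : ∀ m, grad src.R x ![m] = 6 * pd m u.trL x := fun m => by
    simp only [grad, Matrix.cons_val]
    exact scalarGrad_eq S.setting.isOpen S.gauge hx S.setting m
  rw [h1, ctr_congr fun a b => h0 a b]
  simp only [ctr_add, ctr_neg, ctr_mul_left, t1, tY, S.setting.div_L hx,
    S.setting.div_emT hx (S.m₁ x hx) (S.m₃ x hx), zero_mul, ctr_zero, h2, S.setting.emT_trace hx]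
  unfold rhs_s
  have r1 : ∀ (A : Tensor 2) (f : Fin 4 → Fin 4 → ℝ),
      ∑ m, ∑ n, f m n * up u.g 0 (up u.g 1 A) x ![m, n]
      = dctr (ginv u.g x) (fun a b => A x ![a, b]) f := fun A f => by
    simp only [up, upd₂₀, upd₂₁, Matrix.cons_val]
    rw [sum_up_up']
  have r2 : ∑ m, ∑ n, u.gradUp x m * u.gradUp x n * u.emT x ![m, n]
      = ctr (ginv u.g x) fun e a =>
        pd e u.Xi x * ctr (ginv u.g x) (fun p q => u.emT x ![a, p] * pd q u.Xi x) := by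
    simp only [mul_assoc, ← Finset.mul_sum]
    simp only [sum_gradUp']
    rw [H.swap]
    exact ctr_congr fun p q => mul_comm _ _
  rw [r2, sum_gradUp]
  simp only [Lup, emTup, r1, eR]
  have r3 := dctr_comm H.hs (fun a b => u.L x ![a, b]) fun a b => u.emT x ![a, b]
  simp only [mul_assoc (6 : ℝ), ctr_mul_left]
  rw [r3, S.setting.src_R_eq S.gauge hx]
  ring

/-- The evolution equation for the Schouten tensor. -/
theorem eq_L (b c : Fin 4) : box u.g u.L x ![b, c]
    = u.rhs_L src (covD u.g u.cotton) x b c := by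
  have H := S.setting.metAlg hx
  have D := S.setting.weylAlg hx
  have hU := S.setting.isOpen
  have ls := S.setting.sym.L_symm x hx
  have sL := S.setting.smooth_L
  have sX := S.setting.smooth_Xi
  have sG := S.setting.smooth_grad sX
  have sC := S.smooth_cotton
  have sDL := S.setting.smooth_covD sL
  have trl : ctr (ginv u.g x) (fun a b => u.L x ![a, b]) = u.trL x := rfl
  set W : Tensor 3 := fun y i => ctr (ginv u.g y) fun p q =>
    grad u.Xi y (Matrix.vecCons p (Matrix.vecCons q i) ∘ ![0])
      * u.d y (Matrix.vecCons p (Matrix.vecCons q i) ∘ ![1, 4, 2, 3]) with hW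
  have sW : SmoothT U W := fun i => smooth_ctr S.setting.metric
    (f := fun y p q => grad u.Xi y (Matrix.vecCons p (Matrix.vecCons q i) ∘ ![0])
      * u.d y (Matrix.vecCons p (Matrix.vecCons q i) ∘ ![1, 4, 2, 3])) fun _ _ =>
        (sG _).mul (S.setting.smooth_d _)
  -- The curl equation exchanges the inner derivative index with an index of `L`, at the price of
  -- derivatives of `∇Ξ · d` and of `Ξ T_{abc}`.
  have step : ∀ p q, covD u.g (covD u.g u.L) x ![p, q, b, c]
      = covD u.g (covD u.g u.L) x ![p, b, q, c]
        + (ctr (ginv u.g x) (fun r s => covD u.g (grad u.Xi) x ![p, r] * u.d x ![s, c, q, b])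
          + ctr (ginv u.g x) (fun r s => pd r u.Xi x * covD u.g u.d x ![p, s, c, q, b]))
        + (pd p u.Xi x * u.cotton x ![q, b, c]
          + u.Xi x * covD u.g u.cotton x ![p, q, b, c]) := by
    intro p q
    have hρ : Function.Bijective (![1, 0, 2] : Fin 3 → Fin 3) := by decide
    have s1 : SmoothT U (fun y i => covD u.g u.L y (i ∘ ![1, 0, 2]) + W y i) :=
      fun i => (sDL _).add (sW i)
    rw [covD_congr hU (T := covD u.g u.L) (S := fun y i => covD u.g u.L y (i ∘ ![1, 0, 2]) + W y i
        + u.Xi y * u.cotton y i) (fun y hy i => by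
        have k := S.setting.curl_L hy (i 0) (i 2) (i 1)
        have k2 := S.div y hy (i 2) (i 0) (i 1)
        have k3 : W y i = u.gradd y (i 2) (i 0) (i 1) := by
          simp only [hW, comp_cons, comp_empty, Matrix.cons_val]; rfl
        have k4 := S.setting.covD_L_symm hy (i 0) (i 2) (i 1)
        have k5 := S.setting.covD_L_symm hy (i 1) (i 2) (i 0)
        rw [k3]
        conv_lhs => rw [eq_triple i]
        conv_rhs => enter [2, 2]; rw [eq_triple i]
        rw [k2]
        simp only [comp_cons, comp_empty, Matrix.cons_val]
        linarith) hx,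
      covD_add hU s1 (fun i => sX.mul (sC i)) hx, covD_add hU (smooth_reindex sDL _) sW hx,
      covD_smul hU sX sC hx, covD_reindex _ _ hρ, hW,
      covD_ctr_mul S.setting.metric sG S.setting.smooth_d (α := ![0]) (β := ![1, 4, 2, 3])
        (by decide) hx p ![q, b, c], ctr_add]
    simp only [comp_cons, comp_empty, Matrix.cons_val]
    rfl
  -- Commuting the derivatives exposes the divergence of `L`, that is the Hessian of `tr L`; the
  -- curvature terms are quadratic in `L` or of the form `Ξ d L`.
  have a1 : ctr (ginv u.g x) (fun p q => covD u.g (covD u.g u.L) x ![p, b, q, c])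
      = covD u.g (grad u.trL) x ![b, c]
        + 4 * ctr (ginv u.g x) (fun r s => u.L x ![b, s] * u.L x ![r, c])
        - u.Xi x * dctr (ginv u.g x) (fun p q => u.L x ![p, q]) (fun p q => u.d x ![b, p, c, q])
        - u.g x ![c, b] * dctr (ginv u.g x) (fun p q => u.L x ![p, q])
          (fun p q => u.L x ![p, q]) := by
    have k0 : ctr (ginv u.g x) (fun p q => covD u.g (covD u.g u.L) x ![b, p, q, c])
        = covD u.g (grad u.trL) x ![b, c] := by
      have k := covD_tctr S.setting.metric (k := 1) sDL hx b ![c]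
      rw [← k]
      refine covD_congr hU (fun y hy i => ?_) hx _
      have := S.setting.div_L hy (i 0)
      rw [show grad u.trL y i = pd (i 0) u.trL y from rfl, ← this, tctr]
      exact ctr_congr fun p q => by
        rw [show i = ![i 0] from List.ofFn_inj.mp rfl]; rfl
    have k1 := ctr_ctr_curvAlg_div (Ξ := u.Xi x) H D ls b fun r => u.L x ![r, c]
    have k2 := ctr_ctr_curvAlg (Ξ := u.Xi x) (d := fun a b c e => u.d x ![a, b, c, e])
      (L := fun a b => u.L x ![a, b]) H c b fun q r => u.L x ![q, r]
    have k3 : ctr (ginv u.g x) (fun p q => covD u.g (covD u.g u.L) x ![p, b, q, c])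
        = ctr (ginv u.g x) (fun p q => covD u.g (covD u.g u.L) x ![b, p, q, c])
        - ctr (ginv u.g x) (fun p q => ctr (ginv u.g x) fun r s =>
            u.K x ![s, q, p, b] * u.L x ![r, c])
        - ctr (ginv u.g x) (fun p q => ctr (ginv u.g x) fun r s =>
            u.K x ![s, c, p, b] * u.L x ![q, r]) := by
      rw [← ctr_sub, ← ctr_sub]
      exact ctr_congr fun p q => by linarith [S.setting.comm₂ hx sL p b q c]
    have k4 : ctr (ginv u.g x) (fun p q => ctr (ginv u.g x) fun r s =>
            u.K x ![s, q, p, b] * u.L x ![r, c]) = _ := k1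
    have k5 : ctr (ginv u.g x) (fun p q => ctr (ginv u.g x) fun r s =>
            u.K x ![s, c, p, b] * u.L x ![q, r]) = _ := k2
    rw [k3, k4, k5, k0, trl]
    have y1 : ctr (ginv u.g x) (fun p q => u.L x ![p, c] * u.L x ![q, b])
        = ctr (ginv u.g x) fun r s => u.L x ![b, s] * u.L x ![r, c] :=
      ctr_congr fun p q => by rw [ls q b]; ring
    have y2 : ctr (ginv u.g x) (fun r s => u.L x ![b, s] * u.L x ![c, r])
        = ctr (ginv u.g x) fun r s => u.L x ![b, s] * u.L x ![r, c] :=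
      ctr_congr fun p q => by rw [ls c p]
    have y3 : ctr (ginv u.g x) (fun p q => ctr (ginv u.g x) fun r s =>
          u.L x ![p, s] * u.L x ![q, r])
        = dctr (ginv u.g x) (fun p q => u.L x ![p, q]) fun p q => u.L x ![p, q] := by
      refine ctr_congr fun p q => ?_
      rw [H.swap]; exact ctr_congr fun r s => mul_comm _ _
    have y4 : ctr (ginv u.g x) (fun p q => ctr (ginv u.g x) fun r s =>
          u.d x ![s, c, p, b] * u.L x ![q, r])
        = dctr (ginv u.g x) (fun p q => u.L x ![p, q]) fun p q => u.d x ![b, p, c, q] := by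
      refine ctr_congr fun p q => ?_
      rw [H.swap]
      exact ctr_congr fun r s => by rw [D.pair, D.anti₁, D.anti₂]; ring
    rw [y1, y2, y3, y4]
    ring
  have a2 : ctr (ginv u.g x) (fun p q => ctr (ginv u.g x) fun r s =>
        covD u.g (grad u.Xi) x ![p, r] * u.d x ![s, c, q, b])
      = -u.Xi x * dctr (ginv u.g x) (fun p q => u.L x ![p, q]) (fun p q => u.d x ![b, p, c, q])
        + (1 / 2) * u.Xi x ^ 3 * dctr (ginv u.g x) (fun p q => u.emT x ![p, q])
          (fun p q => u.d x ![b, p, c, q]) := by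
    -- The part of the Hessian proportional to `s g` disappears because `d` is trace-free.
    have k1 : ctr (ginv u.g x) (fun p q => ctr (ginv u.g x) fun r s =>
        u.g x ![p, r] * u.d x ![s, c, q, b]) = 0 := by
      rw [ctr_congr fun p q => H.ctr_g_left p fun s => u.d x ![s, c, q, b]]
      exact D.tr₀₂ c b
    have k2 : ∀ A : Tensor 2, ctr (ginv u.g x) (fun p q => ctr (ginv u.g x) fun r s =>
        A x ![p, r] * u.d x ![s, c, q, b]) = dctr (ginv u.g x) (fun p q => A x ![p, q])
          (fun p q => u.d x ![b, p, c, q]) := fun A => by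
      rw [H.swap]
      refine ctr_congr fun p q => ?_
      rw [H.swap]
      exact ctr_congr fun r s => by rw [D.pair r c p b, D.anti₁ p b, D.anti₂ b p]; ring
    rw [← k2, ← k2, ← add_zero (_ + _), ← mul_zero (u.s x), ← k1]
    simp only [← ctr_mul_left, ← ctr_add]
    refine ctr_congr fun p q => ctr_congr fun r s => ?_
    rw [S.hess x hx]; ring
  -- The divergence of `d` is again the Cotton tensor, contracted with `∇Ξ`.
  have a3 : ctr (ginv u.g x) (fun p q => ctr (ginv u.g x) fun r s =>
        pd r u.Xi x * covD u.g u.d x ![p, s, c, q, b])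
      = ctr (ginv u.g x) fun r s => u.cotton x ![s, c, b] * pd r u.Xi x := by
    rw [ctr_comm]
    refine ctr_congr fun r s => ?_
    rw [ctr_mul_left, mul_comm, S.div x hx]
    congr 1
    exact ctr_congr fun p q => (S.setting.covD_weyl hx p).pair s c q b
  have main : box u.g u.L x ![b, c] = covD u.g (grad u.trL) x ![b, c]
        + 4 * ctr (ginv u.g x) (fun r s => u.L x ![b, s] * u.L x ![r, c])
        - 2 * u.Xi x * dctr (ginv u.g x) (fun p q => u.L x ![p, q])
          (fun p q => u.d x ![b, p, c, q])
        - u.g x ![c, b] * dctr (ginv u.g x) (fun p q => u.L x ![p, q])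
          (fun p q => u.L x ![p, q])
        + (1 / 2) * u.Xi x ^ 3 * dctr (ginv u.g x) (fun p q => u.emT x ![p, q])
          (fun p q => u.d x ![b, p, c, q])
        + ctr (ginv u.g x) (fun r s => u.cotton x ![s, c, b] * pd r u.Xi x)
        + ctr (ginv u.g x) (fun p q => pd p u.Xi x * u.cotton x ![q, b, c])
        + u.Xi x * ctr (ginv u.g x) (fun p q => covD u.g u.cotton x ![p, q, b, c]) := by
    rw [box_eq, ctr_congr fun p q => step p q]
    simp only [ctr_add, ctr_mul_left]
    rw [a1, a2, a3]; ring
  rw [main]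
  unfold rhs_L sym₂
  have r1 : ∀ (A : Tensor 2), ∑ m, ∑ n, u.d x ![b, m, c, n] * up u.g 0 (up u.g 1 A) x ![m, n]
      = dctr (ginv u.g x) (fun a b => A x ![a, b]) fun m n => u.d x ![b, m, c, n] := fun A => by
    simp only [up, upd₂₀, upd₂₁, Matrix.cons_val]
    rw [sum_up_up' (h := ginv u.g x) (fun a b => A x ![a, b]) fun m n => u.d x ![b, m, c, n]]
  have r2 : ∑ m, ∑ n, u.L x ![m, n] * up u.g 0 (up u.g 1 u.L) x ![m, n]
      = dctr (ginv u.g x) (fun a b => u.L x ![a, b]) fun a b => u.L x ![a, b] := by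
    simp only [up, upd₂₀, upd₂₁, Matrix.cons_val]
    rw [sum_up_up' (h := ginv u.g x) (fun a b => u.L x ![a, b]) fun m n => u.L x ![m, n]]
  have r3 : ∑ e, up u.g 1 u.L x ![b, e] * u.L x ![c, e]
      = ctr (ginv u.g x) fun r s => u.L x ![b, s] * u.L x ![r, c] := by
    simp only [up, upd₂₁, Matrix.cons_val]
    rw [sum_up]
    exact ctr_congr fun r s => by rw [ls c r]
  have r4 : ∑ e, up u.g 0 (covD u.g u.cotton) x ![e, b, e, c]
      = -ctr (ginv u.g x) (fun p q => covD u.g u.cotton x ![p, q, b, c]) := by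
    simp only [up, update_cons_zero', Matrix.cons_val]
    rw [H.swap, ← ctr_neg]
    exact Finset.sum_congr rfl fun p _ => Finset.sum_congr rfl fun q _ => by
      beta_reduce
      rw [S.covD_cotton_antisymm hx q b p c]
  have r5 : ∑ e, (u.cotton x ![b, e, c] + u.cotton x ![c, e, b]) / 2 * u.gradUp x e
      = -(1 / 2) * (ctr (ginv u.g x) (fun r s => u.cotton x ![s, c, b] * pd r u.Xi x)
        + ctr (ginv u.g x) (fun p q => pd p u.Xi x * u.cotton x ![q, b, c])) := by
    rw [sum_gradUp, ← ctr_add, ← ctr_mul_left, H.swap]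
    exact ctr_congr fun p q => by
      rw [S.cotton_antisymm hx b q, S.cotton_antisymm hx c q]; ring
  have r6 : covD u.g (grad src.R) x ![b, c] = 6 * covD u.g (grad u.trL) x ![b, c] := by
    rw [← covD_const_mul hU _ (S.setting.smooth_grad S.setting.smooth_trL) hx]
    exact covD_congr hU (fun y hy i => scalarGrad_eq hU S.gauge hy S.setting (i 0)) hx _
  simp only [Lup, emTup, r1, r2, r3, r4, r5, r6]
  rw [H.gs c b]
  ring

end Solution

end Fields

end CEM
-- Evolution equation for the rescaled Weyl tensor
namespace CEM

section Algebra

variable {h g : Fin 4 → Fin 4 → ℝ} (H : MetAlg h g) {d : Fin 4 → Fin 4 → Fin 4 → Fin 4 → ℝ}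
include H

/-- The full contraction of `kulkarni` with a symmetric tensor. -/
theorem kulkarni_dctr (D : WeylAlg h d) (hk : ∀ a b c k f l, kulkarni g d a b c k f l = 0)
    {A : Fin 4 → Fin 4 → ℝ} (hA : ∀ a b, A a b = A b a) {P : Fin 4 → Fin 4 → Fin 4 → Fin 4 → ℝ}
    (hP : ∀ a b c k, P a b c k = ctr h fun p q => A a p * d q b c k) {E : Fin 4 → Fin 4 → ℝ}
    (hE : ∀ b c, E b c = dctr h A fun p q => d b p c q) (a b c k : Fin 4) :
    ctr h A * d a b c k - P c k a b + P k c a b - P a b c k + g a c * E b k - g a k * E b c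
      + P b a c k - g b c * E a k + g b k * E a c = 0 := by
  have e : dctr h A (fun e f => kulkarni g d a b e c k f) = 0 := by
    simp only [hk, dctr_zero]
  have t0 : ∀ X : ℝ, dctr h A (fun e f => g e f * X) = ctr h A * X := fun X => by
    unfold dctr
    rw [← ctr_mul_right, H.swap]
    refine ctr_congr fun p q => ?_
    rw [← H.ctr_g_left q fun e => A p e * X]
    exact ctr_congr fun _ _ => by ring
  have t1 : ∀ c k a b, dctr h A (fun e f => g e c * d a b k f) = -P c k a b := by
    intro c k a b
    rw [hP, ← ctr_neg, dctr_congr fun e f => show g e c * d a b k f = g c e * d a b k f by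
      rw [H.gs], dctr_g_left H A c fun f => d a b k f, H.swap]
    exact ctr_congr fun p q => by rw [D.pair, D.anti₁]; ring
  have t2 : ∀ c k a b, dctr h A (fun e f => g e k * d a b f c) = P k c a b := by
    intro c k a b
    rw [← neg_neg (P k c a b), ← t1 k c a b, ← dctr_neg]
    exact dctr_congr fun e f => by rw [D.anti₂]; ring
  have t3 : ∀ a b c k, dctr h A (fun e f => g a f * d b e c k) = -P a b c k := by
    intro a b c k
    rw [dctr_g_right H A a fun e => d b e c k, hP, ← ctr_neg, H.swap]
    exact ctr_congr fun p q => by rw [hA, D.anti₁]; ring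
  have t4 : ∀ a b c k, dctr h A (fun e f => g b f * d e a c k) = P b a c k := by
    intro a b c k
    rw [← neg_neg (P b a c k), ← t3, ← dctr_neg]
    exact dctr_congr fun e f => by rw [D.anti₁]; ring
  have t5 : ∀ b k, dctr h A (fun e f => d b e k f) = E b k := fun b k => (hE b k).symm
  have t6 : ∀ b c, dctr h A (fun e f => d b e f c) = -E b c := fun b c => by
    rw [hE, ← dctr_neg]; exact dctr_congr fun e f => D.anti₂ _ _ _ _
  have t7 : ∀ b k, dctr h A (fun e f => d e b k f) = -E b k := fun b k => by
    rw [hE, ← dctr_neg]; exact dctr_congr fun e f => D.anti₁ _ _ _ _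
  have t8 : ∀ b c, dctr h A (fun e f => d e b f c) = E b c := fun b c => by
    rw [hE]; exact dctr_congr fun e f => by rw [D.anti₁, D.anti₂]; ring
  simp only [kulkarni, dctr_add, dctr_mul_left, t0, t1, t2, t3, t4, t5, t6, t7, t8] at e
  linarith

/-- The cyclic sum `X_{e ab ck} + X_{a be ck} + X_{b ea ck}` in terms of the divergence
of `X`. -/
theorem kulkarni_div {X : Fin 4 → Fin 4 → Fin 4 → Fin 4 → Fin 4 → ℝ}
    (D : ∀ p, WeylAlg h (X p)) (hk : ∀ p a b c k f l, kulkarni g (X p) a b c k f l = 0)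
    {δ : Fin 4 → Fin 4 → Fin 4 → ℝ} (hδ : ∀ a b c, δ a b c = ctr h fun p q => X p q a b c)
    (e a b c k : Fin 4) :
    X e a b c k + X a b e c k + X b e a c k
      = g e c * δ k a b - g e k * δ c a b + (g a c * δ k b e - g a k * δ c b e)
        + (g b c * δ k e a - g b k * δ c e a) := by
  -- In the identity for each `X p`, the derivative index `p` is traced with the last index of the
  -- second triple, which turns part of the terms into divergences.
  have h0 : ctr h (fun p f => kulkarni g (X p) a b e c k f) = 0 := by
    simp only [hk, ctr_zero]
  have t1 : ∀ e a b c k, ctr h (fun p f => g e f * X p a b c k) = X e a b c k :=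
    fun e a b c k => H.ctr_g_right e fun p => X p a b c k
  have t2 : ∀ k a b, ctr h (fun p f => X p a b f k) = δ k a b := fun k a b => by
    rw [hδ]; exact ctr_congr fun p q => (D p).pair _ _ _ _
  have t3 : ∀ k a b, ctr h (fun p f => X p a b k f) = -δ k a b := fun k a b => by
    rw [← t2, ← ctr_neg]; exact ctr_congr fun p q => (D p).anti₂ _ _ _ _
  simp only [kulkarni, ctr_add, ctr_mul_left, t1, t2, t3] at h0
  linarith

end Algebra

namespace Fields

namespace Setting

variable {u : Fields} {U : Set Pt} (S : u.Setting U)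
include S

theorem kulkarni_covD {x : Pt} (hx : x ∈ U) (p a b c k f l : Fin 4) :
    kulkarni (fun a b => u.g x ![a, b]) (fun a b c e => covD u.g u.d x ![p, a, b, c, e])
      a b c k f l = 0 :=
  S.kulkarni_of_weylAlg hx (S.covD_weyl hx p) a b c k f l

end Setting

namespace Solution

variable {u : Fields} {U : Set Pt} {src : GaugeSource} (S : u.Solution U src)
include S

variable {x : Pt} (hx : x ∈ U)
include hx

/-- In dimension four the cyclic sum carries no information beyond the divergence; this is the
counterpart for `d` of the curl equation for `L`. -/
theorem covD_d_cyc (e a b c k : Fin 4) : covD u.g u.d x ![e, a, b, c, k]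
    + covD u.g u.d x ![a, b, e, c, k] + covD u.g u.d x ![b, e, a, c, k]
    = u.g x ![e, c] * u.divd x ![k, a, b] - u.g x ![e, k] * u.divd x ![c, a, b]
      + (u.g x ![a, c] * u.divd x ![k, b, e] - u.g x ![a, k] * u.divd x ![c, b, e])
      + (u.g x ![b, c] * u.divd x ![k, e, a] - u.g x ![b, k] * u.divd x ![c, e, a]) :=
  kulkarni_div (S.setting.metAlg hx) (fun p => S.setting.covD_weyl hx p)
    (fun p => S.setting.kulkarni_covD hx p) (fun _ _ _ => rfl) e a b c k

/-- The derivative of `covD_d_cyc`; the metric factors pass through because `∇g = 0`. -/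
theorem covD_covD_d_cyc (p e a b c k : Fin 4) : covD u.g (covD u.g u.d) x ![p, e, a, b, c, k]
    = -covD u.g (covD u.g u.d) x ![p, a, b, e, c, k] - covD u.g (covD u.g u.d) x ![p, b, e, a, c, k]
      + (u.g x ![e, c] * covD u.g u.divd x ![p, k, a, b]
        - u.g x ![e, k] * covD u.g u.divd x ![p, c, a, b])
      + (u.g x ![a, c] * covD u.g u.divd x ![p, k, b, e]
        - u.g x ![a, k] * covD u.g u.divd x ![p, c, b, e])
      + (u.g x ![b, c] * covD u.g u.divd x ![p, k, e, a]
        - u.g x ![b, k] * covD u.g u.divd x ![p, c, e, a]) := by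
  have hU := S.setting.isOpen
  have sg := S.setting.smooth_g
  have sv := S.smooth_divd
  have sD := S.setting.smooth_covD S.setting.smooth_d
  have pr : ∀ {α : Fin 2 → Fin 5} {β : Fin 3 → Fin 5},
      Function.Bijective (Fin.append α β) → ∀ i : Fin 5 → Fin 4,
      covD u.g (fun y j => u.g y (j ∘ α) * u.divd y (j ∘ β)) x (Matrix.vecCons p i)
        = u.g x (i ∘ α) * covD u.g u.divd x (Matrix.vecCons p (i ∘ β)) := by
    intro α β h i
    rw [covD_mul hU sg sv h hx, covD_metric S.setting.metric hx, zero_mul, zero_add]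
  have sp : ∀ (α : Fin 2 → Fin 5) (β : Fin 3 → Fin 5),
      SmoothT U (fun y j => u.g y (j ∘ α) * u.divd y (j ∘ β)) :=
    fun α β i => (sg _).mul (sv _)
  have h1 : Function.Bijective (![1, 2, 0, 3, 4] : Fin 5 → Fin 5) := by decide
  have h2 : Function.Bijective (![2, 0, 1, 3, 4] : Fin 5 → Fin 5) := by decide
  have s1 := smooth_reindex sD (![1, 2, 0, 3, 4] : Fin 5 → Fin 5)
  have s2 := smooth_reindex sD (![2, 0, 1, 3, 4] : Fin 5 → Fin 5)
  set T₁ : Tensor 5 := fun y j => covD u.g u.d y j + covD u.g u.d y (j ∘ ![1, 2, 0, 3, 4])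
    + covD u.g u.d y (j ∘ ![2, 0, 1, 3, 4]) with hT₁
  set A : (Fin 2 → Fin 5) → (Fin 3 → Fin 5) → Tensor 5 := fun α β y j =>
    u.g y (j ∘ α) * u.divd y (j ∘ β) with hA
  have key : covD u.g T₁ x ![p, e, a, b, c, k]
      = covD u.g (fun y j => (A ![0, 3] ![4, 1, 2] y j - A ![0, 4] ![3, 1, 2] y j)
        + (A ![1, 3] ![4, 2, 0] y j - A ![1, 4] ![3, 2, 0] y j)
        + (A ![2, 3] ![4, 0, 1] y j - A ![2, 4] ![3, 0, 1] y j)) x ![p, e, a, b, c, k] := by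
    refine covD_congr hU (fun y hy i => ?_) hx _
    have i5 : i = ![i 0, i 1, i 2, i 3, i 4] := by funext j; fin_cases j <;> rfl
    have := S.covD_d_cyc hy (i 0) (i 1) (i 2) (i 3) (i 4)
    rw [← i5] at this
    simp only [hT₁, hA]
    generalize hc : covD u.g u.d y i = C at *
    rw [i5]
    simp only [comp_cons, comp_empty, Matrix.cons_val]
    exact this
  have sub : ∀ α β α' β', SmoothT U (fun y j => A α β y j - A α' β' y j) :=
    fun α β α' β' i => (sp α β i).sub (sp α' β' i)
  rw [hT₁, covD_add hU (T := fun y j => covD u.g u.d y j + covD u.g u.d y (j ∘ ![1, 2, 0, 3, 4]))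
      (fun i => (sD i).add (s1 i)) s2 hx, covD_add hU sD s1 hx, covD_reindex _ _ h1,
    covD_reindex _ _ h2,
    covD_add hU (T := fun y j => (A ![0, 3] ![4, 1, 2] y j - A ![0, 4] ![3, 1, 2] y j)
        + (A ![1, 3] ![4, 2, 0] y j - A ![1, 4] ![3, 2, 0] y j))
      (fun i => (sub _ _ _ _ i).add (sub _ _ _ _ i)) (sub _ _ _ _) hx,
    covD_add hU (sub _ _ _ _) (sub _ _ _ _) hx,
    covD_sub hU (sp _ _) (sp _ _) hx, covD_sub hU (sp _ _) (sp _ _) hx,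
    covD_sub hU (sp _ _) (sp _ _) hx,
    pr (by decide), pr (by decide), pr (by decide), pr (by decide), pr (by decide),
    pr (by decide)] at key
  simp only [comp_cons, comp_empty, Matrix.cons_val] at key
  linarith

/-- Commuting the derivatives in `∇^q ∇_a d_{qbck}`. -/
theorem div_covD_d (a b c k : Fin 4) :
    ctr (ginv u.g x) (fun p q => covD u.g (covD u.g u.d) x ![p, a, q, b, c, k])
      = covD u.g u.cotton x ![a, c, k, b]
        + ctr (ginv u.g x) (fun p q => u.L x ![a, p] * u.d x ![q, b, c, k])
        + ctr (ginv u.g x) (fun p q => u.L x ![b, p] * u.d x ![q, a, c, k])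
        + ctr (ginv u.g x) (fun p q => u.L x ![c, p] * u.d x ![q, b, a, k])
        + ctr (ginv u.g x) (fun p q => u.L x ![k, p] * u.d x ![q, b, c, a])
        + ctr (ginv u.g x) (fun p q => u.L x ![a, p] * u.d x ![q, k, c, b])
        + ctr (ginv u.g x) (fun p q => u.L x ![a, p] * u.d x ![q, c, b, k])
        + u.trL x * u.d x ![a, b, c, k]
        - u.g x ![c, a] * dctr (ginv u.g x) (fun p q => u.L x ![p, q])
          (fun p q => u.d x ![b, p, k, q])
        + u.g x ![k, a] * dctr (ginv u.g x) (fun p q => u.L x ![p, q])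
          (fun p q => u.d x ![b, p, c, q])
        - u.Xi x * dctr (ginv u.g x) (fun p q => u.d x ![a, p, b, q])
          (fun p q => u.d x ![c, k, p, q])
        - u.Xi x * dctr (ginv u.g x) (fun p q => u.d x ![a, p, c, q])
          (fun p q => u.d x ![k, q, b, p])
        + u.Xi x * dctr (ginv u.g x) (fun p q => u.d x ![a, p, k, q])
          (fun p q => u.d x ![c, q, b, p]) := by
  have H := S.setting.metAlg hx
  have D := S.setting.weylAlg hx
  have ls := S.setting.sym.L_symm x hx
  have sd := S.setting.smooth_d
  set h := ginv u.g x with hh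
  have trl : ctr h (fun a b => u.L x ![a, b]) = u.trL x := rfl
  have k0 := ctr_ctr_curvAlg_div (Ξ := u.Xi x) H D ls a fun r => u.d x ![r, b, c, k]
  have k1 := ctr_ctr_curvAlg (Ξ := u.Xi x) (d := fun a b c e => u.d x ![a, b, c, e])
    (L := fun a b => u.L x ![a, b]) H b a fun q r => u.d x ![q, r, c, k]
  have k2 := ctr_ctr_curvAlg (Ξ := u.Xi x) (d := fun a b c e => u.d x ![a, b, c, e])
    (L := fun a b => u.L x ![a, b]) H c a fun q r => u.d x ![q, b, r, k]
  have k3 := ctr_ctr_curvAlg (Ξ := u.Xi x) (d := fun a b c e => u.d x ![a, b, c, e])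
    (L := fun a b => u.L x ![a, b]) H k a fun q r => u.d x ![q, b, c, r]
  have da : ∀ q r, u.d x ![q, r, c, k] = -u.d x ![r, q, c, k] := fun q r => D.anti₁ _ _ _ _
  have z1 : ctr h (fun q r => u.d x ![q, r, c, k]) = 0 := H.ctr_antisymm da
  have z2 : ctr h (fun q r => u.d x ![q, b, r, k]) = 0 := D.tr₀₂ b k
  have z3 : ctr h (fun q r => u.d x ![q, b, c, r]) = 0 := D.tr₀₃ b c
  have z4 : ctr h (fun p q => ctr h fun r s => u.L x ![p, s] * u.d x ![q, r, c, k]) = 0 :=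
    ctr_ctr_symm_antisymm H ls da
  have y0 : ctr h (fun r s => u.L x ![a, s] * u.d x ![r, b, c, k])
      = ctr h fun p q => u.L x ![a, p] * u.d x ![q, b, c, k] := H.swap _
  have y1 : ctr h (fun r s => u.L x ![a, s] * u.d x ![b, r, c, k])
      = -ctr h fun p q => u.L x ![a, p] * u.d x ![q, b, c, k] := by
    rw [← ctr_neg, H.swap]; exact ctr_congr fun p q => by rw [D.anti₁]; ring
  have y2 : ctr h (fun r s => u.L x ![a, s] * u.d x ![c, b, r, k])
      = ctr h fun p q => u.L x ![a, p] * u.d x ![q, k, c, b] := by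
    rw [H.swap]; exact ctr_congr fun p q => by rw [D.pair]
  have y3 : ctr h (fun r s => u.L x ![a, s] * u.d x ![k, b, c, r])
      = ctr h fun p q => u.L x ![a, p] * u.d x ![q, c, b, k] := by
    rw [H.swap]
    exact ctr_congr fun p q => by rw [D.pair k b c q, D.anti₁ c q, D.anti₂ q c]; ring
  have y4 : ∀ b c k a, ctr h (fun p q => u.L x ![p, b] * u.d x ![q, a, c, k])
      = ctr h fun p q => u.L x ![b, p] * u.d x ![q, a, c, k] := fun b c k a =>
    ctr_congr fun p q => by rw [ls]
  have x1 : ctr h (fun p q => ctr h fun r s => u.L x ![p, s] * u.d x ![q, b, r, k])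
      = dctr h (fun p q => u.L x ![p, q]) fun p q => u.d x ![b, p, k, q] := by
    rw [H.swap]
    exact ctr_congr fun p q => ctr_congr fun r s => by rw [D.anti₁ p b, D.anti₂ b p]; ring
  have x2 : ctr h (fun p q => ctr h fun r s => u.L x ![p, s] * u.d x ![q, b, c, r])
      = -dctr h (fun p q => u.L x ![p, q]) fun p q => u.d x ![b, p, c, q] := by
    rw [H.swap, ← dctr_neg]
    exact ctr_congr fun p q => ctr_congr fun r s => by rw [D.anti₁ p b]
  have w1 : ctr h (fun p q => ctr h fun r s => u.d x ![s, b, p, a] * u.d x ![q, r, c, k])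
      = dctr h (fun p q => u.d x ![a, p, b, q]) fun p q => u.d x ![c, k, p, q] := by
    rw [H.swap]
    refine ctr_congr fun p q => ctr_congr fun r s => ?_
    rw [D.pair s b q a, D.anti₁ q a, D.anti₂ a q, D.pair p r]; ring
  have w2 : ctr h (fun p q => ctr h fun r s => u.d x ![s, c, p, a] * u.d x ![q, b, r, k])
      = dctr h (fun p q => u.d x ![a, p, c, q]) fun p q => u.d x ![k, q, b, p] := by
    rw [H.swap]
    refine ctr_congr fun p q => ctr_congr fun r s => ?_
    rw [D.pair s c q a, D.anti₁ q a, D.anti₂ a q, D.pair p b r k, D.anti₁ r k, D.anti₂ k r]; ring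
  have w3 : ctr h (fun p q => ctr h fun r s => u.d x ![s, k, p, a] * u.d x ![q, b, c, r])
      = -dctr h (fun p q => u.d x ![a, p, k, q]) fun p q => u.d x ![c, q, b, p] := by
    rw [H.swap, ← dctr_neg]
    refine ctr_congr fun p q => ctr_congr fun r s => ?_
    rw [D.pair s k q a, D.anti₁ q a, D.anti₂ a q, D.pair p b c r, D.anti₂ c r]; ring
  rw [z1, z4, y1, y4, w1] at k1
  rw [z2, x1, y2, y4, w2] at k2
  rw [z3, x2, y3, y4, w3] at k3
  rw [y0, trl] at k0
  have d0 : ctr h (fun p q => covD u.g (covD u.g u.d) x ![a, p, q, b, c, k])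
      = covD u.g u.cotton x ![a, c, k, b] := by
    rw [S.covD_cotton hx]
    have e := covD_tctr S.setting.metric (k := 3) (S.setting.smooth_covD sd) hx a ![b, c, k]
    rw [← e]
    refine covD_congr S.setting.isOpen (fun y hy i => ?_) hx _
    conv_lhs => rw [eq_triple i]
    rfl
  have hc : ctr h (fun p q => covD u.g (covD u.g u.d) x ![p, a, q, b, c, k])
      = ctr h (fun p q => covD u.g (covD u.g u.d) x ![a, p, q, b, c, k])
      - ctr h (fun p q => ctr h fun r s => u.K x ![s, q, p, a] * u.d x ![r, b, c, k])
      - ctr h (fun p q => ctr h fun r s => u.K x ![s, b, p, a] * u.d x ![q, r, c, k])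
      - ctr h (fun p q => ctr h fun r s => u.K x ![s, c, p, a] * u.d x ![q, b, r, k])
      - ctr h (fun p q => ctr h fun r s => u.K x ![s, k, p, a] * u.d x ![q, b, c, r]) := by
    rw [← ctr_sub, ← ctr_sub, ← ctr_sub, ← ctr_sub]
    exact ctr_congr fun p q => by linarith [S.setting.comm₄ hx sd p a q b c k]
  have q0 : ctr h (fun p q => ctr h fun r s => u.K x ![s, q, p, a] * u.d x ![r, b, c, k]) = _ := k0
  have q1 : ctr h (fun p q => ctr h fun r s => u.K x ![s, b, p, a] * u.d x ![q, r, c, k]) = _ := k1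
  have q2 : ctr h (fun p q => ctr h fun r s => u.K x ![s, c, p, a] * u.d x ![q, b, r, k]) = _ := k2
  have q3 : ctr h (fun p q => ctr h fun r s => u.K x ![s, k, p, a] * u.d x ![q, b, c, r]) = _ := k3
  rw [hc, q0, q1, q2, q3, d0]
  ring

/-- The evolution equation for the rescaled Weyl tensor. -/
theorem eq_d (a b c k : Fin 4) : box u.g u.d x ![a, b, c, k]
    = u.rhs_d src (covD u.g u.cotton) (covD u.g (dual u.g u.cotton)) x a b c k := by
  have H := S.setting.metAlg hx
  have D := S.setting.weylAlg hx
  have ls := S.setting.sym.L_symm x hx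
  have es := S.setting.emT_symm hx
  have hkz := S.setting.kulkarni_eq_zero hx
  set h := ginv u.g x with hh
  -- The trace of `covD_covD_d_cyc` over the two derivative indices expresses `□d` by two mixed
  -- divergences, evaluated in `div_covD_d`, and by derivatives of the Cotton tensor.
  have main : box u.g u.d x ![a, b, c, k]
      = ctr h (fun p q => covD u.g (covD u.g u.d) x ![p, a, q, b, c, k])
        - ctr h (fun p q => covD u.g (covD u.g u.d) x ![p, b, q, a, c, k])
        + (covD u.g u.cotton x ![c, a, b, k] - covD u.g u.cotton x ![k, a, b, c])
        + (u.g x ![a, c] * ctr h (fun p q => covD u.g u.cotton x ![p, b, q, k])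
          - u.g x ![a, k] * ctr h (fun p q => covD u.g u.cotton x ![p, b, q, c]))
        + (u.g x ![b, c] * ctr h (fun p q => covD u.g u.cotton x ![p, q, a, k])
          - u.g x ![b, k] * ctr h (fun p q => covD u.g u.cotton x ![p, q, a, c])) := by
    have e1 : ∀ p q, covD u.g (covD u.g u.d) x ![p, a, b, q, c, k]
        = -covD u.g (covD u.g u.d) x ![p, a, q, b, c, k] := by
      intro p q
      have := covD_of_antisymm (g := u.g) S.setting.isOpen
        (S.setting.smooth_covD S.setting.smooth_d) (ρ := ![0, 2, 1, 3, 4]) (by decide)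
        (fun y hy i => by
          have i5 : i = ![i 0, i 1, i 2, i 3, i 4] := by funext j; fin_cases j <;> rfl
          conv_lhs => rw [i5]
          rw [(S.setting.covD_weyl hy (i 0)).anti₁]; simp [comp_cons, comp_empty]) hx p
          ![a, b, q, c, k]
      simpa [comp_cons, comp_empty] using this
    have e2 : ∀ p q, covD u.g (covD u.g u.d) x ![p, q, a, b, c, k]
        = covD u.g (covD u.g u.d) x ![p, a, q, b, c, k]
        - covD u.g (covD u.g u.d) x ![p, b, q, a, c, k]
        + (u.g x ![q, c] * covD u.g u.cotton x ![p, a, b, k]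
          - u.g x ![q, k] * covD u.g u.cotton x ![p, a, b, c])
        + (u.g x ![a, c] * covD u.g u.cotton x ![p, b, q, k]
          - u.g x ![a, k] * covD u.g u.cotton x ![p, b, q, c])
        + (u.g x ![b, c] * covD u.g u.cotton x ![p, q, a, k]
          - u.g x ![b, k] * covD u.g u.cotton x ![p, q, a, c]) := by
      intro p q
      rw [S.covD_covD_d_cyc hx, e1]
      simp only [S.covD_cotton hx]
      ring
    rw [box_eq, ctr_congr fun p q => e2 p q]
    simp only [ctr_add, ctr_sub, ctr_mul_left]
    rw [H.ctr_g_right' c fun p => covD u.g u.cotton x ![p, a, b, k],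
      H.ctr_g_right' k fun p => covD u.g u.cotton x ![p, a, b, c]]
  -- The remaining Cotton derivatives are precisely the double dual term. The trace hypothesis holds
  -- because the divergence of `d` is trace-free.
  have dd := double_dual H (V := vol u.g x)
    (vol_mul_vol (S.setting.metric.det_neg x hx))
    (X := fun f p q e => covD u.g u.cotton x ![f, p, q, e])
    (fun f p q e => S.covD_cotton_antisymm hx f p q e) (fun f q => by
      rw [H.swap, ← S.covD_divd_trace hx f q]
      exact ctr_congr fun p e => S.covD_cotton hx f e q p) a b c k
  -- The identity contracted with `L` converts the products of `L` and `d` into `(tr L) d`.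
  -- Contracted with the trace-free energy-momentum tensor, in `kE`, it shows that the four terms
  -- with `Ξ²` in the displayed equation add up to zero.
  have kL := kulkarni_dctr H D hkz ls (P := fun a b c k => ctr h fun p q =>
    u.L x ![a, p] * u.d x ![q, b, c, k]) (fun a b c k => rfl)
    (E := fun b c => dctr h (fun p q => u.L x ![p, q]) fun p q => u.d x ![b, p, c, q])
    (fun b c => rfl) a b c k
  have kE := kulkarni_dctr H D hkz es (P := fun a b c k => ctr h fun p q =>
    u.emT x ![a, p] * u.d x ![q, b, c, k]) (fun a b c k => rfl)
    (E := fun b c => dctr h (fun p q => u.emT x ![p, q]) fun p q => u.d x ![b, p, c, q])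
    (fun b c => rfl) a b c k
  have trl : ctr h (fun a b => u.L x ![a, b]) = u.trL x := rfl
  rw [S.setting.emT_trace hx] at kE
  rw [trl] at kL
  obtain ⟨P, hP⟩ : ∃ P : Fin 4 → Fin 4 → Fin 4 → Fin 4 → ℝ, ∀ a b c k,
    (ctr h fun p q => u.L x ![a, p] * u.d x ![q, b, c, k]) = P a b c k := ⟨_, fun _ _ _ _ => rfl⟩
  have Pa : ∀ a b c k, P a b c k = -P a b k c := fun a b c k => by
    rw [← hP, ← hP, ← ctr_neg]; exact ctr_congr fun p q => by rw [D.anti₂]; ring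
  have Pc : ∀ a b c k, P a b c k + P a c k b + P a k b c = 0 := fun a b c k => by
    rw [← hP, ← hP, ← hP, ← ctr_add, ← ctr_add, ← ctr_zero (h := h)]
    exact ctr_congr fun p q => by linear_combination u.L x ![a, p] * D.cyc q b c k
  have q1 : ∀ a b, dctr h (fun p q => u.d x ![b, p, a, q]) (fun p q => u.d x ![c, k, p, q])
      = -dctr h (fun p q => u.d x ![a, p, b, q]) (fun p q => u.d x ![c, k, p, q]) := fun a b => by
    rw [dctr_transpose, ← dctr_neg]
    refine ctr_congr fun p q => ctr_congr fun r s => ?_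
    beta_reduce
    rw [D.pair b s a q, D.anti₂ c k r p]
  have q2 : ∀ c k, dctr h (fun p q => u.d x ![b, p, c, q]) (fun p q => u.d x ![k, q, a, p])
      = dctr h (fun p q => u.d x ![a, p, k, q]) (fun p q => u.d x ![c, q, b, p]) := fun c k => by
    rw [dctr_comm H.hs]
    refine ctr_congr fun p q => ctr_congr fun r s => ?_
    beta_reduce
    rw [D.pair k s a q, D.pair b p c r]
  -- the right-hand side
  have r1 : ∀ a b c k, ∑ f, up u.g 1 u.emT x ![a, f] * u.d x ![b, f, c, k]
      = -ctr h (fun p q => u.emT x ![a, p] * u.d x ![q, b, c, k]) := fun a b c k => by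
    simp only [up, upd₂₁, Matrix.cons_val]
    rw [sum_up, ← hh, ← ctr_neg, H.swap]
    exact ctr_congr fun p q => by rw [D.anti₁]; ring
  have r2 : ∀ k b, ∑ p, ∑ f, u.d x ![k, p, b, f] * u.emTup x ![f, p]
      = dctr h (fun p q => u.emT x ![p, q]) fun p q => u.d x ![b, p, k, q] := fun k b => by
    rw [Finset.sum_comm]
    simp only [emTup, up, upd₂₀, upd₂₁, Matrix.cons_val]
    rw [sum_up_up' (h := ginv u.g x) (fun a b => u.emT x ![a, b]) fun f p => u.d x ![k, p, b, f]]
    exact dctr_congr fun p q => D.pair _ _ _ _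
  have r3 : ∀ a b c k, ∑ f, ∑ e, up u.g 1 (up u.g 3 u.d) x ![a, f, c, e] * u.d x ![k, e, b, f]
      = dctr h (fun p q => u.d x ![a, p, c, q]) fun p q => u.d x ![k, q, b, p] :=
    fun a b c k => by
      simp only [up, upd₄₁, upd₄₃, Matrix.cons_val]
      rw [sum_up_up (h := ginv u.g x) (fun r s => u.d x ![a, r, c, s])
        fun f e => u.d x ![k, e, b, f]]
  have r4 : ∑ f, ∑ e, up u.g 1 (up u.g 3 u.d) x ![a, f, b, e] * u.d x ![c, k, f, e]
      = dctr h (fun p q => u.d x ![a, p, b, q]) fun p q => u.d x ![c, k, p, q] := by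
    simp only [up, upd₄₁, upd₄₃, Matrix.cons_val]
    rw [sum_up_up (h := ginv u.g x) (fun r s => u.d x ![a, r, b, s])
        fun f e => u.d x ![c, k, f, e]]
  have r5 : ∑ e, ∑ f, vol u.g x ![a, b, e, f]
        * up u.g 0 (up u.g 3 (covD u.g (dual u.g u.cotton))) x ![f, c, k, e]
      = ctr h (fun e e' => ctr h fun f f' => vol u.g x ![a, b, e, f]
        * ((1 / 2) * dctr h (fun p q => vol u.g x ![c, k, p, q])
          fun p q => covD u.g u.cotton x ![f', p, q, e'])) := by
    rw [Finset.sum_comm]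
    have u3 : ∀ r c k e s : Fin 4, Function.update ![r, c, k, e] (3 : Fin (3 + 1)) s
        = ![r, c, k, s] := upd₄₃
    simp only [up, update_cons_zero', u3, Matrix.cons_val]
    rw [sum_up_up' (h := ginv u.g x) (fun f e => covD u.g (dual u.g u.cotton) x ![f, c, k, e])
      fun f e => vol u.g x ![a, b, e, f]]
    unfold dctr
    rw [ctr_comm]
    refine ctr_congr fun e e' => ctr_congr fun f f' => ?_
    have := covD_dual S.setting.metric S.smooth_cotton hx f' c k e'
    exact (congrArg (· * vol u.g x ![a, b, e, f]) this).trans (mul_comm _ _)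
  rw [main, S.div_covD_d hx, S.div_covD_d hx b a]
  unfold rhs_d alt₂
  simp only [r1, r2, r3, r4]
  rw [r5, dd, q1 a b, q2 c k, q2 k c, S.setting.src_R_eq S.gauge hx]
  have da : u.d x ![b, a, c, k] = -u.d x ![a, b, c, k] := D.anti₁ _ _ _ _
  rw [da, H.gs c a, H.gs k a, H.gs c b, H.gs k b]
  simp only [← hh, hP] at kL ⊢
  linear_combination -kL + (1 / 2) * u.Xi x ^ 2 * kE - Pc a b c k + Pa a k c b + Pa a c b k
    + Pc b a c k - Pa b k c a - Pa b c a k + Pc c b a k - Pa c a k b - Pa c k b a + Pc k b c a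
    - Pa k a b c

end Solution

end Fields

end CEM
-- The reduced system on solutions of the conformal equations
namespace CEM

theorem box_congr {U : Set Pt} (hU : IsOpen U) {g : Tensor 2} {k : ℕ} {T S : Tensor k}
    (h : ∀ y ∈ U, ∀ i, T y i = S y i) {x : Pt} (hx : x ∈ U) (i : Fin k → Fin 4) :
    box g T x i = box g S x i := by
  unfold box
  refine Finset.sum_congr rfl fun a _ => Finset.sum_congr rfl fun b _ => ?_
  rw [covD_congr hU (fun y hy j => covD_congr hU h hy j) hx]

namespace Fields

theorem rhs_congr (u : Fields) (src : GaugeSource) {DT SDT DT' SDT' : Tensor 4} {x : Pt}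
    (h : ∀ i, DT x i = DT' x i) (h' : ∀ i, SDT x i = SDT' x i) (A : Slot) :
    u.rhs src DT SDT x A = u.rhs src DT' SDT' x A := by
  cases A <;> simp only [rhs, rhs_L, rhs_d, up, h, h']

theorem cottonLin_eq_zero (u : Fields) {v : Tensor 1} {x : Pt} (h : ∀ i, v x i = 0)
    (i : Fin 3 → Fin 4) : u.cottonLin v x i = 0 := by
  simp [cottonLin, alt₂, up, h]

theorem dual_eq_zero (g : Tensor 2) {T : Tensor 3} {x : Pt} (h : ∀ i, T x i = 0)
    (i : Fin 3 → Fin 4) : dual g T x i = 0 := by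
  simp [dual, h]

/-- The Hessian equation is `Υ = 0`, and the terms removed by the elimination are linear in `Υ`. -/
theorem eliminatedEq_iff_of_hess {u : Fields} {src : GaugeSource} {x : Pt}
    (h : ∀ a b, covD u.g (grad u.Xi) x ![a, b] =
      -u.Xi x * u.L x ![a, b] + u.s x * u.g x ![a, b] + (1 / 2) * u.Xi x ^ 3 * u.emT x ![a, b])
    (A : Slot) : u.EliminatedEq src A x ↔ u.ReducedEq src A x := by
  have hY : ∀ a b, u.Upsilon x ![a, b] = 0 := fun a b => by
    unfold Upsilon; rw [h]; ring
  have h1 : ∀ i, u.cottonUpsilon x i = 0 := fun i => u.cottonLin_eq_zero (fun _ => hY _ _) _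
  have h2 : ∀ i, u.dualCottonUpsilon x i = 0 := fun i => dual_eq_zero _ (fun _ => h1 _) _
  unfold EliminatedEq ReducedEq
  rw [u.rhs_congr src (DT' := covD u.g u.cotton) (SDT' := covD u.g (dual u.g u.cotton))
    (fun i => by rw [h1, sub_zero]) (fun i => by rw [h2, sub_zero])]

namespace Solution

variable {u : Fields} {U : Set Pt} {src : GaugeSource} (S : u.Solution U src)
include S

variable {x : Pt} (hx : x ∈ U)
include hx

/-- The reduced Einstein equation. -/
theorem eq_g (i : Fin 2 → Fin 4) :
    reducedRicci u.g src x i = 2 * u.L x i + (1 / 6) * src.R x * u.g x i := by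
  obtain ⟨a, b, rfl⟩ : ∃ a b, i = ![a, b] := ⟨_, _, eq_pair i⟩
  have h : ∀ b a, covDVec u.g (Gam u.g) x b a = covDVec u.g src.F x b a :=
    covDVec_congr S.setting.isOpen (fun y hy => (S.gauge y hy).2) hx
  unfold reducedRicci
  simp only [h]
  rw [S.setting.ricci_eq hx, S.setting.src_R_eq S.gauge hx]
  ring

/-- `box_F` with vanishing `M`; vanishing on the open set gives vanishing derivatives. -/
theorem eq_F (b c : Fin 4) : box u.g u.F x ![b, c]
    = 2 * u.trL x * u.F x ![b, c] - 2 * u.Xi x * u.Fd x ![b, c] := by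
  have hU := S.setting.isOpen
  have h1 : ∀ i, covD u.g u.M₁ x i = 0 := fun i => by
    rw [covD_congr hU (S := fun _ _ => 0) S.m₁ hx, covD_zero]
  have h3 : ∀ i, covD u.g u.M₃ x i = 0 := fun i => by
    rw [covD_congr hU (S := fun _ _ => 0) S.m₃ hx, covD_zero]
  rw [S.setting.box_F hx]
  simp only [h1, h3, ctr_zero]
  ring

/-- `box_covD_F` with `M₁` and `M₃` zero, `∇F` renamed to `H`, and the divergence of `d` replaced by
the Cotton tensor. -/
theorem eq_H (a b c : Fin 4) : box u.g u.H x ![a, b, c] = u.rhs_H src x a b c := by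
  have hH : ∀ y ∈ U, ∀ i, u.H y i = covD u.g u.F y i := fun y hy i => sub_eq_zero.1 (S.q₃ y hy i)
  rw [box_congr S.setting.isOpen hH hx,
    S.setting.box_covD_F hx S.gauge (fun y hy b c => S.eq_F hy b c), rhs_H_eq,
    S.setting.src_R_eq S.gauge hx]
  simp only [auxH, alt₂, up, hH x hx, S.div x hx, S.m₁ x hx, S.m₃ x hx, mul_zero, zero_mul,
    Finset.sum_const_zero]
  ring

theorem reducedEq (A : Slot) : u.ReducedEq src A x := by
  have hb := @Setting.blackBox_eq u U S.setting src S.gauge x hx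
  cases A with
  | Xi => exact S.eq_Xi hx
  | s => exact S.eq_s hx
  | L i =>
    refine (hb _ _).trans ?_
    conv_lhs => rw [eq_pair i]
    exact S.eq_L hx _ _
  | d i =>
    refine (hb _ _).trans ?_
    conv_lhs => rw [eq_quad i]
    exact S.eq_d hx _ _ _ _
  | g i => exact S.eq_g hx i
  | F i =>
    refine (hb _ _).trans ?_
    conv_lhs => rw [eq_pair i]
    exact (S.eq_F hx _ _).trans (S.setting.rhs_F_eq S.gauge hx _ _).symm
  | H i =>
    refine (hb _ _).trans ?_
    conv_lhs => rw [eq_triple i]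
    exact S.eq_H hx _ _ _

end Solution

/-- Solutions of the conformal Einstein-Maxwell equations satisfy the reduced system. -/
theorem reduced_of_conformalEinsteinMaxwell {U : Set Pt} {u : Fields} {src : GaugeSource} {lam : ℝ}
    (hU : IsOpen U) (reg : u.RegularOn U) (sym : u.SymmetricOn U) (hg : InGauge U u.g src)
    (hE : u.IsConformalEinsteinMaxwell U lam) (hq : ∀ x ∈ U, ∀ i, u.Q₃ x i = 0) {x : Pt}
    (hx : x ∈ U) : (∀ i, u.cottonDef x i = u.cotton x i) ∧
      ∀ A, u.ReducedEq src A x ∧ u.EliminatedEq src A x := by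
  have S : u.Setting U := ⟨hU, reg, sym, hE.cfe₆⟩
  have hc : ∀ y ∈ U, ∀ i, u.cottonDef y i = u.cotton y i := fun y hy i =>
    S.cottonDef_eq hy (hE.maxwell₂ y hy) (hq y hy) i
  have hS : u.Solution U src := by
    refine ⟨S, hg, hE.cfe₁, fun y hy a => ?_, fun y hy a b c => ?_, hE.maxwell₁, hE.maxwell₂, hq⟩
    · rw [hE.cfe₂ y hy, sum_gradUp, sum_gradUp']
    · have h := S.Lambda_eq hy a b c
      unfold Lambda at h
      rw [← hc y hy]
      have h4 := hE.cfe₄ y hy a b c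
      simp only [Matrix.cons_val] at h
      linarith
  exact ⟨hc x hx, fun A => ⟨hS.reducedEq hx A,
    (eliminatedEq_iff_of_hess (hE.cfe₁ x hx) A).2 (hS.reducedEq hx A)⟩⟩

end Fields

end CEM
namespace CEM

/-! ### Polynomial expressions in the jet of the unknowns -/

/-- The data at a point of the coordinate patch are regular. -/
structure RegularAt (U : Set Pt) (u : Fields) (src : GaugeSource) (x : Pt) : Prop where
  isOpen : IsOpen U
  reg : u.RegularOn U
  smooth : src.SmoothOn U
  mem : x ∈ U

theorem RegularAt.metric {U : Set Pt} {u : Fields} {src : GaugeSource} {x : Pt}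
    (h : RegularAt U u src x) : IsMetricOn U u.g :=
  isMetricOn_of_regular h.isOpen h.reg

/-- The expression `f` is a universal polynomial in the components of `jet`. -/
def IsPoly (f : Fields → GaugeSource → Pt → ℝ) : Prop :=
  ∃ p : MvPolynomial JetVar ℝ, ∀ U u src x, RegularAt U u src x →
    f u src x = MvPolynomial.eval (jet u src x) p

namespace IsPoly

variable {f g : Fields → GaugeSource → Pt → ℝ}

theorem congr (hf : IsPoly f) (h : ∀ U u src x, RegularAt U u src x → g u src x = f u src x) :
    IsPoly g := by
  obtain ⟨p, hp⟩ := hf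
  exact ⟨p, fun U u src x hx => (h U u src x hx).trans (hp U u src x hx)⟩

theorem const (c : ℝ) : IsPoly fun _ _ _ => c := ⟨MvPolynomial.C c, by simp⟩

theorem var (v : JetVar) : IsPoly fun u src x => jet u src x v := ⟨MvPolynomial.X v, by simp⟩

theorem add (hf : IsPoly f) (hg : IsPoly g) : IsPoly fun u src x => f u src x + g u src x := by
  obtain ⟨p, hp⟩ := hf
  obtain ⟨q, hq⟩ := hg
  exact ⟨p + q, fun U u src x h => by rw [map_add, ← hp U u src x h, ← hq U u src x h]⟩

theorem mul (hf : IsPoly f) (hg : IsPoly g) : IsPoly fun u src x => f u src x * g u src x := by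
  obtain ⟨p, hp⟩ := hf
  obtain ⟨q, hq⟩ := hg
  exact ⟨p * q, fun U u src x h => by rw [map_mul, ← hp U u src x h, ← hq U u src x h]⟩

theorem neg (hf : IsPoly f) : IsPoly fun u src x => -f u src x :=
  ((const (-1)).mul hf).congr fun _ _ _ _ _ => by ring

theorem sub (hf : IsPoly f) (hg : IsPoly g) : IsPoly fun u src x => f u src x - g u src x :=
  (hf.add hg.neg).congr fun _ _ _ _ _ => by ring

theorem pow (hf : IsPoly f) (n : ℕ) : IsPoly fun u src x => f u src x ^ n := by
  obtain ⟨p, hp⟩ := hf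
  exact ⟨p ^ n, fun U u src x h => by rw [map_pow, ← hp U u src x h]⟩

theorem sum {ι : Type*} [Fintype ι] {f : ι → Fields → GaugeSource → Pt → ℝ}
    (hf : ∀ i, IsPoly (f i)) : IsPoly fun u src x => ∑ i, f i u src x := by
  choose p hp using hf
  exact ⟨∑ i, p i, fun U u src x h => by
    rw [map_sum]; exact Finset.sum_congr rfl fun i _ => hp i U u src x h⟩

theorem alt₂ {a b : Fin 4} {f : Fields → GaugeSource → Pt → Fin 4 → Fin 4 → ℝ}
    (hf : ∀ a b, IsPoly fun u src x => f u src x a b) :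
    IsPoly fun u src x => CEM.alt₂ a b (f u src x) :=
  ((const (1 / 2)).mul ((hf a b).sub (hf b a))).congr fun _ _ _ _ _ => by
    unfold CEM.alt₂; ring

theorem sym₂ {a b : Fin 4} {f : Fields → GaugeSource → Pt → Fin 4 → Fin 4 → ℝ}
    (hf : ∀ a b, IsPoly fun u src x => f u src x a b) :
    IsPoly fun u src x => CEM.sym₂ a b (f u src x) :=
  ((const (1 / 2)).mul ((hf a b).add (hf b a))).congr fun _ _ _ _ _ => by
    unfold CEM.sym₂; ring

theorem ginv (a b : Fin 4) : IsPoly fun u _ x => CEM.ginv u.g x a b := var (.ginv a b)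

theorem up {k : ℕ} {T : Fields → GaugeSource → Tensor k} {m : Fin k} {i : Fin k → Fin 4}
    (hT : ∀ i, IsPoly fun u src x => T u src x i) :
    IsPoly fun u src x => CEM.up u.g m (T u src) x i :=
  sum fun _ => (ginv _ _).mul (hT _)

theorem ctr {f : Fields → GaugeSource → Pt → Fin 4 → Fin 4 → ℝ}
    (hf : ∀ a b, IsPoly fun u src x => f u src x a b) :
    IsPoly fun u src x => CEM.ctr (CEM.ginv u.g x) (f u src x) :=
  sum fun _ => sum fun _ => (ginv _ _).mul (hf _ _)

theorem christoffel (a b c : Fin 4) : IsPoly fun u _ x => CEM.christoffel u.g x a b c :=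
  (const _).mul (sum fun r => (ginv a r).mul
    (((var (.der b (.g ![r, c]))).add (var (.der c (.g ![b, r])))).sub
      (var (.der r (.g ![b, c])))))

end IsPoly

/-- The expression `f` is smooth, and it and its first derivatives are universal polynomials in
the components of `jet`. -/
structure IsPoly₁ (f : Fields → GaugeSource → Pt → ℝ) : Prop where
  isPoly : IsPoly f
  smooth : ∀ U u src x, RegularAt U u src x → ContDiffOn ℝ ∞ (f u src) U
  pd : ∀ m, IsPoly fun u src x => pd m (f u src) x

namespace IsPoly₁

variable {f g : Fields → GaugeSource → Pt → ℝ}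

theorem diffAt (hf : IsPoly₁ f) {U : Set Pt} {u : Fields} {src : GaugeSource} {x : Pt}
    (h : RegularAt U u src x) : DifferentiableAt ℝ (f u src) x :=
  CEM.diffAt h.isOpen (hf.smooth U u src x h) h.mem

theorem const (c : ℝ) : IsPoly₁ fun _ _ _ => c where
  isPoly := .const c
  smooth _ _ _ _ _ := contDiffOn_const
  pd _ := (IsPoly.const 0).congr fun _ _ _ _ _ => pd_const _ _ _

theorem add (hf : IsPoly₁ f) (hg : IsPoly₁ g) : IsPoly₁ fun u src x => f u src x + g u src x where
  isPoly := hf.isPoly.add hg.isPoly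
  smooth U u src x h := (hf.smooth U u src x h).add (hg.smooth U u src x h)
  pd m := ((hf.pd m).add (hg.pd m)).congr fun _ _ _ _ h => pd_add (hf.diffAt h) (hg.diffAt h)

theorem mul (hf : IsPoly₁ f) (hg : IsPoly₁ g) : IsPoly₁ fun u src x => f u src x * g u src x where
  isPoly := hf.isPoly.mul hg.isPoly
  smooth U u src x h := (hf.smooth U u src x h).mul (hg.smooth U u src x h)
  pd m := (((hf.pd m).mul hg.isPoly).add (hf.isPoly.mul (hg.pd m))).congr
    fun _ _ _ _ h => pd_mul (hf.diffAt h) (hg.diffAt h)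

/-- In contrast to `IsPoly.congr`, equality is required everywhere, since derivatives see a
neighbourhood. -/
theorem congr (hf : IsPoly₁ f) (h : ∀ u src x, g u src x = f u src x) : IsPoly₁ g := by
  rwa [show g = f from funext fun u => funext fun src => funext fun x => h u src x]

theorem neg (hf : IsPoly₁ f) : IsPoly₁ fun u src x => -f u src x :=
  ((const (-1)).mul hf).congr fun _ _ _ => by ring

theorem sub (hf : IsPoly₁ f) (hg : IsPoly₁ g) : IsPoly₁ fun u src x => f u src x - g u src x :=
  (hf.add hg.neg).congr fun _ _ _ => by ring

theorem sum {ι : Type*} [Fintype ι] {f : ι → Fields → GaugeSource → Pt → ℝ}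
    (hf : ∀ i, IsPoly₁ (f i)) : IsPoly₁ fun u src x => ∑ i, f i u src x where
  isPoly := .sum fun i => (hf i).isPoly
  smooth U u src x h := ContDiffOn.sum fun i _ => (hf i).smooth U u src x h
  pd m := (IsPoly.sum fun i => (hf i).pd m).congr fun _ _ _ _ h => pd_sum fun i _ => (hf i).diffAt h

theorem alt₂ {a b : Fin 4} {f : Fields → GaugeSource → Pt → Fin 4 → Fin 4 → ℝ}
    (hf : ∀ a b, IsPoly₁ fun u src x => f u src x a b) :
    IsPoly₁ fun u src x => CEM.alt₂ a b (f u src x) :=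
  ((const (1 / 2)).mul ((hf a b).sub (hf b a))).congr fun _ _ _ => by
    unfold CEM.alt₂; ring

theorem comp (A : Slot) : IsPoly₁ fun u _ x => u.comp A x where
  isPoly := .var (.val A)
  smooth _ _ _ _ h := h.reg.1 A
  pd m := .var (.der m A)

theorem Xi : IsPoly₁ fun u _ x => u.Xi x := comp .Xi
theorem s : IsPoly₁ fun u _ x => u.s x := comp .s
theorem L (i : Fin 2 → Fin 4) : IsPoly₁ fun u _ x => u.L x i := comp (.L i)
theorem d (i : Fin 4 → Fin 4) : IsPoly₁ fun u _ x => u.d x i := comp (.d i)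
theorem metric (i : Fin 2 → Fin 4) : IsPoly₁ fun u _ x => u.g x i := comp (.g i)
theorem F (i : Fin 2 → Fin 4) : IsPoly₁ fun u _ x => u.F x i := comp (.F i)
theorem H (i : Fin 3 → Fin 4) : IsPoly₁ fun u _ x => u.H x i := comp (.H i)

/-- The derivative of `g⁻¹` is polynomial in `g⁻¹` and `∂g`. With `g⁻¹` among the variables, no
division by the determinant is ever needed. -/
theorem ginv (a b : Fin 4) : IsPoly₁ fun u _ x => CEM.ginv u.g x a b where
  isPoly := .ginv a b
  smooth _ _ _ _ h := h.metric.smooth_ginv a b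
  pd m := (((IsPoly.sum fun r => (IsPoly.christoffel a m r).mul (.ginv r b)).neg).sub
    (IsPoly.sum fun r => (IsPoly.christoffel b m r).mul (.ginv a r))).congr
      fun _ _ _ _ h => h.metric.pd_ginv h.mem m a b

theorem srcR : IsPoly₁ fun _ src x => src.R x where
  isPoly := .var .R
  smooth _ _ _ _ h := h.smooth.1
  pd m := .var (.dR m)

theorem grad_srcR (i : Fin 1 → Fin 4) : IsPoly₁ fun _ src x => grad src.R x i where
  isPoly := .var (.dR (i 0))
  smooth _ _ _ _ h := smooth_pd h.isOpen h.smooth.1 _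
  pd m := .var (.ddR m (i 0))

theorem srcF (a : Fin 4) : IsPoly₁ fun _ src x => src.F x a where
  isPoly := .var (.srcF a)
  smooth _ _ _ _ h := h.smooth.2 a
  pd m := .var (.dsrcF m a)

theorem up {k : ℕ} {T : Fields → GaugeSource → Tensor k} {m : Fin k} {i : Fin k → Fin 4}
    (hT : ∀ i, IsPoly₁ fun u src x => T u src x i) :
    IsPoly₁ fun u src x => CEM.up u.g m (T u src) x i :=
  sum fun _ => (ginv _ _).mul (hT _)

/-- One derivative of an expression of order zero stays in the first jet; the covariant derivative
of an expression that already contains derivatives is not covered. -/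
theorem covD {k : ℕ} {T : Fields → GaugeSource → Tensor k} {i : Fin (k + 1) → Fin 4}
    (hT : ∀ i, IsPoly₁ fun u src x => T u src x i) :
    IsPoly fun u src x => CEM.covD u.g (T u src) x i :=
  ((hT _).pd _).sub (.sum fun _ => .sum fun _ => (IsPoly.christoffel _ _ _).mul (hT _).isPoly)

theorem FF : IsPoly₁ fun u _ x => u.FF x :=
  sum fun _ => sum fun _ => (F _).mul (up (T := fun u _ => CEM.up u.g 1 u.F) fun _ => up F)

theorem emT (i : Fin 2 → Fin 4) : IsPoly₁ fun u _ x => u.emT x i :=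
  (sum fun _ => (F _).mul (up F)).sub (((const _).mul (metric _)).mul FF)

theorem Fup (i : Fin 2 → Fin 4) : IsPoly₁ fun u _ x => u.Fup x i :=
  up (T := fun u _ => CEM.up u.g 1 u.F) fun _ => up F

theorem cottonAlg (i : Fin 3 → Fin 4) : IsPoly₁ fun u _ x => u.cottonAlg x i :=
  ((Xi.mul (alt₂ fun _ _ => sum fun _ => (up F).mul (H _))).sub
    (((const _).mul Xi).mul (sum fun _ => (up F).mul (H _)))).add
    (((const _).mul Xi).mul (alt₂ fun _ _ => (metric _).mul (sum fun _ => sum fun _ =>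
      (Fup _).mul (H _))))

theorem cottonLin {v : Fields → GaugeSource → Tensor 1}
    (hv : ∀ i, IsPoly₁ fun u src x => v u src x i) (i : Fin 3 → Fin 4) :
    IsPoly₁ fun u src x => u.cottonLin (v u src) x i :=
  (((const _).mul (alt₂ fun _ _ => (sum fun _ => (F _).mul (up F)).mul (hv _))).add
    (FF.mul (alt₂ fun _ _ => (metric _).mul (hv _)))).sub
    (alt₂ fun _ _ => (metric _).mul (sum fun _ => sum fun _ => ((up F).mul (F _)).mul (up hv)))

end IsPoly₁

end CEM
namespace CEM

/-! ### Second derivatives of the metric in the reduced operators -/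

/-- `∂_a ∂_b g_{ce}`. -/
noncomputable def ddg (g : Tensor 2) (x : Pt) (a b c e : Fin 4) : ℝ :=
  pd a (pd b fun y => g y ![c, e]) x

/-- The part of `∂_m Γ^a_{bc}` which contains second derivatives of the metric. -/
noncomputable def ddChr (g : Tensor 2) (x : Pt) (m a b c : Fin 4) : ℝ :=
  (1 / 2) * ∑ r, ginv g x a r * (ddg g x m b r c + ddg g x m c b r - ddg g x m r b c)

/-- `g^{ce} ∂_c ∂_b g_{ea}`. -/
noncomputable def ddgDiv (g : Tensor 2) (x : Pt) (a b : Fin 4) : ℝ :=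
  ctr (ginv g x) fun c e => ddg g x c b e a

/-- `g^{ce} ∂_c ∂_e g_{ab}`. -/
noncomputable def ddgWave (g : Tensor 2) (x : Pt) (a b : Fin 4) : ℝ :=
  ctr (ginv g x) fun c e => ddg g x c e a b

/-- `g^{ce} ∂_a ∂_b g_{ce}`. -/
noncomputable def ddgTr (g : Tensor 2) (x : Pt) (a b : Fin 4) : ℝ :=
  ctr (ginv g x) fun c e => ddg g x a b c e

namespace IsMetricOn

variable {U : Set Pt} {g : Tensor 2} (hg : IsMetricOn U g) {x : Pt} (hx : x ∈ U)
include hg hx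

theorem metAlg : MetAlg (ginv g x) fun a b => g x ![a, b] where
  hs := hg.ginv_symm hx
  gs := hg.symm x hx
  inv := hg.mul_ginv hx

theorem ddg_comm (a b c e : Fin 4) : ddg g x a b c e = ddg g x b a c e :=
  pd_comm hg.isOpen (hg.smooth ![c, e]) hx a b

theorem ddg_symm (a b c e : Fin 4) : ddg g x a b c e = ddg g x a b e c :=
  pd_congr hg.isOpen (fun _ hy => pd_congr hg.isOpen (fun z hz => hg.symm z hz c e) hy b) hx a

/-- As for the Christoffel symbols themselves: lowering the index cancels the inverse metric. Every
combination below then reduces to the three traces `ddgDiv`, `ddgWave` and `ddgTr`. -/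
theorem lower_ddChr (s m b c : Fin 4) : ∑ a, g x ![a, s] * ddChr g x m a b c
    = (1 / 2) * (ddg g x m b s c + ddg g x m c b s - ddg g x m s b c) := by
  unfold ddChr
  set W : Fin 4 → ℝ := fun r => ddg g x m b r c + ddg g x m c b r - ddg g x m r b c with hW
  change ∑ a, g x ![a, s] * (1 / 2 * ∑ r, ginv g x a r * W r) = 1 / 2 * W s
  have h : ∀ a, g x ![a, s] * (1 / 2 * ∑ r, ginv g x a r * W r)
      = 1 / 2 * ∑ r, (g x ![s, a] * ginv g x a r) * W r := by
    intro a; rw [hg.symm x hx a s, Finset.mul_sum, Finset.mul_sum, Finset.mul_sum]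
    exact Finset.sum_congr rfl fun r _ => by ring
  simp_rw [h]
  rw [← Finset.mul_sum, Finset.sum_comm]
  simp_rw [← Finset.sum_mul, hg.mul_ginv hx]
  simp

theorem sum_ddChr₁ (t l : Fin 4) : ∑ c, ddChr g x c c l t
    = (1 / 2) * (ddgDiv g x t l + ddgDiv g x l t - ddgWave g x l t) := by
  unfold ddChr ddgDiv ddgWave
  rw [← Finset.mul_sum, ← ctr_add, ← ctr_sub]
  simp only [fun c r => hg.ddg_symm hx c t l r]
  rfl

theorem sum_ddChr₂ (t l : Fin 4) : ∑ c, ddChr g x l c c t = (1 / 2) * ddgTr g x l t := by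
  have h : ∑ c, ddChr g x l c c t = (1 / 2) * ctr (ginv g x) fun c r =>
      ddg g x l c r t + ddg g x l t c r - ddg g x l r c t := by
    unfold ddChr; rw [← Finset.mul_sum]; rfl
  rw [h, ctr_sub, ctr_add, (hg.metAlg hx).swap fun c r => ddg g x l c r t]
  unfold ddgTr
  ring

theorem ctr_ddChr_lower (t l : Fin 4) :
    ∑ a, g x ![a, t] * ctr (ginv g x) (fun b c => ddChr g x l a b c)
      = ddgDiv g x t l - (1 / 2) * ddgTr g x l t := by
  have h : ∑ a, g x ![a, t] * ctr (ginv g x) (fun b c => ddChr g x l a b c)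
      = ctr (ginv g x) fun b c => ∑ a, g x ![a, t] * ddChr g x l a b c := by
    simp only [ctr, Finset.mul_sum]
    rw [Finset.sum_comm]
    refine Finset.sum_congr rfl fun b _ => ?_
    rw [Finset.sum_comm]
    exact Finset.sum_congr rfl fun c _ => Finset.sum_congr rfl fun a _ => by ring
  have e1 : ctr (ginv g x) (fun b c => ddg g x l b t c) = ddgDiv g x t l := by
    unfold ddgDiv
    exact ctr_congr fun b c => by rw [hg.ddg_comm hx, hg.ddg_symm hx]
  have e2 : ctr (ginv g x) (fun b c => ddg g x l c b t) = ddgDiv g x t l := by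
    unfold ddgDiv
    rw [(hg.metAlg hx).swap]
    exact ctr_congr fun b c => by rw [hg.ddg_comm hx]
  rw [h, ctr_congr fun b c => hg.lower_ddChr hx t l b c, ctr_mul_left, ctr_sub, ctr_add, e1, e2]
  unfold ddgTr
  ring

/-- The contribution of `□` to one tensor slot, written in the three basic traces so that it can be
compared with the Ricci and gauge terms. -/
theorem ctr_ddChr_lower' (t l : Fin 4) :
    ∑ r, g x ![r, t] * ctr (ginv g x) (fun a b => ddChr g x a r b l)
      = (1 / 2) * (ddgWave g x t l + ddgDiv g x t l - ddgDiv g x l t) := by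
  have h : ∑ r, g x ![r, t] * ctr (ginv g x) (fun a b => ddChr g x a r b l)
      = ctr (ginv g x) fun a b => ∑ r, g x ![r, t] * ddChr g x a r b l := by
    simp only [ctr, Finset.mul_sum]
    rw [Finset.sum_comm]
    refine Finset.sum_congr rfl fun b _ => ?_
    rw [Finset.sum_comm]
    exact Finset.sum_congr rfl fun c _ => Finset.sum_congr rfl fun a _ => by ring
  rw [h, ctr_congr fun a b => hg.lower_ddChr hx t a b l, ctr_mul_left, ctr_sub, ctr_add]
  rfl

end IsMetricOn

namespace IsPoly

/-- The derivative falling on `g⁻¹` stays in the first jet; the rest is `ddChr`. -/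
theorem pd_christoffel (m a b c : Fin 4) : IsPoly fun u _ x =>
    pd m (fun y => CEM.christoffel u.g y a b c) x - ddChr u.g x m a b c := by
  refine ((const (1 / 2)).mul (sum fun r => ((IsPoly₁.ginv a r).pd m).mul
    ((((IsPoly₁.metric ![r, c]).pd b).add ((IsPoly₁.metric ![b, r]).pd c)).sub
      ((IsPoly₁.metric ![b, c]).pd r)))).congr fun U u src x h => ?_
  have hU := h.isOpen
  have sg := h.metric.smooth
  have sp : ∀ i m, DifferentiableAt ℝ (pd m fun y => u.g y i) x := fun i m =>
    CEM.diffAt hU (smooth_pd hU (sg i) m) h.mem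
  have sh : ∀ r, DifferentiableAt ℝ (fun y => CEM.ginv u.g y a r) x := fun r =>
    (IsPoly₁.ginv a r).diffAt h
  have sW : ∀ r, DifferentiableAt ℝ (fun y => pd b (fun y => u.g y ![r, c]) y
      + pd c (fun y => u.g y ![b, r]) y - pd r (fun y => u.g y ![b, c]) y) x := fun r =>
    ((sp _ _).add (sp _ _)).sub (sp _ _)
  have sm : ∀ r, DifferentiableAt ℝ (fun y => CEM.ginv u.g y a r *
      (pd b (fun y => u.g y ![r, c]) y + pd c (fun y => u.g y ![b, r]) y
        - pd r (fun y => u.g y ![b, c]) y)) x := fun r => (sh r).mul (sW r)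
  unfold CEM.christoffel ddChr ddg
  rw [pd_const_mul _ (DifferentiableAt.fun_sum fun r _ => sm r), pd_sum fun r _ => sm r, ← mul_sub, ← Finset.sum_sub_distrib]
  congr 1
  refine Finset.sum_congr rfl fun r _ => ?_
  rw [pd_mul (sh r) (sW r), pd_sub (f := fun y => pd b (fun y => u.g y ![r, c]) y
    + pd c (fun y => u.g y ![b, r]) y) ((sp _ _).add (sp _ _)) (sp _ _), pd_add (sp _ _) (sp _ _)]
  ring

/-- Only the two `∂Γ` terms of the curvature matter modulo first-jet polynomials, and they are
evaluated by `sum_ddChr₁` and `sum_ddChr₂`. -/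
theorem ricci (t l : Fin 4) : IsPoly fun u _ x => CEM.ricci u.g x ![t, l]
    - (1 / 2) * (ddgDiv u.g x t l + ddgDiv u.g x l t - ddgWave u.g x l t - ddgTr u.g x l t) := by
  refine ((sum fun c => ((pd_christoffel c c l t).sub (pd_christoffel l c c t)).add
    (sum fun e => ((christoffel c c e).mul (christoffel e l t)).sub
      ((christoffel c l e).mul (christoffel e c t))))).congr fun U u src x h => ?_
  have h1 := h.metric.sum_ddChr₁ h.mem t l
  have h2 := h.metric.sum_ddChr₂ h.mem t l
  simp only [Finset.sum_add_distrib, Finset.sum_sub_distrib] at *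
  simp only [CEM.ricci, curv, Matrix.cons_val, Finset.sum_add_distrib, Finset.sum_sub_distrib]
  linarith

theorem pd_Gam (l a : Fin 4) : IsPoly fun u _ x => pd l (fun y => Gam u.g y a) x
    - CEM.ctr (CEM.ginv u.g x) (fun b c => ddChr u.g x l a b c) := by
  refine (sum fun b => sum fun c => (((IsPoly₁.ginv b c).pd l).mul (christoffel a b c)).add
    ((ginv b c).mul (pd_christoffel l a b c))).congr fun U u src x h => ?_
  unfold Gam CEM.ctr
  rw [pd_sum_sum_mul (fun b c => (IsPoly₁.ginv b c).diffAt h)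
    fun b c => CEM.diffAt h.isOpen (h.metric.smooth_christoffel a b c) h.mem]
  simp only [← Finset.sum_sub_distrib]
  exact Finset.sum_congr rfl fun b _ => Finset.sum_congr rfl fun c _ => by ring

theorem Gam (a : Fin 4) : IsPoly fun u _ x => CEM.Gam u.g x a :=
  sum fun _ => sum fun _ => (ginv _ _).mul (christoffel _ _ _)

/-- The contribution of `∇_l Γ^a`. -/
theorem covDVec_Gam (t l : Fin 4) : IsPoly fun u _ x =>
    ∑ a, u.g x ![a, t] * covDVec u.g (CEM.Gam u.g) x l a
      - (ddgDiv u.g x t l - (1 / 2) * ddgTr u.g x l t) := by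
  refine (sum fun a => (IsPoly₁.metric ![a, t]).isPoly.mul ((pd_Gam l a).add
    (sum fun c => (christoffel a l c).mul (Gam c)))).congr fun U u src x h => ?_
  rw [← h.metric.ctr_ddChr_lower h.mem, ← Finset.sum_sub_distrib]
  exact Finset.sum_congr rfl fun a _ => by unfold covDVec; ring

theorem covDVec_srcF (l a : Fin 4) : IsPoly fun u src x => covDVec u.g src.F x l a :=
  ((IsPoly₁.srcF a).pd l).add (sum fun c => (christoffel a l c).mul (IsPoly₁.srcF c).isPoly)

/-- The generalised wave gauge mechanism: the symmetrised `∇Γ` removes the divergence and trace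
terms of the Ricci tensor, leaving `-½` times the wave operator on the metric component. -/
theorem reducedRicci (i : Fin 2 → Fin 4) : IsPoly fun u src x =>
    CEM.reducedRicci u.g src x i + (1 / 2) * u.principal (.g i) x := by
  refine (((ricci (i 0) (i 1)).sub ((const (1 / 2)).mul ((covDVec_Gam (i 0) (i 1)).add
    (covDVec_Gam (i 1) (i 0))))).add (sym₂ (a := i 0) (b := i 1) fun m n => sum fun a =>
      (IsPoly₁.metric ![a, m]).isPoly.mul (covDVec_srcF n a))).congr fun U u src x h => ?_
  have h1 : u.principal (.g i) x = ddgWave u.g x (i 1) (i 0) := by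
    unfold ddgWave
    rw [ctr_congr fun c e => h.metric.ddg_symm h.mem c e (i 1) (i 0)]
    unfold ddg
    rw [← eq_pair i]
    rfl
  have h2 : ddgTr u.g x (i 0) (i 1) = ddgTr u.g x (i 1) (i 0) := by
    unfold ddgTr
    exact ctr_congr fun c e => h.metric.ddg_comm h.mem _ _ _ _
  unfold CEM.reducedRicci
  rw [h1, ← eq_pair i]
  simp only [CEM.sym₂]
  rw [h2]
  ring

/-- In `-R_{tl} + g_{at} ∇_l Γ^a` the trace terms cancel. What remains is `½ (ddgWave + ddgDiv_{tl}
- ddgDiv_{lt})`, the combination of `ctr_ddChr_lower'`. -/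
theorem bbCoef (t l : Fin 4) : IsPoly fun u src x => CEM.bbCoef u.g u.L src x t l
    - ∑ r, u.g x ![r, t] * CEM.ctr (CEM.ginv u.g x) (fun a b => ddChr u.g x a r b l) := by
  refine (((((const 2).mul (IsPoly₁.L ![t, l]).isPoly).add (((const (1 / 6)).mul
    IsPoly₁.srcR.isPoly).mul (IsPoly₁.metric ![t, l]).isPoly)).sub (ricci t l)).sub
    ((sum fun a => (IsPoly₁.metric ![a, t]).isPoly.mul (covDVec_srcF l a)).sub
      (covDVec_Gam t l))).congr fun U u src x h => ?_
  have h1 : ∀ a, covDVec u.g (fun y b => src.F y b - CEM.Gam u.g y b) x l a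
      = covDVec u.g src.F x l a - covDVec u.g (CEM.Gam u.g) x l a := fun a => by
    have sG : DifferentiableAt ℝ (fun y => CEM.Gam u.g y a) x := DifferentiableAt.fun_sum
      fun b _ => DifferentiableAt.fun_sum fun c _ => ((IsPoly₁.ginv b c).diffAt h).mul
        (CEM.diffAt h.isOpen (h.metric.smooth_christoffel a b c) h.mem)
    unfold covDVec
    rw [pd_sub ((IsPoly₁.srcF a).diffAt h) sG]
    simp only [mul_sub, Finset.sum_sub_distrib]
    ring
  have h2 : ddgTr u.g x l t = ddgTr u.g x t l := by
    unfold ddgTr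
    exact ctr_congr fun c e => h.metric.ddg_comm h.mem _ _ _ _
  have h3 : ddgWave u.g x l t = ddgWave u.g x t l := by
    unfold ddgWave
    exact ctr_congr fun c e => h.metric.ddg_symm h.mem _ _ _ _
  rw [h.metric.ctr_ddChr_lower' h.mem, h3]
  unfold CEM.bbCoef
  simp only [h1, mul_sub, Finset.sum_sub_distrib]
  ring

end IsPoly

end CEM
-- Principal parts of the wave operators and of the Cotton derivatives
namespace CEM

theorem ctr_sum {ι : Type*} [Fintype ι] (h : Fin 4 → Fin 4 → ℝ) (f : ι → Fin 4 → Fin 4 → ℝ) :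
    ctr h (fun p q => ∑ i, f i p q) = ∑ i, ctr h (f i) := by
  simp only [ctr, Finset.mul_sum]
  refine Eq.trans (Finset.sum_congr rfl fun p _ => ?_) Finset.sum_comm
  exact Finset.sum_comm

namespace IsPoly

section Box

variable {k : ℕ} {T : Fields → GaugeSource → Tensor k}
  (hT : ∀ i, IsPoly₁ fun u src x => T u src x i)
include hT

/-- The second derivatives are those of the component itself and those of the metric in the
derivative of the Christoffel symbols; all other terms lie in the first jet. -/
theorem covD_covD (a b : Fin 4) (i : Fin k → Fin 4) : IsPoly fun u src x =>
    covD u.g (covD u.g (T u src)) x (Matrix.vecCons a (Matrix.vecCons b i))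
      - (pd a (pd b fun y => T u src y i) x
        - ∑ m, ∑ r, ddChr u.g x a r b (i m) * T u src x (Function.update i m r)) := by
  refine (((sum fun m => sum fun r => (((pd_christoffel a r b (i m)).mul
      (hT (Function.update i m r)).isPoly).add ((christoffel r b (i m)).mul
        ((hT (Function.update i m r)).pd a)))).add
    (sum fun m : Fin (k + 1) => sum fun r : Fin 4 =>
      (christoffel r a (Matrix.vecCons b i m : Fin 4)).mul (IsPoly₁.covD
        (i := Function.update (Matrix.vecCons b i) m r) hT))).neg).congr fun U u src x h => ?_
  have sT : ∀ j, ContDiffOn ℝ ∞ (fun y => T u src y j) U := fun j => (hT j).smooth U u src x h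
  have sd : ∀ m r, DifferentiableAt ℝ (fun y => CEM.christoffel u.g y r b (i m)) x := fun m r =>
    CEM.diffAt h.isOpen (h.metric.smooth_christoffel _ _ _) h.mem
  have sdT : ∀ j, DifferentiableAt ℝ (fun y => T u src y j) x := fun j => (hT j).diffAt h
  have sm : ∀ m r, DifferentiableAt ℝ (fun y => CEM.christoffel u.g y r b (i m)
      * T u src y (Function.update i m r)) x := fun m r => (sd m r).mul (sdT _)
  rw [covD_cons]
  simp only [covD_cons u.g (T u src) _ b i]
  rw [pd_sub (CEM.diffAt h.isOpen (smooth_pd h.isOpen (sT i) b) h.mem)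
      (DifferentiableAt.fun_sum fun m _ => DifferentiableAt.fun_sum fun r _ => sm m r),
    pd_sum_sum_mul sd fun m r => sdT (Function.update i m r)]
  simp only [sub_mul, Finset.sum_add_distrib, Finset.sum_sub_distrib]
  ring

theorem box (i : Fin k → Fin 4) : IsPoly fun u src x => CEM.box u.g (T u src) x i
    - (∑ a, ∑ b, CEM.ginv u.g x a b * pd a (pd b fun y => T u src y i) x
      - ∑ m, ∑ r, CEM.ctr (CEM.ginv u.g x) (fun a b => ddChr u.g x a r b (i m))
        * T u src x (Function.update i m r)) := by
  refine (ctr fun a b => covD_covD hT a b i).congr fun U u src x h => ?_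
  have e : ∑ m, ∑ r, CEM.ctr (CEM.ginv u.g x) (fun a b => ddChr u.g x a r b (i m))
        * T u src x (Function.update i m r)
      = CEM.ctr (CEM.ginv u.g x) fun a b => ∑ m, ∑ r, ddChr u.g x a r b (i m)
        * T u src x (Function.update i m r) := by
    simp only [ctr_sum, ctr_mul_right]
  rw [e, ctr_sub, ctr_sub]
  rfl

/-- The correction term removes, slot by slot, the second metric derivatives that `□` contains,
leaving the scalar wave operator on each component. -/
theorem blackBox (i : Fin k → Fin 4) : IsPoly fun u src x => CEM.blackBox u.g u.L src (T u src) x i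
    - ∑ a, ∑ b, CEM.ginv u.g x a b * pd a (pd b fun y => T u src y i) x := by
  refine ((box hT i).add (sum fun m => sum fun t => sum fun r => ((bbCoef t (i m)).mul
    (ginv t r)).mul (hT (Function.update i m r)).isPoly)).congr fun U u src x h => ?_
  -- The coefficient carries a lowered index and the tensor a raised one; `g g⁻¹ = 1` matches the
  -- term of `□`.
  have e : ∀ m r, ∑ t, (∑ s, u.g x ![s, t] * CEM.ctr (CEM.ginv u.g x) fun a b =>
      ddChr u.g x a s b (i m)) * CEM.ginv u.g x t r
      = CEM.ctr (CEM.ginv u.g x) fun a b => ddChr u.g x a r b (i m) := fun m r => by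
    simp only [Finset.sum_mul]
    rw [Finset.sum_comm]
    have : ∀ s t, u.g x ![s, t] * (CEM.ctr (CEM.ginv u.g x) fun a b => ddChr u.g x a s b (i m))
        * CEM.ginv u.g x t r = (u.g x ![s, t] * CEM.ginv u.g x t r)
          * CEM.ctr (CEM.ginv u.g x) fun a b => ddChr u.g x a s b (i m) := fun s t => by ring
    simp only [this, ← Finset.sum_mul, h.metric.mul_ginv h.mem]
    simp
  have e' : ∀ m, ∑ r, CEM.ctr (CEM.ginv u.g x) (fun a b => ddChr u.g x a r b (i m))
        * T u src x (Function.update i m r)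
      = ∑ t, ∑ r, ((∑ s, u.g x ![s, t] * CEM.ctr (CEM.ginv u.g x) fun a b =>
        ddChr u.g x a s b (i m)) * CEM.ginv u.g x t r) * T u src x (Function.update i m r) :=
    fun m => by
      rw [Finset.sum_comm]
      simp only [← Finset.sum_mul, e]
  have e2 : ∀ m t, CEM.bbCoef u.g u.L src x t (i m)
      * CEM.up u.g m (T u src) x (Function.update i m t)
      = ∑ r, CEM.bbCoef u.g u.L src x t (i m) * CEM.ginv u.g x t r
        * T u src x (Function.update i m r) := fun m t => by
    unfold CEM.up
    rw [Finset.mul_sum]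
    exact Finset.sum_congr rfl fun r _ => by
      rw [Function.update_self, Function.update_idem]; ring
  unfold CEM.blackBox
  simp only [e2, e', sub_mul, Finset.sum_sub_distrib]
  ring

end Box

/-- On scalars only undifferentiated Christoffel symbols occur, so no correction is needed. -/
theorem boxScalar {φ : Fields → GaugeSource → Pt → ℝ} (hφ : IsPoly₁ φ) : IsPoly fun u src x =>
    CEM.boxScalar u.g (φ u src) x - ∑ a, ∑ b, CEM.ginv u.g x a b * pd a (pd b (φ u src)) x := by
  refine (ctr fun a b => (sum fun r => (christoffel r a b).mul (hφ.pd r)).neg).congr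
    fun U u src x h => ?_
  simp only [CEM.boxScalar, CEM.ctr, ← Finset.sum_sub_distrib]
  refine Finset.sum_congr rfl fun a _ => Finset.sum_congr rfl fun b _ => ?_
  rw [covD_cons]
  simp [grad]
  ring

theorem grad_Xi (i : Fin 1 → Fin 4) : IsPoly fun u _ x => grad u.Xi x i := var (.der (i 0) .Xi)

end IsPoly

namespace Fields

/-- The coefficient of `v_f` in `cottonLin`. -/
noncomputable def cottonCoef (u : Fields) (x : Pt) (f : Fin 4) (i : Fin 3 → Fin 4) : ℝ :=
  u.cottonLin (fun _ j => if j 0 = f then 1 else 0) x i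

/-- Linearity in `v` at the point: once the expression is known to be some linear form in the
components of `v`, its coefficients are the values on the coordinate covectors. -/
theorem cottonLin_eq (u : Fields) (v : Tensor 1) (x : Pt) (i : Fin 3 → Fin 4) :
    u.cottonLin v x i = ∑ f, u.cottonCoef x f i * v x ![f] := by
  obtain ⟨α, β, γ, h⟩ : ∃ α β : ℝ, ∃ γ : Fin 4 → ℝ, ∀ v : Tensor 1, u.cottonLin v x i
      = α * v x ![i 1] + β * v x ![i 0] + ∑ f, γ f * v x ![f] := by
    obtain ⟨Y, e⟩ : ∃ Y : Fin 4 → Fin 4 → ℝ, ∀ (v : Tensor 1) b, ∑ d, ∑ e,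
        up u.g 1 u.F x ![b, e] * u.F x ![d, e] * up u.g 0 v x ![d] = ∑ f, Y b f * v x ![f] := by
      refine ⟨fun b f => ∑ d, ∑ e, up u.g 1 u.F x ![b, e] * u.F x ![d, e] * ginv u.g x d f,
        fun v b => ?_⟩
      have hv : ∀ d, up u.g 0 v x ![d] = ∑ r, ginv u.g x d r * v x ![r] := fun d => by
        simp only [up, update_cons_zero', Matrix.cons_val]
      simp only [hv, Finset.sum_mul, Finset.mul_sum]
      refine (Finset.sum_congr rfl fun d _ => Finset.sum_comm).trans ?_
      rw [Finset.sum_comm]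
      exact Finset.sum_congr rfl fun f _ => Finset.sum_congr rfl fun d _ =>
        Finset.sum_congr rfl fun e _ => by ring
    refine ⟨-(3 / 2) * (∑ d, u.F x ![i 2, d] * up u.g 1 u.F x ![i 0, d])
        + (1 / 2) * u.FF x * u.g x ![i 2, i 0],
      (3 / 2) * (∑ d, u.F x ![i 2, d] * up u.g 1 u.F x ![i 1, d])
        - (1 / 2) * u.FF x * u.g x ![i 2, i 1], fun f =>
      (1 / 2) * (u.g x ![i 2, i 1] * Y (i 0) f - u.g x ![i 2, i 0] * Y (i 1) f), fun v => ?_⟩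
    unfold cottonLin alt₂
    simp only [e]
    simp only [mul_assoc, sub_mul, ← Finset.mul_sum, Finset.sum_sub_distrib]
    ring
  unfold cottonCoef
  simp only [h, add_mul, Finset.sum_add_distrib, Finset.sum_mul]
  simp

theorem isPoly₁_cottonCoef (f : Fin 4) (i : Fin 3 → Fin 4) :
    IsPoly₁ fun u _ x => u.cottonCoef x f i :=
  IsPoly₁.cottonLin (v := fun _ _ _ j => if j 0 = f then 1 else 0) (fun _ => .const _) i

theorem isPoly_cotton (i : Fin 3 → Fin 4) : IsPoly fun u _ x => u.cotton x i :=
  ((IsPoly₁.cottonAlg i).isPoly.add (.sum fun f =>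
    (isPoly₁_cottonCoef f i).isPoly.mul (IsPoly.grad_Xi ![f]))).congr fun _ u _ x _ => by
      unfold cotton; rw [cottonLin_eq]

/-- `Υ_{ab}` equals `∂_a ∂_b Ξ` modulo the first jet, so either may stand for the other in principal
parts. -/
theorem isPoly_Upsilon (a b : Fin 4) : IsPoly fun u _ x =>
    u.Upsilon x ![a, b] - pd a (pd b u.Xi) x := by
  refine ((((IsPoly.sum fun r => (IsPoly.christoffel r a b).mul (IsPoly₁.Xi.pd r)).neg.add
    (IsPoly₁.Xi.isPoly.mul (IsPoly₁.L ![a, b]).isPoly)).sub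
      (IsPoly₁.s.isPoly.mul (IsPoly₁.metric ![a, b]).isPoly)).sub
    (((IsPoly.const (1 / 2)).mul (IsPoly₁.Xi.isPoly.pow 3)).mul
      (IsPoly₁.emT ![a, b]).isPoly)).congr fun U u src x h => ?_
  unfold Upsilon
  rw [covD_cons]
  simp [grad]
  ring

/-- After the elimination of `∇∇Ξ` the derivatives of the rescaled Cotton tensor are of
lower order. -/
theorem isPoly_covD_cotton (i : Fin 4 → Fin 4) : IsPoly fun u _ x =>
    covD u.g u.cotton x i - u.cottonUpsilon x i := by
  obtain ⟨e, j, rfl⟩ : ∃ e j, i = Matrix.vecCons e j :=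
    ⟨_, _, (Matrix.cons_head_tail i).symm⟩
  refine ((((IsPoly₁.cottonAlg j).pd e).add (IsPoly.sum fun f =>
    (((isPoly₁_cottonCoef f j).pd e).mul (IsPoly₁.Xi.pd f)).sub
      ((isPoly₁_cottonCoef f j).isPoly.mul (isPoly_Upsilon e f)))).sub
    (IsPoly.sum fun m => IsPoly.sum fun r => (IsPoly.christoffel r e (j m)).mul
      (isPoly_cotton (Function.update j m r)))).congr fun U u src x h => ?_
  have hK : ∀ f, DifferentiableAt ℝ (fun y => u.cottonCoef y f j) x := fun f =>
    (isPoly₁_cottonCoef f j).diffAt (src := src) h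
  have hX : ∀ f, DifferentiableAt ℝ (fun y => pd f u.Xi y) x := fun f =>
    diffAt h.isOpen (smooth_pd h.isOpen (h.reg.1 .Xi) f) h.mem
  have hm : ∀ f, DifferentiableAt ℝ (fun y => u.cottonCoef y f j * pd f u.Xi y) x := fun f =>
    (hK f).mul (hX f)
  -- The second derivatives of `Ξ` enter with the coefficients `cottonCoef`, the same as those of
  -- `Υ` in `cottonUpsilon`.
  have h1 : pd e (fun y => u.cotton y j) x = pd e (fun y => u.cottonAlg y j) x
      + ∑ f, (pd e (fun y => u.cottonCoef y f j) x * pd f u.Xi x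
        + u.cottonCoef x f j * pd e (pd f u.Xi) x) := by
    have : (fun y => u.cotton y j) = fun y => u.cottonAlg y j
        + ∑ f, u.cottonCoef y f j * pd f u.Xi y := funext fun y => by
      unfold cotton; rw [cottonLin_eq]; rfl
    rw [this, pd_add ((IsPoly₁.cottonAlg j).diffAt (src := src) h)
      (DifferentiableAt.fun_sum fun f _ => hm f),
      pd_sum fun f _ => hm f]
    congr 1
    exact Finset.sum_congr rfl fun f _ => pd_mul (hK f) (hX f)
  rw [covD_cons, h1]
  unfold cottonUpsilon
  rw [cottonLin_eq]
  simp only [Matrix.tail_cons, Matrix.cons_val_zero, Finset.sum_add_distrib,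
    Finset.sum_sub_distrib, mul_sub]
  ring

end Fields

end CEM
-- Expressions linear in `Υ`, and the double dual term
namespace CEM

/-- The expression `f` is a linear combination of the components of `Υ` with universal polynomial
coefficients. -/
def IsUpsilonLin (f : Fields → GaugeSource → Pt → ℝ) : Prop :=
  ∃ q : Fin 4 → Fin 4 → MvPolynomial JetVar ℝ, ∀ U u src x, RegularAt U u src x →
    f u src x = ∑ m, ∑ n, MvPolynomial.eval (jet u src x) (q m n) * u.Upsilon x ![m, n]

namespace IsUpsilonLin

variable {f g : Fields → GaugeSource → Pt → ℝ}

theorem congr (hf : IsUpsilonLin f) (h : ∀ U u src x, RegularAt U u src x →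
    g u src x = f u src x) : IsUpsilonLin g := by
  obtain ⟨p, hp⟩ := hf
  exact ⟨p, fun U u src x hx => (h U u src x hx).trans (hp U u src x hx)⟩

theorem upsilon (a b : Fin 4) : IsUpsilonLin fun u _ x => u.Upsilon x ![a, b] :=
  ⟨fun m n => if m = a then (if n = b then 1 else 0) else 0, fun U u src x _ => by
    have : ∀ m n, MvPolynomial.eval (jet u src x)
        (if m = a then (if n = b then 1 else 0) else 0) * u.Upsilon x ![m, n]
        = if m = a then (if n = b then u.Upsilon x ![m, n] else 0) else 0 := fun m n => by
      split_ifs <;> simp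
    simp [this]⟩

theorem mul (hc : IsPoly f) (hg : IsUpsilonLin g) :
    IsUpsilonLin fun u src x => f u src x * g u src x := by
  obtain ⟨p, hp⟩ := hc
  obtain ⟨q, hq⟩ := hg
  refine ⟨fun m n => p * q m n, fun U u src x h => ?_⟩
  beta_reduce
  rw [hp U u src x h, hq U u src x h]
  simp only [map_mul, mul_assoc, ← Finset.mul_sum]

theorem add (hf : IsUpsilonLin f) (hg : IsUpsilonLin g) :
    IsUpsilonLin fun u src x => f u src x + g u src x := by
  obtain ⟨p, hp⟩ := hf
  obtain ⟨q, hq⟩ := hg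
  refine ⟨fun m n => p m n + q m n, fun U u src x h => ?_⟩
  beta_reduce
  rw [hp U u src x h, hq U u src x h]
  simp only [map_add, add_mul, Finset.sum_add_distrib]

theorem sub (hf : IsUpsilonLin f) (hg : IsUpsilonLin g) :
    IsUpsilonLin fun u src x => f u src x - g u src x :=
  (hf.add (mul (.const (-1)) hg)).congr fun _ _ _ _ _ => by ring

theorem sum {ι : Type*} [Fintype ι] {f : ι → Fields → GaugeSource → Pt → ℝ}
    (hf : ∀ i, IsUpsilonLin (f i)) : IsUpsilonLin fun u src x => ∑ i, f i u src x := by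
  choose q hq using hf
  refine ⟨fun m n => ∑ i, q i m n, fun U u src x h => ?_⟩
  beta_reduce
  simp only [fun i => hq i U u src x h, map_sum, Finset.sum_mul]
  rw [Finset.sum_comm]
  exact Finset.sum_congr rfl fun m _ => Finset.sum_comm

theorem ctr {f : Fields → GaugeSource → Pt → Fin 4 → Fin 4 → ℝ}
    (hf : ∀ a b, IsUpsilonLin fun u src x => f u src x a b) :
    IsUpsilonLin fun u src x => CEM.ctr (ginv u.g x) (f u src x) :=
  sum fun _ => sum fun _ => mul (.ginv _ _) (hf _ _)

theorem alt₂ {a b : Fin 4} {f : Fields → GaugeSource → Pt → Fin 4 → Fin 4 → ℝ}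
    (hf : ∀ a b, IsUpsilonLin fun u src x => f u src x a b) :
    IsUpsilonLin fun u src x => CEM.alt₂ a b (f u src x) :=
  (mul (.const (1 / 2)) ((hf a b).sub (hf b a))).congr fun _ _ _ _ _ => by
    unfold CEM.alt₂; ring

theorem cottonUpsilon (i : Fin 4 → Fin 4) : IsUpsilonLin fun u _ x => u.cottonUpsilon x i :=
  (sum fun f => mul (Fields.isPoly₁_cottonCoef f (Matrix.vecTail i)).isPoly
    (upsilon (i 0) f)).congr fun _ u _ x _ => by
      unfold Fields.cottonUpsilon; rw [Fields.cottonLin_eq]; rfl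

end IsUpsilonLin

/-! ### The dual term in the equation for the rescaled Weyl tensor -/

/-- A single volume form contains a square root and is not polynomial; the product of two is minus a
Gram determinant. -/
theorem IsPoly.vol_mul_vol (i j : Fin 4 → Fin 4) :
    IsPoly fun u _ x => vol u.g x i * vol u.g x j := by
  refine (IsPoly.sum fun σ : Equiv.Perm (Fin 4) =>
    (IsPoly.const (((Equiv.Perm.sign σ : ℤˣ) : ℤ) : ℝ)).mul
      ((((IsPoly₁.metric ![i (σ 0), j 0]).isPoly.mul (IsPoly₁.metric ![i (σ 1), j 1]).isPoly).mul
        (IsPoly₁.metric ![i (σ 2), j 2]).isPoly).mul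
        (IsPoly₁.metric ![i (σ 3), j 3]).isPoly)).neg.congr fun U u src x h => ?_
  rw [CEM.vol_mul_vol (h.metric.det_neg x h.mem), Matrix.det_apply']
  simp only [Fin.prod_univ_four, Matrix.of_apply]

namespace Fields

/-- `ε_{ab}{}^{ef} ∇_f {}^*X_{cke}` in terms of `X_{fabc} = ∇_f T_{abc}`. -/
noncomputable def doubleDual (u : Fields) (X : Tensor 4) (x : Pt) (a b c k : Fin 4) : ℝ :=
  ctr (ginv u.g x) fun e e' => ctr (ginv u.g x) fun f f' => (1 / 2) *
    ctr (ginv u.g x) fun p p' => ctr (ginv u.g x) fun q q' =>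
      vol u.g x ![a, b, e, f] * vol u.g x ![c, k, p', q'] * X x ![f', p, q, e']

/-- The two volume forms are brought next to each other so that only their product occurs. The
hypothesis says that `SX` is the dual of `X` on its middle indices; it holds for `∇ *T`, for its `Υ`
part and for their difference. -/
theorem doubleDual_eq {u : Fields} {X SX : Tensor 4} {x : Pt}
    (h : ∀ f c k e, SX x ![f, c, k, e] = (1 / 2) * dctr (ginv u.g x)
      (fun p q => vol u.g x ![c, k, p, q]) fun p q => X x ![f, p, q, e]) (a b c k : Fin 4) :
    ∑ e, ∑ f, vol u.g x ![a, b, e, f] * up u.g 0 (up u.g 3 SX) x ![f, c, k, e]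
      = u.doubleDual X x a b c k := by
  have u3 : ∀ r c k e s : Fin 4, Function.update ![r, c, k, e] (3 : Fin (3 + 1)) s
      = ![r, c, k, s] := upd₄₃
  rw [Finset.sum_comm]
  simp only [up, update_cons_zero', u3, Matrix.cons_val]
  rw [sum_up_up' (h := ginv u.g x) (fun f e => SX x ![f, c, k, e])
    fun f e => vol u.g x ![a, b, e, f]]
  unfold dctr
  rw [ctr_comm]
  refine ctr_congr fun e e' => ctr_congr fun f f' => ?_
  beta_reduce
  rw [h]
  unfold dctr
  rw [mul_assoc, ← ctr_mul_right]
  congr 1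
  refine ctr_congr fun p p' => ?_
  rw [← ctr_mul_right]
  exact ctr_congr fun q q' => by ring

theorem doubleDual_sub (u : Fields) (X Y : Tensor 4) (x : Pt) (a b c k : Fin 4) :
    u.doubleDual X x a b c k - u.doubleDual Y x a b c k
      = u.doubleDual (fun y i => X y i - Y y i) x a b c k := by
  simp only [doubleDual, ← ctr_sub, ← mul_sub]

theorem isPoly_doubleDual {X : Fields → GaugeSource → Tensor 4}
    (hX : ∀ i, IsPoly fun u src x => X u src x i) (a b c k : Fin 4) :
    IsPoly fun u src x => u.doubleDual (X u src) x a b c k :=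
  .ctr fun _ _ => .ctr fun _ _ => (IsPoly.const _).mul (.ctr fun _ _ => .ctr fun _ _ =>
    (IsPoly.vol_mul_vol _ _).mul (hX _))

theorem isUpsilonLin_doubleDual {X : Fields → GaugeSource → Tensor 4}
    (hX : ∀ i, IsUpsilonLin fun u src x => X u src x i) (a b c k : Fin 4) :
    IsUpsilonLin fun u src x => u.doubleDual (X u src) x a b c k :=
  .ctr fun _ _ => .ctr fun _ _ => .mul (.const _) (.ctr fun _ _ => .ctr fun _ _ =>
    .mul (IsPoly.vol_mul_vol _ _) (hX _))

end Fields

end CEM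
-- Polynomial right-hand sides and the normal form
namespace CEM

namespace Fields

/-- Holds for arbitrary regular fields, without the field equations: the coefficients are smooth and
so is `∂Ξ`. -/
theorem smooth_cotton_of_regular {U : Set Pt} {u : Fields} {src : GaugeSource} {x : Pt}
    (h : RegularAt U u src x) : SmoothT U u.cotton := fun i =>
  ((IsPoly₁.cottonAlg i).smooth U u src x h).add ((ContDiffOn.sum fun f _ =>
    ((isPoly₁_cottonCoef f i).smooth U u src x h).mul
      (smooth_pd h.isOpen (h.reg.1 .Xi) f)).congr fun y _ => by
        rw [cottonLin_eq]; rfl)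

theorem dualCottonUpsilon_eq (u : Fields) (x : Pt) (f c k e : Fin 4) :
    u.dualCottonUpsilon x ![f, c, k, e] = (1 / 2) * dctr (ginv u.g x)
      (fun p q => vol u.g x ![c, k, p, q]) fun p q => u.cottonUpsilon x ![f, p, q, e] := by
  unfold dualCottonUpsilon
  rw [dual_eq]
  rfl

theorem isPoly_gradUp (a : Fin 4) : IsPoly fun u _ x => u.gradUp x a :=
  .up (T := fun u _ => grad u.Xi) IsPoly.grad_Xi

theorem isPoly_rhs_s : IsPoly fun u src x => u.rhs_s src x := by
  unfold rhs_s Lup emTup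
  repeat' with_reducible first
    | apply IsPoly.add | apply IsPoly.sub | apply IsPoly.mul | apply IsPoly.sum | apply IsPoly.pow
    | apply IsPoly.up | apply IsPoly.const | exact IsPoly₁.Xi.isPoly | exact IsPoly₁.s.isPoly
    | exact IsPoly₁.srcR.isPoly | exact (IsPoly₁.L _).isPoly | exact (IsPoly₁.emT _).isPoly
    | apply isPoly_gradUp | exact (IsPoly₁.grad_srcR _).isPoly
    | intro _

theorem isPoly_rhs_L {X : Fields → GaugeSource → Tensor 4}
    (hX : ∀ i, IsPoly fun u src x => X u src x i) (a b : Fin 4) :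
    IsPoly fun u src x => u.rhs_L src (X u src) x a b := by
  unfold rhs_L Lup emTup
  repeat' with_reducible first
    | exact hX _ | apply IsPoly.add | apply IsPoly.sub | apply IsPoly.mul | apply IsPoly.sum
    | apply IsPoly.pow | apply IsPoly.up | apply IsPoly.sym₂
    | apply IsPoly.const | exact IsPoly₁.Xi.isPoly | exact (IsPoly₁.L _).isPoly
    | exact (IsPoly₁.d _).isPoly | exact (IsPoly₁.metric _).isPoly | exact (IsPoly₁.emT _).isPoly
    | apply isPoly_cotton | apply isPoly_gradUp | exact IsPoly₁.covD IsPoly₁.grad_srcR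
    | intro _

theorem isPoly_rhs_F (b c : Fin 4) : IsPoly fun u src x => u.rhs_F src x b c := by
  unfold rhs_F Fup
  repeat' with_reducible first
    | apply IsPoly.add | apply IsPoly.sub | apply IsPoly.mul | apply IsPoly.sum
    | apply IsPoly.up | apply IsPoly.const | exact IsPoly₁.Xi.isPoly | exact IsPoly₁.srcR.isPoly
    | exact (IsPoly₁.d _).isPoly | exact (IsPoly₁.F _).isPoly
    | intro _

theorem isPoly_rhs_H (a b c : Fin 4) : IsPoly fun u src x => u.rhs_H src x a b c := by
  unfold rhs_H Fup
  repeat' with_reducible first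
    | apply IsPoly.add | apply IsPoly.sub | apply IsPoly.mul | apply IsPoly.sum
    | apply IsPoly.up | apply IsPoly.alt₂ | apply IsPoly.const | exact IsPoly₁.Xi.isPoly
    | exact IsPoly₁.srcR.isPoly | exact (IsPoly₁.L _).isPoly | exact (IsPoly₁.d _).isPoly
    | exact (IsPoly₁.metric _).isPoly | exact (IsPoly₁.F _).isPoly | exact (IsPoly₁.H _).isPoly
    | apply isPoly_cotton | apply isPoly_gradUp | apply IsPoly.grad_Xi
    | exact (IsPoly₁.grad_srcR _).isPoly | exact IsPoly₁.covD IsPoly₁.d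
    | intro _

/-- The dual term is rewritten by `doubleDual` before polynomiality is checked, since `SX` alone
need not be polynomial. -/
theorem isPoly_rhs_d {X SX : Fields → GaugeSource → Tensor 4}
    (hX : ∀ i, IsPoly fun u src x => X u src x i)
    (hS : ∀ U u src x, RegularAt U u src x → ∀ f c k e, SX u src x ![f, c, k, e]
      = (1 / 2) * dctr (ginv u.g x) (fun p q => vol u.g x ![c, k, p, q])
        fun p q => X u src x ![f, p, q, e]) (a b c k : Fin 4) :
    IsPoly fun u src x => u.rhs_d src (X u src) (SX u src) x a b c k := by
  unfold rhs_d emTup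
  refine .add ?_ ((isPoly_doubleDual hX a b c k).congr fun U u src x h =>
    doubleDual_eq (hS U u src x h) a b c k)
  repeat' with_reducible first
    | exact hX _ | apply IsPoly.add | apply IsPoly.sub | apply IsPoly.mul | apply IsPoly.sum
    | apply IsPoly.pow | apply IsPoly.up | apply IsPoly.alt₂ | apply IsPoly.const
    | exact IsPoly₁.Xi.isPoly | exact IsPoly₁.srcR.isPoly | exact (IsPoly₁.d _).isPoly
    | exact (IsPoly₁.metric _).isPoly | exact (IsPoly₁.emT _).isPoly
    | intro _

/-- The derivatives of the rescaled Cotton tensor after the elimination of `∇∇Ξ`. -/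
noncomputable def cottonElim (u : Fields) : Tensor 4 := fun x i =>
  covD u.g u.cotton x i - u.cottonUpsilon x i

/-- The derivatives of the dual of the rescaled Cotton tensor after the elimination of `∇∇Ξ`. -/
noncomputable def dualCottonElim (u : Fields) : Tensor 4 := fun x i =>
  covD u.g (dual u.g u.cotton) x i - u.dualCottonUpsilon x i

theorem covD_dual_cotton {U : Set Pt} {u : Fields} {src : GaugeSource} {x : Pt}
    (h : RegularAt U u src x) (f c k e : Fin 4) : covD u.g (dual u.g u.cotton) x ![f, c, k, e]
      = (1 / 2) * dctr (ginv u.g x) (fun p q => vol u.g x ![c, k, p, q])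
        fun p q => covD u.g u.cotton x ![f, p, q, e] :=
  covD_dual h.metric (smooth_cotton_of_regular h) h.mem f c k e

theorem dualCottonElim_eq {U : Set Pt} {u : Fields} {src : GaugeSource} {x : Pt}
    (h : RegularAt U u src x) (f c k e : Fin 4) : u.dualCottonElim x ![f, c, k, e]
      = (1 / 2) * dctr (ginv u.g x) (fun p q => vol u.g x ![c, k, p, q])
        fun p q => u.cottonElim x ![f, p, q, e] := by
  unfold dualCottonElim cottonElim
  rw [covD_dual_cotton h, dualCottonUpsilon_eq, dctr_sub]
  ring

theorem isPoly_rhs_elim (A : Slot) :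
    IsPoly fun u src x => u.rhs src u.cottonElim u.dualCottonElim x A := by
  cases A with
  | Xi =>
    exact ((IsPoly.const 4).mul IsPoly₁.s.isPoly).sub
      (((IsPoly.const (1 / 6)).mul IsPoly₁.Xi.isPoly).mul IsPoly₁.srcR.isPoly)
  | s => exact isPoly_rhs_s
  | L i => exact isPoly_rhs_L (X := fun u _ => u.cottonElim) isPoly_covD_cotton (i 0) (i 1)
  | d i =>
    exact isPoly_rhs_d (X := fun u _ => u.cottonElim) (SX := fun u _ => u.dualCottonElim)
      isPoly_covD_cotton (fun _ _ _ _ h => dualCottonElim_eq h) (i 0) (i 1) (i 2) (i 3)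
  | g i =>
    exact ((IsPoly.const 2).mul (IsPoly₁.L i).isPoly).add
      (((IsPoly.const (1 / 6)).mul IsPoly₁.srcR.isPoly).mul (IsPoly₁.metric i).isPoly)
  | F i => exact isPoly_rhs_F (i 0) (i 1)
  | H i => exact isPoly_rhs_H (i 0) (i 1) (i 2)

theorem isUpsilonLin_rhs_L (a b : Fin 4) : IsUpsilonLin fun u src x =>
    u.rhs_L src (covD u.g u.cotton) x a b - u.rhs_L src u.cottonElim x a b := by
  refine (IsUpsilonLin.mul IsPoly₁.Xi.isPoly.neg (.sum fun c => .sum fun r => .mul (.ginv c r)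
    (.cottonUpsilon ![r, a, c, b]))).congr fun U u src x h => ?_
  have e : ∀ (X : Tensor 4) c, up u.g 0 X x ![c, a, c, b]
      = ∑ r, ginv u.g x c r * X x ![r, a, c, b] := fun X c => by
    simp only [up, update_cons_zero', Matrix.cons_val]
  unfold rhs_L cottonElim
  simp only [e, mul_sub, Finset.sum_sub_distrib]
  ring

/-- The two right-hand sides differ only through the Cotton derivatives and their duals, and
`doubleDual` is linear in its tensor. -/
theorem isUpsilonLin_rhs_d (a b c k : Fin 4) : IsUpsilonLin fun u src x =>
    u.rhs_d src (covD u.g u.cotton) (covD u.g (dual u.g u.cotton)) x a b c k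
      - u.rhs_d src u.cottonElim u.dualCottonElim x a b c k := by
  refine ((IsUpsilonLin.mul (.const 2) (.alt₂ (a := a) (b := b) fun a b =>
    .cottonUpsilon ![a, c, k, b])).add (isUpsilonLin_doubleDual (X := fun u _ => u.cottonUpsilon)
      IsUpsilonLin.cottonUpsilon a b c k)).congr fun U u src x h => ?_
  have e := u.doubleDual_sub (covD u.g u.cotton) u.cottonElim x a b c k
  have e' : (fun y i => covD u.g u.cotton y i - u.cottonElim y i) = u.cottonUpsilon := by
    funext y i; unfold cottonElim; ring
  rw [e'] at e
  rw [← e]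
  unfold rhs_d
  rw [doubleDual_eq (covD_dual_cotton h), doubleDual_eq (dualCottonElim_eq h)]
  unfold cottonElim CEM.alt₂
  ring

theorem isPoly_lhs (A : Slot) (hA : ∀ i, A ≠ .g i) :
    IsPoly fun u src x => u.lhs src x A - u.principal A x := by
  cases A with
  | Xi => exact IsPoly.boxScalar (φ := fun u _ => u.Xi) IsPoly₁.Xi
  | s => exact IsPoly.boxScalar (φ := fun u _ => u.s) IsPoly₁.s
  | L i => exact IsPoly.blackBox (T := fun u _ => u.L) IsPoly₁.L i
  | d i => exact IsPoly.blackBox (T := fun u _ => u.d) IsPoly₁.d i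
  | g i => exact absurd rfl (hA i)
  | F i => exact IsPoly.blackBox (T := fun u _ => u.F) IsPoly₁.F i
  | H i => exact IsPoly.blackBox (T := fun u _ => u.H) IsPoly₁.H i

/-- Here `κ` is the coefficient of the scalar wave operator on the left. Solving for the principal
part divides the polynomials by `κ`. -/
theorem normal_form_of_isPoly (A : Slot) {κ : ℝ} (hκ : κ ≠ 0)
    (hl : IsPoly fun u src x => u.lhs src x A - κ * u.principal A x)
    {q : Fin 4 → Fin 4 → MvPolynomial JetVar ℝ} (hq : ∀ U u src x, RegularAt U u src x →
      u.rhs src (covD u.g u.cotton) (covD u.g (dual u.g u.cotton)) x A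
        - u.rhs src u.cottonElim u.dualCottonElim x A
        = ∑ m, ∑ n, MvPolynomial.eval (jet u src x) (q m n) * u.Upsilon x ![m, n]) :
    ∃ p : MvPolynomial JetVar ℝ, ∀ U u src x, RegularAt U u src x →
      (u.EliminatedEq src A x ↔ u.principal A x = MvPolynomial.eval (jet u src x) p) ∧
      (u.ReducedEq src A x ↔ u.principal A x = MvPolynomial.eval (jet u src x) p
        + ∑ m, ∑ n, MvPolynomial.eval (jet u src x) (MvPolynomial.C κ⁻¹ * q m n)
          * u.Upsilon x ![m, n]) := by
  obtain ⟨p₁, h₁⟩ := hl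
  obtain ⟨p₂, h₂⟩ := isPoly_rhs_elim A
  refine ⟨MvPolynomial.C κ⁻¹ * (p₂ - p₁), fun U u src x h => ?_⟩
  have e₁ := h₁ U u src x h
  have e₂ := h₂ U u src x h
  have e₃ := hq U u src x h
  have hE : u.EliminatedEq src A x ↔ u.lhs src x A
    = u.rhs src u.cottonElim u.dualCottonElim x A := Iff.rfl
  rw [hE]
  unfold ReducedEq
  simp only [map_mul, map_sub, MvPolynomial.eval_C, mul_assoc, ← Finset.mul_sum]
  rw [← e₃]
  beta_reduce at e₁ e₂
  rw [← e₁, ← e₂]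
  constructor
  · rw [eq_inv_mul_iff_mul_eq₀ hκ]
    constructor <;> intro H <;> linarith
  · rw [← mul_add, eq_inv_mul_iff_mul_eq₀ hκ]
    constructor <;> intro H <;> linarith

/-- The reduced system is a quasilinear system of wave equations. -/
theorem exists_normal_form (A : Slot) :
    ∃ (p : MvPolynomial JetVar ℝ) (q : Fin 4 → Fin 4 → MvPolynomial JetVar ℝ),
      ((∀ i, A ≠ .L i) → (∀ i, A ≠ .d i) → q = 0) ∧
      ∀ U u src x, RegularAt U u src x →
        (u.EliminatedEq src A x ↔ u.principal A x = MvPolynomial.eval (jet u src x) p) ∧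
        (u.ReducedEq src A x ↔ u.principal A x = MvPolynomial.eval (jet u src x) p
          + ∑ m, ∑ n, MvPolynomial.eval (jet u src x) (q m n) * u.Upsilon x ![m, n]) := by
  have hl : (∀ i, A ≠ .g i) → IsPoly fun u src x => u.lhs src x A - 1 * u.principal A x :=
    fun hA => (isPoly_lhs A hA).congr fun _ _ _ _ _ => by ring
  -- For equations that do not contain derivatives of the Cotton tensor the two right-hand sides
  -- coincide, so the coefficients of `Υ` are zero.
  have h0 : ∀ {κ : ℝ}, κ ≠ 0 → IsPoly (fun u src x => u.lhs src x A - κ * u.principal A x) →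
      (∀ (u : Fields) src x, u.rhs src (covD u.g u.cotton) (covD u.g (dual u.g u.cotton)) x A
        = u.rhs src u.cottonElim u.dualCottonElim x A) →
      ∃ p : MvPolynomial JetVar ℝ, ∀ U u src x, RegularAt U u src x →
        (u.EliminatedEq src A x ↔ u.principal A x = MvPolynomial.eval (jet u src x) p) ∧
        (u.ReducedEq src A x ↔ u.principal A x = MvPolynomial.eval (jet u src x) p
          + ∑ m, ∑ n, MvPolynomial.eval (jet u src x)
            ((0 : Fin 4 → Fin 4 → MvPolynomial JetVar ℝ) m n) * u.Upsilon x ![m, n]) := by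
    intro κ hκ hp hr
    obtain ⟨p, hp⟩ := normal_form_of_isPoly A hκ hp (q := 0) fun U u src x _ => by simp [hr]
    exact ⟨p, by simpa using hp⟩
  have h1 : (∀ i, A ≠ .g i) → IsUpsilonLin (fun u src x =>
      u.rhs src (covD u.g u.cotton) (covD u.g (dual u.g u.cotton)) x A
        - u.rhs src u.cottonElim u.dualCottonElim x A) →
      ∃ (p : MvPolynomial JetVar ℝ) (q : Fin 4 → Fin 4 → MvPolynomial JetVar ℝ),
        ∀ U u src x, RegularAt U u src x →
        (u.EliminatedEq src A x ↔ u.principal A x = MvPolynomial.eval (jet u src x) p) ∧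
        (u.ReducedEq src A x ↔ u.principal A x = MvPolynomial.eval (jet u src x) p
          + ∑ m, ∑ n, MvPolynomial.eval (jet u src x) (q m n) * u.Upsilon x ![m, n]) := by
    rintro hA ⟨q, hq⟩
    obtain ⟨p, hp⟩ := normal_form_of_isPoly A one_ne_zero (hl hA) hq
    exact ⟨p, _, hp⟩
  cases A with
  | L i =>
    obtain ⟨p, q, h⟩ := h1 (fun _ => by simp) (isUpsilonLin_rhs_L (i 0) (i 1))
    exact ⟨p, q, fun hA => absurd rfl (hA i), h⟩
  | d i =>
    obtain ⟨p, q, h⟩ := h1 (fun _ => by simp) (isUpsilonLin_rhs_d (i 0) (i 1) (i 2) (i 3))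
    exact ⟨p, q, fun _ hA => absurd rfl (hA i), h⟩
  | g i =>
    -- The factor `-½` is that of the wave operator on the metric in the reduced Ricci tensor; in
    -- all other equations it is `1`.
    obtain ⟨p, h⟩ := h0 (κ := -(1 / 2)) (by norm_num) ((IsPoly.reducedRicci i).congr
      fun _ _ _ _ _ => by simp only [lhs]; ring) fun _ _ _ => rfl
    exact ⟨p, 0, fun _ _ => rfl, h⟩
  | Xi =>
    obtain ⟨p, h⟩ := h0 one_ne_zero (hl fun _ => by simp) fun _ _ _ => rfl
    exact ⟨p, 0, fun _ _ => rfl, h⟩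
  | s =>
    obtain ⟨p, h⟩ := h0 one_ne_zero (hl fun _ => by simp) fun _ _ _ => rfl
    exact ⟨p, 0, fun _ _ => rfl, h⟩
  | F i =>
    obtain ⟨p, h⟩ := h0 one_ne_zero (hl fun _ => by simp) fun _ _ _ => rfl
    exact ⟨p, 0, fun _ _ => rfl, h⟩
  | H i =>
    obtain ⟨p, h⟩ := h0 one_ne_zero (hl fun _ => by simp) fun _ _ _ => rfl
    exact ⟨p, 0, fun _ _ => rfl, h⟩

end Fields

end CEM
theorem mainTheorem7 :
    -- (a) the reduced system is a proper quasilinear system of wave equations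
    (∃ (p : CEM.Slot → MvPolynomial CEM.JetVar ℝ)
       (q : CEM.Slot → Fin 4 → Fin 4 → MvPolynomial CEM.JetVar ℝ),
      (∀ A, (∀ i, A ≠ CEM.Slot.L i) → (∀ i, A ≠ CEM.Slot.d i) → q A = 0) ∧
      ∀ (U : Set CEM.Pt) (u : CEM.Fields) (src : CEM.GaugeSource),
        IsOpen U → u.RegularOn U → src.SmoothOn U → ∀ x ∈ U, ∀ A,
          (u.EliminatedEq src A x ↔
            u.principal A x = MvPolynomial.eval (CEM.jet u src x) (p A)) ∧
          (u.ReducedEq src A x ↔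
            u.principal A x = MvPolynomial.eval (CEM.jet u src x) (p A)
              + ∑ m, ∑ n, MvPolynomial.eval (CEM.jet u src x) (q A m n)
                  * u.Upsilon x ![m, n])) ∧
    -- (b) it is satisfied by the solutions of the conformal Einstein-Maxwell equations
    (∀ (U : Set CEM.Pt) (u : CEM.Fields) (src : CEM.GaugeSource) (lam : ℝ),
      IsOpen U → u.RegularOn U → u.SymmetricOn U → CEM.InGauge U u.g src →
      u.IsConformalEinsteinMaxwell U lam → (∀ x ∈ U, ∀ i, u.Q₃ x i = 0) →
      ∀ x ∈ U, (∀ i, u.cottonDef x i = u.cotton x i) ∧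
        ∀ A, u.ReducedEq src A x ∧ u.EliminatedEq src A x) ∧
    -- (c) the matter zero-quantities satisfy homogeneous wave equations
    (∀ (U : Set CEM.Pt) (u : CEM.Fields) (src : CEM.GaugeSource),
      IsOpen U → u.RegularOn U → u.SymmetricOn U → CEM.InGauge U u.g src →
      (∀ x ∈ U, ∀ i, u.Pzq x i = 0) →
      (∀ x ∈ U, ∀ i, u.ReducedEq src (CEM.Slot.F i) x) →
      (∀ x ∈ U, ∀ i, u.ReducedEq src (CEM.Slot.H i) x) →
      ∀ x ∈ U, u.WaveM₁ x ∧ u.WaveM₃ x ∧ u.WaveQ₃ x) := by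
  -- The polynomials depend only on the label of the equation and are fixed before any domain,
  -- fields or gauge sources are given, which is what universality means.
  choose p q hq hpq using CEM.Fields.exists_normal_form
  refine ⟨⟨p, q, hq, fun U u src hU reg hs x hx A => hpq A U u src x ⟨hU, reg, hs, hx⟩⟩,
    fun U u src lam hU reg sym hg hE hq x hx =>
    CEM.Fields.reduced_of_conformalEinsteinMaxwell hU reg sym hg hE hq hx,
    fun U u src hU reg sym hg hP hF hH x hx =>
      CEM.wave_zeroQuantities hU reg sym hg hP hF hH hx⟩
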